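/- **Setting.** Let $d\in\{2,3\}$ and let $\Omega\subset\mathbb R^d$ be a polygon/polyhedron, that is, a bounded domain which is the interior of its closure and whose boundary lies in finitely many hyperplanes. Let $\mathcal T_h$ be a conforming mesh of $\Omega$ made of finitely many polygonal/polyhedral elements $K$ with flat faces $F\in\mathcal F_h$; $\mathcal F(K)$ is the set of faces of $K$, $h_K$ its diameter, $n$ its outward unit normal. Write $(\cdot,\cdot)_D$, $\langle\cdot,\cdot\rangle_D$, $\|\cdot\|_D$ for $L^2$ inner products and norms, $(\cdot,\cdot)_{\mathcal T_h}=\sum_K(\cdot,\cdot)_K$ and $\langle\cdot,\cdot\rangle_{\partial\mathcal T_h}=\sum_K\langle\cdot,\cdot\rangle_{\partial K}$. **M-decompositions.** Let $V(K)$ be a space of vector fields in $H(\mathrm{div},K)$ with normal trace in $L^2(\partial K)$, $W(K)$ a space of functions on $K$, and $M(\partial K)=\{\mu\in L^2(\partial K):\mu|_F\in M(F)\ \forall F\in\mathcal F(K)\}$, all finite dimensional. Put $\mathrm{tr}(v,w)=(v\cdot n+w)|_{\partial K}$. The pair $V(K)\times W(K)$ admits an $M(\partial K)$-decomposition if $\mathrm{tr}(V(K)\times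 W(K))\subset M(\partial K)$ and there are subspaces $\widetilde V\subset V(K)$, $\widetilde W\subset W(K)$ with $\nabla W(K)\subset\widetilde V$, $\nabla\cdot V(K)\subset\widetilde W$ such that $\mathrm{tr}:\widetilde V^\perp\times\widetilde W^\perp\to M(\partial K)$ is an isomorphism, where $\perp$ denotes the $L^2(K)$-orthogonal complements in $V(K)$ and in $W(K)$. **Local spaces.** For every face let $M(F)\subset L^3(F)$ be finite dimensional. For every $K$ let $W(K)$ be a space of polynomials closed under all $\partial_i$, and let $V(K)\subset V^*(K)$ with $\nabla\cdot V^*(K)=W(K)$ be such that both $V(K)\times W(K)$ and $V^*(K)\times W(K)$ admit an $M(\partial K)$-decomposition. Let $M_S(\partial K)\subset M(\partial K)$ satisfy $\dim M_S(\partial K)=\dim W(K)-\dim\nabla\cdot V(K)$, and let $w\mapsto\|P_{M_S}w\|_{\partial K}$ be a norm on the $L^2(K)$-orthogonal complement of $\nabla\cdot V(K)$ in $W(K)$, where $P_{M_S}$ is the $L^2(\partial K)$-projection onto $M_S(\partial K)$. Let $\mathcal G_h$ be the $d\times d$ matrix fields whose rows lie in $V(K)$ on each $K$; $\boldsymbol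 V_h$ the vector fields with components in $W(K)$ on each $K$; $\mathring Q_h$ the functions $q$ with $q|_K\in W(K)$ and $(q,1)_\Omega=0$; and $\boldsymbol M_h(0)$ the vector functions on $\mathcal F_h$ with components in $M(F)$ that vanish on $\partial\Omega$. **The method.** Let $\nu>0$ and $f\in L^2(\Omega)^d$. A solution of the HDG method is $(L_h,u_h,p_h,\hat u_h)\in\mathcal G_h\times\boldsymbol V_h\times\mathring Q_h\times\boldsymbol M_h(0)$ such that for all $(G,v,q,\hat v)$ in the same space $$(\nu L_h,G)_{\mathcal T_h}+(u_h,\nu\nabla\cdot G)_{\mathcal T_h}-\langle\hat u_h,\nu G n\rangle_{\partial\mathcal T_h}=0,$$ $$\begin{aligned}&(\nu L_h,\nabla v)_{\mathcal T_h}+\langle-\nu L_hn+\alpha_v(u_h-\hat u_h),v-\hat v\rangle_{\partial\mathcal T_h}-(p_h,\nabla\cdot v)_{\mathcal T_h}+\langle p_hn,v-\hat v\rangle_{\partial\mathcal T_h}\\&\quad-(u_h\otimes\beta,\nabla v)_{\mathcal T_h}+\langle(\beta\cdot n)\hat u_h+\alpha_c(u_h-\hat u_h),v-\hat v\rangle_{\partial\mathcal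 T_h}=(f,v)_{\mathcal T_h},\end{aligned}$$ $$-(u_h,\nabla q)_{\mathcal T_h}+\langle\hat u_h\cdot n,q\rangle_{\partial\mathcal T_h}=0.$$ Here $\alpha_v(\hat v)=\frac{\nu}{h_K}P_{M_S}\hat v$ (componentwise), $\alpha_c(\hat v)=\max\{\beta\cdot n,0\}\hat v$, and $\beta|_K\in V^*(K)$ is the post-processed velocity given by $(\beta,v)_K=(u_h,v)_K$ for $v\in\nabla W(K)\oplus\{b\in V^*(K):\nabla\cdot b=0,\ b\cdot n|_{\partial K}=0\}$ and $\langle\beta\cdot n,\mu\rangle_{\partial K}=\langle\hat u_h\cdot n,\mu\rangle_{\partial K}$ for $\mu\in M(\partial K)$. Put $$|||(u_h,\hat u_h)|||_{1,\mathcal T_h}^2=\sum_{i=1}^d\sum_{K}\big(\|\nabla u_{h,i}\|_K^2+h_K^{-1}\|u_{h,i}-\hat u_{h,i}\|_{\partial K}^2\big).$$ **Parameters.** The mesh is $\sigma$-shape-regular if each $K$ contains a ball of radius $h_K/\sigma$ and has at most $\sigma$ faces. The spaces have parameters $(k,\Lambda)$ if, for all $K$: polynomials in $W(K)$ have degree at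 most $k$; $\|v\|_K\le\Lambda h_K^{1/2}\|v\cdot n\|_{\partial K}$ for every $v$ in the $L^2(K)$-orthogonal complement of $\nabla W(K)\oplus\{b:\nabla\cdot b=0,\ b\cdot n=0\}$ in $V(K)$, and likewise in $V^*(K)$; $\|w\|_{\partial K}\le\Lambda\|P_{M_S}w\|_{\partial K}$ for every $w$ in the orthogonal complement of $\nabla\cdot V(K)$ in $W(K)$; and $\|\mu\|_{L^3(F)}\le\Lambda h_K^{-(d-1)/6}\|\mu\|_F$ for $\mu\in M(F)$, $F\in\mathcal F(K)$. **Theorem.** (i) Every mesh and every choice of spaces as above is $\sigma$-shape-regular for some $\sigma>0$ and has parameters $(k,\Lambda)$ for some $k,\Lambda$. (ii) For every $\Omega$, $\sigma>0$, $k$, $\Lambda$ there are constants $\delta>0$ and $C>0$ such that for every $\sigma$-shape-regular mesh of $\Omega$, all spaces with parameters $(k,\Lambda)$, all $\nu>0$ and all $f\in L^2(\Omega)^d$ with $\nu^{-2}\|f\|_\Omega\le\delta$, the HDG method has a unique solution $(L_h,u_h,p_h,\hat u_h)$, and $$|||(u_h,\hat u_h)|||_{1,\mathcal T_h}\le C\,\nu^{-1}\|f\|_\Omega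 .$$ -/

import Mathlib

open MeasureTheory Filter Topology
open scoped ENNReal ContDiff

namespace HDG

/-- Euclidean space `ℝ^d`. -/
abbrev Space (d : ℕ) := EuclideanSpace ℝ (Fin d)

/-- Polynomials in `d` variables. -/
abbrev Poly (d : ℕ) := MvPolynomial (Fin d) ℝ

/-! ### Polynomials as functions -/

/-- The value of a polynomial at a point. -/
noncomputable def evalAt {d : ℕ} (p : Poly d) (x : Space d) : ℝ :=
  MvPolynomial.eval (fun r => x r) p

/-- The vector field with polynomial components `v r`. -/
noncomputable def vecAt {d : ℕ} (v : Fin d → Poly d) (x : Space d) : Space d :=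
  WithLp.toLp 2 fun r => evalAt (v r) x

/-- The components of the gradient of a polynomial. -/
noncomputable def grad {d : ℕ} (p : Poly d) : Fin d → Poly d :=
  fun s => MvPolynomial.pderiv s p

/-- The divergence of a polynomial vector field. -/
noncomputable def divP {d : ℕ} (v : Fin d → Poly d) : Poly d :=
  ∑ r, MvPolynomial.pderiv r (v r)

theorem continuous_evalAt {d : ℕ} (p : Poly d) : Continuous (evalAt p) :=
  (MvPolynomial.continuous_eval p).comp (by fun_prop)

theorem continuous_vecAt {d : ℕ} (v : Fin d → Poly d) : Continuous (vecAt v) :=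
  (PiLp.continuous_toLp 2 _).comp (continuous_pi fun r => continuous_evalAt (v r))

/-! ### Finite measures carried by a compact set -/

/-- A finite measure that is carried by a compact set. -/
def CompactlyCarried {d : ℕ} (μ : Measure (Space d)) : Prop :=
  IsFiniteMeasure μ ∧ ∃ S : Set (Space d), IsCompact S ∧ ∀ᵐ x ∂μ, x ∈ S

theorem CompactlyCarried.memLp {d : ℕ} {μ : Measure (Space d)} (h : CompactlyCarried μ)
    {G : Type*} [NormedAddCommGroup G] [SecondCountableTopology G] {g : Space d → G}
    (hg : Continuous g) (p : ℝ≥0∞) : MemLp g p μ := by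
  obtain ⟨hfin, S, hS, hμ⟩ := h
  obtain ⟨C, hC⟩ := hS.exists_bound_of_continuousOn hg.continuousOn
  exact MemLp.of_bound hg.aestronglyMeasurable C (hμ.mono fun x hx => hC x hx)

/-- A polynomial as an element of `L²(μ)`. -/
noncomputable def polyL2 {d : ℕ} {μ : Measure (Space d)} (h : CompactlyCarried μ) :
    Poly d →ₗ[ℝ] Lp ℝ 2 μ where
  toFun p := (h.memLp (continuous_evalAt p) 2).toLp (evalAt p)
  map_add' p q := by
    rw [← MemLp.toLp_add]
    exact MemLp.toLp_congr _ _ (ae_of_all _ fun x => by simp [evalAt])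
  map_smul' c p := by
    rw [RingHom.id_apply, ← MemLp.toLp_const_smul]
    exact MemLp.toLp_congr _ _ (ae_of_all _ fun x => by simp [evalAt, MvPolynomial.smul_eval])

/-- A polynomial vector field as an element of `L²(μ)^d`. -/
noncomputable def vecL2 {d : ℕ} {μ : Measure (Space d)} (h : CompactlyCarried μ)
    (v : Fin d → Poly d) : Lp (Space d) 2 μ :=
  (h.memLp (continuous_vecAt v) 2).toLp (vecAt v)

/-! ### Polyhedral domains and meshes -/

/-- A polygon (`d = 2`) or polyhedron (`d = 3`): a bounded domain that is the interior of its
closure and whose boundary lies in a finite union of hyperplanes. It need not be convex. -/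
structure IsPolyhedralDomain {d : ℕ} (U : Set (Space d)) : Prop where
  isOpen : IsOpen U
  isConnected : IsConnected U
  isBounded : Bornology.IsBounded U
  regular : interior (closure U) = U
  flat : ∃ H : Set (AffineSubspace ℝ (Space d)), H.Finite ∧
    (∀ A ∈ H, Module.finrank ℝ A.direction + 1 = d) ∧ frontier U ⊆ ⋃ A ∈ H, (A : Set (Space d))

/-- A flat face: a compact connected piece of a hyperplane, which is the closure of its relative
interior. -/
structure IsFlatFace {d : ℕ} (F : Set (Space d)) : Prop where
  isCompact : IsCompact F
  isConnected : IsConnected F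
  finrank_direction : Module.finrank ℝ (affineSpan ℝ F).direction + 1 = d
  subset_closure : F ⊆ closure (intrinsicInterior ℝ F)

/-- A conforming mesh of `Ω` made of polyhedral elements. The faces are shared: the boundary of
each element is the union of its faces, and different faces overlap only in a set of surface
measure zero, so that a face of an element is a full face of every element that it touches in a set
of positive measure. -/
structure Mesh {d : ℕ} (Ω : Set (Space d)) where
  /-- number of elements -/
  nK : ℕ
  /-- number of faces -/
  nF : ℕ
  /-- the (open) elements -/
  elem : Fin nK → Set (Space d)
  /-- the (closed) faces -/
  face : Fin nF → Set (Space d)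
  /-- the faces of an element -/
  faces : Fin nK → Finset (Fin nF)
  /-- the outward unit normal of an element on one of its faces -/
  normal : (i : Fin nK) → faces i → Space d
  elem_polyhedral : ∀ i, IsPolyhedralDomain (elem i)
  elem_disjoint : Pairwise fun i i' => Disjoint (elem i) (elem i')
  elem_cover : ⋃ i, closure (elem i) = closure Ω
  face_flat : ∀ j, IsFlatFace (face j)
  face_overlap : Pairwise fun j j' => μHE[d - 1] (face j ∩ face j') = 0
  face_used : ∀ j, ∃ i, j ∈ faces i
  frontier_elem : ∀ i, frontier (elem i) = ⋃ j ∈ faces i, face j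
  norm_normal : ∀ i j, ‖normal i j‖ = 1
  normal_orthogonal : ∀ i (j : faces i), ∀ v ∈ (affineSpan ℝ (face j)).direction,
    inner ℝ (normal i j) v = 0
  normal_outward : ∀ i (j : faces i), ∀ᵐ x ∂((μHE[d - 1]).restrict (face j)),
    ∀ᶠ t : ℝ in 𝓝[>] 0, x - t • normal i j ∈ elem i ∧ x + t • normal i j ∉ elem i

theorem IsFlatFace.measure_lt_top {d : ℕ} {F : Set (Space d)} (hF : IsFlatFace F) :
    μHE[d - 1] F < ⊤ := by
  obtain ⟨p, hp⟩ := hF.isConnected.nonempty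
  let D := (affineSpan ℝ F).direction
  have hdim : Module.finrank ℝ D = d - 1 := by
    exact Nat.eq_sub_of_add_eq hF.finrank_direction
  let g : D → Space d := fun v => (v : Space d) + p
  have hg : Isometry g := by
    refine Isometry.of_dist_eq fun a b => ?_
    rw [dist_add_right]
    rfl
  have himg : g '' (g ⁻¹' F) = F := by
    refine Set.image_preimage_eq_of_subset fun x hx => ?_
    refine ⟨⟨x - p, ?_⟩, by simp [g]⟩
    exact AffineSubspace.vsub_mem_direction (subset_affineSpan ℝ F hx) (subset_affineSpan ℝ F hp)
  have hc : IsCompact (g ⁻¹' F) := hg.isClosedEmbedding.isCompact_preimage hF.isCompact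
  rw [← himg, hg.euclideanHausdorffMeasure_image, ← hdim]
  exact hc.measure_lt_top

namespace Mesh

variable {d : ℕ} {Ω : Set (Space d)} (T : Mesh Ω)

/-- Lebesgue measure on an element. -/
noncomputable def vol (i : Fin T.nK) : Measure (Space d) := volume.restrict (T.elem i)

/-- Surface measure on a face. -/
noncomputable def surf (j : Fin T.nF) : Measure (Space d) := (μHE[d - 1]).restrict (T.face j)

/-- The diameter `h_K` of an element. -/
noncomputable def h (i : Fin T.nK) : ℝ := Metric.diam (T.elem i)

theorem carried_vol (i : Fin T.nK) : CompactlyCarried (T.vol i) := by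
  have hb := (T.elem_polyhedral i).isBounded
  refine ⟨⟨?_⟩, closure (T.elem i), hb.isCompact_closure, ?_⟩
  · rw [vol, Measure.restrict_apply_univ]
    exact hb.measure_lt_top
  · exact (ae_restrict_mem (T.elem_polyhedral i).isOpen.measurableSet).mono
      fun x hx => subset_closure hx

theorem carried_surf (j : Fin T.nF) : CompactlyCarried (T.surf j) := by
  have hc := (T.face_flat j).isCompact
  refine ⟨⟨?_⟩, T.face j, hc, ae_restrict_mem hc.measurableSet⟩
  rw [surf, Measure.restrict_apply_univ]
  exact (T.face_flat j).measure_lt_top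

/-- `L²(∂K)`, as the orthogonal sum of the spaces `L²(F)` over the faces `F` of `K`. -/
abbrev TraceL2 (i : Fin T.nK) := PiLp 2 fun j : T.faces i => Lp ℝ 2 (T.surf j)

/-- A polynomial as an element of `L²(K)`. -/
noncomputable def polyK (i : Fin T.nK) : Poly d →ₗ[ℝ] Lp ℝ 2 (T.vol i) := polyL2 (T.carried_vol i)

/-- A polynomial vector field as an element of `L²(K)^d`. -/
noncomputable def vecK (i : Fin T.nK) (v : Fin d → Poly d) : Lp (Space d) 2 (T.vol i) :=
  vecL2 (T.carried_vol i) v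

/-- The trace on `∂K` of a polynomial. -/
noncomputable def traceK (i : Fin T.nK) (p : Poly d) : T.TraceL2 i :=
  WithLp.toLp 2 fun j => polyL2 (T.carried_surf j) p

/-- The restriction to `∂K` of a function on the skeleton of the mesh. -/
noncomputable def restrictK (i : Fin T.nK) (μ : (j : Fin T.nF) → Lp ℝ 2 (T.surf j)) :
    T.TraceL2 i :=
  WithLp.toLp 2 fun j => μ j

/-- The product of a function on `∂K` with the component `r` of the outward unit normal. -/
noncomputable def mulNormal (i : Fin T.nK) (r : Fin d) (τ : T.TraceL2 i) : T.TraceL2 i :=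
  WithLp.toLp 2 fun j => T.normal i j r • τ j

/-- The vector fields in `H(div, K)` that have a polynomial divergence and a normal trace in
`L²(∂K)`. An element is a triple `(v, ∇·v, v·n)` of the field, its weak divergence, and its normal
trace, which are tied together by Green's formula
`(v, ∇φ)_K + (∇·v, φ)_K = ⟨v·n, φ⟩_∂K` for all smooth `φ`; the field determines the other two. -/
noncomputable def HDiv (i : Fin T.nK) :
    Submodule ℝ (Lp (Space d) 2 (T.vol i) × Poly d × T.TraceL2 i) where
  carrier := {v | ∀ φ : Space d → ℝ, ContDiff ℝ ∞ φ →
    ∫ x, inner ℝ (v.1 x) (gradient φ x) ∂(T.vol i) + ∫ x, evalAt v.2.1 x * φ x ∂(T.vol i)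
      = ∑ j : T.faces i, ∫ x, v.2.2 j x * φ x ∂(T.surf j)}
  zero_mem' := by
    intro φ hφ
    have h1 : ∫ x, inner ℝ ((0 : Lp (Space d) 2 (T.vol i)) x) (gradient φ x) ∂(T.vol i) = 0 := by
      refine integral_eq_zero_of_ae ?_
      filter_upwards [Lp.coeFn_zero (Space d) 2 (T.vol i)] with x hx
      rw [hx, Pi.zero_apply, inner_zero_left, Pi.zero_apply]
    have h2 : ∀ j : T.faces i, ∫ x, (0 : Lp ℝ 2 (T.surf j)) x * φ x ∂(T.surf j) = 0 := by
      intro j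
      refine integral_eq_zero_of_ae ?_
      filter_upwards [Lp.coeFn_zero ℝ 2 (T.surf j)] with x hx
      rw [hx, Pi.zero_apply, zero_mul]
    simp only [Prod.fst_zero, Prod.snd_zero, PiLp.zero_apply, h1, h2]
    simp [evalAt]
  add_mem' := by
    intro v w hv hw φ hφ
    have hgr : Continuous (gradient φ) :=
      (InnerProductSpace.toDual ℝ (Space d)).symm.continuous.comp
        (hφ.continuous_fderiv (by simp))
    have hG : ∀ u : Lp (Space d) 2 (T.vol i),
        Integrable (fun x => inner ℝ (u x) (gradient φ x)) (T.vol i) := by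
      intro u
      have hm := (T.carried_vol i).memLp hgr 2
      refine (L2.integrable_inner (𝕜 := ℝ) u (hm.toLp _)).congr ?_
      filter_upwards [hm.coeFn_toLp] with x hx
      rw [hx]
    have hP : ∀ p : Poly d, Integrable (fun x => evalAt p x * φ x) (T.vol i) := fun p =>
      memLp_one_iff_integrable.1
        ((T.carried_vol i).memLp ((continuous_evalAt p).mul hφ.continuous) 1)
    have hS : ∀ (j : T.faces i) (u : Lp ℝ 2 (T.surf j)),
        Integrable (fun x => u x * φ x) (T.surf j) := fun j u =>
      (Lp.memLp u).integrable_mul ((T.carried_surf j).memLp hφ.continuous 2)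
    have e1 : ∫ x, inner ℝ ((v.1 + w.1 : Lp (Space d) 2 (T.vol i)) x) (gradient φ x) ∂(T.vol i)
        = ∫ x, inner ℝ (v.1 x) (gradient φ x) ∂(T.vol i)
          + ∫ x, inner ℝ (w.1 x) (gradient φ x) ∂(T.vol i) := by
      rw [← integral_add (hG _) (hG _)]
      refine integral_congr_ae ?_
      filter_upwards [Lp.coeFn_add v.1 w.1] with x hx
      rw [hx, Pi.add_apply, inner_add_left]
    have e2 : ∫ x, evalAt (v.2.1 + w.2.1) x * φ x ∂(T.vol i)
        = ∫ x, evalAt v.2.1 x * φ x ∂(T.vol i) + ∫ x, evalAt w.2.1 x * φ x ∂(T.vol i) := by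
      rw [← integral_add (hP _) (hP _)]
      refine integral_congr_ae (ae_of_all _ fun x => ?_)
      simp [evalAt, add_mul]
    have e3 : ∀ j : T.faces i,
        ∫ x, (v.2.2 j + w.2.2 j : Lp ℝ 2 (T.surf j)) x * φ x ∂(T.surf j)
        = ∫ x, v.2.2 j x * φ x ∂(T.surf j) + ∫ x, w.2.2 j x * φ x ∂(T.surf j) := by
      intro j
      rw [← integral_add (hS j _) (hS j _)]
      refine integral_congr_ae ?_
      filter_upwards [Lp.coeFn_add (v.2.2 j) (w.2.2 j)] with x hx
      rw [hx, Pi.add_apply, add_mul]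
    have a := hv φ hφ
    have b := hw φ hφ
    simp only [Prod.fst_add, Prod.snd_add, PiLp.add_apply, e1, e2, e3, Finset.sum_add_distrib]
    linarith
  smul_mem' := by
    intro c v hv φ hφ
    have e1 : ∫ x, inner ℝ ((c • v.1 : Lp (Space d) 2 (T.vol i)) x) (gradient φ x) ∂(T.vol i)
        = c * ∫ x, inner ℝ (v.1 x) (gradient φ x) ∂(T.vol i) := by
      rw [← integral_const_mul]
      refine integral_congr_ae ?_
      filter_upwards [Lp.coeFn_smul c v.1] with x hx
      rw [hx, Pi.smul_apply, real_inner_smul_left]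
    have e2 : ∫ x, evalAt (c • v.2.1) x * φ x ∂(T.vol i)
        = c * ∫ x, evalAt v.2.1 x * φ x ∂(T.vol i) := by
      rw [← integral_const_mul]
      refine integral_congr_ae (ae_of_all _ fun x => ?_)
      simp [evalAt, MvPolynomial.smul_eval, mul_assoc]
    have e3 : ∀ j : T.faces i, ∫ x, (c • v.2.2 j : Lp ℝ 2 (T.surf j)) x * φ x ∂(T.surf j)
        = c * ∫ x, v.2.2 j x * φ x ∂(T.surf j) := by
      intro j
      rw [← integral_const_mul]
      refine integral_congr_ae ?_
      filter_upwards [Lp.coeFn_smul c (v.2.2 j)] with x hx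
      rw [hx, Pi.smul_apply, smul_eq_mul, mul_assoc]
    have a := hv φ hφ
    simp only [Prod.smul_fst, Prod.smul_snd, PiLp.smul_apply, e1, e2, e3, ← Finset.mul_sum]
    rw [← mul_add, a]

/-- The field of an element of `H(div, K)`. -/
noncomputable def field (i : Fin T.nK) : T.HDiv i →ₗ[ℝ] Lp (Space d) 2 (T.vol i) :=
  LinearMap.fst ℝ _ _ ∘ₗ (T.HDiv i).subtype

/-- The divergence. -/
noncomputable def dvg (i : Fin T.nK) : T.HDiv i →ₗ[ℝ] Poly d :=
  LinearMap.fst ℝ _ _ ∘ₗ LinearMap.snd ℝ _ _ ∘ₗ (T.HDiv i).subtype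

/-- The normal trace on `∂K`. -/
noncomputable def ntr (i : Fin T.nK) : T.HDiv i →ₗ[ℝ] T.TraceL2 i :=
  LinearMap.snd ℝ _ _ ∘ₗ LinearMap.snd ℝ _ _ ∘ₗ (T.HDiv i).subtype

/-- The space `M(∂K)` of the functions on `∂K` whose restriction to each face `F` is in `M(F)`. -/
noncomputable def bdrySpace (M : (j : Fin T.nF) → Submodule ℝ (Lp ℝ 2 (T.surf j))) (i : Fin T.nK) :
    Submodule ℝ (T.TraceL2 i) where
  carrier := {μ | ∀ j : T.faces i, μ j ∈ M j}
  zero_mem' j := (M j).zero_mem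
  add_mem' ha hb j := (M j).add_mem (ha j) (hb j)
  smul_mem' c _ ha j := (M j).smul_mem c (ha j)

/-- `V(K) × W(K)` admits an `M(∂K)`-decomposition: the combined trace
`tr (v, w) = v·n + w` maps `V × W` into `M(∂K)`, and there are subspaces `Vt ≤ V`, `Wt ≤ W` with
`∇W ⊆ Vt`, `∇·V ⊆ Wt` such that `tr` is an isomorphism from the product of the `L²(K)`-orthogonal
complements of `Vt` in `V` and of `Wt` in `W` onto `M(∂K)`. -/
def AdmitsMDecomposition (i : Fin T.nK) (V : Submodule ℝ (T.HDiv i)) (W : Submodule ℝ (Poly d))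
    (Mb : Submodule ℝ (T.TraceL2 i)) : Prop :=
  (∀ v ∈ V, ∀ w ∈ W, T.ntr i v + T.traceK i w ∈ Mb) ∧
  ∃ (Vt : Submodule ℝ (T.HDiv i)) (Wt : Submodule ℝ (Poly d)), Vt ≤ V ∧ Wt ≤ W ∧
    (∀ w ∈ W, ∃ v ∈ Vt, T.field i v = T.vecK i (grad w)) ∧
    (∀ v ∈ V, T.dvg i v ∈ Wt) ∧
    Set.BijOn (fun z : T.HDiv i × Poly d => T.ntr i z.1 + T.traceK i z.2)
      ({v | v ∈ V ∧ ∀ v' ∈ Vt, inner ℝ (T.field i v) (T.field i v') = 0} ×ˢ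
        {w | w ∈ W ∧ ∀ w' ∈ Wt, inner ℝ (T.polyK i w) (T.polyK i w') = 0})
      (Mb : Set (T.TraceL2 i))

/-- `v` is `L²(K)`-orthogonal to `∇W(K) ⊕ {b ∈ V(K) : ∇·b = 0, b·n = 0}`. -/
def PerpGradBubble (i : Fin T.nK) (V : Submodule ℝ (T.HDiv i)) (W : Submodule ℝ (Poly d))
    (v : Lp (Space d) 2 (T.vol i)) : Prop :=
  (∀ w ∈ W, inner ℝ v (T.vecK i (grad w)) = 0) ∧
  ∀ b ∈ V, T.dvg i b = 0 → T.ntr i b = 0 → inner ℝ v (T.field i b) = 0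

/-- `w` is `L²(K)`-orthogonal to `∇·V(K)`. -/
def PerpDiv (i : Fin T.nK) (V : Submodule ℝ (T.HDiv i)) (w : Poly d) : Prop :=
  ∀ v ∈ V, inner ℝ (T.polyK i w) (T.polyK i (T.dvg i v)) = 0

/-- Shape regularity with parameter `σ`: each element contains a ball of radius `h_K / σ` and has
at most `σ` faces. -/
def IsShapeRegular (σ : ℝ) : Prop :=
  ∀ i, (∃ x, Metric.ball x (T.h i / σ) ⊆ T.elem i) ∧ ((T.faces i).card : ℝ) ≤ σ

end Mesh

/-! ### The finite element spaces -/

/-- The local spaces from which the method is built. On each element `K` there are the scalar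
spaces `V(K)` of vector fields, `W(K)` of polynomials, the enriched space `Vs(K)` for the
post-processed velocity, and the stabilization subspace `MS(K)` of `M(∂K)`; on each face there is
`M(F)`. The velocity gradient has its rows in `V(K)`, the velocity its components in `W(K)`, the
pressure is in `W(K)`, and the numerical trace has its components in `M(F)`. The functions in `M(F)`
are assumed cubically integrable, so that the convective terms on the faces are defined. -/
structure FESpaces {d : ℕ} {Ω : Set (Space d)} (T : Mesh Ω) where
  V : (i : Fin T.nK) → Submodule ℝ (T.HDiv i)
  W : (i : Fin T.nK) → Submodule ℝ (Poly d)
  M : (j : Fin T.nF) → Submodule ℝ (Lp ℝ 2 (T.surf j))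
  Vs : (i : Fin T.nK) → Submodule ℝ (T.HDiv i)
  MS : (i : Fin T.nK) → Submodule ℝ (T.TraceL2 i)
  finite_V : ∀ i, FiniteDimensional ℝ (V i)
  finite_W : ∀ i, FiniteDimensional ℝ (W i)
  finite_M : ∀ j, FiniteDimensional ℝ (M j)
  finite_Vs : ∀ i, FiniteDimensional ℝ (Vs i)
  finite_MS : ∀ i, FiniteDimensional ℝ (MS i)
  memLp_M : ∀ j, ∀ μ ∈ M j, MemLp μ 3 (T.surf j)
  /-- `W(K)` is closed under partial derivatives -/
  pderiv_W : ∀ i, ∀ w ∈ W i, ∀ s, MvPolynomial.pderiv s w ∈ W i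
  decomp : ∀ i, T.AdmitsMDecomposition i (V i) (W i) (T.bdrySpace M i)
  V_le_Vs : ∀ i, V i ≤ Vs i
  div_Vs : ∀ i, (Vs i).map (T.dvg i) = W i
  decomp_Vs : ∀ i, T.AdmitsMDecomposition i (Vs i) (W i) (T.bdrySpace M i)
  MS_le : ∀ i, MS i ≤ T.bdrySpace M i
  /-- `dim MS(K) = dim W(K) - dim ∇·V(K)` -/
  finrank_MS : ∀ i, Module.finrank ℝ (MS i) + Module.finrank ℝ ((V i).map (T.dvg i))
    = Module.finrank ℝ (W i)
  /-- the seminorm `‖P_MS w‖_∂K` is a norm on the orthogonal complement of `∇·V(K)` in `W(K)` -/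
  norm_MS : ∀ i, ∀ w ∈ W i, T.PerpDiv i (V i) w →
    (MS i).starProjection (T.traceK i w) = 0 → w = 0

attribute [instance] FESpaces.finite_MS

namespace FESpaces

variable {d : ℕ} {Ω : Set (Space d)} {T : Mesh Ω} (S : FESpaces T)

/-- The scale-invariant quantities of the local spaces on which constants are allowed to depend:
the degree of the polynomials in `W(K)`, and bounds `Λ` for the constants that express, by
equivalence of norms on finite-dimensional spaces, that the normal trace is injective on the
orthogonal complement of `∇W ⊕ {b : ∇·b = 0, b·n = 0}` in `V(K)` and in `Vs(K)`, that `P_MS` is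
injective on the complement of `∇·V(K)` in `W(K)`, and that `M(F)` lies in `L³(F)`. For given
spaces, such `k` and `Λ` always exist. -/
structure HasParameters (k : ℕ) (Λ : ℝ) : Prop where
  degree : ∀ i, ∀ w ∈ S.W i, w.totalDegree ≤ k
  lift_V : ∀ i, ∀ v ∈ S.V i, T.PerpGradBubble i (S.V i) (S.W i) (T.field i v) →
    ‖T.field i v‖ ≤ Λ * √(T.h i) * ‖T.ntr i v‖
  lift_Vs : ∀ i, ∀ v ∈ S.Vs i, T.PerpGradBubble i (S.Vs i) (S.W i) (T.field i v) →
    ‖T.field i v‖ ≤ Λ * √(T.h i) * ‖T.ntr i v‖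
  stab : ∀ i, ∀ w ∈ S.W i, T.PerpDiv i (S.V i) w →
    ‖T.traceK i w‖ ≤ Λ * ‖(S.MS i).starProjection (T.traceK i w)‖
  inverse : ∀ i, ∀ j ∈ T.faces i, ∀ μ ∈ S.M j,
    eLpNorm μ 3 (T.surf j) ≤ ENNReal.ofReal (Λ * T.h i ^ (-((d : ℝ) - 1) / 6) * ‖μ‖)

end FESpaces

/-! ### The HDG method -/

/-- A tuple `(L, u, p, û)` of a broken velocity gradient (given by its rows), a broken velocity, a
broken pressure and a velocity trace on the faces. It is used for unknowns and test functions. -/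
structure Tuple {d : ℕ} {Ω : Set (Space d)} (T : Mesh Ω) where
  L : (i : Fin T.nK) → Fin d → T.HDiv i
  u : (i : Fin T.nK) → Fin d → Poly d
  p : (i : Fin T.nK) → Poly d
  uhat : (j : Fin T.nF) → Fin d → Lp ℝ 2 (T.surf j)

namespace Tuple

variable {d : ℕ} {Ω : Set (Space d)} {T : Mesh Ω}

/-- The trace on `∂K` of the component `r` of `û`. -/
noncomputable def hatTr (X : Tuple T) (i : Fin T.nK) (r : Fin d) : T.TraceL2 i :=
  T.restrictK i fun j => X.uhat j r

/-- The component `r` of `u - û` on `∂K`. -/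
noncomputable def jump (X : Tuple T) (i : Fin T.nK) (r : Fin d) : T.TraceL2 i :=
  T.traceK i (X.u i r) - X.hatTr i r

/-- `û·n` on `∂K`. -/
noncomputable def hatNormal (X : Tuple T) (i : Fin T.nK) : T.TraceL2 i :=
  ∑ r, T.mulNormal i r (X.hatTr i r)

/-- The discrete `H¹`-norm of the velocity `(u, û)`. -/
noncomputable def normOne (X : Tuple T) : ℝ :=
  √(∑ r, ∑ i, (‖T.vecK i (grad (X.u i r))‖ ^ 2 + (T.h i)⁻¹ * ‖X.jump i r‖ ^ 2))

end Tuple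

namespace FESpaces

variable {d : ℕ} {Ω : Set (Space d)} {T : Mesh Ω} (S : FESpaces T)

/-- The tuple lies in `𝒢_h × V_h × Q̊_h × M_h(0)`: pressures have mean zero on `Ω`, and velocity
traces vanish on the faces on `∂Ω`. -/
structure Mem (X : Tuple T) : Prop where
  L : ∀ i r, X.L i r ∈ S.V i
  u : ∀ i r, X.u i r ∈ S.W i
  p : ∀ i, X.p i ∈ S.W i
  mean_p : ∑ i, ∫ x, evalAt (X.p i) x ∂(T.vol i) = 0
  uhat : ∀ j r, X.uhat j r ∈ S.M j
  boundary : ∀ j, T.face j ⊆ frontier Ω → ∀ r, X.uhat j r = 0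

/-- `β` is the post-processed velocity of `(u, û)`: on each element `K` it is the function in
`Vs(K)` with `(β, v)_K = (u, v)_K` for `v ∈ ∇W(K) ⊕ {b ∈ Vs(K) : ∇·b = 0, b·n = 0}` and
`⟨β·n, μ⟩_∂K = ⟨û·n, μ⟩_∂K` for `μ ∈ M(∂K)`. -/
structure IsPostprocessed (X : Tuple T) (β : (i : Fin T.nK) → T.HDiv i) : Prop where
  mem : ∀ i, β i ∈ S.Vs i
  grad : ∀ i, ∀ w ∈ S.W i, inner ℝ (T.field i (β i)) (T.vecK i (grad w))
    = inner ℝ (T.vecK i (X.u i)) (T.vecK i (grad w))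
  bubble : ∀ i, ∀ b ∈ S.Vs i, T.dvg i b = 0 → T.ntr i b = 0 →
    inner ℝ (T.field i (β i)) (T.field i b) = inner ℝ (T.vecK i (X.u i)) (T.field i b)
  trace : ∀ i, ∀ μ ∈ T.bdrySpace S.M i,
    inner ℝ (T.ntr i (β i)) μ = inner ℝ (X.hatNormal i) μ

/-- `(νL, G) + (u, ν∇·G) - ⟨û, νGn⟩`. -/
noncomputable def gradientForm (ν : ℝ) (X Y : Tuple T) : ℝ :=
  ∑ i, ∑ r, (inner ℝ (ν • T.field i (X.L i r)) (T.field i (Y.L i r))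
    + inner ℝ (T.polyK i (X.u i r)) (ν • T.polyK i (T.dvg i (Y.L i r)))
    - inner ℝ (X.hatTr i r) (ν • T.ntr i (Y.L i r)))

/-- `(νL, ∇v) + ⟨-νLn + α_v(u - û), v - v̂⟩`, with the minimal viscous stabilization
`α_v = (ν / h_K) P_MS`, applied to each component. -/
noncomputable def viscousForm (ν : ℝ) (X Y : Tuple T) : ℝ :=
  ∑ i, ∑ r, (inner ℝ (ν • T.field i (X.L i r)) (T.vecK i (grad (Y.u i r)))
    + inner ℝ (-(ν • T.ntr i (X.L i r)) + (ν / T.h i) • (S.MS i).starProjection (X.jump i r))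
        (Y.jump i r))

/-- `-(p, ∇·v) + ⟨p n, v - v̂⟩`. -/
noncomputable def pressureForm (X Y : Tuple T) : ℝ :=
  ∑ i, (-inner ℝ (T.polyK i (X.p i)) (T.polyK i (divP (Y.u i)))
    + ∑ r, inner ℝ (T.mulNormal i r (T.traceK i (X.p i))) (Y.jump i r))

/-- `-(u ⊗ β, ∇v) + ⟨(β·n) û + α_c(u - û), v - v̂⟩`, with the upwinding stabilization
`α_c = max (β·n) 0`. -/
noncomputable def convectiveForm (β : (i : Fin T.nK) → T.HDiv i) (X Y : Tuple T) : ℝ :=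
  ∑ i, ∑ r, (-∫ x, evalAt (X.u i r) x * inner ℝ (T.field i (β i) x) (vecAt (grad (Y.u i r)) x)
      ∂(T.vol i)
    + ∑ j : T.faces i, ∫ x, (T.ntr i (β i) j x * X.uhat j r x
        + max (T.ntr i (β i) j x) 0 * (evalAt (X.u i r) x - X.uhat j r x))
          * (evalAt (Y.u i r) x - Y.uhat j r x) ∂(T.surf j))

/-- `(f, v)`. -/
noncomputable def load (f : Space d → Space d) (Y : Tuple T) : ℝ :=
  ∑ i, ∫ x, inner ℝ (f x) (vecAt (Y.u i) x) ∂(T.vol i)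

/-- `-(u, ∇q) + ⟨û·n, q⟩`. -/
noncomputable def divergenceForm (X Y : Tuple T) : ℝ :=
  ∑ i, (-inner ℝ (T.vecK i (X.u i)) (T.vecK i (grad (Y.p i)))
    + inner ℝ (X.hatNormal i) (T.traceK i (Y.p i)))

/-- `X = (L_h, u_h, p_h, û_h)` solves the HDG method for the Navier-Stokes equations with viscosity
`ν` and body force `f`. -/
def IsSolution (ν : ℝ) (f : Space d → Space d) (X : Tuple T) : Prop :=
  S.Mem X ∧ ∃ β : (i : Fin T.nK) → T.HDiv i, S.IsPostprocessed X β ∧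
    ∀ Y : Tuple T, S.Mem Y →
      gradientForm ν X Y = 0 ∧
      S.viscousForm ν X Y + pressureForm X Y + convectiveForm β X Y = load f Y ∧
      divergenceForm X Y = 0

end FESpaces

end HDG

/-! The nonlinearity enters only through the post-processed velocity `β`. Freezing `β` at the one
that belongs to a discretely divergence-free tuple `Z` leaves a linear (Oseen) problem, and a
solution of the method is a tuple whose own velocity reproduces the `β` with which it was computed.
For small `ν⁻²‖f‖` the passage from `Z` to the Oseen solution `X` halves distances in the discrete
`H¹`-norm, so that Banach's principle applies. Three estimates carry this, with constants that see
only `Ω`, `σ`, `k` and `Λ`.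

Coercivity (`HasParameters.local_coercivity`). On each element the M-decomposition splits the jump
`u - û` orthogonally into a normal trace `G·n`, with `G` orthogonal to gradients and bubbles, and a
trace of some `w` orthogonal to `∇·V`. Testing the gradient equation with `G` bounds the first part
by `L`; the minimal stabilization `P_MS` bounds the second. Testing with `∇u` then bounds `∇u`. So
`ν(‖L‖² + h⁻¹‖P_MS(u - û)‖²)`, which is what the energy identity yields, dominates `ν` times the
square of the full discrete norm.

Sign of convection (`convectiveForm_self_nonneg`). Because `∇·V* = W`, the discrete constraint makes
`β` exactly divergence-free, and its normal trace is `û·n` for a single-valued `û` that vanishes on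
the boundary. Integration by parts then reduces the upwinded form on the diagonal to a nonnegative
jump term. Hence the Oseen problem is uniquely solvable, and its solutions obey the energy bound
without any smallness of the data.

Continuity of convection (`exists_abs_convectiveForm_sub_le`). The form is Lipschitz in `β`, because
`max (β·n) 0` is. A mesh-independent constant comes from Hölder's inequality with exponents 4, 4, 2
and a discrete Sobolev inequality (`Mesh.exists_sobolev`). The latter is obtained from the embedding
of `W^{1,1}` into `L^{3/2}`, valid for `d ≤ 3`, applied to mollifications of the piecewise
polynomial `u⁴`: its total variation is controlled by the `L²`-norm of `u³` times the energy, while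
its `L^{3/2}`-norm is a power of the integral of `u⁶`, so the latter integral can be absorbed. On
the faces `u⁴` is compared with the fourth power of a truncated `û`.

The embedding is applied to functions that jump across faces, which needs the divergence theorem on
elements. It is derived directly from the definition of a mesh, by comparing an element with its
translates. The same mollification argument shows that a piecewise constant function without
interior jumps is constant; with it the pressure is recovered from the momentum equation, since only
uniqueness of the pressure, and no quantitative inf-sup constant, is needed. -/

namespace HDG

/-! ### Slicing Lebesgue measure along a direction transversal to a hyperplane -/

/-- Lebesgue measure as a product of a hyperplane and its unit normal. -/
theorem lintegral_eq_lintegral_normal {d : ℕ} {D : Submodule ℝ (Space d)}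
    (hD : Module.finrank ℝ D + 1 = d) {n : Space d} (hn : ‖n‖ = 1)
    (hnD : ∀ v ∈ D, inner ℝ n v = 0) (p : Space d) {G : Space d → ℝ≥0∞} (hG : Measurable G) :
    ∫⁻ x, G x = ∫⁻ s : ℝ, ∫⁻ z : D, G ((z : Space d) + p + s • n) := by
  have hmp := D.measurePreserving_measurableEquivProd p
  have hE : (μHE[Module.finrank ℝ (Space d)] : Measure (Space d)) = volume :=
    InnerProductSpace.euclideanHausdorffMeasure_eq_volume
  rw [hE] at hmp
  have hn' : n ∈ Dᗮ := by
    rw [Submodule.mem_orthogonal']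
    exact hnD
  have hrank : Module.finrank ℝ Dᗮ = 1 := by
    have := D.finrank_add_finrank_orthogonal
    rw [finrank_euclideanSpace_fin] at this
    omega
  let n' : Dᗮ := ⟨n, hn'⟩
  have hn0 : n' ≠ 0 := by
    intro h
    have : n = 0 := congrArg Subtype.val h
    simp [this] at hn
  -- The orthogonal complement is the line spanned by the unit vector `n`, so its volume is the
  -- image of Lebesgue measure under `s ↦ s n`, with factor `‖n‖ = 1`.
  have hv := volume_eq_of_finrank_eq_one hrank hn0
  have hnorm : ‖n'‖ₑ = 1 := by
    rw [← ofReal_norm]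
    change ENNReal.ofReal ‖n‖ = 1
    simp [hn]
  rw [hnorm, one_smul] at hv
  let f := ContinuousLinearEquiv.toSpanNonzeroSingleton ℝ n' hn0
  have h1 : ∫⁻ x, G x = ∫⁻ q : D × Dᗮ, G ((D.measurableEquivProd p).symm q) :=
    (hmp.symm.lintegral_comp hG).symm
  rw [h1, Measure.volume_eq_prod, lintegral_prod_symm _ (by fun_prop)]
  rw [hv, lintegral_map]
  · refine lintegral_congr fun s => lintegral_congr fun z => ?_
    rw [Submodule.measurableEquivProd_symm_apply]
    congr 1
    simp [n']
    abel
  · have : Measurable fun q : Dᗮ × D => G ((D.measurableEquivProd p).symm (q.2, q.1)) := by fun_prop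
    exact this.lintegral_prod_right'
  · fun_prop

/-- Lebesgue measure as a product of a hyperplane and a transversal direction. -/
theorem lintegral_eq_lintegral_transversal {d : ℕ} {D : Submodule ℝ (Space d)}
    (hD : Module.finrank ℝ D + 1 = d) {n : Space d} (hn : ‖n‖ = 1)
    (hnD : ∀ v ∈ D, inner ℝ n v = 0) (p : Space d) {e : Space d} (he : inner ℝ n e ≠ 0)
    {G : Space d → ℝ≥0∞} (hG : Measurable G) :
    ∫⁻ x, G x = ENNReal.ofReal |inner ℝ n e| *
      ∫⁻ s : ℝ, ∫⁻ z : D, G ((z : Space d) + p + s • e) := by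
  set c : ℝ := inner ℝ n e with hc
  have hn' : n ∈ Dᗮ := by
    rw [Submodule.mem_orthogonal']
    exact hnD
  have hrank : Module.finrank ℝ Dᗮ = 1 := by
    have := D.finrank_add_finrank_orthogonal
    rw [finrank_euclideanSpace_fin] at this
    omega
  have hspan : Submodule.span ℝ {n} = Dᗮ := by
    refine Submodule.eq_of_le_of_finrank_eq ?_ ?_
    · rw [Submodule.span_singleton_le_iff_mem]
      exact hn'
    · rw [finrank_span_singleton, hrank]
      intro h
      simp [h] at hn
  have hmem : e - c • n ∈ D := by
    rw [← D.orthogonal_orthogonal, ← hspan, Submodule.mem_orthogonal_singleton_iff_inner_right,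
      inner_sub_right, inner_smul_right, real_inner_self_eq_norm_sq, hn]
    simp [hc]
  let m : D := ⟨e - c • n, hmem⟩
  -- Since `e - c n` lies in `D`, a translation inside `D` replaces `s e` by `(c s) n`. The
  -- substitution `s ↦ c s` then produces the factor `|c|`.
  have h1 : ∀ s : ℝ, ∫⁻ z : D, G ((z : Space d) + p + s • e)
      = ∫⁻ z : D, G ((z : Space d) + p + (c * s) • n) := by
    intro s
    rw [← lintegral_add_right_eq_self (fun z : D => G ((z : Space d) + p + (c * s) • n)) (s • m)]
    refine lintegral_congr fun z => ?_
    congr 1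
    simp only [Submodule.coe_add, Submodule.coe_smul, m]
    module
  simp_rw [h1]
  have hmeas : Measurable fun s : ℝ => ∫⁻ z : D, G ((z : Space d) + p + s • n) := by
    have : Measurable fun q : ℝ × D => G ((q.2 : Space d) + p + q.1 • n) := by fun_prop
    exact this.lintegral_prod_right'
  have h2 : ∫⁻ s : ℝ, ∫⁻ z : D, G ((z : Space d) + p + (c * s) • n)
      = ENNReal.ofReal |c⁻¹| * ∫⁻ s : ℝ, ∫⁻ z : D, G ((z : Space d) + p + s • n) := by
    rw [← lintegral_map (f := fun s : ℝ => ∫⁻ z : D, G ((z : Space d) + p + s • n)) hmeas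
      (measurable_const_mul c), Real.map_volume_mul_left he, lintegral_smul_measure]
    rfl
  rw [h2, ← mul_assoc, ← ENNReal.ofReal_mul (abs_nonneg _), ← abs_mul, mul_inv_cancel₀ he,
    abs_one, ENNReal.ofReal_one, one_mul]
  exact lintegral_eq_lintegral_normal hD hn hnD p hG

/-- The surface measure of a hyperplane is the image of the volume of its direction. -/
theorem map_volume_direction {d : ℕ} {D : Submodule ℝ (Space d)}
    (hD : Module.finrank ℝ D + 1 = d) (p : Space d) :
    Measure.map (fun z : D => (z : Space d) + p) volume
      = (μHE[d - 1] : Measure (Space d)).restrict (Set.range fun z : D => (z : Space d) + p) := by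
  have hiso : Isometry (fun z : D => (z : Space d) + p) := by
    refine Isometry.of_dist_eq fun a b => ?_
    rw [dist_add_right]
    rfl
  have hr : Module.finrank ℝ D = d - 1 := by omega
  rw [← hiso.map_euclideanHausdorffMeasure, ← hr,
    InnerProductSpace.euclideanHausdorffMeasure_eq_volume]

/-- Slicing along a direction `e` transversal to the hyperplane of a set `F`. -/
theorem lintegral_sweep {d : ℕ} {D : Submodule ℝ (Space d)}
    (hD : Module.finrank ℝ D + 1 = d) {n : Space d} (hn : ‖n‖ = 1)
    (hnD : ∀ v ∈ D, inner ℝ n v = 0) {p e : Space d} (he : inner ℝ n e ≠ 0)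
    {F : Set (Space d)} (hF : MeasurableSet F) (hFD : ∀ x ∈ F, x - p ∈ D)
    {I : Set ℝ} (hI : MeasurableSet I) {G : Space d → ℝ≥0∞} (hG : Measurable G) :
    ∫⁻ x in {x | ∃ s ∈ I, x - s • e ∈ F}, G x = ENNReal.ofReal |inner ℝ n e| *
      ∫⁻ q, G (q.1 + q.2 • e) ∂(((μHE[d - 1]).restrict F).prod (volume.restrict I)) := by
  set g : D → Space d := fun z => (z : Space d) + p
  have hgc : Continuous g := by fun_prop
  have hFr : F ⊆ Set.range g := fun x hx => ⟨⟨x - p, hFD x hx⟩, by simp [g]⟩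
  -- Transversality makes the parameter unique: the inner product with `n` is constant on the
  -- hyperplane, so it determines `s`.
  have key : ∀ (z : D) (s : ℝ), g z + s • e ∈ {x | ∃ s ∈ I, x - s • e ∈ F} ↔ g z ∈ F ∧ s ∈ I := by
    intro z s
    constructor
    · rintro ⟨s', hs', h⟩
      have h1 := hnD _ (hFD _ h)
      have h2 := hnD _ z.2
      have h3 : (s - s') * inner ℝ n e = 0 := by
        simp only [inner_sub_right, inner_smul_right, inner_add_right, g] at h1
        linarith
      have h4 : s = s' := by
        rcases mul_eq_zero.1 h3 with h3 | h3
        · linarith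
        · exact absurd h3 he
      subst h4
      exact ⟨by simpa using h, hs'⟩
    · rintro ⟨h, h'⟩
      exact ⟨s, h', by simpa using h⟩
  -- the swept set is measurable
  have hmA : MeasurableSet {x : Space d | ∃ s ∈ I, x - s • e ∈ F} := by
    -- `τ x` is the only time at which `x - τ x • e` can lie in the hyperplane, so the swept set is
    -- the preimage of measurable sets under continuous maps.
    let τ : Space d → ℝ := fun x => inner ℝ n (x - p) / inner ℝ n e
    have hτ : Continuous τ := by fun_prop
    have : {x : Space d | ∃ s ∈ I, x - s • e ∈ F} = {x | τ x ∈ I ∧ x - τ x • e ∈ F} := by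
      ext x
      constructor
      · rintro ⟨s, hs, h⟩
        have h1 := hnD _ (hFD _ h)
        have : τ x = s := by
          simp only [inner_sub_right, inner_smul_right] at h1
          simp only [τ, inner_sub_right]
          field_simp
          linarith
        exact ⟨this ▸ hs, this ▸ h⟩
      · rintro ⟨hs, h⟩
        exact ⟨_, hs, h⟩
    rw [this]
    exact (hτ.measurable hI).inter ((by fun_prop : Continuous fun x => x - τ x • e).measurable hF)
  rw [← lintegral_indicator hmA,
    lintegral_eq_lintegral_transversal hD hn hnD p he (hG.indicator hmA)]
  congr 1
  have h1 : (μHE[d - 1] : Measure (Space d)).restrict F = (Measure.map g volume).restrict F := by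
    rw [map_volume_direction hD p, Measure.restrict_restrict_of_subset hFr]
  rw [h1, lintegral_prod_symm _ (by fun_prop), ← lintegral_indicator hI]
  refine lintegral_congr fun s => ?_
  by_cases hs : s ∈ I
  · rw [Set.indicator_of_mem hs]
    rw [← lintegral_indicator hF, lintegral_map _ hgc.measurable]
    · refine lintegral_congr fun z => ?_
      by_cases hz : g z ∈ F
      · rw [Set.indicator_of_mem ((key z s).2 ⟨hz, hs⟩), Set.indicator_of_mem hz]
      · rw [Set.indicator_of_notMem (fun h => hz ((key z s).1 h).1), Set.indicator_of_notMem hz]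
    · exact Measurable.indicator (by fun_prop) hF
  · rw [Set.indicator_of_notMem hs]
    have : ∀ z : D, Set.indicator {x | ∃ s ∈ I, x - s • e ∈ F} G ((z : Space d) + p + s • e) = 0 :=
      fun z => Set.indicator_of_notMem (fun h => hs ((key z s).1 h).2) _
    simp [this]

end HDG

namespace HDG

/-! ### Geometry of the mesh -/

namespace Mesh

variable {d : ℕ} {Ω : Set (Space d)} (T : Mesh Ω)

theorem isFiniteMeasure_vol (i : Fin T.nK) : IsFiniteMeasure (T.vol i) := (T.carried_vol i).1

theorem isFiniteMeasure_surf (j : Fin T.nF) : IsFiniteMeasure (T.surf j) := (T.carried_surf j).1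

attribute [instance] isFiniteMeasure_vol isFiniteMeasure_surf

theorem measurableSet_face (j : Fin T.nF) : MeasurableSet (T.face j) :=
  (T.face_flat j).isCompact.measurableSet

theorem measurableSet_elem (i : Fin T.nK) : MeasurableSet (T.elem i) :=
  (T.elem_polyhedral i).isOpen.measurableSet

/-- An open subset of the closure of `Ω` lies in the interior of that closure, which is `Ω` by
regularity. -/
theorem elem_subset (hΩ : IsPolyhedralDomain Ω) (i : Fin T.nK) : T.elem i ⊆ Ω := by
  refine (interior_maximal (s := closure Ω) ?_ (T.elem_polyhedral i).isOpen).trans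
    hΩ.regular.subset
  rw [← T.elem_cover]
  exact subset_closure.trans (Set.subset_iUnion (fun i => closure (T.elem i)) i)

theorem face_subset_closure {i : Fin T.nK} {j : Fin T.nF} (hj : j ∈ T.faces i) :
    T.face j ⊆ closure (T.elem i) := by
  refine subset_trans ?_ frontier_subset_closure
  rw [T.frontier_elem i]
  exact Set.subset_biUnion_of_mem (u := fun j => T.face j) hj

theorem inner_normal_sub {i : Fin T.nK} (j : T.faces i) {x y : Space d} (hx : x ∈ T.face j)
    (hy : y ∈ T.face j) : inner ℝ (T.normal i j) (x - y) = 0 :=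
  T.normal_orthogonal i j _ (AffineSubspace.vsub_mem_direction (subset_affineSpan ℝ _ hx)
    (subset_affineSpan ℝ _ hy))

/-- Almost every point of a face lies in no other face. -/
theorem ae_surf_notMem (j : Fin T.nF) :
    ∀ᵐ x ∂T.surf j, x ∈ T.face j ∧ ∀ k, k ≠ j → x ∉ T.face k := by
  refine (ae_restrict_mem (T.measurableSet_face j)).and (ae_all_iff.2 fun k => ?_)
  by_cases hk : k = j
  · exact ae_of_all _ fun x h => absurd hk h
  · have h0 : ∀ᵐ x ∂T.surf j, x ∉ T.face k := by
      rw [ae_iff]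
      simp only [not_not, Set.ofPred_mem_eq]
      rw [surf, Measure.restrict_apply (T.measurableSet_face k)]
      exact T.face_overlap hk
    exact h0.mono fun x hx _ => hx

/-- A neighbourhood of a point that meets only one face. -/
theorem exists_ball_disjoint_face {j : Fin T.nF} {x : Space d}
    (hx : ∀ k, k ≠ j → x ∉ T.face k) :
    ∃ r > 0, ∀ k, k ≠ j → ∀ y ∈ Metric.ball x r, y ∉ T.face k := by
  have hc : IsClosed (⋃ k ∈ {k | k ≠ j}, T.face k) :=
    (Set.toFinite _).isClosed_biUnion fun k _ => (T.face_flat k).isCompact.isClosed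
  have hx' : x ∈ (⋃ k ∈ {k | k ≠ j}, T.face k)ᶜ := by simpa using hx
  obtain ⟨r, hr, h⟩ := Metric.isOpen_iff.1 hc.isOpen_compl x hx'
  refine ⟨r, hr, fun k hk y hy hyk => h hy ?_⟩
  exact Set.mem_biUnion (show k ∈ {k | k ≠ j} from hk) hyk

/-- Off the frontier, a set is separated from its complement by two disjoint open sets. This turns
membership at a single point into membership of a whole half-ball or segment. -/
theorem subset_of_isPreconnected {X : Type*} [TopologicalSpace X] {s t : Set X}
    (hs : IsPreconnected s) (ht : Disjoint s (frontier t)) (h : (s ∩ t).Nonempty) : s ⊆ t := by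
  intro x hx
  by_contra hxt
  have h1 := hs (interior t) (closure t)ᶜ isOpen_interior isClosed_closure.isOpen_compl ?_ ?_ ?_
  · obtain ⟨y, -, hy, hy'⟩ := h1
    exact hy' (interior_subset.trans subset_closure hy)
  · intro y hy
    by_cases hyt : y ∈ closure t
    · left
      by_contra hyi
      exact Set.disjoint_left.1 ht hy ⟨hyt, hyi⟩
    · exact Or.inr hyt
  · obtain ⟨y, hy, hyt⟩ := h
    refine ⟨y, hy, ?_⟩
    by_contra hyi
    exact Set.disjoint_left.1 ht hy ⟨subset_closure hyt, hyi⟩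
  · refine ⟨x, hx, fun hxc => ?_⟩
    exact Set.disjoint_left.1 ht hx ⟨hxc, fun hxi => hxt (interior_subset hxi)⟩

theorem isPreconnected_halfBall (x n : Space d) (r : ℝ) :
    IsPreconnected (Metric.ball x r ∩ {y | inner ℝ n (y - x) < 0}) := by
  refine Convex.isPreconnected ((convex_ball x r).inter ?_)
  intro a ha b hb s t hs ht hst
  simp only [Set.mem_ofPred_eq] at *
  have hab : s • a + t • b - x = s • (a - x) + t • (b - x) := by
    obtain rfl : s = 1 - t := by linarith
    module
  rw [hab, inner_add_right, inner_smul_right, inner_smul_right]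
  rcases hs.eq_or_lt with rfl | hs
  · have : t = 1 := by linarith
    subst this; simpa using hb
  · nlinarith [mul_neg_of_pos_of_neg hs ha, mul_nonpos_of_nonneg_of_nonpos ht hb.le]

/-- Near almost every point of a face, an element lies on one side of the face, which is determined
by the normal. -/
theorem ae_surf_sides (i : Fin T.nK) (j : T.faces i) :
    ∀ᵐ x ∂T.surf j, x ∈ T.face j ∧ ∃ r > 0, (∀ k, k ≠ (j : Fin T.nF) → ∀ y ∈ Metric.ball x r,
        y ∉ T.face k) ∧
      (∀ y ∈ Metric.ball x r, inner ℝ (T.normal i j) (y - x) < 0 → y ∈ T.elem i) ∧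
      ∀ y ∈ Metric.ball x r, 0 < inner ℝ (T.normal i j) (y - x) → y ∉ T.elem i := by
  filter_upwards [T.ae_surf_notMem j, T.normal_outward i j] with x hx hout
  obtain ⟨hxF, hxk⟩ := hx
  obtain ⟨r, hr, hrk⟩ := T.exists_ball_disjoint_face hxk
  refine ⟨hxF, r, hr, hrk, ?_⟩
  -- Inside the ball only the face `j` can meet the boundary of the element, and that face lies in
  -- its hyperplane; off the hyperplane there are no boundary points.
  have hfr : ∀ y ∈ Metric.ball x r, inner ℝ (T.normal i j) (y - x) ≠ 0 →
      y ∉ frontier (T.elem i) := by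
    intro y hy hne hyf
    rw [T.frontier_elem i] at hyf
    obtain ⟨k, hk, hyk⟩ := Set.mem_iUnion₂.1 hyf
    by_cases hkj : k = j
    · subst hkj
      exact hne (T.inner_normal_sub j hyk hxF)
    · exact hrk k hkj y hy hyk
  have hnn : inner ℝ (T.normal i j) (T.normal i j) = 1 := by
    rw [real_inner_self_eq_norm_sq, T.norm_normal]; norm_num
  -- One short step along the normal supplies a point of the element in the inner half-ball and a
  -- point outside it in the outer one. Connectedness of the half-balls does the rest.
  obtain ⟨t, ⟨ht1, ht2⟩, ht0, htr⟩ :=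
    (hout.and (Ioo_mem_nhdsGT hr)).exists
  have hd1 : x - t • T.normal i j ∈ Metric.ball x r := by
    rw [mem_ball_iff_norm, sub_sub_cancel_left, norm_neg, norm_smul, T.norm_normal, mul_one,
      Real.norm_of_nonneg ht0.le]
    exact htr
  have hd2 : x + t • T.normal i j ∈ Metric.ball x r := by
    rw [mem_ball_iff_norm, add_sub_cancel_left, norm_smul, T.norm_normal, mul_one,
      Real.norm_of_nonneg ht0.le]
    exact htr
  constructor
  · intro y hy hyn
    refine subset_of_isPreconnected (isPreconnected_halfBall x (T.normal i j) r) ?_ ?_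
      ⟨hy, hyn⟩
    · exact Set.disjoint_left.2 fun z hz => hfr z hz.1 (ne_of_lt hz.2)
    · refine ⟨_, ⟨hd1, ?_⟩, ht1⟩
      simp only [Set.mem_ofPred_eq, sub_sub_cancel_left, inner_neg_right, inner_smul_right, hnn]
      linarith
  · intro y hy hyn
    refine subset_of_isPreconnected (t := (T.elem i)ᶜ)
      (isPreconnected_halfBall x (-T.normal i j) r) ?_ ?_ ⟨hy, by simpa using hyn⟩
    · rw [frontier_compl]
      refine Set.disjoint_left.2 fun z hz => hfr z hz.1 ?_
      have := hz.2
      simp only [Set.mem_ofPred_eq, inner_neg_left] at this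
      linarith
    · refine ⟨_, ⟨hd2, ?_⟩, ht2⟩
      simp only [Set.mem_ofPred_eq, add_sub_cancel_left, inner_neg_left, inner_smul_right, hnn]
      linarith

/-- The face is the closure of its relative interior, so an open set that meets the face meets the
relative interior. There it contains a relatively open piece of the hyperplane, on which surface
measure is the volume of the direction space. -/
theorem surf_ne_zero (j : Fin T.nF) {U : Set (Space d)} (hU : IsOpen U)
    (hne : (U ∩ T.face j).Nonempty) : T.surf j U ≠ 0 := by
  have hF := T.face_flat j
  obtain ⟨y, hyU, hyF⟩ := hne
  obtain ⟨x, hxU, hx⟩ := mem_closure_iff.1 (hF.subset_closure hyF) U hU hyU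
  set A := affineSpan ℝ (T.face j)
  obtain ⟨x', hx', hxx⟩ := hx
  obtain ⟨V, hVint, hVo, hxV⟩ := mem_interior.1 hx'
  -- pull back to the direction of the hyperplane
  let g : A.direction → Space d := fun z => (z : Space d) + x
  let g' : A.direction → A := fun z => ⟨(z : Space d) + x, by
    have := AffineSubspace.vadd_mem_of_mem_direction z.2 (hxx ▸ x'.2 : x ∈ A)
    exact this⟩
  have hg' : Continuous g' := by
    apply Continuous.subtype_mk
    fun_prop
  have hgc : Continuous g := by fun_prop
  have hO : IsOpen (g ⁻¹' U ∩ g' ⁻¹' V) := (hU.preimage hgc).inter (hVo.preimage hg')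
  have h0 : (0 : A.direction) ∈ g ⁻¹' U ∩ g' ⁻¹' V := by
    refine ⟨by simpa [g] using hxU, ?_⟩
    have : g' 0 = x' := Subtype.ext (by simp [g', hxx])
    simpa [this] using hxV
  have hpos := hO.measure_pos volume ⟨0, h0⟩
  have hm := map_volume_direction (d := d) hF.finrank_direction x
  have hsub : g ⁻¹' U ∩ g' ⁻¹' V ⊆ g ⁻¹' (U ∩ T.face j) := by
    rintro z ⟨hz1, hz2⟩
    exact ⟨hz1, hVint hz2⟩
  have hms : MeasurableSet (U ∩ T.face j) := hU.measurableSet.inter (T.measurableSet_face j)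
  have h1 : volume (g ⁻¹' (U ∩ T.face j)) = T.surf j U := by
    rw [← Measure.map_apply hgc.measurable hms, hm, Measure.restrict_apply hms, surf,
      Measure.restrict_apply hU.measurableSet, Set.inter_eq_left.2]
    rintro z ⟨-, hz⟩
    refine ⟨⟨z - x, ?_⟩, by simp⟩
    exact AffineSubspace.vsub_mem_direction (subset_affineSpan ℝ _ hz) (hxx ▸ x'.2 : x ∈ A)
  rw [← h1]
  exact (hpos.trans_le (measure_mono hsub)).ne'

/-- A point of a face at which the elements with this face are separated by the face. -/
structure IsSeparating (j : Fin T.nF) (x : Space d) (r : ℝ) : Prop where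
  mem : x ∈ T.face j
  pos : 0 < r
  notMem : ∀ k, k ≠ j → ∀ y ∈ Metric.ball x r, y ∉ T.face k
  inside : ∀ i (h : j ∈ T.faces i), ∀ y ∈ Metric.ball x r,
    inner ℝ (T.normal i ⟨j, h⟩) (y - x) < 0 → y ∈ T.elem i
  outside : ∀ i (h : j ∈ T.faces i), ∀ y ∈ Metric.ball x r,
    0 < inner ℝ (T.normal i ⟨j, h⟩) (y - x) → y ∉ T.elem i

/-- Separating points have full surface measure, while every open set that meets the face has
positive surface measure. The radius is the minimum over the finitely many elements that own the
face. -/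
theorem exists_isSeparating {j : Fin T.nF} {U : Set (Space d)} (hU : IsOpen U)
    (hne : (U ∩ T.face j).Nonempty) : ∃ x ∈ U, ∃ r, T.IsSeparating j x r := by
  have hall : ∀ᵐ x ∂T.surf j, ∃ r, T.IsSeparating j x r := by
    have h1 : ∀ᵐ x ∂T.surf j, ∀ i (h : j ∈ T.faces i), ∃ r > 0,
        (∀ y ∈ Metric.ball x r, inner ℝ (T.normal i ⟨j, h⟩) (y - x) < 0 → y ∈ T.elem i) ∧
        ∀ y ∈ Metric.ball x r, 0 < inner ℝ (T.normal i ⟨j, h⟩) (y - x) → y ∉ T.elem i := by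
      refine ae_all_iff.2 fun i => ?_
      by_cases h : j ∈ T.faces i
      · filter_upwards [T.ae_surf_sides i ⟨j, h⟩] with x hx _
        obtain ⟨-, r, hr, -, h2⟩ := hx
        exact ⟨r, hr, h2⟩
      · exact ae_of_all _ fun x h' => absurd h' h
    filter_upwards [h1, T.ae_surf_notMem j] with x hx hx'
    obtain ⟨r₀, hr₀, hk⟩ := T.exists_ball_disjoint_face hx'.2
    choose! r hr hin hout using fun (i : {i // j ∈ T.faces i}) => hx i.1 i.2
    have hm : ∃ ε > 0, ε ≤ r₀ ∧ ∀ i, ε ≤ r i := by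
      rcases isEmpty_or_nonempty {i // j ∈ T.faces i} with he | he
      · exact ⟨r₀, hr₀, le_rfl, fun i => he.elim i⟩
      · obtain ⟨i₀, hi₀⟩ := Finite.exists_min r
        exact ⟨min r₀ (r i₀), lt_min hr₀ (hr i₀), min_le_left _ _,
          fun i => (min_le_right _ _).trans (hi₀ i)⟩
    obtain ⟨ε, hε, hε0, hεi⟩ := hm
    exact ⟨ε, hx'.1, hε, fun k hk' y hy => hk k hk' y (Metric.ball_subset_ball hε0 hy),
      fun i h y hy => hin ⟨i, h⟩ y (Metric.ball_subset_ball (hεi _) hy),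
      fun i h y hy => hout ⟨i, h⟩ y (Metric.ball_subset_ball (hεi _) hy)⟩
  by_contra hcon
  push Not at hcon
  refine T.surf_ne_zero j hU hne (measure_mono_null (fun y hy => ?_) (ae_iff.1 hall))
  rintro ⟨r, h⟩
  exact hcon y hy r h

theorem inner_normal_self (i : Fin T.nK) (j : T.faces i) :
    inner ℝ (T.normal i j) (T.normal i j) = 1 := by
  rw [real_inner_self_eq_norm_sq, T.norm_normal]; norm_num

/-- Both normals are unit vectors in the orthogonal complement of the direction of the face, which
is a line. -/
theorem normal_eq_or_eq_neg {j : Fin T.nF} {i i' : Fin T.nK} (hi : j ∈ T.faces i)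
    (hi' : j ∈ T.faces i') :
    T.normal i' ⟨j, hi'⟩ = T.normal i ⟨j, hi⟩ ∨ T.normal i' ⟨j, hi'⟩ = -T.normal i ⟨j, hi⟩ := by
  have hrank : Module.finrank ℝ (affineSpan ℝ (T.face j)).directionᗮ = 1 := by
    have h1 := (affineSpan ℝ (T.face j)).direction.finrank_add_finrank_orthogonal
    have h2 := (T.face_flat j).finrank_direction
    rw [finrank_euclideanSpace_fin] at h1
    omega
  have hm : ∀ i'' (h : j ∈ T.faces i''),
      T.normal i'' ⟨j, h⟩ ∈ (affineSpan ℝ (T.face j)).directionᗮ := by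
    intro i'' h
    rw [Submodule.mem_orthogonal']
    exact T.normal_orthogonal i'' ⟨j, h⟩
  have hn0 : (⟨T.normal i ⟨j, hi⟩, hm i hi⟩ : (affineSpan ℝ (T.face j)).directionᗮ) ≠ 0 := by
    intro h0
    have h1 : T.normal i ⟨j, hi⟩ = 0 := congrArg Subtype.val h0
    have h2 := T.norm_normal i ⟨j, hi⟩
    simp [h1] at h2
  obtain ⟨c, hc⟩ := exists_smul_eq_of_finrank_eq_one hrank hn0 ⟨_, hm i' hi'⟩
  have hc' : c • T.normal i ⟨j, hi⟩ = T.normal i' ⟨j, hi'⟩ := congrArg Subtype.val hc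
  have hcn : |c| = 1 := by
    have h3 := T.norm_normal i' ⟨j, hi'⟩
    rw [← hc', norm_smul, T.norm_normal, mul_one] at h3
    exact h3
  rcases eq_or_eq_neg_of_abs_eq hcn with h1 | h1
  · left; rw [← hc', h1, one_smul]
  · right; rw [← hc', h1, neg_smul, one_smul]

/-- Two elements on the same side of a face would both contain the inner half-ball at a separating
point, against disjointness. -/
theorem elem_eq_of_normal_eq {j : Fin T.nF} {i i' : Fin T.nK} (hi : j ∈ T.faces i)
    (hi' : j ∈ T.faces i') (he : T.normal i ⟨j, hi⟩ = T.normal i' ⟨j, hi'⟩) : i = i' := by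
  by_contra hne
  obtain ⟨x₀, hx₀⟩ := (T.face_flat j).isConnected.nonempty
  obtain ⟨x, -, r, hx⟩ := T.exists_isSeparating isOpen_univ ⟨x₀, trivial, hx₀⟩
  have hr := hx.pos
  have hb : x - (r / 2) • T.normal i ⟨j, hi⟩ ∈ Metric.ball x r := by
    rw [mem_ball_iff_norm, sub_sub_cancel_left, norm_neg, norm_smul, T.norm_normal, mul_one,
      Real.norm_of_nonneg (by positivity)]
    linarith
  have hneg : inner ℝ (T.normal i ⟨j, hi⟩) (x - (r / 2) • T.normal i ⟨j, hi⟩ - x) < 0 := by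
    rw [sub_sub_cancel_left, inner_neg_right, inner_smul_right, T.inner_normal_self]
    linarith
  exact Set.disjoint_left.1 (T.elem_disjoint hne) (hx.inside i hi _ hb hneg)
    (hx.inside i' hi' _ hb (he ▸ hneg))

/-- A face belongs to at most two elements. -/
theorem card_elem_le_two (j : Fin T.nF) :
    (Finset.univ.filter fun i => j ∈ T.faces i).card ≤ 2 := by
  classical
  obtain ⟨i, hi⟩ := T.face_used j
  -- The normal on `j` takes at most two values and determines the element.
  refine (Finset.card_le_card_of_injOn (t := {T.normal i ⟨j, hi⟩, -T.normal i ⟨j, hi⟩})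
    (fun i' => if h : j ∈ T.faces i' then T.normal i' ⟨j, h⟩ else 0) ?_ ?_).trans
    Finset.card_le_two
  · intro i' hi'
    have h' : j ∈ T.faces i' := (Finset.mem_filter.1 hi').2
    simp only [dif_pos h', Finset.coe_insert, Finset.coe_singleton, Set.mem_insert_iff,
      Set.mem_singleton_iff]
    exact T.normal_eq_or_eq_neg hi h'
  · intro i' hi' i'' hi'' he
    have h' : j ∈ T.faces i' := (Finset.mem_filter.1 hi').2
    have h'' : j ∈ T.faces i'' := (Finset.mem_filter.1 hi'').2
    simp only [dif_pos h', dif_pos h''] at he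
    exact T.elem_eq_of_normal_eq h' h'' he

/-- The normals on the two sides of an interior face cancel. -/
theorem sum_normal_eq_zero (hΩ : IsPolyhedralDomain Ω) {j : Fin T.nF}
    (hj : ¬ T.face j ⊆ frontier Ω) :
    ∑ i, (if h : j ∈ T.faces i then T.normal i ⟨j, h⟩ else 0) = 0 := by
  obtain ⟨x0, hx0F, hx0⟩ := Set.not_subset.1 hj
  obtain ⟨x, hxO, r, hx⟩ :=
    T.exists_isSeparating isClosed_frontier.isOpen_compl ⟨x0, hx0, hx0F⟩
  obtain ⟨i, hi⟩ := T.face_used j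
  obtain ⟨hxF, hr, hrk, -, hout⟩ := hx
  replace hout := hout i hi
  set n := T.normal i ⟨j, hi⟩ with hn
  have hnn : inner ℝ n n = 1 := T.inner_normal_self i ⟨j, hi⟩
  -- `x` is in `Ω`
  have hxcl : x ∈ closure Ω := by
    rw [← T.elem_cover]
    exact Set.mem_iUnion.2 ⟨i, T.face_subset_closure hi hxF⟩
  have hxΩ : x ∈ Ω := by
    by_contra hxn
    exact hxO ⟨hxcl, by rwa [hΩ.isOpen.interior_eq]⟩
  obtain ⟨ρ, hρ, hρΩ⟩ := Metric.isOpen_iff.1 hΩ.isOpen x hxΩ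
  have hdir : ∀ i' (h : j ∈ T.faces i'), T.normal i' ⟨j, h⟩ = n ∨ T.normal i' ⟨j, h⟩ = -n :=
    fun i' h => T.normal_eq_or_eq_neg hi h
  have huniq : ∀ i' i'' (h' : j ∈ T.faces i') (h'' : j ∈ T.faces i''),
      T.normal i' ⟨j, h'⟩ = T.normal i'' ⟨j, h''⟩ → i' = i'' :=
    fun i' i'' h' h'' => T.elem_eq_of_normal_eq h' h''
  -- the element on the other side
  obtain ⟨i', hi', hne'⟩ : ∃ i' : Fin T.nK, ∃ h : j ∈ T.faces i', i' ≠ i := by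
    set t := min r ρ / 2 with ht
    have ht0 : 0 < t := by positivity
    have hmin := min_le_left r ρ
    have hmin' := min_le_right r ρ
    -- The half-ball beyond the face, small enough to lie in `Ω`. It meets no face, so an element
    -- whose closure contains one of its points contains all of it.
    set B := Metric.ball x (min r ρ) ∩ {y | inner ℝ (-n) (y - x) < 0} with hB
    have hyB : x + t • n ∈ B := by
      refine ⟨?_, ?_⟩
      · rw [mem_ball_iff_norm, add_sub_cancel_left, norm_smul, T.norm_normal, mul_one,
          Real.norm_of_nonneg ht0.le]
        linarith
      · simp only [Set.mem_ofPred_eq, add_sub_cancel_left, inner_neg_left, inner_smul_right, hnn]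
        linarith
    have hBface : ∀ y ∈ B, ∀ k, y ∉ T.face k := by
      intro y hy k hyk
      by_cases hk : k = j
      · subst hk
        have h1 := T.inner_normal_sub ⟨k, hi⟩ hyk hxF
        have h2 := hy.2
        rw [← hn] at h1
        simp [h1] at h2
      · exact hrk k hk y (Metric.ball_subset_ball hmin hy.1) hyk
    have hBfr : ∀ i', Disjoint B (frontier (T.elem i')) := by
      intro i'
      rw [T.frontier_elem i']
      refine Set.disjoint_left.2 fun y hy hy' => ?_
      obtain ⟨k, -, hk⟩ := Set.mem_iUnion₂.1 hy'
      exact hBface y hy k hk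
    have hyΩ : x + t • n ∈ closure Ω :=
      subset_closure (hρΩ (Metric.ball_subset_ball hmin' hyB.1))
    rw [← T.elem_cover] at hyΩ
    obtain ⟨i', hi'⟩ := Set.mem_iUnion.1 hyΩ
    have hyi' : x + t • n ∈ T.elem i' := by
      by_contra hcon
      exact Set.disjoint_left.1 (hBfr i') hyB
        ⟨hi', by rwa [(T.elem_polyhedral i').isOpen.interior_eq]⟩
    have hBi' : B ⊆ T.elem i' := subset_of_isPreconnected
      (isPreconnected_halfBall x (-n) _) (hBfr i') ⟨_, hyB, hyi'⟩
    have hne' : i' ≠ i := by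
      rintro rfl
      refine hout _ (Metric.ball_subset_ball hmin hyB.1) ?_ hyi'
      have := hyB.2
      simp only [Set.mem_ofPred_eq, inner_neg_left] at this
      linarith
    refine ⟨i', ?_, hne'⟩
    -- `x` is on the boundary of this element
    have hxc : x ∈ closure (T.elem i') := by
      refine closure_mono hBi' ?_
      rw [mem_closure_iff_seq_limit]
      refine ⟨fun k => x + (t / (k + 1)) • n, fun k => ?_, ?_⟩
      · have hk : 0 < t / ((k : ℝ) + 1) := by positivity
        have hk' : t / ((k : ℝ) + 1) ≤ t := div_le_self ht0.le (by linarith [k.cast_nonneg (α := ℝ)])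
        refine ⟨?_, ?_⟩
        · rw [mem_ball_iff_norm, add_sub_cancel_left, norm_smul, T.norm_normal, mul_one,
            Real.norm_of_nonneg hk.le]
          linarith
        · simp only [Set.mem_ofPred_eq, add_sub_cancel_left, inner_neg_left, inner_smul_right, hnn]
          linarith
      · have h1 : Tendsto (fun k : ℕ => t / ((k : ℝ) + 1)) atTop (𝓝 0) :=
          tendsto_const_nhds.div_atTop
            (tendsto_natCast_atTop_atTop.atTop_add tendsto_const_nhds)
        simpa using tendsto_const_nhds.add (h1.smul_const n)
    -- The point `x` is in the closure of the first element, hence not in the second, which is open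
    -- and disjoint from the first. So `x` is a boundary point of the second element, and `j` is the
    -- only face available there.
    have hxn : x ∉ T.elem i' := by
      intro hxe
      have := (T.elem_disjoint hne').closure_right (T.elem_polyhedral i').isOpen
      exact Set.disjoint_left.1 this hxe (T.face_subset_closure hi hxF)
    have hxfr : x ∈ frontier (T.elem i') :=
      ⟨hxc, by rwa [(T.elem_polyhedral i').isOpen.interior_eq]⟩
    rw [T.frontier_elem i'] at hxfr
    obtain ⟨k, hk, hxk⟩ := Set.mem_iUnion₂.1 hxfr
    by_cases hkj : k = j
    · exact hkj ▸ hk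
    · exact absurd hxk (hrk k hkj x (Metric.mem_ball_self hr))
  have hn' : T.normal i' ⟨j, hi'⟩ = -n := by
    rcases hdir i' hi' with h1 | h1
    · exact absurd (huniq i' i hi' hi (h1.trans hn)) hne'
    · exact h1
  rw [Finset.sum_eq_add i i' hne'.symm]
  · rw [dif_pos hi, dif_pos hi', hn', ← hn, add_neg_cancel]
  · rintro l - ⟨hli, hli'⟩
    refine dif_neg fun hl => ?_
    rcases hdir l hl with h1 | h1
    · exact hli (huniq l i hl hi (h1.trans hn))
    · exact hli' (huniq l i' hl hi' (h1.trans hn'.symm))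
  · simp
  · simp

end Mesh

end HDG

namespace HDG

/-! ### The divergence theorem on an element -/

/-- The one-sided fundamental theorem of calculus on the segment from `z` in direction `e`. -/
theorem tendsto_average_segment {d : ℕ} {φ : Space d → ℝ} (hφ : Continuous φ) (z e : Space d) :
    Tendsto (fun t : ℝ => t⁻¹ * ∫ s in Set.Icc 0 t, φ (z + s • e)) (𝓝[>] 0) (𝓝 (φ z)) := by
  have hc : Continuous fun s : ℝ => φ (z + s • e) := by fun_prop
  have h1 : HasDerivAt (fun u => ∫ s in (0 : ℝ)..u, φ (z + s • e)) (φ (z + (0 : ℝ) • e)) 0 :=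
    hc.integral_hasStrictDerivAt 0 0 |>.hasDerivAt
  have h2 := h1.tendsto_slope_zero_right
  simp only [zero_add, zero_smul, add_zero, intervalIntegral.integral_same, sub_zero,
    smul_eq_mul] at h2
  refine h2.congr' ?_
  filter_upwards [self_mem_nhdsWithin] with t ht
  rw [intervalIntegral.integral_of_le (le_of_lt ht), integral_Icc_eq_integral_Ioc]

namespace Mesh

variable {d : ℕ} {Ω : Set (Space d)} (T : Mesh Ω)

/-- The set swept by the face `j` in direction `e` up to the time `t`. -/
def sweep (j : Fin T.nF) (e : Space d) (t : ℝ) : Set (Space d) :=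
  {x | ∃ s ∈ Set.Icc 0 t, x - s • e ∈ T.face j}

theorem measurableSet_sweep (j : Fin T.nF) (e : Space d) (t : ℝ) :
    MeasurableSet (T.sweep j e t) := by
  have : T.sweep j e t = (fun q : ℝ × Space d => q.2 + q.1 • e) '' (Set.Icc 0 t ×ˢ T.face j) := by
    ext x
    constructor
    · rintro ⟨s, hs, h⟩
      exact ⟨(s, x - s • e), ⟨hs, h⟩, by simp⟩
    · rintro ⟨⟨s, y⟩, ⟨hs, hy⟩, rfl⟩
      exact ⟨s, hs, by simpa using hy⟩
  rw [this]
  exact ((isCompact_Icc.prod (T.face_flat j).isCompact).image (by fun_prop)).measurableSet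

/-- A face that moves in a direction tangent to it never leaves its hyperplane. -/
theorem volume_sweep_eq_zero {i : Fin T.nK} (j : T.faces i) {e : Space d}
    (he : inner ℝ (T.normal i j) e = 0) (t : ℝ) : volume (T.sweep j e t) = 0 := by
  obtain ⟨p, hp⟩ := (T.face_flat j).isConnected.nonempty
  refine measure_mono_null (t := (AffineSubspace.mk' p (Submodule.span ℝ {T.normal i j})ᗮ :
    Set (Space d))) ?_ (Measure.addHaar_affineSubspace _ _ ?_)
  · rintro x ⟨s, -, h⟩
    rw [SetLike.mem_coe, AffineSubspace.mem_mk', Submodule.mem_orthogonal_singleton_iff_inner_right]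
    have h1 := T.inner_normal_sub j h hp
    simp only [inner_sub_right, inner_smul_right, he, mul_zero, sub_zero] at h1
    rw [vsub_eq_sub, inner_sub_right, h1]
  · intro h
    have h1 : p + T.normal i j ∈ AffineSubspace.mk' p (Submodule.span ℝ {T.normal i j})ᗮ := by
      rw [h]; trivial
    rw [AffineSubspace.mem_mk', Submodule.mem_orthogonal_singleton_iff_inner_right] at h1
    simp [T.norm_normal] at h1

/-- A prism over the face carries the product of surface measure and Lebesgue measure in time,
scaled by the cosine between the direction and the normal. It is the slicing formula, tested on
indicator functions. -/
theorem restrict_sweep {i : Fin T.nK} (j : T.faces i) {e : Space d}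
    (he : inner ℝ (T.normal i j) e ≠ 0) (t : ℝ) :
    (volume : Measure (Space d)).restrict (T.sweep j e t)
      = ENNReal.ofReal |inner ℝ (T.normal i j) e| •
        Measure.map (fun q : Space d × ℝ => q.1 + q.2 • e)
          ((T.surf j).prod (volume.restrict (Set.Icc 0 t))) := by
  obtain ⟨p, hp⟩ := (T.face_flat j).isConnected.nonempty
  ext B hB
  have h := lintegral_sweep (T.face_flat j).finrank_direction (T.norm_normal i j)
    (T.normal_orthogonal i j) (p := p) he (T.measurableSet_face j)
    (fun x hx => AffineSubspace.vsub_mem_direction (subset_affineSpan ℝ _ hx)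
      (subset_affineSpan ℝ _ hp)) (measurableSet_Icc (a := (0 : ℝ)) (b := t))
    (G := B.indicator 1) (measurable_one.indicator hB)
  have hm : Measurable fun q : Space d × ℝ => q.1 + q.2 • e := by fun_prop
  rw [lintegral_indicator_one hB] at h
  rw [Measure.smul_apply, Measure.map_apply hm hB, ← lintegral_indicator_one (hm hB)]
  exact h

/-- The left side is a limit of difference quotients. Translation invariance moves the shift from
`φ` to the indicator of the element `K`, and the difference of the indicators of `K + t e` and `K`
lives on the sets swept by the faces in time `t`. Near almost every point of a face this difference
is the sign of `n·e`, and the slicing formula contributes `|n·e|`. Edges and corners need no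
description, because only almost every face point matters. -/
theorem integral_fderiv_eq_of_hasCompactSupport (i : Fin T.nK) (e : Space d) {φ : Space d → ℝ}
    (hφ : ContDiff ℝ 1 φ) (hc : HasCompactSupport φ) :
    ∫ x, fderiv ℝ φ x e ∂(T.vol i)
      = ∑ j : T.faces i, inner ℝ (T.normal i j) e * ∫ x, φ x ∂(T.surf j) := by
  classical
  have hφc := hφ.continuous
  obtain ⟨M, hM⟩ := (hc.fderiv ℝ).exists_bound_of_continuous (hφ.continuous_fderiv one_ne_zero)
  obtain ⟨B, hB⟩ := hc.exists_bound_of_continuous hφc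
  have hB0 : 0 ≤ B := (norm_nonneg _).trans (hB 0)
  have hint : Integrable φ := hφc.integrable_of_hasCompactSupport hc
  -- the difference quotients
  have h1 : Tendsto (fun t : ℝ => ∫ x, t⁻¹ * (φ (x + t • e) - φ x) ∂(T.vol i)) (𝓝[>] 0)
      (𝓝 (∫ x, fderiv ℝ φ x e ∂(T.vol i))) := by
    refine tendsto_integral_filter_of_dominated_convergence (fun _ => M * ‖e‖) ?_ ?_
      (integrable_const _) ?_
    · exact Eventually.of_forall fun t =>
        (by fun_prop : Continuous fun x => t⁻¹ * (φ (x + t • e) - φ x)).aestronglyMeasurable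
    · filter_upwards [self_mem_nhdsWithin] with t ht
      refine ae_of_all _ fun x => ?_
      have ht' : (0 : ℝ) < t := ht
      have h2 := convex_univ.norm_image_sub_le_of_norm_fderiv_le (𝕜 := ℝ) (f := φ) (C := M)
        (fun x _ => (hφ.differentiable one_ne_zero) x) (fun x _ => hM x) (Set.mem_univ x)
        (Set.mem_univ (x + t • e))
      rw [add_sub_cancel_left, norm_smul, Real.norm_of_nonneg ht'.le] at h2
      rw [norm_mul, norm_inv, Real.norm_of_nonneg ht'.le, inv_mul_le_iff₀ ht']
      linarith
    · refine ae_of_all _ fun x => ?_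
      have := ((hφ.differentiable one_ne_zero) x).hasFDerivAt.hasLineDerivAt e
      simpa using this.tendsto_slope_zero_right
  -- rewriting as an integral over the swept sets
  let K := T.elem i
  let χ : ℝ → Space d → ℝ := fun t x =>
    K.indicator (fun _ => (1 : ℝ)) (x - t • e) - K.indicator (fun _ => (1 : ℝ)) x
  -- The number of sweeps through `x`. Dividing by it shares points of overlapping sweeps evenly, so
  -- that the contributions of the faces add up exactly; near almost every face point it will equal
  -- one.
  let m : ℝ → Space d → ℝ := fun t x =>
    ∑ k : T.faces i, (T.sweep k e t).indicator (fun _ => (1 : ℝ)) x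
  let g : ℝ → Space d → ℝ := fun t x => χ t x * φ x / m t x
  have hKm : Measurable (K.indicator (fun _ => (1 : ℝ))) :=
    measurable_const.indicator (T.measurableSet_elem i)
  have hχm : ∀ t, Measurable (χ t) := fun t =>
    (hKm.comp (measurable_id.sub_const _)).sub hKm
  have hmm : ∀ t, Measurable (m t) := fun t =>
    Finset.measurable_fun_sum _ fun k _ => measurable_const.indicator (T.measurableSet_sweep k e t)
  have hgm : ∀ t, Measurable (g t) := fun t =>
    ((hχm t).mul hφc.measurable).div (hmm t)
  have hχ1 : ∀ t x, |χ t x| ≤ 1 := by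
    intro t x
    simp only [χ, Set.indicator_apply]
    split_ifs <;> norm_num
  have hm1 : ∀ t x (k : T.faces i), x ∈ T.sweep k e t → 1 ≤ m t x := by
    intro t x k hk
    have := Finset.single_le_sum (f := fun k : T.faces i =>
      (T.sweep k e t).indicator (fun _ => (1 : ℝ)) x)
      (fun k _ => Set.indicator_nonneg (fun _ _ => zero_le_one) _) (Finset.mem_univ k)
    rwa [Set.indicator_of_mem hk] at this
  have hm0 : ∀ t x, m t x = 0 ∨ 1 ≤ m t x := by
    intro t x
    by_cases h : ∃ k : T.faces i, x ∈ T.sweep k e t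
    · obtain ⟨k, hk⟩ := h
      exact Or.inr (hm1 t x k hk)
    · push Not at h
      exact Or.inl (Finset.sum_eq_zero fun k _ => Set.indicator_of_notMem (h k) _)
  have hgB : ∀ t x, ‖g t x‖ ≤ B := by
    intro t x
    rcases hm0 t x with h | h
    · simp [g, h, hB0]
    · rw [norm_div, norm_mul, Real.norm_of_nonneg (zero_le_one.trans h),
        div_le_iff₀ (zero_lt_one.trans_le h)]
      calc ‖χ t x‖ * ‖φ x‖ ≤ 1 * B := mul_le_mul (hχ1 t x) (hB x) (norm_nonneg _) zero_le_one
        _ ≤ B * m t x := by nlinarith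
  -- If exactly one of `x` and `x - t e` is in the element, the segment between them meets the
  -- boundary, hence a face; then `x` lies in the sweep of that face.
  have hcross : ∀ t, 0 ≤ t → ∀ x, χ t x ≠ 0 → ∃ k : T.faces i, x ∈ T.sweep k e t := by
    intro t ht x hx
    have hseg : ∃ s ∈ Set.Icc 0 t, x - s • e ∈ frontier K := by
      by_contra hcon
      push Not at hcon
      have hpre : IsPreconnected ((fun s : ℝ => x - s • e) '' Set.Icc 0 t) :=
        isPreconnected_Icc.image _ (by fun_prop)
      have hdis : Disjoint ((fun s : ℝ => x - s • e) '' Set.Icc 0 t) (frontier K) := by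
        rw [Set.disjoint_left]
        rintro y ⟨s, hs, rfl⟩
        exact hcon s hs
      have e0 : x ∈ (fun s : ℝ => x - s • e) '' Set.Icc 0 t := ⟨0, ⟨le_rfl, ht⟩, by simp⟩
      have e1 : x - t • e ∈ (fun s : ℝ => x - s • e) '' Set.Icc 0 t := ⟨t, ⟨ht, le_rfl⟩, rfl⟩
      apply hx
      by_cases hxK : x ∈ K
      · have := subset_of_isPreconnected hpre hdis ⟨x, e0, hxK⟩ e1
        simp [χ, hxK, this]
      · have : x - t • e ∉ K := fun h =>
          hxK (subset_of_isPreconnected hpre hdis ⟨_, e1, h⟩ e0)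
        simp [χ, hxK, this]
    obtain ⟨s, hs, h⟩ := hseg
    rw [T.frontier_elem i] at h
    obtain ⟨k, hk, hk'⟩ := Set.mem_iUnion₂.1 h
    exact ⟨⟨k, hk⟩, s, hs, hk'⟩
  have hsplit : ∀ t, 0 ≤ t → ∀ x,
      χ t x * φ x = ∑ k : T.faces i, (T.sweep k e t).indicator (g t) x := by
    intro t ht x
    have e1 : ∑ k : T.faces i, (T.sweep k e t).indicator (g t) x = m t x * g t x := by
      rw [Finset.sum_mul]
      refine Finset.sum_congr rfl fun k _ => ?_
      by_cases hk : x ∈ T.sweep k e t <;> simp [hk]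
    rw [e1]
    by_cases hx : χ t x = 0
    · simp [g, hx]
    · obtain ⟨k, hk⟩ := hcross t ht x hx
      have := hm1 t x k hk
      simp only [g]
      field_simp
  have hgi : ∀ t (k : T.faces i), IntegrableOn (g t) (T.sweep k e t) := by
    intro t k
    have hfin : volume (T.sweep k e t) < ⊤ := by
      by_cases he : inner ℝ (T.normal i k) e = 0
      · rw [T.volume_sweep_eq_zero k he]; exact ENNReal.zero_lt_top
      · rw [← Measure.restrict_apply_univ, T.restrict_sweep k he, Measure.smul_apply,
          Measure.map_apply (by fun_prop) MeasurableSet.univ]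
        refine ENNReal.mul_lt_top ENNReal.ofReal_lt_top ?_
        exact measure_lt_top _ _
    exact Measure.integrableOn_of_bounded hfin.ne (hgm t).aestronglyMeasurable
      (ae_of_all _ (hgB t))
  have h2 : ∀ t > 0, ∫ x, t⁻¹ * (φ (x + t • e) - φ x) ∂(T.vol i)
      = ∑ k : T.faces i, t⁻¹ * ∫ x in T.sweep k e t, g t x := by
    intro t ht
    have hKi : ∀ ψ : Space d → ℝ, ∫ x, ψ x ∂(T.vol i)
        = ∫ x, K.indicator (fun _ => (1 : ℝ)) x * ψ x := by
      intro ψ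
      rw [vol, ← integral_indicator (T.measurableSet_elem i)]
      refine integral_congr_ae (ae_of_all _ fun x => ?_)
      by_cases hx : x ∈ K
      · rw [Set.indicator_of_mem hx]; simp only [Set.indicator_of_mem hx, one_mul]
      · rw [Set.indicator_of_notMem hx]; simp only [Set.indicator_of_notMem hx, zero_mul]
    have hmul : ∀ (f : Space d → ℝ), Measurable f → (∀ x, |f x| ≤ 1) → ∀ ψ : Space d → ℝ,
        Integrable ψ → Integrable fun x => f x * ψ x := by
      intro f hf hf1 ψ hψ
      refine hψ.bdd_mul hf.aestronglyMeasurable (c := 1) (ae_of_all _ hf1)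
    have hK1 : ∀ x, |K.indicator (fun _ => (1 : ℝ)) x| ≤ 1 := by
      intro x
      simp only [Set.indicator_apply]
      split_ifs <;> norm_num
    rw [integral_const_mul, ← Finset.mul_sum]
    congr 1
    rw [integral_sub, hKi, hKi]
    -- Translating the integral of the shifted `φ` by `-t e` leaves `φ` unshifted and puts the shift
    -- on the indicator.
    · rw [← integral_add_right_eq_self _ (-(t • e))]
      simp only [neg_add_cancel_right]
      simp only [← sub_eq_add_neg]
      rw [← integral_sub]
      · simp_rw [← sub_mul]
        rw [integral_congr_ae (ae_of_all _ (hsplit t (le_of_lt ht)))]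
        rw [integral_finsetSum]
        · exact Finset.sum_congr rfl fun k _ => integral_indicator (T.measurableSet_sweep k e t)
        · exact fun k _ => (hgi t k).integrable_indicator (T.measurableSet_sweep k e t)
      · exact hmul _ (hKm.comp (measurable_id.sub_const _)) (fun x => hK1 _) φ hint
      · exact hmul _ hKm hK1 φ hint
    · exact (hint.comp_add_right (t • e)).restrict
    · exact hint.restrict
  -- the limit for each face
  have h3 : ∀ k : T.faces i, Tendsto (fun t : ℝ => t⁻¹ * ∫ x in T.sweep k e t, g t x) (𝓝[>] 0)
      (𝓝 (inner ℝ (T.normal i k) e * ∫ x, φ x ∂(T.surf k))) := by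
    intro k
    set c : ℝ := inner ℝ (T.normal i k) e with hcdef
    by_cases he : c = 0
    · have : ∀ t, ∫ x in T.sweep k e t, g t x = 0 := by
        intro t
        rw [Measure.restrict_eq_zero.2 (T.volume_sweep_eq_zero k he t), integral_zero_measure]
      simp [this, he]
    have hmq : Measurable fun q : Space d × ℝ => q.1 + q.2 • e := by fun_prop
    have h4 : ∀ t > 0, t⁻¹ * ∫ x in T.sweep k e t, g t x
        = |c| * ∫ z, t⁻¹ * (∫ s in Set.Icc 0 t, g t (z + s • e)) ∂(T.surf k) := by
      intro t ht
      rw [T.restrict_sweep k he, integral_smul_measure,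
        integral_map hmq.aemeasurable (hgm t).aestronglyMeasurable, integral_prod,
        ENNReal.toReal_ofReal (abs_nonneg _), integral_const_mul, smul_eq_mul]
      · ring
      · exact Integrable.of_bound ((hgm t).comp hmq).aestronglyMeasurable B
          (ae_of_all _ fun q => hgB t _)
    -- Dominated convergence on the face, with the uniform bound `B`. For almost every `z` and all
    -- small `t` the integrand is exactly the sign of `c` times the average of `φ` over the segment.
    have h5 : Tendsto (fun t : ℝ => ∫ z, t⁻¹ * (∫ s in Set.Icc 0 t, g t (z + s • e)) ∂(T.surf k))
        (𝓝[>] 0) (𝓝 (∫ z, SignType.sign c * φ z ∂(T.surf k))) := by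
      refine tendsto_integral_filter_of_dominated_convergence (fun _ => B) ?_ ?_
        (integrable_const _) ?_
      · refine Eventually.of_forall fun t => ?_
        have := ((hgm t).comp hmq).stronglyMeasurable.integral_prod_right'
          (ν := volume.restrict (Set.Icc 0 t))
        exact (this.const_mul _).aestronglyMeasurable
      · filter_upwards [self_mem_nhdsWithin] with t ht
        have ht' : (0 : ℝ) < t := ht
        refine ae_of_all _ fun z => ?_
        have := norm_setIntegral_le_of_norm_le_const (μ := volume) (s := Set.Icc 0 t)
          (f := fun s : ℝ => g t (z + s • e)) (C := B) (by simp) (fun s _ => hgB t _)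
        rw [Real.volume_real_Icc_of_le ht'.le, sub_zero] at this
        rw [norm_mul, norm_inv, Real.norm_of_nonneg ht'.le, inv_mul_le_iff₀ ht']
        linarith
      · filter_upwards [T.ae_surf_sides i k] with z hz
        obtain ⟨hzF, r, hr, hrk, hin, hout⟩ := hz
        refine ((tendsto_average_segment hφc z e).const_mul
          ((SignType.sign c : SignType) : ℝ)).congr' ?_
        have hsmall : ∀ᶠ t in 𝓝[>] (0 : ℝ), t * (‖e‖ + 1) < r := by
          have : Tendsto (fun t : ℝ => t * (‖e‖ + 1)) (𝓝[>] 0) (𝓝 (0 * (‖e‖ + 1))) :=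
            (tendsto_id.mul_const _).mono_left nhdsWithin_le_nhds
          rw [zero_mul] at this
          exact this.eventually_lt_const hr
        filter_upwards [self_mem_nhdsWithin, hsmall] with t ht htr
        have ht' : (0 : ℝ) < t := ht
        have hball : ∀ s : ℝ, |s| ≤ t → z + s • e ∈ Metric.ball z r := by
          intro s hs
          rw [mem_ball_iff_norm, add_sub_cancel_left, norm_smul, Real.norm_eq_abs]
          have := mul_le_mul_of_nonneg_right hs (norm_nonneg e)
          nlinarith
        rw [mul_left_comm, ← integral_const_mul, integral_Icc_eq_integral_Ioo,
          integral_Icc_eq_integral_Ioo]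
        congr 1
        refine setIntegral_congr_fun measurableSet_Ioo fun s hs => ?_
        obtain ⟨hs0, hst⟩ := hs
        -- A second sweep through this point would put a point of another face on the short segment
        -- around `z`, inside the ball that meets only the face `k`.
        have hmone : m t (z + s • e) = 1 := by
          simp only [m]
          rw [Finset.sum_eq_single k]
          · rw [Set.indicator_of_mem]
            exact ⟨s, ⟨hs0.le, hst.le⟩, by simpa using hzF⟩
          · intro l _ hl
            refine Set.indicator_of_notMem ?_ _
            rintro ⟨s', ⟨hs'0, hs't⟩, h⟩
            refine hrk l (fun h => hl (Subtype.ext h)) (z + (s - s') • e)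
              (hball _ (abs_le.2 ⟨by linarith, by linarith⟩)) ?_
            rwa [sub_smul, ← add_sub_assoc]
          · simp
        have hz1 : z + s • e - t • e = z + (s - t) • e := by module
        have hb1 := hball s (abs_le.2 ⟨by linarith, by linarith⟩)
        have hb2 := hball (s - t) (abs_le.2 ⟨by linarith, by linarith⟩)
        have hi1 : inner ℝ (T.normal i k) (z + s • e - z) = s * c := by
          rw [add_sub_cancel_left, inner_smul_right]
        have hi2 : inner ℝ (T.normal i k) (z + (s - t) • e - z) = (s - t) * c := by
          rw [add_sub_cancel_left, inner_smul_right]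
        simp only [g, hmone, div_one, χ, hz1]
        congr 1
        -- For `c < 0` the direction points into the element: `z + s e` is inside and `z + (s - t)
        -- e` is outside, so the difference of indicators is `-1`. For `c > 0` the roles are
        -- exchanged.
        rcases lt_or_gt_of_ne he with hneg | hpos
        · have a1 : z + s • e ∈ K := hin _ hb1 (by rw [hi1]; nlinarith)
          have a2 : z + (s - t) • e ∉ K := hout _ hb2 (by rw [hi2]; nlinarith)
          simp [a1, a2, sign_neg hneg]
        · have a1 : z + s • e ∉ K := hout _ hb1 (by rw [hi1]; positivity)
          have a2 : z + (s - t) • e ∈ K := hin _ hb2 (by rw [hi2]; nlinarith)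
          simp [a1, a2, sign_pos hpos]
    have h6 := h5.const_mul |c|
    rw [integral_const_mul, ← mul_assoc, mul_comm |c|, sign_mul_abs] at h6
    refine h6.congr' ?_
    filter_upwards [self_mem_nhdsWithin] with t ht
    exact (h4 t ht).symm
  refine tendsto_nhds_unique h1 ((tendsto_finsetSum _ fun k _ => h3 k).congr' ?_)
  filter_upwards [self_mem_nhdsWithin] with t ht
  exact (h2 t ht).symm

/-- The divergence theorem on an element. -/
theorem integral_fderiv_eq (i : Fin T.nK) (e : Space d) {φ : Space d → ℝ}
    (hφ : ContDiff ℝ 1 φ) :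
    ∫ x, fderiv ℝ φ x e ∂(T.vol i)
      = ∑ j : T.faces i, inner ℝ (T.normal i j) e * ∫ x, φ x ∂(T.surf j) := by
  obtain ⟨R, hR⟩ := (T.elem_polyhedral i).isBounded.closure.subset_ball 0
  have hR' : closure (T.elem i) ⊆ Metric.ball 0 (max R 1) :=
    hR.trans (Metric.ball_subset_ball (le_max_left _ _))
  -- A cutoff that equals one near the closure of the element changes neither side of the identity
  -- and makes the integrand compactly supported.
  let χ : ContDiffBump (0 : Space d) := ⟨max R 1, max R 1 + 1, by positivity, by linarith⟩
  have hχ : ∀ x ∈ closure (T.elem i), χ =ᶠ[𝓝 x] 1 := fun x hx =>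
    χ.eventuallyEq_one_of_mem_ball (hR' hx)
  have h := T.integral_fderiv_eq_of_hasCompactSupport i e (φ := fun x => χ x * φ x)
    (χ.contDiff.mul hφ) χ.hasCompactSupport.mul_right
  have e1 : ∫ x, fderiv ℝ (fun x => χ x * φ x) x e ∂(T.vol i)
      = ∫ x, fderiv ℝ φ x e ∂(T.vol i) := by
    refine setIntegral_congr_fun (T.measurableSet_elem i) fun x hx => ?_
    have : (fun x => χ x * φ x) =ᶠ[𝓝 x] φ := by
      filter_upwards [hχ x (subset_closure hx)] with y hy
      simp [hy]
    simp only [this.fderiv_eq]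
  rw [e1] at h
  rw [h]
  refine Finset.sum_congr rfl fun j _ => ?_
  congr 1
  refine setIntegral_congr_fun (T.measurableSet_face j) fun x hx => ?_
  have := (hχ x (T.face_subset_closure j.2 hx)).eq_of_nhds
  simp [this]

end Mesh

end HDG

namespace HDG

/-! ### Calculus of polynomials as functions -/

section Polynomials

variable {d : ℕ}

@[simp] theorem evalAt_zero (x : Space d) : evalAt (0 : Poly d) x = 0 := by simp [evalAt]

@[simp] theorem evalAt_one (x : Space d) : evalAt (1 : Poly d) x = 1 := by simp [evalAt]

@[simp] theorem evalAt_C (c : ℝ) (x : Space d) : evalAt (MvPolynomial.C c : Poly d) x = c := by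
  simp [evalAt]

@[simp] theorem evalAt_X (r : Fin d) (x : Space d) :
    evalAt (MvPolynomial.X r : Poly d) x = x r := by simp [evalAt]

@[simp] theorem evalAt_add (p q : Poly d) (x : Space d) :
    evalAt (p + q) x = evalAt p x + evalAt q x := by simp [evalAt]

@[simp] theorem evalAt_sub (p q : Poly d) (x : Space d) :
    evalAt (p - q) x = evalAt p x - evalAt q x := by simp [evalAt]

@[simp] theorem evalAt_mul (p q : Poly d) (x : Space d) :
    evalAt (p * q) x = evalAt p x * evalAt q x := by simp [evalAt]

@[simp] theorem evalAt_smul (c : ℝ) (p : Poly d) (x : Space d) :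
    evalAt (c • p) x = c * evalAt p x := by simp [evalAt, MvPolynomial.smul_eval]

@[simp] theorem evalAt_pow (p : Poly d) (n : ℕ) (x : Space d) :
    evalAt (p ^ n) x = evalAt p x ^ n := by simp [evalAt]

@[simp] theorem evalAt_sum {ι : Type*} (s : Finset ι) (p : ι → Poly d) (x : Space d) :
    evalAt (∑ a ∈ s, p a) x = ∑ a ∈ s, evalAt (p a) x := by simp [evalAt]

@[simp] theorem vecAt_apply (v : Fin d → Poly d) (x : Space d) (r : Fin d) :
    vecAt v x r = evalAt (v r) x := rfl

theorem inner_vecAt (v : Fin d → Poly d) (x y : Space d) :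
    inner ℝ (vecAt v x) y = ∑ r, evalAt (v r) x * y r := by
  simp [PiLp.inner_apply, mul_comm]

theorem hasGradientAt_evalAt (p : Poly d) (x : Space d) :
    HasGradientAt (evalAt p) (vecAt (grad p) x) x := by
  rw [hasGradientAt_iff_hasFDerivAt]
  induction p using MvPolynomial.induction_on with
  | C c =>
    have : vecAt (grad (MvPolynomial.C c)) x = 0 := by
      ext r; simp [grad]
    rw [this, map_zero]
    have h2 : evalAt (MvPolynomial.C c : Poly d) = fun _ => c := by ext y; simp
    rw [h2]; exact hasFDerivAt_const c x
  | add p q hp hq =>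
    have h1 : vecAt (grad (p + q)) x = vecAt (grad p) x + vecAt (grad q) x := by
      ext r; simp [grad]
    have h2 : evalAt (p + q) = evalAt p + evalAt q := by ext y; simp
    rw [h1, h2, map_add]
    exact hp.add hq
  | mul_X p r hp =>
    have h2 : evalAt (p * MvPolynomial.X r) = fun y => evalAt p y * y r := by ext y; simp
    rw [h2]
    have h3 : HasFDerivAt (fun y : Space d => y r) (EuclideanSpace.proj r : Space d →L[ℝ] ℝ) x :=
      (EuclideanSpace.proj r : Space d →L[ℝ] ℝ).hasFDerivAt
    refine (hp.mul h3).congr_fderiv ?_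
    ext y
    simp only [add_apply, smul_apply,
      InnerProductSpace.toDual_apply_apply, inner_vecAt, grad, PiLp.proj_apply,
      smul_eq_mul, MvPolynomial.pderiv_mul, evalAt_add, evalAt_mul, evalAt_X, add_mul,
      Finset.sum_add_distrib, Finset.mul_sum]
    rw [add_comm]
    congr 1
    · exact Finset.sum_congr rfl fun s _ => by ring
    · rw [Finset.sum_eq_single r]
      · simp [MvPolynomial.pderiv_X]
      · intro s _ hs
        simp [MvPolynomial.pderiv_X, hs.symm]
      · simp

theorem gradient_evalAt (p : Poly d) (x : Space d) :
    gradient (evalAt p) x = vecAt (grad p) x := (hasGradientAt_evalAt p x).gradient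

theorem contDiff_evalAt (p : Poly d) {n : WithTop ℕ∞} : ContDiff ℝ n (evalAt p) := by
  induction p using MvPolynomial.induction_on with
  | C c =>
    have h2 : evalAt (MvPolynomial.C c : Poly d) = fun _ => c := by ext y; simp
    rw [h2]; exact contDiff_const
  | add p q hp hq =>
    have h2 : evalAt (p + q) = fun y => evalAt p y + evalAt q y := by ext y; simp
    rw [h2]; exact hp.add hq
  | mul_X p r hp =>
    have h2 : evalAt (p * MvPolynomial.X r) = fun y => evalAt p y * y r := by ext y; simp
    rw [h2]
    exact hp.mul (EuclideanSpace.proj r : Space d →L[ℝ] ℝ).contDiff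

theorem fderiv_evalAt_single (p : Poly d) (x : Space d) (r : Fin d) :
    fderiv ℝ (evalAt p) x (EuclideanSpace.single r 1) = evalAt (MvPolynomial.pderiv r p) x := by
  have h := (hasGradientAt_iff_hasFDerivAt.1 (hasGradientAt_evalAt p x)).fderiv
  rw [h, InnerProductSpace.toDual_apply_apply, EuclideanSpace.inner_single_right]
  simp [grad]

/-- An open set contains a product of intervals, that is, of infinite sets of coordinates. -/
theorem poly_eq_zero_of_eqOn_open {U : Set (Space d)} (hU : IsOpen U) (hne : U.Nonempty)
    {p : Poly d} (h : ∀ x ∈ U, evalAt p x = 0) : p = 0 := by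
  obtain ⟨x, hx⟩ := hne
  have hU' : IsOpen ((fun y : Fin d → ℝ => WithLp.toLp 2 y) ⁻¹' U) :=
    hU.preimage (PiLp.continuous_toLp 2 _)
  obtain ⟨ε, hε, hball⟩ := Metric.isOpen_iff.1 hU' (WithLp.ofLp x) hx
  refine MvPolynomial.funext_set (fun r => Metric.ball (x r) ε) (fun r => ?_) fun y hy => ?_
  · rw [Real.ball_eq_Ioo]
    exact Set.Ioo_infinite (by linarith)
  · rw [map_zero]
    have : y ∈ Metric.ball (WithLp.ofLp x) ε := by
      rw [ball_pi _ hε]; exact hy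
    exact h _ (hball this)

theorem poly_eq_zero_of_ae_eq_zero {U : Set (Space d)} (hU : IsOpen U) (hne : U.Nonempty)
    {p : Poly d} (h : ∀ᵐ x ∂(volume.restrict U), evalAt p x = 0) : p = 0 := by
  refine poly_eq_zero_of_eqOn_open hU hne fun x hx => ?_
  have h2 := MeasureTheory.Measure.eqOn_open_of_ae_eq (μ := volume) (f := evalAt p)
    (g := fun _ => (0 : ℝ)) h hU (continuous_evalAt p).continuousOn continuousOn_const
  exact h2 hx

/-- Passing to a reference ball is such an affine substitution; the degree bound must survive it for
the inverse inequalities to scale. -/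
theorem totalDegree_bind₁_affine_le (p : Poly d) (a : Fin d → ℝ) (c : ℝ) :
    (MvPolynomial.bind₁ (fun r => MvPolynomial.C (a r) + MvPolynomial.C c * MvPolynomial.X r :
      Fin d → Poly d) p).totalDegree ≤ p.totalDegree := by
  have hl : ∀ r : Fin d, (MvPolynomial.C (a r) + MvPolynomial.C c * MvPolynomial.X r :
      Poly d).totalDegree ≤ 1 := by
    intro r
    refine (MvPolynomial.totalDegree_add _ _).trans (max_le (by simp) ?_)
    refine (MvPolynomial.totalDegree_mul _ _).trans ?_
    simp
  conv_lhs => rw [p.as_sum, map_sum]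
  refine MvPolynomial.totalDegree_finsetSum_le fun m hm => ?_
  rw [MvPolynomial.bind₁_monomial]
  refine (MvPolynomial.totalDegree_mul _ _).trans ?_
  rw [MvPolynomial.totalDegree_C, zero_add]
  refine (MvPolynomial.totalDegree_finsetProd _ _).trans ?_
  refine le_trans ?_ (MvPolynomial.le_totalDegree hm)
  refine Finset.sum_le_sum fun r _ => ?_
  refine (MvPolynomial.totalDegree_pow _ _).trans ?_
  simpa using Nat.mul_le_mul_left (m r) (hl r)

/-- On a finite dimensional space, a linear map is bounded by any linear map with smaller kernel. -/
theorem exists_norm_le_mul_norm {V E F : Type*} [AddCommGroup V] [Module ℝ V]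
    [FiniteDimensional ℝ V] [NormedAddCommGroup E] [NormedSpace ℝ E] [NormedAddCommGroup F]
    [NormedSpace ℝ F] (f : V →ₗ[ℝ] E) (g : V →ₗ[ℝ] F) (h : ∀ v, f v = 0 → g v = 0) :
    ∃ C > 0, ∀ v, ‖g v‖ ≤ C * ‖f v‖ := by
  -- A linear section of `f` over its range. The inclusion of kernels makes `g` factor through `f`,
  -- and the factor is bounded because the range is finite-dimensional.
  obtain ⟨s, hs⟩ := f.rangeRestrict.exists_rightInverse_of_surjective
    (LinearMap.range_eq_top.2 f.surjective_rangeRestrict)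
  let φ : LinearMap.range f →L[ℝ] F := LinearMap.toContinuousLinearMap (g ∘ₗ s)
  refine ⟨‖φ‖ + 1, by positivity, fun v => ?_⟩
  have h1 : g v = φ (f.rangeRestrict v) := by
    have h2 : f.rangeRestrict (s (f.rangeRestrict v)) = f.rangeRestrict v := LinearMap.congr_fun hs _
    have h3 : f (v - s (f.rangeRestrict v)) = 0 := by
      rw [map_sub, sub_eq_zero]
      exact (congrArg Subtype.val h2).symm
    have h4 := h _ h3
    rw [map_sub, sub_eq_zero] at h4
    exact h4
  rw [h1]
  calc ‖φ (f.rangeRestrict v)‖ ≤ ‖φ‖ * ‖f.rangeRestrict v‖ := φ.le_opNorm _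
    _ ≤ (‖φ‖ + 1) * ‖f v‖ := by
      gcongr
      · linarith
      · rfl

theorem compactlyCarried_restrict {U : Set (Space d)} (hU : IsOpen U)
    (hb : Bornology.IsBounded U) : CompactlyCarried (volume.restrict U) := by
  refine ⟨⟨?_⟩, closure U, hb.isCompact_closure, ?_⟩
  · rw [Measure.restrict_apply_univ]
    exact hb.measure_lt_top
  · exact (ae_restrict_mem hU.measurableSet).mono fun x hx => subset_closure hx

theorem polyL2_coeFn {μ : Measure (Space d)} (h : CompactlyCarried μ) (p : Poly d) :
    ∀ᵐ x ∂μ, polyL2 h p x = evalAt p x := MemLp.coeFn_toLp (h.memLp (continuous_evalAt p) 2)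

theorem vecL2_coeFn {μ : Measure (Space d)} (h : CompactlyCarried μ) (v : Fin d → Poly d) :
    ∀ᵐ x ∂μ, vecL2 h v x = vecAt v x := MemLp.coeFn_toLp (h.memLp (continuous_vecAt v) 2)

theorem inner_polyL2 {μ : Measure (Space d)} (h : CompactlyCarried μ) (p q : Poly d) :
    inner ℝ (polyL2 h p) (polyL2 h q) = ∫ x, evalAt p x * evalAt q x ∂μ := by
  rw [L2.inner_def]
  refine integral_congr_ae ?_
  filter_upwards [polyL2_coeFn h p, polyL2_coeFn h q] with x hx hy
  rw [hx, hy]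
  simp [mul_comm]

theorem norm_sq_polyL2 {μ : Measure (Space d)} (h : CompactlyCarried μ) (p : Poly d) :
    ‖polyL2 h p‖ ^ 2 = ∫ x, evalAt p x ^ 2 ∂μ := by
  rw [← real_inner_self_eq_norm_sq, inner_polyL2]
  simp_rw [sq]

/-- The restriction of a polynomial to a set, as a continuous function. -/
noncomputable def polyRestrict (B : Set (Space d)) : Poly d →ₗ[ℝ] C(B, ℝ) where
  toFun p := ⟨fun y => evalAt p y, (continuous_evalAt p).comp continuous_subtype_val⟩
  map_add' p q := by ext y; simp
  map_smul' c p := by ext y; simp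

/-- Inverse inequality on the unit ball. -/
theorem exists_sq_le_integral_unitBall (k : ℕ) (R : ℝ) :
    ∃ C > 0, ∀ p : Poly d, p.totalDegree ≤ k → ∀ y ∈ Metric.closedBall (0 : Space d) R,
      evalAt p y ^ 2 ≤ C * ∫ x in Metric.ball (0 : Space d) 1, evalAt p x ^ 2 := by
  let P := MvPolynomial.restrictTotalDegree (Fin d) ℝ k
  have hcar : CompactlyCarried ((volume : Measure (Space d)).restrict (Metric.ball 0 1)) :=
    compactlyCarried_restrict Metric.isOpen_ball Metric.isBounded_ball
  have : CompactSpace (Metric.closedBall (0 : Space d) R) :=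
    isCompact_iff_compactSpace.1 (isCompact_closedBall _ _)
  obtain ⟨g, hg⟩ : ∃ g : P →ₗ[ℝ] C(Metric.closedBall (0 : Space d) R, ℝ),
      ∀ (p : P) (y : Metric.closedBall (0 : Space d) R), g p y = evalAt (p : Poly d) y :=
    ⟨polyRestrict _ ∘ₗ P.subtype, fun p y => rfl⟩
  obtain ⟨f, hf⟩ : ∃ f : P →ₗ[ℝ] Lp ℝ 2 ((volume : Measure (Space d)).restrict (Metric.ball 0 1)),
      ∀ p : P, f p = polyL2 hcar (p : Poly d) := ⟨polyL2 hcar ∘ₗ P.subtype, fun p => rfl⟩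
  -- A polynomial that vanishes almost everywhere on the unit ball is zero, so on polynomials of
  -- bounded degree the mean square over the ball dominates the maximum over any larger ball.
  have hker : ∀ p : P, f p = 0 → g p = 0 := by
    intro p hp
    rw [hf] at hp
    have h0 : (p : Poly d) = 0 := by
      refine poly_eq_zero_of_ae_eq_zero Metric.isOpen_ball
        ⟨0, Metric.mem_ball_self (zero_lt_one)⟩ ?_
      filter_upwards [polyL2_coeFn hcar (p : Poly d), Lp.coeFn_zero ℝ 2
        ((volume : Measure (Space d)).restrict (Metric.ball 0 1))] with x hx h0
      rw [← hx, hp, h0]; rfl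
    ext y
    rw [hg, h0]
    simp
  obtain ⟨C, hC, h⟩ := exists_norm_le_mul_norm f g hker
  refine ⟨C ^ 2, by positivity, fun p hp y hy => ?_⟩
  let p' : P := ⟨p, (MvPolynomial.mem_restrictTotalDegree _ _ _).2 hp⟩
  have h2 := (g p').norm_coe_le_norm ⟨y, hy⟩
  rw [hg, Real.norm_eq_abs] at h2
  have h3 := h2.trans (h p')
  rw [hf] at h3
  rw [← norm_sq_polyL2 hcar p, ← mul_pow, ← sq_abs]
  exact pow_le_pow_left₀ (abs_nonneg _) h3 2

/-- Inverse inequality: a polynomial is bounded on a large ball by its mean square on a small one. -/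
theorem exists_sq_le_integral_ball (k : ℕ) (R : ℝ) :
    ∃ C > 0, ∀ p : Poly d, p.totalDegree ≤ k → ∀ (x₀ : Space d) (ρ : ℝ), 0 < ρ →
      ∀ y ∈ Metric.closedBall x₀ (R * ρ),
      ρ ^ d * evalAt p y ^ 2 ≤ C * ∫ x in Metric.ball x₀ ρ, evalAt p x ^ 2 := by
  obtain ⟨C, hC, h⟩ := exists_sq_le_integral_unitBall (d := d) k R
  refine ⟨C, hC, fun p hp x₀ ρ hρ y hy => ?_⟩
  -- The polynomial pulled back to the unit ball; the Jacobian of the scaling is the factor `ρ ^ d`.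
  set q : Poly d := MvPolynomial.bind₁ (fun r =>
    MvPolynomial.C (x₀ r) + MvPolynomial.C ρ * MvPolynomial.X r : Fin d → Poly d) p with hq
  have heval : ∀ z : Space d, evalAt q z = evalAt p (x₀ + ρ • z) := by
    intro z
    simp only [evalAt, hq, MvPolynomial.eval, MvPolynomial.eval₂Hom_bind₁]
    simp
  have hy' : ρ⁻¹ • (y - x₀) ∈ Metric.closedBall (0 : Space d) R := by
    rw [mem_closedBall_zero_iff, norm_smul, norm_inv, Real.norm_of_nonneg hρ.le,
      inv_mul_le_iff₀ hρ, mul_comm]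
    rwa [mem_closedBall_iff_norm] at hy
  have h1 := h q ((totalDegree_bind₁_affine_le p _ _).trans hp) _ hy'
  rw [heval, smul_inv_smul₀ hρ.ne', add_sub_cancel] at h1
  have h2 : ∫ x in Metric.ball (0 : Space d) 1, evalAt q x ^ 2
      = (ρ ^ d)⁻¹ * ∫ x in Metric.ball x₀ ρ, evalAt p x ^ 2 := by
    rw [← integral_indicator Metric.isOpen_ball.measurableSet,
      ← integral_indicator Metric.isOpen_ball.measurableSet]
    set F : Space d → ℝ := (Metric.ball x₀ ρ).indicator fun x => evalAt p x ^ 2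
    have h3 : ∀ x, (Metric.ball (0 : Space d) 1).indicator (fun x => evalAt q x ^ 2) x
        = F (x₀ + ρ • x) := by
      intro x
      have : x₀ + ρ • x ∈ Metric.ball x₀ ρ ↔ x ∈ Metric.ball (0 : Space d) 1 := by
        rw [mem_ball_iff_norm, add_sub_cancel_left, norm_smul, Real.norm_of_nonneg hρ.le,
          mem_ball_zero_iff]
        constructor <;> intro h <;> nlinarith
      by_cases hx : x ∈ Metric.ball (0 : Space d) 1
      · simp only [F, Set.indicator_of_mem hx, Set.indicator_of_mem (this.2 hx), heval]
      · simp only [F, Set.indicator_of_notMem hx,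
          Set.indicator_of_notMem (fun h => hx (this.1 h))]
    simp_rw [h3]
    rw [Measure.integral_comp_smul volume (fun x => F (x₀ + x)) ρ, integral_add_left_eq_self F x₀,
      finrank_euclideanSpace_fin, abs_of_nonneg (by positivity), smul_eq_mul]
  rw [h2] at h1
  calc ρ ^ d * evalAt p y ^ 2 ≤ ρ ^ d * (C * ((ρ ^ d)⁻¹ * ∫ x in Metric.ball x₀ ρ, evalAt p x ^ 2)) :=
        mul_le_mul_of_nonneg_left h1 (by positivity)
    _ = C * ∫ x in Metric.ball x₀ ρ, evalAt p x ^ 2 := by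
        field_simp

end Polynomials

end HDG

namespace HDG

/-! ### Norms of polynomials on elements and faces -/

/-- Directions of different faces are different spaces; this lets one constant, depending only on
the dimension, bound the areas of all faces. -/
theorem volume_unitBall_eq {D : Type*} [NormedAddCommGroup D] [InnerProductSpace ℝ D]
    [FiniteDimensional ℝ D] [MeasurableSpace D] [BorelSpace D] {m : ℕ}
    (h : Module.finrank ℝ D = m) :
    volume (Metric.ball (0 : D) 1) = volume (Metric.ball (0 : Space m) 1) := by
  subst h
  have e := (stdOrthonormalBasis ℝ D).repr
  rw [← (e.measurePreserving).measure_preimage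
    Metric.isOpen_ball.measurableSet.nullMeasurableSet]
  congr 1
  ext x
  simp

namespace Mesh

variable {d : ℕ} {Ω : Set (Space d)} (T : Mesh Ω)

theorem elem_nonempty (i : Fin T.nK) : (T.elem i).Nonempty :=
  (T.elem_polyhedral i).isConnected.nonempty

theorem h_pos (hd : 0 < d) (i : Fin T.nK) : 0 < T.h i := by
  obtain ⟨x, hx⟩ := T.elem_nonempty i
  obtain ⟨ε, hε, hb⟩ := Metric.isOpen_iff.1 (T.elem_polyhedral i).isOpen x hx
  let v : Space d := EuclideanSpace.single ⟨0, hd⟩ (ε / 2)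
  have hv : ‖v‖ = ε / 2 := by simp [v, abs_of_pos hε]
  have hy : x + v ∈ T.elem i := hb (by rw [mem_ball_iff_norm, add_sub_cancel_left, hv]; linarith)
  have := Metric.dist_le_diam_of_mem (T.elem_polyhedral i).isBounded hy hx
  rw [dist_eq_norm, add_sub_cancel_left, hv] at this
  exact lt_of_lt_of_le (by positivity) this

theorem h_nonneg (i : Fin T.nK) : 0 ≤ T.h i := Metric.diam_nonneg

theorem dist_le_h {i : Fin T.nK} {x y : Space d} (hx : x ∈ closure (T.elem i))
    (hy : y ∈ closure (T.elem i)) : dist x y ≤ T.h i := by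
  rw [h, ← Metric.diam_closure]
  exact Metric.dist_le_diam_of_mem (T.elem_polyhedral i).isBounded.closure hx hy

theorem poly_eq_zero_of_polyK {i : Fin T.nK} {p : Poly d} (hp : T.polyK i p = 0) : p = 0 := by
  refine poly_eq_zero_of_ae_eq_zero (T.elem_polyhedral i).isOpen (T.elem_nonempty i) ?_
  change ∀ᵐ x ∂(T.vol i), _
  filter_upwards [polyL2_coeFn (T.carried_vol i) p, Lp.coeFn_zero ℝ 2 (T.vol i)] with x hx h0
  have h1 : polyL2 (T.carried_vol i) p = 0 := hp
  rw [← hx, h1, h0]; rfl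

theorem inner_polyK (i : Fin T.nK) (p q : Poly d) :
    inner ℝ (T.polyK i p) (T.polyK i q) = ∫ x, evalAt p x * evalAt q x ∂(T.vol i) :=
  inner_polyL2 _ p q

theorem norm_sq_polyK (i : Fin T.nK) (p : Poly d) :
    ‖T.polyK i p‖ ^ 2 = ∫ x, evalAt p x ^ 2 ∂(T.vol i) := norm_sq_polyL2 _ p

theorem norm_sq_traceL2 {i : Fin T.nK} (τ : T.TraceL2 i) : ‖τ‖ ^ 2 = ∑ j, ‖τ j‖ ^ 2 :=
  PiLp.norm_sq_eq_of_L2 _ τ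

theorem norm_apply_le {i : Fin T.nK} (τ : T.TraceL2 i) (j : T.faces i) : ‖τ j‖ ≤ ‖τ‖ :=
  PiLp.norm_apply_le τ j

theorem integrable_of_continuous {i : Fin T.nK} {g : Space d → ℝ} (hg : Continuous g) :
    Integrable g (T.vol i) :=
  memLp_one_iff_integrable.1 ((T.carried_vol i).memLp hg 1)

theorem integrable_surf_of_continuous {j : Fin T.nF} {g : Space d → ℝ} (hg : Continuous g) :
    Integrable g (T.surf j) :=
  memLp_one_iff_integrable.1 ((T.carried_surf j).memLp hg 1)

theorem inner_vecK (i : Fin T.nK) (v w : Fin d → Poly d) :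
    inner ℝ (T.vecK i v) (T.vecK i w) = ∑ r, inner ℝ (T.polyK i (v r)) (T.polyK i (w r)) := by
  rw [L2.inner_def]
  simp_rw [inner_polyK]
  rw [← integral_finsetSum]
  · refine integral_congr_ae ?_
    filter_upwards [vecL2_coeFn (T.carried_vol i) v, vecL2_coeFn (T.carried_vol i) w] with x hx hy
    change inner ℝ (vecL2 (T.carried_vol i) v x) (vecL2 (T.carried_vol i) w x) = _
    rw [hx, hy, inner_vecAt]
    rfl
  · intro r _
    exact T.integrable_of_continuous ((continuous_evalAt _).mul (continuous_evalAt _))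

theorem norm_sq_vecK (i : Fin T.nK) (v : Fin d → Poly d) :
    ‖T.vecK i v‖ ^ 2 = ∑ r, ‖T.polyK i (v r)‖ ^ 2 := by
  simp_rw [← real_inner_self_eq_norm_sq, inner_vecK]

theorem traceK_apply (i : Fin T.nK) (p : Poly d) (j : T.faces i) :
    T.traceK i p j = polyL2 (T.carried_surf j) p := rfl

theorem traceK_add (i : Fin T.nK) (p q : Poly d) :
    T.traceK i (p + q) = T.traceK i p + T.traceK i q := by
  ext1 j; simp [traceK_apply]

theorem traceK_smul (i : Fin T.nK) (c : ℝ) (p : Poly d) :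
    T.traceK i (c • p) = c • T.traceK i p := by
  ext1 j; simp [traceK_apply]

theorem vecK_add (i : Fin T.nK) (v w : Fin d → Poly d) :
    T.vecK i (v + w) = T.vecK i v + T.vecK i w := by
  rw [vecK, vecK, vecK, vecL2, vecL2, vecL2, ← MemLp.toLp_add]
  exact MemLp.toLp_congr _ _ (ae_of_all _ fun x => by ext r; simp)

theorem vecK_smul (i : Fin T.nK) (c : ℝ) (v : Fin d → Poly d) :
    T.vecK i (c • v) = c • T.vecK i v := by
  rw [vecK, vecK, vecL2, vecL2, ← MemLp.toLp_const_smul]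
  exact MemLp.toLp_congr _ _ (ae_of_all _ fun x => by ext r; simp)

theorem grad_add (p q : Poly d) : grad (p + q) = grad p + grad q := by
  ext1 r; simp [grad]

theorem grad_smul (c : ℝ) (p : Poly d) : grad (c • p) = c • grad p := by
  ext1 r; simp [grad]

/-- The maximum of a polynomial on the closure of an element. -/
noncomputable def supNorm (i : Fin T.nK) (p : Poly d) : ℝ :=
  sSup ((fun x => |evalAt p x|) '' closure (T.elem i))

theorem exists_supNorm_eq (i : Fin T.nK) (p : Poly d) :
    ∃ x ∈ closure (T.elem i), T.supNorm i p = |evalAt p x| := by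
  have hc : IsCompact (closure (T.elem i)) := (T.elem_polyhedral i).isBounded.isCompact_closure
  obtain ⟨x, hx, h⟩ := hc.exists_sSup_image_eq (T.elem_nonempty i).closure
    (continuous_evalAt p).abs.continuousOn
  exact ⟨x, hx, h⟩

theorem abs_le_supNorm {i : Fin T.nK} (p : Poly d) {x : Space d} (hx : x ∈ closure (T.elem i)) :
    |evalAt p x| ≤ T.supNorm i p := by
  have hc : IsCompact (closure (T.elem i)) := (T.elem_polyhedral i).isBounded.isCompact_closure
  exact le_csSup (hc.bddAbove_image (continuous_evalAt p).abs.continuousOn)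
    (Set.mem_image_of_mem _ hx)

theorem supNorm_nonneg (i : Fin T.nK) (p : Poly d) : 0 ≤ T.supNorm i p := by
  obtain ⟨x, -, h⟩ := T.exists_supNorm_eq i p
  rw [h]; exact abs_nonneg _

theorem ae_vol_mem (i : Fin T.nK) : ∀ᵐ x ∂(T.vol i), x ∈ closure (T.elem i) :=
  (ae_restrict_mem (T.measurableSet_elem i)).mono fun _ hx => subset_closure hx

theorem ae_surf_mem {i : Fin T.nK} (j : T.faces i) :
    ∀ᵐ x ∂(T.surf j), x ∈ closure (T.elem i) :=
  (ae_restrict_mem (T.measurableSet_face j)).mono fun _ hx => T.face_subset_closure j.2 hx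

theorem ae_vol_abs_le (i : Fin T.nK) (p : Poly d) :
    ∀ᵐ x ∂(T.vol i), |evalAt p x| ≤ T.supNorm i p :=
  (T.ae_vol_mem i).mono fun _ hx => T.abs_le_supNorm p hx

theorem ae_surf_abs_le {i : Fin T.nK} (j : T.faces i) (p : Poly d) :
    ∀ᵐ x ∂(T.surf j), |evalAt p x| ≤ T.supNorm i p :=
  (T.ae_surf_mem j).mono fun _ hx => T.abs_le_supNorm p hx

theorem integral_sq_le {μ : Measure (Space d)} [IsFiniteMeasure μ] {p : Poly d} {A : ℝ}
    (h : ∀ᵐ x ∂μ, |evalAt p x| ≤ A) : ∫ x, evalAt p x ^ 2 ∂μ ≤ μ.real Set.univ * A ^ 2 := by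
  have h1 : ∀ᵐ x ∂μ, evalAt p x ^ 2 ≤ A ^ 2 := by
    filter_upwards [h] with x hx
    rw [← sq_abs]
    exact pow_le_pow_left₀ (abs_nonneg _) hx 2
  calc ∫ x, evalAt p x ^ 2 ∂μ ≤ ∫ _, A ^ 2 ∂μ :=
        integral_mono_of_nonneg (ae_of_all _ fun x => sq_nonneg _) (integrable_const _) h1
    _ = μ.real Set.univ * A ^ 2 := by simp

/-- The geometric bounds for a shape regular mesh, and the inverse inequalities for polynomials of
degree at most `k`, with a common constant. -/
structure Bounds (k : ℕ) (C : ℝ) : Prop where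
  one_le : 1 ≤ C
  h_le : ∀ i, T.h i ≤ C
  vol_le : ∀ i, (T.vol i).real Set.univ ≤ C * T.h i ^ d
  surf_le : ∀ i, ∀ j ∈ T.faces i, (T.surf j).real Set.univ ≤ C * T.h i ^ (d - 1)
  card_le : ∀ i, ((T.faces i).card : ℝ) ≤ C
  sum_le : ∑ i, T.h i ^ d ≤ C
  inverse : ∀ i (p : Poly d), p.totalDegree ≤ k →
    T.h i ^ d * T.supNorm i p ^ 2 ≤ C * ∫ x, evalAt p x ^ 2 ∂(T.vol i)
  inverse_six : ∀ i (p : Poly d), p.totalDegree ≤ k →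
    T.h i ^ d * T.supNorm i p ^ 6 ≤ C * ∫ x, evalAt p x ^ 6 ∂(T.vol i)

/-- A face lies in the ball of radius `h` of its hyperplane around any of its points. The summand
`1` only keeps the constant visibly positive. -/
theorem exists_surf_le (d : ℕ) : ∃ C > 0, ∀ {Ω : Set (Space d)} (T : Mesh Ω),
    ∀ i, ∀ j ∈ T.faces i, (T.surf j).real Set.univ ≤ C * T.h i ^ (d - 1) := by
  refine ⟨(volume (Metric.ball (0 : Space (d - 1)) 1)).toReal + 1, by positivity,
    fun {Ω} T i j hj => ?_⟩
  obtain ⟨p, hp⟩ := (T.face_flat j).isConnected.nonempty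
  set D := (affineSpan ℝ (T.face j)).direction with hD
  have hr : Module.finrank ℝ D = d - 1 := by
    have : Module.finrank ℝ D + 1 = d := (T.face_flat j).finrank_direction
    omega
  have hm := map_volume_direction (D := D) (T.face_flat j).finrank_direction p
  have h1 : T.surf j Set.univ ≤ volume (Metric.closedBall (0 : D) (T.h i)) := by
    have hsub : T.face j ⊆ Set.range fun z : D => (z : Space d) + p := by
      intro x hx
      exact ⟨⟨x - p, AffineSubspace.vsub_mem_direction (subset_affineSpan ℝ _ hx)
        (subset_affineSpan ℝ _ hp)⟩, by simp⟩
    have h2 : T.surf j Set.univ = volume ((fun z : D => (z : Space d) + p) ⁻¹' T.face j) := by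
      rw [← Measure.map_apply (by fun_prop) (T.measurableSet_face j), hm, surf,
        Measure.restrict_apply_univ, Measure.restrict_apply (T.measurableSet_face j),
        Set.inter_eq_left.2 hsub]
    rw [h2]
    refine measure_mono fun z hz => ?_
    rw [mem_closedBall_zero_iff]
    have := T.dist_le_h (T.face_subset_closure hj hz) (T.face_subset_closure hj hp)
    rwa [dist_eq_norm, add_sub_cancel_right] at this
  rw [Measure.addHaar_closedBall _ _ (T.h_nonneg i), hr, volume_unitBall_eq hr] at h1
  have h3 := ENNReal.toReal_mono (ENNReal.mul_ne_top ENNReal.ofReal_ne_top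
    measure_ball_lt_top.ne) h1
  rw [ENNReal.toReal_mul, ENNReal.toReal_ofReal (pow_nonneg (T.h_nonneg i) _)] at h3
  change (T.surf j Set.univ).toReal ≤ _
  nlinarith [pow_nonneg (T.h_nonneg i) (d - 1)]

/-- An element lies in the ball of radius `h` around the centre of its inscribed ball of radius `h /
σ`, so inverse inequalities between concentric balls with ratio `σ` transfer to it. The other bounds
come from elements and faces having diameter at most `h`, and from a packing argument in `Ω`. -/
theorem exists_bounds (hd : 0 < d) (hΩ : IsPolyhedralDomain Ω) {σ : ℝ} (hσ : 0 < σ) (k : ℕ) :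
    ∃ C, ∀ T : Mesh Ω, T.IsShapeRegular σ → T.Bounds k C := by
  obtain ⟨C₁, hC₁, hsurf⟩ := exists_surf_le d
  set κ := (volume (Metric.ball (0 : Space d) 1)).toReal with hκ
  have hκpos : 0 < κ := ENNReal.toReal_pos (Metric.measure_ball_pos _ _ zero_lt_one).ne'
    measure_ball_lt_top.ne
  obtain ⟨C₂, hC₂, hinv⟩ := exists_sq_le_integral_ball (d := d) k σ
  -- The sixth power of `p` is the square of `p ^ 3`, whence the degree `3 * k`.
  obtain ⟨C₃, hC₃, hinv3⟩ := exists_sq_le_integral_ball (d := d) (3 * k) σ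
  set V := (volume Ω).toReal with hV
  have hV0 : 0 ≤ V := ENNReal.toReal_nonneg
  set C := 1 + Metric.diam Ω + κ + C₁ + σ + V * σ ^ d / κ + C₂ * σ ^ d + C₃ * σ ^ d with hC
  have hdiam : 0 ≤ Metric.diam Ω := Metric.diam_nonneg
  have p1 : 0 ≤ V * σ ^ d / κ := by positivity
  have p2 : 0 ≤ C₂ * σ ^ d := by positivity
  have p3 : 0 ≤ C₃ * σ ^ d := by positivity
  refine ⟨C, fun T hT => ?_⟩
  have hpos := T.h_pos hd
  -- inverse inequality for any degree
  have hgen : ∀ (m : ℕ) (c : ℝ), 0 < c → (∀ p : Poly d, p.totalDegree ≤ m →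
      ∀ (x₀ : Space d) (ρ : ℝ), 0 < ρ → ∀ y ∈ Metric.closedBall x₀ (σ * ρ),
      ρ ^ d * evalAt p y ^ 2 ≤ c * ∫ x in Metric.ball x₀ ρ, evalAt p x ^ 2) →
      ∀ i (p : Poly d), p.totalDegree ≤ m → ∀ y ∈ closure (T.elem i),
      T.h i ^ d * evalAt p y ^ 2 ≤ c * σ ^ d * ∫ x, evalAt p x ^ 2 ∂(T.vol i) := by
    intro m c hc hm i p hp y hy
    obtain ⟨x, hx⟩ := (hT i).1
    have hρ : 0 < T.h i / σ := div_pos (hpos i) hσ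
    have hxi : x ∈ T.elem i := hx (Metric.mem_ball_self hρ)
    have h1 := hm p hp x (T.h i / σ) hρ y (by
      rw [mul_div_cancel₀ _ hσ.ne']
      exact T.dist_le_h hy (subset_closure hxi))
    have h2 : ∫ x in Metric.ball x (T.h i / σ), evalAt p x ^ 2 ≤ ∫ x, evalAt p x ^ 2 ∂(T.vol i) :=
      setIntegral_mono_set (T.integrable_of_continuous ((continuous_evalAt p).pow 2))
        (ae_of_all _ fun x => sq_nonneg _) (Eventually.of_forall hx)
    rw [div_pow, div_mul_eq_mul_div, div_le_iff₀ (by positivity)] at h1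
    calc _ ≤ _ := h1
      _ = c * σ ^ d * ∫ x in Metric.ball x (T.h i / σ), evalAt p x ^ 2 := by ring
      _ ≤ _ := by gcongr
  refine ⟨by linarith, fun i => ?_, fun i => ?_, fun i j hj => ?_, fun i => ?_, ?_,
    fun i p hp => ?_, fun i p hp => ?_⟩
  · have : T.h i ≤ Metric.diam Ω := Metric.diam_mono (T.elem_subset hΩ i) hΩ.isBounded
    linarith
  · obtain ⟨x, hx⟩ := T.elem_nonempty i
    have h1 : T.vol i Set.univ ≤ volume (Metric.closedBall x (T.h i)) := by
      rw [vol, Measure.restrict_apply_univ]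
      exact measure_mono fun y hy => T.dist_le_h (subset_closure hy) (subset_closure hx)
    rw [Measure.addHaar_closedBall _ _ (T.h_nonneg i), finrank_euclideanSpace_fin] at h1
    have h3 := ENNReal.toReal_mono (ENNReal.mul_ne_top ENNReal.ofReal_ne_top
      measure_ball_lt_top.ne) h1
    rw [ENNReal.toReal_mul, ENNReal.toReal_ofReal (pow_nonneg (T.h_nonneg i) _)] at h3
    change (T.vol i Set.univ).toReal ≤ _
    refine h3.trans ?_
    rw [mul_comm]
    exact mul_le_mul_of_nonneg_right (by linarith) (pow_nonneg (T.h_nonneg i) _)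
  · refine (hsurf T i j hj).trans ?_
    exact mul_le_mul_of_nonneg_right (by linarith) (pow_nonneg (T.h_nonneg i) _)
  · have := (hT i).2
    linarith
  -- Each element has at least the volume of its inscribed ball, and the disjoint elements fit into
  -- `Ω`.
  · have h1 : ∀ i, T.h i ^ d * κ / σ ^ d ≤ volume.real (T.elem i) := by
      intro i
      obtain ⟨x, hx⟩ := (hT i).1
      have h2 := measureReal_mono hx (μ := volume) (T.elem_polyhedral i).isBounded.measure_lt_top.ne
      refine le_trans (le_of_eq ?_) h2
      rw [Measure.real, Measure.addHaar_ball_of_pos _ _ (div_pos (hpos i) hσ),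
        finrank_euclideanSpace_fin, ENNReal.toReal_mul, ENNReal.toReal_ofReal (by
          have := T.h_nonneg i; positivity), div_pow]
      ring
    have h2 : ∑ i, volume.real (T.elem i) ≤ V := by
      have h3 : ∑ i, volume (T.elem i) ≤ volume Ω := by
        rw [← measure_biUnion_finset (fun a _ b _ hab => T.elem_disjoint hab)
          (fun i _ => T.measurableSet_elem i)]
        exact measure_mono (Set.iUnion₂_subset fun i _ => T.elem_subset hΩ i)
      have h4 := ENNReal.toReal_mono hΩ.isBounded.measure_lt_top.ne h3
      rwa [ENNReal.toReal_sum fun i _ => (T.elem_polyhedral i).isBounded.measure_lt_top.ne] at h4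
    have h5 : ∑ i, T.h i ^ d ≤ V * σ ^ d / κ := by
      rw [le_div_iff₀ hκpos, Finset.sum_mul]
      have h6 := (Finset.sum_le_sum fun i (_ : i ∈ Finset.univ) => h1 i).trans h2
      rwa [← Finset.sum_div, div_le_iff₀ (by positivity)] at h6
    linarith
  · obtain ⟨y, hy, hyA⟩ := T.exists_supNorm_eq i p
    rw [hyA, sq_abs]
    refine (hgen k C₂ hC₂ hinv i p hp y hy).trans ?_
    exact mul_le_mul_of_nonneg_right (by linarith) (integral_nonneg fun x => sq_nonneg _)
  · obtain ⟨y, hy, hyA⟩ := T.exists_supNorm_eq i p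
    have h1 := hgen (3 * k) C₃ hC₃ hinv3 i (p ^ 3)
      ((MvPolynomial.totalDegree_pow _ _).trans (Nat.mul_le_mul_left 3 hp)) y hy
    simp only [evalAt_pow, ← pow_mul] at h1
    have h2 : |evalAt p y| ^ 6 = evalAt p y ^ 6 := by
      rw [Even.pow_abs (by decide)]
    rw [hyA, h2]
    refine h1.trans ?_
    exact mul_le_mul_of_nonneg_right (by linarith)
      (integral_nonneg fun x => Even.pow_nonneg (by decide) _)

end Mesh

end HDG

namespace HDG

/-! ### Green's formula in `H(div, K)` -/

namespace Mesh

variable {d : ℕ} {Ω : Set (Space d)} (T : Mesh Ω)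

theorem inner_polyL2_right {μ : Measure (Space d)} (h : CompactlyCarried μ) (τ : Lp ℝ 2 μ)
    (q : Poly d) : inner ℝ τ (polyL2 h q) = ∫ x, τ x * evalAt q x ∂μ := by
  rw [L2.inner_def]
  refine integral_congr_ae ?_
  filter_upwards [polyL2_coeFn h q] with x hx
  rw [hx]
  simp [mul_comm]

theorem inner_traceK_right {i : Fin T.nK} (τ : T.TraceL2 i) (q : Poly d) :
    inner ℝ τ (T.traceK i q) = ∑ j : T.faces i, ∫ x, τ j x * evalAt q x ∂(T.surf j) := by
  rw [PiLp.inner_apply]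
  exact Finset.sum_congr rfl fun j _ => inner_polyL2_right _ _ _

theorem hdiv_green {i : Fin T.nK} (v : T.HDiv i) {φ : Space d → ℝ} (hφ : ContDiff ℝ ∞ φ) :
    ∫ x, inner ℝ (T.field i v x) (gradient φ x) ∂(T.vol i)
      + ∫ x, evalAt (T.dvg i v) x * φ x ∂(T.vol i)
      = ∑ j : T.faces i, ∫ x, T.ntr i v j x * φ x ∂(T.surf j) := v.2 φ hφ

theorem inner_vecK_right {i : Fin T.nK} (g : Lp (Space d) 2 (T.vol i)) (v : Fin d → Poly d) :
    inner ℝ g (T.vecK i v) = ∫ x, inner ℝ (g x) (vecAt v x) ∂(T.vol i) := by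
  rw [L2.inner_def]
  refine integral_congr_ae ?_
  filter_upwards [vecL2_coeFn (T.carried_vol i) v] with x hx
  change inner ℝ (g x) (vecL2 (T.carried_vol i) v x) = _
  rw [hx]

/-- Green's formula for a field in `H(div, K)` and a polynomial. -/
theorem green {i : Fin T.nK} (v : T.HDiv i) (w : Poly d) :
    inner ℝ (T.field i v) (T.vecK i (grad w)) + inner ℝ (T.polyK i (T.dvg i v)) (T.polyK i w)
      = inner ℝ (T.ntr i v) (T.traceK i w) := by
  rw [inner_traceK_right, inner_polyK, inner_vecK_right, ← T.hdiv_green v (contDiff_evalAt w)]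
  simp_rw [gradient_evalAt]

/-- The outward normal component on `∂K` of a polynomial vector field. -/
noncomputable def normalTrace (i : Fin T.nK) (v : Fin d → Poly d) : T.TraceL2 i :=
  ∑ r, T.mulNormal i r (T.traceK i (v r))

theorem normalTrace_ae {i : Fin T.nK} (v : Fin d → Poly d) (j : T.faces i) :
    ∀ᵐ x ∂(T.surf j), T.normalTrace i v j x = ∑ r, T.normal i j r * evalAt (v r) x := by
  have h1 : T.normalTrace i v j = ∑ r, T.normal i j r • polyL2 (T.carried_surf j) (v r) := by
    simp only [normalTrace, WithLp.ofLp_sum, Finset.sum_apply]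
    rfl
  have h2 : T.normalTrace i v j
      = polyL2 (T.carried_surf j) (∑ r, T.normal i j r • v r) := by
    rw [h1, map_sum]; simp
  rw [h2]
  filter_upwards [polyL2_coeFn (T.carried_surf j) (∑ r, T.normal i j r • v r)] with x hx
  rw [hx]; simp

/-- The divergence theorem for a polynomial vector field and a smooth function. -/
theorem vecAt_green (i : Fin T.nK) (v : Fin d → Poly d) {φ : Space d → ℝ}
    (hφ : ContDiff ℝ ∞ φ) :
    ∫ x, inner ℝ (vecAt v x) (gradient φ x) ∂(T.vol i) + ∫ x, evalAt (divP v) x * φ x ∂(T.vol i)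
      = ∑ j : T.faces i, ∫ x, (∑ r, T.normal i j r * evalAt (v r) x) * φ x ∂(T.surf j) := by
  have hφ1 : ContDiff ℝ 1 φ := hφ.of_le (by exact_mod_cast le_top)
  have hφd : Differentiable ℝ φ := hφ1.differentiable one_ne_zero
  have hgc : Continuous (gradient φ) :=
    (InnerProductSpace.toDual ℝ (Space d)).symm.continuous.comp
      (hφ1.continuous_fderiv one_ne_zero)
  have hr : ∀ r x, fderiv ℝ (fun x => evalAt (v r) x * φ x) x (EuclideanSpace.single r 1)
      = evalAt (v r) x * gradient φ x r + evalAt (MvPolynomial.pderiv r (v r)) x * φ x := by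
    intro r x
    rw [fderiv_fun_mul ((contDiff_evalAt (v r)).differentiable one_ne_zero x) (hφd x)]
    simp only [add_apply, smul_apply, fderiv_evalAt_single, smul_eq_mul]
    have : fderiv ℝ φ x (EuclideanSpace.single r 1) = gradient φ x r := by
      have h1 := (hasGradientAt_iff_hasFDerivAt.1 (hφd x).hasGradientAt).fderiv
      rw [h1, InnerProductSpace.toDual_apply_apply, EuclideanSpace.inner_single_right]
      simp
    rw [this]; ring
  have h1 : ∀ r, ∫ x, (evalAt (v r) x * gradient φ x r
      + evalAt (MvPolynomial.pderiv r (v r)) x * φ x) ∂(T.vol i)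
      = ∑ j : T.faces i, T.normal i j r * ∫ x, evalAt (v r) x * φ x ∂(T.surf j) := by
    intro r
    simp_rw [← hr]
    rw [T.integral_fderiv_eq i _ ((contDiff_evalAt (v r)).mul hφ1)]
    refine Finset.sum_congr rfl fun j _ => ?_
    rw [EuclideanSpace.inner_single_right]; simp
  rw [← integral_add]
  · have h2 : ∀ x, inner ℝ (vecAt v x) (gradient φ x) + evalAt (divP v) x * φ x
        = ∑ r, (evalAt (v r) x * gradient φ x r
          + evalAt (MvPolynomial.pderiv r (v r)) x * φ x) := by
      intro x
      rw [inner_vecAt, divP, evalAt_sum, Finset.sum_mul, Finset.sum_add_distrib]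
    simp_rw [h2]
    rw [integral_finsetSum]
    · simp_rw [h1]
      rw [Finset.sum_comm]
      refine Finset.sum_congr rfl fun j _ => ?_
      simp_rw [Finset.sum_mul]
      rw [integral_finsetSum]
      · refine Finset.sum_congr rfl fun r _ => ?_
        rw [← integral_const_mul]
        simp_rw [mul_assoc]
      · intro r _
        exact T.integrable_surf_of_continuous
          (((continuous_evalAt _).const_mul _).mul hφ.continuous)
    · intro r _
      refine T.integrable_of_continuous ?_
      have := continuous_evalAt (v r)
      have := continuous_evalAt (MvPolynomial.pderiv r (v r))
      have := hφ.continuous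
      have : Continuous fun x => gradient φ x r := by fun_prop
      fun_prop
  · exact T.integrable_of_continuous ((continuous_vecAt v).inner hgc)
  · exact T.integrable_of_continuous ((continuous_evalAt _).mul hφ.continuous)

/-- A polynomial vector field as an element of `H(div, K)`. -/
noncomputable def polyHDiv (i : Fin T.nK) (v : Fin d → Poly d) : T.HDiv i :=
  ⟨(T.vecK i v, divP v, T.normalTrace i v), by
    intro φ hφ
    have h := T.vecAt_green i v hφ
    have h1 : ∫ x, inner ℝ (T.vecK i v x) (gradient φ x) ∂(T.vol i)
        = ∫ x, inner ℝ (vecAt v x) (gradient φ x) ∂(T.vol i) := by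
      refine integral_congr_ae ?_
      filter_upwards [vecL2_coeFn (T.carried_vol i) v] with x hx
      change inner ℝ (vecL2 (T.carried_vol i) v x) _ = _
      rw [hx]
    have h2 : ∀ j : T.faces i, ∫ x, T.normalTrace i v j x * φ x ∂(T.surf j)
        = ∫ x, (∑ r, T.normal i j r * evalAt (v r) x) * φ x ∂(T.surf j) := by
      intro j
      refine integral_congr_ae ?_
      filter_upwards [T.normalTrace_ae v j] with x hx
      rw [hx]
    simp only [h1, h2]
    exact h⟩

/-- The field determines its weak divergence and its normal trace. -/
theorem field_injective (i : Fin T.nK) : Function.Injective (T.field i) := by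
  rw [injective_iff_map_eq_zero]
  intro v hv
  have hz : ∀ φ : Space d → ℝ, ContDiff ℝ ∞ φ → ∫ x, evalAt (T.dvg i v) x * φ x ∂(T.vol i)
      = ∑ j : T.faces i, ∫ x, T.ntr i v j x * φ x ∂(T.surf j) := by
    intro φ hφ
    rw [← T.hdiv_green v hφ, hv, right_eq_add]
    refine integral_eq_zero_of_ae ?_
    filter_upwards [Lp.coeFn_zero (Space d) 2 (T.vol i)] with x hx
    rw [hx]; simp
  have hopen := (T.elem_polyhedral i).isOpen
  -- Test functions supported inside the element do not see the boundary terms.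
  have hdiv : T.dvg i v = 0 := by
    refine poly_eq_zero_of_ae_eq_zero hopen (T.elem_nonempty i) ?_
    have h1 := hopen.ae_eq_zero_of_integral_contDiff_smul_eq_zero (μ := volume)
      (f := evalAt (T.dvg i v)) ((continuous_evalAt _).locallyIntegrable.locallyIntegrableOn _) ?_
    · exact (ae_restrict_iff' hopen.measurableSet).2 h1
    · intro g hg hgc hgs
      have h2 := hz g hg
      have h3 : ∀ j : T.faces i, ∫ x, T.ntr i v j x * g x ∂(T.surf j) = 0 := by
        intro j
        refine integral_eq_zero_of_ae ?_
        filter_upwards [ae_restrict_mem (T.measurableSet_face j)] with x hx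
        have hxf : x ∈ frontier (T.elem i) := by
          rw [T.frontier_elem i]; exact Set.mem_biUnion j.2 hx
        have : x ∉ tsupport g := fun h => by
          have := hgs h
          rw [hopen.frontier_eq] at hxf
          exact hxf.2 this
        simp [image_eq_zero_of_notMem_tsupport this]
      rw [Finset.sum_eq_zero fun j _ => h3 j] at h2
      rw [← h2]
      refine Eq.trans ?_ (setIntegral_eq_integral_of_forall_compl_eq_zero ?_).symm
      · exact integral_congr_ae (ae_of_all _ fun x => by simp [mul_comm])
      · intro x hx
        have : x ∉ tsupport g := fun h => hx (hgs h)
        simp [image_eq_zero_of_notMem_tsupport this]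
  -- Test functions supported away from all other faces isolate the trace on `j`; almost every point
  -- of `j` lies in the open set where they are available.
  have hntr : T.ntr i v = 0 := by
    ext1 j
    refine Lp.ext ?_
    have hU : IsOpen (⋃ k ∈ {k | k ≠ (j : Fin T.nF)}, T.face k)ᶜ :=
      ((Set.toFinite _).isClosed_biUnion fun k _ =>
        (T.face_flat k).isCompact.isClosed).isOpen_compl
    have h1 := hU.ae_eq_zero_of_integral_contDiff_smul_eq_zero (μ := T.surf j)
      (f := T.ntr i v j) ?_ ?_
    · filter_upwards [h1, T.ae_surf_notMem j, Lp.coeFn_zero ℝ 2 (T.surf j)] with x hx hx' h0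
      change (T.ntr i v j) x = (0 : Lp ℝ 2 (T.surf j)) x
      rw [h0]
      refine hx ?_
      simpa using hx'.2
    · exact ((Lp.memLp (T.ntr i v j)).integrable one_le_two).locallyIntegrable.locallyIntegrableOn _
    · intro g hg hgc hgs
      have h2 := hz g hg
      rw [hdiv] at h2
      simp only [evalAt_zero, zero_mul, integral_zero] at h2
      rw [Finset.sum_eq_single j] at h2
      · rw [h2]
        exact integral_congr_ae (ae_of_all _ fun x => by simp [mul_comm])
      · intro k _ hk
        refine integral_eq_zero_of_ae ?_
        filter_upwards [ae_restrict_mem (T.measurableSet_face k)] with x hx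
        have : x ∉ tsupport g := fun h => by
          refine hgs h (Set.mem_biUnion (x := (k : Fin T.nF)) ?_ hx)
          exact fun h => hk (Subtype.ext h)
        simp [image_eq_zero_of_notMem_tsupport this]
      · simp
  refine Subtype.ext (Prod.ext hv (Prod.ext hdiv hntr))

@[simp] theorem field_polyHDiv (i : Fin T.nK) (v : Fin d → Poly d) :
    T.field i (T.polyHDiv i v) = T.vecK i v := rfl

@[simp] theorem dvg_polyHDiv (i : Fin T.nK) (v : Fin d → Poly d) :
    T.dvg i (T.polyHDiv i v) = divP v := rfl

@[simp] theorem ntr_polyHDiv (i : Fin T.nK) (v : Fin d → Poly d) :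
    T.ntr i (T.polyHDiv i v) = T.normalTrace i v := rfl

/-- The M-decomposition only provides some element of `V` with field `∇w`. This identifies its
divergence and normal trace with the classical ones. -/
theorem eq_polyHDiv {i : Fin T.nK} {v : T.HDiv i} {w : Fin d → Poly d}
    (h : T.field i v = T.vecK i w) : v = T.polyHDiv i w := T.field_injective i h

theorem inner_mulNormal (i : Fin T.nK) (r : Fin d) (τ τ' : T.TraceL2 i) :
    inner ℝ (T.mulNormal i r τ) τ' = inner ℝ τ (T.mulNormal i r τ') := by
  simp only [PiLp.inner_apply, mulNormal]
  refine Finset.sum_congr rfl fun j _ => ?_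
  rw [real_inner_smul_left, real_inner_smul_right]

theorem abs_normal_apply_le {i : Fin T.nK} (j : T.faces i) (r : Fin d) :
    |T.normal i j r| ≤ 1 := by
  rw [← T.norm_normal i j]
  exact PiLp.norm_apply_le (T.normal i j) r

theorem norm_mulNormal_le (i : Fin T.nK) (r : Fin d) (τ : T.TraceL2 i) :
    ‖T.mulNormal i r τ‖ ≤ ‖τ‖ := by
  refine le_of_sq_le_sq ?_ (norm_nonneg _)
  rw [norm_sq_traceL2, norm_sq_traceL2]
  refine Finset.sum_le_sum fun j _ => ?_
  change ‖T.normal i j r • τ j‖ ^ 2 ≤ _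
  rw [norm_smul, mul_pow]
  have : ‖T.normal i j r‖ ≤ 1 := T.abs_normal_apply_le j r
  exact mul_le_of_le_one_left (sq_nonneg _) (pow_le_one₀ (norm_nonneg _) this)

/-- The divergence theorem for polynomials. -/
theorem green_poly (i : Fin T.nK) (v : Fin d → Poly d) (p : Poly d) :
    inner ℝ (T.polyK i p) (T.polyK i (divP v)) + inner ℝ (T.vecK i v) (T.vecK i (grad p))
      = ∑ r, inner ℝ (T.mulNormal i r (T.traceK i p)) (T.traceK i (v r)) := by
  have h := T.green (T.polyHDiv i v) p
  rw [field_polyHDiv, dvg_polyHDiv, ntr_polyHDiv, normalTrace, sum_inner] at h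
  rw [real_inner_comm, add_comm, h]
  refine Finset.sum_congr rfl fun r _ => ?_
  rw [real_inner_comm, inner_mulNormal]

end Mesh

end HDG

namespace HDG

/-! ### A Sobolev inequality for piecewise polynomial functions -/

open scoped Convolution NNReal

namespace Mesh

variable {d : ℕ} {Ω : Set (Space d)} (T : Mesh Ω)

/-- Single valued face contributions that vanish on the boundary cancel. -/
theorem sum_normal_mul_eq_zero (hΩ : IsPolyhedralDomain Ω) (e : Space d) {c : Fin T.nF → ℝ}
    (hc : ∀ j, T.face j ⊆ frontier Ω → c j = 0) :
    ∑ i, ∑ j : T.faces i, inner ℝ (T.normal i j) e * c j = 0 := by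
  -- Extending the inner sum to all faces allows the order of summation to be exchanged; each
  -- interior face then collects the normals of its two sides.
  have h1 : ∀ i, ∑ j : T.faces i, inner ℝ (T.normal i j) e * c j
      = ∑ j, inner ℝ (if h : j ∈ T.faces i then T.normal i ⟨j, h⟩ else 0) e * c j := by
    intro i
    symm
    rw [← Finset.sum_subset (Finset.subset_univ (T.faces i))]
    · rw [← Finset.sum_coe_sort]
      refine Finset.sum_congr rfl fun j _ => ?_
      rw [dif_pos j.2]
    · intro j _ hj
      rw [dif_neg hj, inner_zero_left, zero_mul]
  simp_rw [h1]
  rw [Finset.sum_comm]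
  refine Finset.sum_eq_zero fun j _ => ?_
  rw [← Finset.sum_mul, ← sum_inner]
  by_cases hj : T.face j ⊆ frontier Ω
  · rw [hc j hj, mul_zero]
  · rw [T.sum_normal_eq_zero hΩ hj, inner_zero_left, zero_mul]

/-- The function on `Ω` that is given by the polynomial `q i` on the element `i`. -/
noncomputable def piecewisePoly (q : Fin T.nK → Poly d) (x : Space d) : ℝ :=
  ∑ i, (T.elem i).indicator (evalAt (q i)) x

theorem piecewisePoly_of_mem (q : Fin T.nK → Poly d) {i : Fin T.nK} {x : Space d}
    (hx : x ∈ T.elem i) : T.piecewisePoly q x = evalAt (q i) x := by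
  rw [piecewisePoly, Finset.sum_eq_single i]
  · exact Set.indicator_of_mem hx _
  · intro i' _ hi'
    exact Set.indicator_of_notMem (fun h => Set.disjoint_left.1 (T.elem_disjoint hi') h hx) _
  · simp

theorem integrable_piecewisePoly (q : Fin T.nK → Poly d) : Integrable (T.piecewisePoly q) := by
  refine integrable_finsetSum _ fun i _ => ?_
  rw [integrable_indicator_iff (T.measurableSet_elem i)]
  exact T.integrable_of_continuous (continuous_evalAt _)

theorem support_piecewisePoly (hΩ : IsPolyhedralDomain Ω) (q : Fin T.nK → Poly d) :
    Function.support (T.piecewisePoly q) ⊆ Ω := by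
  intro x hx
  by_contra hxΩ
  refine hx (Finset.sum_eq_zero fun i _ => Set.indicator_of_notMem (fun h => hxΩ ?_) _)
  exact T.elem_subset hΩ i h

/-- The derivative of a mollified piecewise polynomial function in terms of the derivatives on the
elements and of the jumps. -/
theorem fderiv_convolution_piecewisePoly (hΩ : IsPolyhedralDomain Ω) (q : Fin T.nK → Poly d)
    {ρ : Space d → ℝ} (hρ : ContDiff ℝ 1 ρ) (hρc : HasCompactSupport ρ)
    {c : Fin T.nF → Space d → ℝ} (hci : ∀ j, Integrable (c j) (T.surf j))
    (x e : Space d) (hc : ∀ j, T.face j ⊆ frontier Ω → ∫ y, c j y * ρ (x - y) ∂(T.surf j) = 0) :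
    fderiv ℝ (T.piecewisePoly q ⋆[ContinuousLinearMap.lsmul ℝ ℝ, volume] ρ) x e
      = ∑ i, (∫ y, fderiv ℝ (evalAt (q i)) y e * ρ (x - y) ∂(T.vol i)
        - ∑ j : T.faces i, inner ℝ (T.normal i j) e *
            ∫ y, (evalAt (q i) y - c j y) * ρ (x - y) ∂(T.surf j)) := by
  have hloc : LocallyIntegrable (T.piecewisePoly q) :=
    (T.integrable_piecewisePoly q).locallyIntegrable
  have hρd : Continuous (fderiv ℝ ρ) := hρ.continuous_fderiv one_ne_zero
  have hρcont := hρ.continuous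
  -- The derivative is put on the mollifier, since the piecewise polynomial jumps. The divergence
  -- theorem brings it back, element by element.
  rw [(hρc.hasFDerivAt_convolution_right (ContinuousLinearMap.lsmul ℝ ℝ) hloc hρ x).fderiv,
    convolution_def]
  have hint := (hρc.fderiv ℝ).convolutionExists_right
    ((ContinuousLinearMap.lsmul ℝ ℝ).precompR (Space d)) hloc hρd x
  rw [ContinuousLinearMap.integral_apply hint]
  have h1 : ∀ y, ((((ContinuousLinearMap.lsmul ℝ ℝ).precompR (Space d)) (T.piecewisePoly q y))
      (fderiv ℝ ρ (x - y))) e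
      = ∑ i, (T.elem i).indicator (fun y => evalAt (q i) y * fderiv ℝ ρ (x - y) e) y := by
    intro y
    change T.piecewisePoly q y * fderiv ℝ ρ (x - y) e = _
    rw [piecewisePoly, Finset.sum_mul]
    refine Finset.sum_congr rfl fun i _ => ?_
    by_cases hy : y ∈ T.elem i <;> simp [hy]
  simp_rw [h1]
  have hρy : ∀ y, HasFDerivAt (fun y => ρ (x - y)) (-(fderiv ℝ ρ (x - y))) y := by
    intro y
    have h2 := (hρ.differentiable one_ne_zero (x - y)).hasFDerivAt.comp y
      ((hasFDerivAt_const x y).sub (hasFDerivAt_id y))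
    refine h2.congr_fderiv ?_
    ext v; simp
  have hρC : ContDiff ℝ 1 fun y => ρ (x - y) := hρ.comp (contDiff_const.sub contDiff_id)
  have hcont1 : ∀ i, Continuous fun y => evalAt (q i) y * fderiv ℝ ρ (x - y) e := by
    intro i
    have := continuous_evalAt (q i)
    fun_prop
  have hcont2 : ∀ i, Continuous fun y => fderiv ℝ (evalAt (q i)) y e * ρ (x - y) := by
    intro i
    have := (contDiff_evalAt (q i) (n := 1)).continuous_fderiv one_ne_zero
    fun_prop
  rw [integral_finsetSum]
  swap
  · intro i _
    rw [integrable_indicator_iff (T.measurableSet_elem i)]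
    exact T.integrable_of_continuous (hcont1 i)
  -- The divergence theorem for the product of `q i` and `ρ (x - ·)`, whose second factor has
  -- derivative `-fderiv ℝ ρ (x - ·)`.
  have h3 : ∀ i, ∫ y, (T.elem i).indicator (fun y => evalAt (q i) y * fderiv ℝ ρ (x - y) e) y
      = ∫ y, fderiv ℝ (evalAt (q i)) y e * ρ (x - y) ∂(T.vol i)
        - ∑ j : T.faces i, inner ℝ (T.normal i j) e *
            ∫ y, evalAt (q i) y * ρ (x - y) ∂(T.surf j) := by
    intro i
    rw [integral_indicator (T.measurableSet_elem i),
      ← T.integral_fderiv_eq i e ((contDiff_evalAt (q i)).mul hρC),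
      ← integral_sub (T.integrable_of_continuous (i := i) (hcont2 i))]
    · refine integral_congr_ae (ae_of_all _ fun y => ?_)
      have := (((contDiff_evalAt (q i) (n := 1)).differentiable one_ne_zero y).hasFDerivAt.mul
        (hρy y)).fderiv
      change _ = _ - fderiv ℝ (evalAt (q i) * fun y => ρ (x - y)) y e
      rw [this]
      simp only [add_apply, smul_apply, neg_apply, smul_eq_mul]
      ring
    · exact T.integrable_of_continuous (i := i)
        ((((contDiff_evalAt (q i)).mul hρC).continuous_fderiv one_ne_zero).clm_apply
          continuous_const)
  simp_rw [h3]
  -- The single-valued `c` contributes zero in total, because the two sides of an interior face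
  -- cancel and boundary faces contribute nothing. Subtracting it turns boundary values into jumps.
  have h4 := T.sum_normal_mul_eq_zero hΩ e hc
  have h5 : ∀ i, ∑ j : T.faces i, inner ℝ (T.normal i j) e *
      ∫ y, (evalAt (q i) y - c j y) * ρ (x - y) ∂(T.surf j)
      = ∑ j : T.faces i, inner ℝ (T.normal i j) e * ∫ y, evalAt (q i) y * ρ (x - y) ∂(T.surf j)
        - ∑ j : T.faces i, inner ℝ (T.normal i j) e * ∫ y, c j y * ρ (x - y) ∂(T.surf j) := by
    intro i
    rw [← Finset.sum_sub_distrib]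
    refine Finset.sum_congr rfl fun j _ => ?_
    rw [← mul_sub, ← integral_sub]
    · simp_rw [sub_mul]
    · exact T.integrable_surf_of_continuous ((continuous_evalAt _).mul hρC.continuous)
    · obtain ⟨B, hB⟩ := hρc.exists_bound_of_continuous hρcont
      exact (hci j).mul_bdd hρC.continuous.aestronglyMeasurable (c := B)
        (ae_of_all _ fun y => hB _)
  simp_rw [h5]
  simp only [Finset.sum_sub_distrib] at h4 ⊢
  rw [h4]; ring

/-- Tonelli and translation invariance. The measure `μ` is arbitrary because the estimate is needed
for volume on elements and for surface measure on faces. -/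
theorem lintegral_ofReal_convolution_le {μ : Measure (Space d)} [SFinite μ] {f ρ : Space d → ℝ}
    (hf : AEMeasurable f μ) (hρ : Measurable ρ) :
    ∫⁻ x, ENNReal.ofReal (∫ y, f y * ρ (x - y) ∂μ)
      ≤ (∫⁻ y, ‖f y‖ₑ ∂μ) * ∫⁻ x, ‖ρ x‖ₑ := by
  calc ∫⁻ x, ENNReal.ofReal (∫ y, f y * ρ (x - y) ∂μ)
      ≤ ∫⁻ x, (∫⁻ y, ‖f y‖ₑ * ‖ρ (x - y)‖ₑ ∂μ) := by
        refine lintegral_mono fun x => (Real.ofReal_le_enorm _).trans ?_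
        refine (enorm_integral_le_lintegral_enorm _).trans (le_of_eq ?_)
        exact lintegral_congr fun y => enorm_mul _ _
    _ = ∫⁻ y, (∫⁻ x, ‖f y‖ₑ * ‖ρ (x - y)‖ₑ) ∂μ := by
        rw [lintegral_lintegral_swap]
        have h1 : AEMeasurable (fun z : Space d × Space d => f z.2) (volume.prod μ) := hf.comp_snd
        have h2 : Measurable fun z : Space d × Space d => ρ (z.1 - z.2) :=
          hρ.comp (measurable_fst.sub measurable_snd)
        exact h1.enorm.mul h2.enorm.aemeasurable
    _ = ∫⁻ y, ‖f y‖ₑ * (∫⁻ x, ‖ρ x‖ₑ) ∂μ := by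
        refine lintegral_congr fun y => ?_
        rw [lintegral_const_mul _ (by fun_prop : Measurable fun x => ‖ρ (x - y)‖ₑ),
          lintegral_sub_right_eq_self (fun x => ‖ρ x‖ₑ) y]
    _ = (∫⁻ y, ‖f y‖ₑ ∂μ) * ∫⁻ x, ‖ρ x‖ₑ := lintegral_mul_const'' _ hf.enorm

/-- The total variation of a piecewise polynomial function, with the jumps measured against the
face functions `c`. -/
noncomputable def variation (q : Fin T.nK → Poly d) (c : Fin T.nF → Space d → ℝ) : ℝ :=
  ∑ i, (∫ y, ‖fderiv ℝ (evalAt (q i)) y‖ ∂(T.vol i)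
    + ∑ j : T.faces i, ∫ y, |evalAt (q i) y - c j y| ∂(T.surf j))

/-- The derivative of the mollified function is dominated by the mollification of the variation
measure, which has a volume part and a jump part; mollification with a kernel of mass one preserves
total mass. -/
theorem lintegral_fderiv_convolution_le (hΩ : IsPolyhedralDomain Ω) (q : Fin T.nK → Poly d)
    {ρ : Space d → ℝ} (hρ : ContDiff ℝ 1 ρ) (hρc : HasCompactSupport ρ) (hρ0 : ∀ x, 0 ≤ ρ x)
    (hρ1 : ∫ x, ρ x = 1) {c : Fin T.nF → Space d → ℝ} (hci : ∀ j, Integrable (c j) (T.surf j))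
    (hc : ∀ j, T.face j ⊆ frontier Ω → ∀ᵐ y ∂(T.surf j), c j y = 0) :
    ∫⁻ x, ‖fderiv ℝ (T.piecewisePoly q ⋆[ContinuousLinearMap.lsmul ℝ ℝ, volume] ρ) x‖ₑ
      ≤ ENNReal.ofReal (T.variation q c) := by
  have hρcont := hρ.continuous
  obtain ⟨B, hB⟩ := hρc.exists_bound_of_continuous hρcont
  have hqd : ∀ i, Continuous (fderiv ℝ (evalAt (q i))) := fun i =>
    (contDiff_evalAt (q i) (n := 1)).continuous_fderiv one_ne_zero
  have hji : ∀ i (j : T.faces i), Integrable (fun y => evalAt (q i) y - c j y) (T.surf j) :=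
    fun i j => (T.integrable_surf_of_continuous (continuous_evalAt _)).sub (hci j)
  have hmass : ∫⁻ x, ‖ρ x‖ₑ = 1 := by
    have h1 := ofReal_integral_eq_lintegral_ofReal (μ := volume) (hρcont.integrable_of_hasCompactSupport hρc)
      (ae_of_all _ hρ0)
    rw [hρ1, ENNReal.ofReal_one] at h1
    rw [h1]
    exact lintegral_congr fun x => Real.enorm_eq_ofReal (hρ0 x)
  -- The density of the mollified variation measure.
  let G : Space d → ℝ := fun x =>
    ∑ i, (∫ y, ‖fderiv ℝ (evalAt (q i)) y‖ * ρ (x - y) ∂(T.vol i)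
      + ∑ j : T.faces i, ∫ y, |evalAt (q i) y - c j y| * ρ (x - y) ∂(T.surf j))
  have hG : ∀ x, ‖fderiv ℝ (T.piecewisePoly q ⋆[ContinuousLinearMap.lsmul ℝ ℝ, volume] ρ) x‖
      ≤ G x := by
    intro x
    have hρx : Continuous fun y => ρ (x - y) := by fun_prop
    have hn1 : ∀ i, 0 ≤ ∫ y, ‖fderiv ℝ (evalAt (q i)) y‖ * ρ (x - y) ∂(T.vol i) := fun i =>
      integral_nonneg fun y => mul_nonneg (norm_nonneg _) (hρ0 _)
    have hn2 : ∀ i (j : T.faces i), 0 ≤ ∫ y, |evalAt (q i) y - c j y| * ρ (x - y) ∂(T.surf j) :=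
      fun i j => integral_nonneg fun y => mul_nonneg (abs_nonneg _) (hρ0 _)
    refine ContinuousLinearMap.opNorm_le_bound _ ?_ fun e => ?_
    · exact Finset.sum_nonneg fun i _ => add_nonneg (hn1 i) (Finset.sum_nonneg fun j _ => hn2 i j)
    rw [T.fderiv_convolution_piecewisePoly hΩ q hρ hρc hci x e]
    · rw [Finset.sum_mul]
      refine (norm_sum_le _ _).trans (Finset.sum_le_sum fun i _ => ?_)
      refine (norm_sub_le _ _).trans ?_
      rw [add_mul]
      gcongr
      · rw [← integral_mul_const]
        refine norm_integral_le_of_norm_le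
          (T.integrable_of_continuous (((hqd i).norm.mul hρx).mul continuous_const))
          (ae_of_all _ fun y => ?_)
        rw [norm_mul, Real.norm_of_nonneg (hρ0 (x - y))]
        calc _ ≤ ‖fderiv ℝ (evalAt (q i)) y‖ * ‖e‖ * ρ (x - y) := by
              gcongr
              · exact hρ0 _
              · exact ContinuousLinearMap.le_opNorm _ _
          _ = _ := by ring
      · rw [Finset.sum_mul]
        refine (norm_sum_le _ _).trans (Finset.sum_le_sum fun j _ => ?_)
        rw [norm_mul, mul_comm]
        have h1 : ‖∫ y, (evalAt (q i) y - c j y) * ρ (x - y) ∂(T.surf j)‖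
            ≤ ∫ y, |evalAt (q i) y - c j y| * ρ (x - y) ∂(T.surf j) := by
          refine norm_integral_le_of_norm_le ?_ (ae_of_all _ fun y => ?_)
          · exact (hji i j).abs.mul_bdd hρx.aestronglyMeasurable (c := B)
              (ae_of_all _ fun y => hB _)
          · rw [norm_mul, Real.norm_of_nonneg (hρ0 (x - y))]; rfl
        have h2 : ‖(inner ℝ (T.normal i j) e : ℝ)‖ ≤ ‖e‖ := by
          have := norm_inner_le_norm (𝕜 := ℝ) (T.normal i j) e
          rwa [T.norm_normal, one_mul] at this
        exact mul_le_mul h1 h2 (norm_nonneg _) (hn2 i j)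
    · intro j hj
      refine integral_eq_zero_of_ae ?_
      filter_upwards [hc j hj] with y hy
      simp [hy]
  have hqe : ∀ i, Continuous fun y => ‖fderiv ℝ (evalAt (q i)) y‖ := fun i => (hqd i).norm
  have hGm1 : ∀ i, Measurable fun x =>
      ENNReal.ofReal (∫ y, ‖fderiv ℝ (evalAt (q i)) y‖ * ρ (x - y) ∂(T.vol i)) := by
    intro i
    have : StronglyMeasurable fun z : Space d × Space d =>
        ‖fderiv ℝ (evalAt (q i)) z.2‖ * ρ (z.1 - z.2) := by
      have := hqe i
      exact (by fun_prop : Continuous _).stronglyMeasurable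
    exact this.integral_prod_right.measurable.ennreal_ofReal
  calc ∫⁻ x, ‖fderiv ℝ (T.piecewisePoly q ⋆[ContinuousLinearMap.lsmul ℝ ℝ, volume] ρ) x‖ₑ
      ≤ ∫⁻ x, ∑ i, (ENNReal.ofReal (∫ y, ‖fderiv ℝ (evalAt (q i)) y‖ * ρ (x - y) ∂(T.vol i))
        + ∑ j : T.faces i,
          ENNReal.ofReal (∫ y, |evalAt (q i) y - c j y| * ρ (x - y) ∂(T.surf j))) := by
        refine lintegral_mono fun x => ?_
        rw [← ofReal_norm]
        refine (ENNReal.ofReal_le_ofReal (hG x)).trans ?_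
        have hn1 : ∀ i, 0 ≤ ∫ y, ‖fderiv ℝ (evalAt (q i)) y‖ * ρ (x - y) ∂(T.vol i) := fun i =>
          integral_nonneg fun y => mul_nonneg (norm_nonneg _) (hρ0 _)
        have hn2 : ∀ i (j : T.faces i),
            0 ≤ ∫ y, |evalAt (q i) y - c j y| * ρ (x - y) ∂(T.surf j) :=
          fun i j => integral_nonneg fun y => mul_nonneg (abs_nonneg _) (hρ0 _)
        rw [ENNReal.ofReal_sum_of_nonneg fun i _ =>
          add_nonneg (hn1 i) (Finset.sum_nonneg fun j _ => hn2 i j)]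
        refine Finset.sum_le_sum fun i _ => ?_
        rw [ENNReal.ofReal_add (hn1 i) (Finset.sum_nonneg fun j _ => hn2 i j),
          ENNReal.ofReal_sum_of_nonneg fun j _ => hn2 i j]
    _ = ∑ i, ((∫⁻ x, ENNReal.ofReal (∫ y, ‖fderiv ℝ (evalAt (q i)) y‖ * ρ (x - y) ∂(T.vol i)))
        + ∑ j : T.faces i,
          ∫⁻ x, ENNReal.ofReal (∫ y, |evalAt (q i) y - c j y| * ρ (x - y) ∂(T.surf j))) := by
        have hGm2 : ∀ i (j : T.faces i), AEMeasurable fun x =>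
            ENNReal.ofReal (∫ y, |evalAt (q i) y - c j y| * ρ (x - y) ∂(T.surf j)) := by
          intro i j
          have h1 : AEStronglyMeasurable (fun z : Space d × Space d =>
              |evalAt (q i) z.2 - c j z.2| * ρ (z.1 - z.2)) (volume.prod (T.surf j)) := by
            refine AEStronglyMeasurable.mul ?_ ?_
            · exact ((hji i j).abs.aestronglyMeasurable.comp_snd)
            · exact (by fun_prop : Continuous fun z : Space d × Space d =>
                ρ (z.1 - z.2)).aestronglyMeasurable
          exact h1.integral_prod_right'.aemeasurable.ennreal_ofReal
        rw [lintegral_finsetSum']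
        · refine Finset.sum_congr rfl fun i _ => ?_
          rw [lintegral_add_left (hGm1 i), lintegral_finsetSum']
          exact fun j _ => hGm2 i j
        · intro i _
          exact (hGm1 i).aemeasurable.add (Finset.aemeasurable_fun_sum _ fun j _ => hGm2 i j)
    _ ≤ ∑ i, ((∫⁻ y, ‖‖fderiv ℝ (evalAt (q i)) y‖‖ₑ ∂(T.vol i))
        + ∑ j : T.faces i, ∫⁻ y, ‖|evalAt (q i) y - c j y|‖ₑ ∂(T.surf j)) := by
        refine Finset.sum_le_sum fun i _ => add_le_add ?_ (Finset.sum_le_sum fun j _ => ?_)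
        · have := lintegral_ofReal_convolution_le (μ := T.vol i) (hqe i).measurable.aemeasurable
            hρcont.measurable
          rwa [hmass, mul_one] at this
        · have := lintegral_ofReal_convolution_le (μ := T.surf j) (hji i j).abs.aemeasurable
            hρcont.measurable
          rwa [hmass, mul_one] at this
    _ = ENNReal.ofReal (T.variation q c) := by
        have hn1 : ∀ i, 0 ≤ ∫ y, ‖fderiv ℝ (evalAt (q i)) y‖ ∂(T.vol i) := fun i =>
          integral_nonneg fun y => norm_nonneg _
        have hn2 : ∀ i (j : T.faces i), 0 ≤ ∫ y, |evalAt (q i) y - c j y| ∂(T.surf j) :=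
          fun i j => integral_nonneg fun y => abs_nonneg _
        rw [variation, ENNReal.ofReal_sum_of_nonneg fun i _ =>
          add_nonneg (hn1 i) (Finset.sum_nonneg fun j _ => hn2 i j)]
        refine Finset.sum_congr rfl fun i _ => ?_
        rw [ENNReal.ofReal_add (hn1 i) (Finset.sum_nonneg fun j _ => hn2 i j),
          ENNReal.ofReal_sum_of_nonneg fun j _ => hn2 i j]
        congr 1
        · rw [ofReal_integral_eq_lintegral_ofReal (T.integrable_of_continuous (hqe i))
            (ae_of_all _ fun y => norm_nonneg _)]
          exact lintegral_congr fun y => Real.enorm_eq_ofReal (norm_nonneg _)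
        · refine Finset.sum_congr rfl fun j _ => ?_
          rw [ofReal_integral_eq_lintegral_ofReal (hji i j).abs (ae_of_all _ fun y => abs_nonneg _)]
          exact lintegral_congr fun y => Real.enorm_eq_ofReal (abs_nonneg _)

/-- A sequence of bump functions that shrink to the origin. -/
noncomputable def shrinkingBump (d : ℕ) (n : ℕ) : ContDiffBump (0 : Space d) :=
  ⟨1 / (2 * (n + 1)), 1 / (n + 1), by positivity, by
    apply one_div_lt_one_div_of_lt <;> linarith [n.cast_nonneg (α := ℝ)]⟩

theorem tendsto_shrinkingBump_rOut (d : ℕ) :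
    Tendsto (fun n => (shrinkingBump d n).rOut) atTop (𝓝 0) :=
  tendsto_one_div_add_atTop_nhds_zero_nat

/-- Lebesgue differentiation applies because the outer radius of each bump is twice its inner
radius, so the kernels do not become too concentrated. -/
theorem ae_tendsto_convolution_shrinkingBump {g : Space d → ℝ} (hg : LocallyIntegrable g) :
    ∀ᵐ x, Tendsto (fun n => (g ⋆[ContinuousLinearMap.lsmul ℝ ℝ, volume]
      (shrinkingBump d n).normed volume) x) atTop (𝓝 (g x)) := by
  have h := ContDiffBump.ae_convolution_tendsto_right_of_locallyIntegrable (K := 2) (μ := volume)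
    (φ := shrinkingBump d) (tendsto_shrinkingBump_rOut d) (Eventually.of_forall fun n => by
      change 1 / ((n : ℝ) + 1) ≤ 2 * (1 / (2 * (n + 1)))
      apply le_of_eq
      field_simp) hg
  filter_upwards [h] with x hx
  refine hx.congr fun n => ?_
  rw [convolution_lsmul_swap, convolution_def]
  exact integral_congr_ae (ae_of_all _ fun y => by simp [mul_comm])

/-- The Gagliardo–Nirenberg–Sobolev inequality for `W^{1,1}`, applied to mollifications that are all
supported in one ball. The exponent `3 / 2` is the critical `d / (d - 1)` for `d = 3` and
subcritical for `d = 2`, so one exponent serves both dimensions. -/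
theorem exists_eLpNorm_piecewisePoly_le (hd : d = 2 ∨ d = 3) (hΩ : IsPolyhedralDomain Ω) :
    ∃ C : ℝ≥0, ∀ (T : Mesh Ω) (q : Fin T.nK → Poly d) (c : Fin T.nF → Space d → ℝ),
      (∀ j, Integrable (c j) (T.surf j)) →
      (∀ j, T.face j ⊆ frontier Ω → ∀ᵐ y ∂(T.surf j), c j y = 0) →
      eLpNorm (T.piecewisePoly q) (3 / 2 : ℝ≥0) volume
        ≤ C * ENNReal.ofReal (T.variation q c) := by
  obtain ⟨R, hR⟩ := hΩ.isBounded.subset_ball 0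
  refine ⟨eLpNormLESNormFDerivOfLeConst ℝ (volume : Measure (Space d))
    (Metric.ball 0 (R + 1)) 1 (3 / 2), fun T q c hci hc => ?_⟩
  set ψ : ℕ → Space d → ℝ := fun n => T.piecewisePoly q ⋆[ContinuousLinearMap.lsmul ℝ ℝ, volume]
      (shrinkingBump d n).normed volume
  have hloc : LocallyIntegrable (T.piecewisePoly q) :=
    (T.integrable_piecewisePoly q).locallyIntegrable
  have hsm : ∀ n, ContDiff ℝ 1 (ψ n) := fun n =>
    (shrinkingBump d n).hasCompactSupport_normed.contDiff_convolution_right _ hloc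
      (shrinkingBump d n).contDiff_normed
  have hsupp : ∀ n, Function.support (ψ n) ⊆ Metric.ball 0 (R + 1) := by
    intro n
    refine (support_convolution_subset _).trans ?_
    rintro _ ⟨x, hx, y, hy, rfl⟩
    have hx' := hR (T.support_piecewisePoly hΩ q hx)
    rw [(shrinkingBump d n).support_normed_eq] at hy
    rw [mem_ball_zero_iff] at hx' hy ⊢
    have h1 : (shrinkingBump d n).rOut ≤ 1 := by
      change 1 / ((n : ℝ) + 1) ≤ 1
      rw [div_le_one (by positivity)]
      linarith [n.cast_nonneg (α := ℝ)]
    calc ‖x + y‖ ≤ ‖x‖ + ‖y‖ := norm_add_le _ _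
      _ < R + 1 := by linarith
  have hbound : ∀ n, eLpNorm (ψ n) (3 / 2 : ℝ≥0) volume
      ≤ eLpNormLESNormFDerivOfLeConst ℝ (volume : Measure (Space d))
        (Metric.ball 0 (R + 1)) 1 (3 / 2) * ENNReal.ofReal (T.variation q c) := by
    intro n
    refine (eLpNorm_le_eLpNorm_fderiv_of_le volume (hsm n) (hsupp n) le_rfl ?_ ?_
      Metric.isBounded_ball).trans ?_
    · rw [finrank_euclideanSpace_fin]
      rcases hd with rfl | rfl <;> norm_num
    · rw [finrank_euclideanSpace_fin]
      rcases hd with rfl | rfl <;> norm_num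
    · gcongr
      rw [ENNReal.coe_one, eLpNorm_one_eq_lintegral_enorm]
      exact T.lintegral_fderiv_convolution_le hΩ q (shrinkingBump d n).contDiff_normed
        (shrinkingBump d n).hasCompactSupport_normed (shrinkingBump d n).nonneg_normed
        (shrinkingBump d n).integral_normed hci hc
  -- Fatou's lemma along the mollifications, which converge almost everywhere.
  have hlim := Lp.eLpNorm_lim_le_liminf_eLpNorm (p := ((3 / 2 : ℝ≥0) : ℝ≥0∞)) (μ := volume)
    (fun n => (hsm n).continuous.aestronglyMeasurable) (T.piecewisePoly q)
    (ae_tendsto_convolution_shrinkingBump hloc)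
  refine hlim.trans ?_
  exact liminf_le_of_le (by isBoundedDefault) fun b hb => by
    obtain ⟨n, hn⟩ := hb.exists
    exact hn.trans (hbound n)

end Mesh

end HDG

namespace HDG
namespace Mesh

variable {d : ℕ} {Ω : Set (Space d)} (T : Mesh Ω)

/-! ### Connectivity of the mesh -/

theorem exists_elem_inter_nonempty {x : Space d} (hx : x ∈ closure Ω) {U : Set (Space d)}
    (hU : IsOpen U) (hxU : x ∈ U) : ∃ i, (T.elem i ∩ U).Nonempty := by
  rw [← T.elem_cover, Set.mem_iUnion] at hx
  obtain ⟨i, hi⟩ := hx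
  rw [mem_closure_iff] at hi
  obtain ⟨y, hy⟩ := hi U hU hxU
  exact ⟨i, y, hy.2, hy.1⟩

/-- Without jumps inside the ball, a mollification of the piecewise constant function has zero
derivative there and is constant. Its limits at suitable points of the two elements are the two
values. No chain of elements through common faces has to be constructed. -/
theorem eq_of_inter_ball_nonempty (hΩ : IsPolyhedralDomain Ω) {c : Fin T.nK → ℝ}
    (hc : ∀ j, ¬ T.face j ⊆ frontier Ω → ∀ i i', j ∈ T.faces i → j ∈ T.faces i' → c i = c i')
    {x : Space d} {r : ℝ} (hr : 0 < r) (hxr : Metric.ball x (2 * r) ⊆ Ω) {i i' : Fin T.nK}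
    (hi : (T.elem i ∩ Metric.ball x r).Nonempty) (hi' : (T.elem i' ∩ Metric.ball x r).Nonempty) :
    c i = c i' := by
  set q : Fin T.nK → Poly d := fun i => MvPolynomial.C (c i) with hq
  have hqe : ∀ i, evalAt (q i) = fun _ => c i := fun i => by ext y; simp [hq]
  choose i₀ hi₀ using T.face_used
  set ψ : ℕ → Space d → ℝ := fun n =>
    convolution (T.piecewisePoly q) ((shrinkingBump d n).normed volume)
      (ContinuousLinearMap.lsmul ℝ ℝ) volume
  have hloc : LocallyIntegrable (T.piecewisePoly q) :=
    (T.integrable_piecewisePoly q).locallyIntegrable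
  have hsm : ∀ n, ContDiff ℝ 1 (ψ n) := fun n =>
    (shrinkingBump d n).hasCompactSupport_normed.contDiff_convolution_right _ hloc
      (shrinkingBump d n).contDiff_normed
  -- Points of the ball of radius `r` stay at distance at least `r` from the complement of `Ω`, so a
  -- mollifier of smaller radius does not reach the boundary faces.
  have hbd : ∀ n, (shrinkingBump d n).rOut < r → ∀ z ∈ Metric.ball x r, ∀ j,
      T.face j ⊆ frontier Ω → ∀ᵐ y ∂(T.surf j), (shrinkingBump d n).normed volume (z - y) = 0 := by
    intro n hn z hz j hj
    filter_upwards [ae_restrict_mem (T.measurableSet_face j)] with y hy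
    rw [← Function.notMem_support, (shrinkingBump d n).support_normed_eq]
    intro hzy
    have hyΩ : y ∉ Ω := by
      have := hj hy
      rw [hΩ.isOpen.frontier_eq] at this
      exact this.2
    refine hyΩ (hxr ?_)
    rw [mem_ball_zero_iff] at hzy
    rw [Metric.mem_ball, dist_eq_norm] at hz ⊢
    calc ‖y - x‖ = ‖(z - x) - (z - y)‖ := by congr 1; abel
      _ ≤ ‖z - x‖ + ‖z - y‖ := norm_sub_le _ _
      _ < 2 * r := by linarith
  have hder : ∀ n, (shrinkingBump d n).rOut < r → ∀ z ∈ Metric.ball x r,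
      fderiv ℝ (ψ n) z = 0 := by
    intro n hn z hz
    ext e
    rw [T.fderiv_convolution_piecewisePoly hΩ q (shrinkingBump d n).contDiff_normed
      (shrinkingBump d n).hasCompactSupport_normed (c := fun j _ => c (i₀ j))
      (fun j => integrable_const _) z e]
    · refine Finset.sum_eq_zero fun i _ => ?_
      rw [hqe]
      simp only [fderiv_fun_const, Pi.zero_apply, zero_apply, zero_mul,
        integral_zero, zero_sub, neg_eq_zero]
      refine Finset.sum_eq_zero fun j _ => ?_
      rw [mul_eq_zero]
      right
      by_cases hj : T.face j ⊆ frontier Ω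
      · refine integral_eq_zero_of_ae ?_
        filter_upwards [hbd n hn z hz j hj] with y hy
        simp [hy]
      · simp [hc j hj i (i₀ j) j.2 (hi₀ j)]
    · intro j hj
      refine integral_eq_zero_of_ae ?_
      filter_upwards [hbd n hn z hz j hj] with y hy
      simp [hy]
  have hconst : ∀ n, (shrinkingBump d n).rOut < r → ∀ y ∈ Metric.ball x r, ∀ z ∈ Metric.ball x r,
      ψ n y = ψ n z := by
    intro n hn y hy z hz
    refine (convex_ball x r).is_const_of_fderivWithin_eq_zero (𝕜 := ℝ)
      ((hsm n).differentiable one_ne_zero).differentiableOn ?_ hy hz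
    intro w hw
    rw [fderivWithin_of_isOpen Metric.isOpen_ball hw, hder n hn w hw]
  have hlim := ae_tendsto_convolution_shrinkingBump hloc
  have hpick : ∀ i, (T.elem i ∩ Metric.ball x r).Nonempty → ∃ y ∈ T.elem i ∩ Metric.ball x r,
      Tendsto (fun n => ψ n y) atTop (𝓝 (c i)) := by
    intro i hi
    have hpos : volume (T.elem i ∩ Metric.ball x r) ≠ 0 :=
      (((T.elem_polyhedral i).isOpen.inter Metric.isOpen_ball).measure_pos volume hi).ne'
    obtain ⟨y, hy, hyl⟩ := ((frequently_ae_mem_iff.2 hpos).and_eventually hlim).exists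
    rw [T.piecewisePoly_of_mem q hy.1, hqe] at hyl
    exact ⟨y, hy, hyl⟩
  obtain ⟨y, hy, hyl⟩ := hpick i hi
  obtain ⟨z, hz, hzl⟩ := hpick i' hi'
  refine tendsto_nhds_unique_of_eventuallyEq hyl hzl ?_
  filter_upwards [(tendsto_shrinkingBump_rOut d).eventually_lt_const hr] with n hn
  exact hconst n hn y hy.2 z hz.2

/-- A piecewise constant function that does not jump across the faces inside `Ω` is constant. -/
theorem eq_of_eq_across_faces (hΩ : IsPolyhedralDomain Ω) {c : Fin T.nK → ℝ}
    (hc : ∀ j, ¬ T.face j ⊆ frontier Ω → ∀ i i', j ∈ T.faces i → j ∈ T.faces i' → c i = c i')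
    (i i' : Fin T.nK) : c i = c i' := by
  by_contra hne
  -- Points around which all nearby elements have a value with the property `p`. Taken for "equal to
  -- `c i`" and "different from `c i`", these open sets cover `Ω`; a common point, forced by
  -- connectedness, is impossible since some element is near it.
  let P : (ℝ → Prop) → Set (Space d) := fun p =>
    {x | ∃ r > 0, ∀ i, (T.elem i ∩ Metric.ball x r).Nonempty → p (c i)}
  have hopen : ∀ p, IsOpen (P p) := by
    intro p
    rw [Metric.isOpen_iff]
    rintro x ⟨r, hr, hx⟩
    refine ⟨r / 2, by positivity, fun y hy => ⟨r / 2, by positivity, fun i hi => hx i ?_⟩⟩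
    refine hi.mono (Set.inter_subset_inter_right _ (Metric.ball_subset_ball' ?_))
    rw [Metric.mem_ball] at hy
    linarith
  have helem : ∀ (p : ℝ → Prop) i, p (c i) → (Ω ∩ P p).Nonempty := by
    intro p i hp
    obtain ⟨x, hx⟩ := T.elem_nonempty i
    obtain ⟨r, hr, hxr⟩ := Metric.isOpen_iff.1 (T.elem_polyhedral i).isOpen x hx
    refine ⟨x, T.elem_subset hΩ i hx, r, hr, fun i' hi' => ?_⟩
    obtain ⟨y, hy, hyr⟩ := hi'
    have : i' = i := by
      by_contra h
      exact Set.disjoint_left.1 (T.elem_disjoint h) hy (hxr hyr)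
    rwa [this]
  have hcover : Ω ⊆ P (fun t => t = c i) ∪ P (fun t => t ≠ c i) := by
    intro x hx
    obtain ⟨r, hr, hxr⟩ := Metric.isOpen_iff.1 hΩ.isOpen x hx
    have hr2 : 0 < r / 2 := by positivity
    obtain ⟨i₁, hi₁⟩ := T.exists_elem_inter_nonempty (subset_closure hx) Metric.isOpen_ball
      (Metric.mem_ball_self hr2)
    have key : ∀ i₂, (T.elem i₂ ∩ Metric.ball x (r / 2)).Nonempty → c i₂ = c i₁ := fun i₂ hi₂ =>
      T.eq_of_inter_ball_nonempty hΩ hc hr2 (by rwa [mul_div_cancel₀ r two_ne_zero]) hi₂ hi₁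
    by_cases h : c i₁ = c i
    · exact Or.inl ⟨r / 2, hr2, fun i₂ hi₂ => (key i₂ hi₂).trans h⟩
    · exact Or.inr ⟨r / 2, hr2, fun i₂ hi₂ => by rw [key i₂ hi₂]; exact h⟩
  obtain ⟨x, hx, ⟨r, hr, h1⟩, ⟨r', hr', h2⟩⟩ := hΩ.isConnected.isPreconnected _ _ (hopen (fun t => t = c i))
    (hopen (fun t => t ≠ c i)) hcover (helem (fun t => t = c i) i rfl) (helem (fun t => t ≠ c i) i' (Ne.symm hne))
  obtain ⟨i₁, hi₁⟩ := T.exists_elem_inter_nonempty (subset_closure hx) Metric.isOpen_ball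
    (Metric.mem_ball_self (lt_min hr hr'))
  exact h2 i₁ (hi₁.mono (Set.inter_subset_inter_right _
    (Metric.ball_subset_ball (min_le_right _ _)))) (h1 i₁ (hi₁.mono
      (Set.inter_subset_inter_right _ (Metric.ball_subset_ball (min_le_left _ _)))))

end Mesh

end HDG

namespace HDG

/-! ### Spaces of polynomials that are closed under differentiation -/

section Poly

variable {d : ℕ}

theorem totalDegree_pderiv_le (p : Poly d) (s : Fin d) :
    (MvPolynomial.pderiv s p).totalDegree ≤ p.totalDegree - 1 := by
  conv_lhs => rw [p.as_sum, map_sum]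
  refine MvPolynomial.totalDegree_finsetSum_le fun m hm => ?_
  rw [MvPolynomial.pderiv_monomial]
  by_cases hs : m s = 0
  · simp [hs]
  refine (MvPolynomial.totalDegree_monomial_le _ _).trans ?_
  have h1 := MvPolynomial.le_totalDegree hm
  have h2 : m = (m - Finsupp.single s 1) + Finsupp.single s 1 := by
    ext t
    by_cases ht : t = s
    · subst ht; simp; omega
    · simp [Ne.symm ht]
  have h3 : (m.sum fun _ e => e) = ((m - Finsupp.single s 1).sum fun _ e => e) + 1 := by
    conv_lhs => rw [h2]
    rw [Finsupp.sum_add_index' (by simp) (by simp), Finsupp.sum_single_index rfl]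
  change ((m - Finsupp.single s 1).sum fun _ e => e) ≤ _
  omega

theorem eq_C_of_grad_eq_zero {p : Poly d} (h : grad p = 0) : p = MvPolynomial.C (evalAt p 0) := by
  have hf : ∀ x, fderiv ℝ (evalAt p) x = 0 := by
    intro x
    have h1 := (hasGradientAt_iff_hasFDerivAt.1 (hasGradientAt_evalAt p x)).fderiv
    rw [h1, h]
    have : vecAt (0 : Fin d → Poly d) x = 0 := by ext r; simp
    rw [this, map_zero]
  have hc := is_const_of_fderiv_eq_zero (𝕜 := ℝ)
    ((contDiff_evalAt p (n := 1)).differentiable one_ne_zero) hf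
  rw [← sub_eq_zero]
  refine poly_eq_zero_of_eqOn_open isOpen_univ Set.univ_nonempty fun x _ => ?_
  rw [evalAt_sub, evalAt_C, hc x 0, sub_self]

/-- Differentiating a nonzero polynomial until its gradient vanishes leaves a nonzero constant; each
derivative that is taken lowers the degree. -/
theorem one_mem_of_pderiv_mem {W : Submodule ℝ (Poly d)}
    (hW : ∀ w ∈ W, ∀ s, MvPolynomial.pderiv s w ∈ W) {w : Poly d} (hw : w ∈ W) (h0 : w ≠ 0) :
    (1 : Poly d) ∈ W := by
  induction hn : w.totalDegree using Nat.strong_induction_on generalizing w with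
  | _ n ih =>
    by_cases hg : grad w = 0
    · rw [eq_C_of_grad_eq_zero hg] at hw h0
      have hc : evalAt w 0 ≠ 0 := fun h => h0 (by rw [h, map_zero])
      have := W.smul_mem (evalAt w 0)⁻¹ hw
      rwa [MvPolynomial.smul_eq_C_mul, ← map_mul, inv_mul_cancel₀ hc, map_one] at this
    · obtain ⟨s, hs⟩ := Function.ne_iff.1 hg
      have hdeg : w.totalDegree ≠ 0 := by
        intro h
        rw [MvPolynomial.totalDegree_eq_zero_iff_eq_C] at h
        apply hs
        simp only [grad, Pi.zero_apply]
        rw [h, MvPolynomial.pderiv_C]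
      refine ih _ ?_ (hW w hw s) hs rfl
      have := totalDegree_pderiv_le w s
      omega

end Poly

/-! ### The discrete Sobolev inequality -/

theorem integral_mul_le_sqrt_mul_sqrt {α : Type*} [MeasurableSpace α] {μ : Measure α}
    {f g : α → ℝ} (hf : MemLp f 2 μ) (hg : MemLp g 2 μ) :
    ∫ x, f x * g x ∂μ ≤ √(∫ x, f x ^ 2 ∂μ) * √(∫ x, g x ^ 2 ∂μ) := by
  have hn : ∀ {f : α → ℝ} (hf : MemLp f 2 μ), ‖hf.toLp f‖ = √(∫ x, f x ^ 2 ∂μ) := by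
    intro f hf
    rw [← Real.sqrt_sq (norm_nonneg (hf.toLp f)), ← real_inner_self_eq_norm_sq, L2.inner_def]
    congr 1
    refine integral_congr_ae ?_
    filter_upwards [hf.coeFn_toLp] with x hx
    simp [hx, sq]
  rw [← hn hf, ← hn hg]
  refine le_trans (le_of_eq ?_) (real_inner_le_norm _ _)
  rw [L2.inner_def]
  refine integral_congr_ae ?_
  filter_upwards [hf.coeFn_toLp, hg.coeFn_toLp] with x hx hy
  simp [hx, hy, mul_comm]

/-- Truncation of a real number to the interval `[-A, A]`. -/
noncomputable def clamp (A t : ℝ) : ℝ := max (-A) (min A t)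

theorem continuous_clamp (A : ℝ) : Continuous (clamp A) := by unfold clamp; fun_prop

theorem abs_clamp_le {A : ℝ} (hA : 0 ≤ A) (t : ℝ) : |clamp A t| ≤ A := by
  unfold clamp
  rw [abs_le]
  exact ⟨le_max_left _ _, max_le (by linarith) (min_le_left _ _)⟩

/-- Truncation is the projection onto an interval that already contains `s`, so it does not move `t`
away from `s`. -/
theorem abs_sub_clamp_le {A s : ℝ} (hs : |s| ≤ A) (t : ℝ) : |s - clamp A t| ≤ |s - t| := by
  have hA := abs_le.1 hs
  unfold clamp
  rcases le_total A t with h | h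
  · rw [min_eq_left h, max_eq_right (by linarith)]
    rw [abs_of_nonpos (by linarith), abs_of_nonpos (by linarith)]
    linarith
  · rw [min_eq_right h]
    rcases le_total (-A) t with h' | h'
    · rw [max_eq_right h']
    · rw [max_eq_left h', abs_of_nonneg (by linarith), abs_of_nonneg (by linarith)]
      linarith

/-- The fourth power of a trace in `L²` need not be integrable. Truncating the trace at a bound for
`u` keeps it single-valued and makes the jump of the fourth power at most `4A³` times the jump
itself. -/
theorem abs_pow_four_sub_le {A s t : ℝ} (hs : |s| ≤ A) :
    |s ^ 4 - clamp A t ^ 4| ≤ 4 * A ^ 3 * |s - t| := by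
  have hA : 0 ≤ A := (abs_nonneg s).trans hs
  set c := clamp A t
  have hc : |c| ≤ A := abs_clamp_le hA t
  have h1 : s ^ 4 - c ^ 4 = (s ^ 3 + s ^ 2 * c + s * c ^ 2 + c ^ 3) * (s - c) := by ring
  rw [h1, abs_mul]
  have h2 : |s ^ 3 + s ^ 2 * c + s * c ^ 2 + c ^ 3| ≤ 4 * A ^ 3 := by
    calc |s ^ 3 + s ^ 2 * c + s * c ^ 2 + c ^ 3|
        ≤ |s ^ 3| + |s ^ 2 * c| + |s * c ^ 2| + |c ^ 3| :=
          (abs_add_le _ _).trans (by gcongr; exact (abs_add_le _ _).trans (by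
            gcongr; exact abs_add_le _ _))
      _ = |s| ^ 3 + |s| ^ 2 * |c| + |s| * |c| ^ 2 + |c| ^ 3 := by simp only [abs_mul, abs_pow]
      _ ≤ A ^ 3 + A ^ 2 * A + A * A ^ 2 + A ^ 3 := by gcongr
      _ = 4 * A ^ 3 := by ring
  exact mul_le_mul h2 (abs_sub_clamp_le hs t) (abs_nonneg _) (by positivity)

namespace Mesh

variable {d : ℕ} {Ω : Set (Space d)} (T : Mesh Ω)

/-- The gradient of `u⁴` is `4u³∇u`, and Cauchy–Schwarz separates `u³` from `∇u`. The power four is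
chosen so that the same integral of `u⁶` appears here and, through the exponent `3 / 2`, on the
other side of the Sobolev inequality. -/
theorem integral_norm_fderiv_pow_four_le (i : Fin T.nK) (p : Poly d) :
    ∫ y, ‖fderiv ℝ (evalAt (p ^ 4)) y‖ ∂(T.vol i)
      ≤ 4 * (√(∫ y, evalAt p y ^ 6 ∂(T.vol i)) * ‖T.vecK i (grad p)‖) := by
  have h1 : ∀ y, ‖fderiv ℝ (evalAt (p ^ 4)) y‖ = 4 * (|evalAt p y| ^ 3 * ‖vecAt (grad p) y‖) := by
    intro y
    have h2 := hasGradientAt_iff_hasFDerivAt.1 (hasGradientAt_evalAt p y)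
    have h3 : evalAt (p ^ 4) = fun y => evalAt p y ^ 4 := by ext; simp
    rw [h3, (h2.pow 4).fderiv, norm_smul, LinearIsometryEquiv.norm_map]
    simp [mul_assoc]
  have hc1 : Continuous fun y => |evalAt p y| ^ 3 := (continuous_evalAt p).abs.pow 3
  have hc2 : Continuous fun y => ‖vecAt (grad p) y‖ := (continuous_vecAt (grad p)).norm
  simp only [h1]
  rw [integral_const_mul]
  refine mul_le_mul_of_nonneg_left ?_ (by norm_num)
  refine (integral_mul_le_sqrt_mul_sqrt ((T.carried_vol i).memLp hc1 2)
    ((T.carried_vol i).memLp hc2 2)).trans (le_of_eq ?_)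
  congr 1
  · congr 1
    refine integral_congr_ae (ae_of_all _ fun y => ?_)
    change (|evalAt p y| ^ 3) ^ 2 = evalAt p y ^ 6
    rw [← pow_mul]
    exact Even.pow_abs (by decide) _
  · rw [← Real.sqrt_sq (norm_nonneg (T.vecK i (grad p))), ← real_inner_self_eq_norm_sq,
      inner_vecK_right]
    congr 1
    refine integral_congr_ae ?_
    filter_upwards [vecL2_coeFn (T.carried_vol i) (grad p)] with y hy
    change ‖vecAt (grad p) y‖ ^ 2 = inner ℝ (vecL2 (T.carried_vol i) (grad p) y) _
    rw [hy, real_inner_self_eq_norm_sq]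

theorem norm_sq_polyL2_sub {μ : Measure (Space d)} (h : CompactlyCarried μ) (p : Poly d)
    (m : Lp ℝ 2 μ) : ‖polyL2 h p - m‖ ^ 2 = ∫ x, (evalAt p x - m x) ^ 2 ∂μ := by
  rw [← real_inner_self_eq_norm_sq, L2.inner_def]
  refine integral_congr_ae ?_
  filter_upwards [polyL2_coeFn h p, Lp.coeFn_sub (polyL2 h p) m] with x hx hs
  rw [hs, Pi.sub_apply, hx]
  simp [sq]

theorem memLp_evalAt_sub {j : Fin T.nF} (p : Poly d) (m : Lp ℝ 2 (T.surf j)) :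
    MemLp (fun x => evalAt p x - m x) 2 (T.surf j) :=
  ((T.carried_surf j).memLp (continuous_evalAt p) 2).sub (Lp.memLp m)

/-- The pointwise bound for truncated fourth powers, followed by Cauchy–Schwarz against the constant
one on the face. -/
theorem integral_abs_pow_four_sub_le {i : Fin T.nK} (j : T.faces i) (p : Poly d)
    (m : Lp ℝ 2 (T.surf j)) {A : ℝ} (hA : T.supNorm i p ≤ A) :
    ∫ y, |evalAt (p ^ 4) y - clamp A (m y) ^ 4| ∂(T.surf j)
      ≤ 4 * A ^ 3 * (√((T.surf j).real Set.univ) * ‖polyL2 (T.carried_surf j) p - m‖) := by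
  have hA0 : 0 ≤ A := (T.supNorm_nonneg i p).trans hA
  have hm := T.memLp_evalAt_sub p m
  have hint : Integrable (fun y => evalAt p y - m y) (T.surf j) :=
    memLp_one_iff_integrable.1 (hm.mono_exponent (by norm_num))
  calc ∫ y, |evalAt (p ^ 4) y - clamp A (m y) ^ 4| ∂(T.surf j)
      ≤ ∫ y, 4 * A ^ 3 * |evalAt p y - m y| ∂(T.surf j) := by
        refine integral_mono_of_nonneg (ae_of_all _ fun y => abs_nonneg _)
          (hint.abs.const_mul _) ?_
        filter_upwards [T.ae_surf_abs_le j p] with y hy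
        rw [evalAt_pow]
        exact abs_pow_four_sub_le (hy.trans hA)
    _ = 4 * A ^ 3 * ∫ y, 1 * |evalAt p y - m y| ∂(T.surf j) := by
        rw [integral_const_mul]; simp
    _ ≤ 4 * A ^ 3 * (√((T.surf j).real Set.univ) * ‖polyL2 (T.carried_surf j) p - m‖) := by
        refine mul_le_mul_of_nonneg_left ?_ (by positivity)
        refine (integral_mul_le_sqrt_mul_sqrt (memLp_const _) hm.abs).trans (le_of_eq ?_)
        congr 1
        · simp
        · rw [← Real.sqrt_sq (norm_nonneg (polyL2 (T.carried_surf j) p - m)), norm_sq_polyL2_sub]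
          simp

/-- Raising `u⁴` to the power `3 / 2` gives `u⁶` in absolute value; the elements are disjoint. -/
theorem ofReal_sum_integral_pow_six_le (u : Fin T.nK → Poly d) :
    ENNReal.ofReal (∑ i, ∫ x, evalAt (u i) x ^ 6 ∂(T.vol i))
      ≤ ∫⁻ x, ‖T.piecewisePoly (fun i => u i ^ 4) x‖ₑ ^ (3 / 2 : ℝ) := by
  rw [ENNReal.ofReal_sum_of_nonneg fun i _ => integral_nonneg fun x => by positivity]
  have h1 : ∀ i, ENNReal.ofReal (∫ x, evalAt (u i) x ^ 6 ∂(T.vol i))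
      = ∫⁻ x in T.elem i, ‖T.piecewisePoly (fun i => u i ^ 4) x‖ₑ ^ (3 / 2 : ℝ) := by
    intro i
    have hint : Integrable (fun x => evalAt (u i) x ^ 6) (T.vol i) :=
      T.integrable_of_continuous ((continuous_evalAt (u i)).pow 6)
    rw [ofReal_integral_eq_lintegral_ofReal hint
      (ae_of_all _ fun x => Even.pow_nonneg (by decide) _)]
    refine lintegral_congr_ae ?_
    filter_upwards [ae_restrict_mem (T.measurableSet_elem i)] with x hx
    rw [T.piecewisePoly_of_mem _ hx, Real.enorm_eq_ofReal_abs,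
      ENNReal.ofReal_rpow_of_nonneg (abs_nonneg _) (by norm_num), evalAt_pow, abs_pow,
      ← Real.rpow_natCast_mul (abs_nonneg _)]
    norm_num
    rw [← ENNReal.ofReal_pow (abs_nonneg _), Even.pow_abs (by decide)]
  simp only [h1]
  have h2 := lintegral_iUnion (μ := volume) T.measurableSet_elem T.elem_disjoint
    fun x => ‖T.piecewisePoly (fun i => u i ^ 4) x‖ₑ ^ (3 / 2 : ℝ)
  rw [tsum_fintype] at h2
  rw [← h2]
  exact setLIntegral_le_lintegral _ _

/-- The discrete energy of a broken polynomial function with a given trace on the faces. -/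
noncomputable def scalarEnergy (u : Fin T.nK → Poly d) (m : (j : Fin T.nF) → Lp ℝ 2 (T.surf j)) :
    ℝ :=
  ∑ i, (‖T.vecK i (grad (u i))‖ ^ 2 + (T.h i)⁻¹ * ‖T.traceK i (u i) - T.restrictK i m‖ ^ 2)

theorem scalarEnergy_nonneg (u : Fin T.nK → Poly d) (m : (j : Fin T.nF) → Lp ℝ 2 (T.surf j)) :
    0 ≤ T.scalarEnergy u m :=
  Finset.sum_nonneg fun i _ => by have := T.h_nonneg i; positivity

end Mesh
end HDG

/-! ### The discrete Sobolev inequality for the sixth power. -/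

namespace HDG
namespace Mesh

variable {d : ℕ} {Ω : Set (Space d)} (T : Mesh Ω)

/-- Each face can be charged to an adjacent element on which `f` is maximal; the total charge is
bounded by a multiple of the sum of `n` over the elements. -/
theorem sum_faces_charge_le {C : ℝ} (hcard : ∀ i, ((T.faces i).card : ℝ) ≤ C)
    {n : Fin T.nK → ℝ} (hn : ∀ i, 0 ≤ n i) {s : Fin T.nF → Fin T.nK}
    (hs : ∀ j, j ∈ T.faces (s j)) :
    ∑ i, ∑ j : T.faces i, n (s j) ≤ 2 * C * ∑ i, n i := by
  have h1 : ∀ g : Fin T.nK → Fin T.nF → ℝ, ∑ i, ∑ j : T.faces i, g i j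
      = ∑ j, ∑ i ∈ Finset.univ.filter (fun i => j ∈ T.faces i), g i j := by
    intro g
    simp_rw [Finset.sum_coe_sort (T.faces _) (g _)]
    exact Finset.sum_comm' fun i j => by simp
  calc ∑ i, ∑ j : T.faces i, n (s j)
      = ∑ j, ((Finset.univ.filter fun i => j ∈ T.faces i).card : ℝ) * n (s j) := by
        rw [h1 fun _ j => n (s j)]
        simp
    _ ≤ ∑ j, 2 * n (s j) := by
        refine Finset.sum_le_sum fun j _ => ?_
        have := T.card_elem_le_two j
        gcongr
        · exact hn _
        · exact_mod_cast this
    _ = 2 * ∑ j, n (s j) := by rw [Finset.mul_sum]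
    _ ≤ 2 * ∑ j, ∑ i ∈ Finset.univ.filter (fun i => j ∈ T.faces i), n i := by
        gcongr with j
        exact Finset.single_le_sum (f := n) (fun i _ => hn i) (by simp [hs j])
    _ = 2 * ∑ i, (T.faces i).card * n i := by
        rw [← h1 fun i _ => n i]
        simp
    _ ≤ 2 * ∑ i, C * n i := by
        gcongr with i
        · exact hn i
        · exact hcard i
    _ = 2 * C * ∑ i, n i := by rw [← Finset.mul_sum]; ring

/-- The truncation level on a face has to be the same on both sides and to dominate `u` on both, so
it is taken from the adjacent element with the larger maximum. -/
theorem exists_maximal_elem (A : Fin T.nK → ℝ) :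
    ∃ s : Fin T.nF → Fin T.nK, ∀ j, j ∈ T.faces (s j) ∧ ∀ i, j ∈ T.faces i → A i ≤ A (s j) := by
  have h : ∀ j, ∃ i, j ∈ T.faces i ∧ ∀ i', j ∈ T.faces i' → A i' ≤ A i := by
    intro j
    obtain ⟨i₀, hi₀⟩ := T.face_used j
    obtain ⟨i, hi, hmax⟩ := (Finset.univ.filter fun i => j ∈ T.faces i).exists_max_image A
      ⟨i₀, by simp [hi₀]⟩
    exact ⟨i, by simpa using hi, fun i' hi' => hmax i' (by simp [hi'])⟩
  exact ⟨fun j => (h j).choose, fun j => (h j).choose_spec⟩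

variable {T}

/-- The variation of `u⁴` in terms of the integral of `u⁶` and of the discrete energy. -/
theorem Bounds.exists_variation_le {k : ℕ} {C : ℝ} (hb : T.Bounds k C) (hd : 0 < d)
    {u : Fin T.nK → Poly d} (hu : ∀ i, (u i).totalDegree ≤ k)
    (m : (j : Fin T.nF) → Lp ℝ 2 (T.surf j))
    (hcmp : ∀ i i', ∀ j ∈ T.faces i, j ∈ T.faces i' → u i' ≠ 0 → T.h i ≤ C * T.h i') :
    ∃ A : Fin T.nF → ℝ, (∀ j, 0 ≤ A j) ∧ T.variation (fun i => u i ^ 4) (fun j y => clamp (A j) (m j y) ^ 4)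
      ≤ 4 * (1 + √(2 * C ^ 4)) * (√(∑ i, ∫ x, evalAt (u i) x ^ 6 ∂(T.vol i))
        * √(T.scalarEnergy u m)) := by
  obtain ⟨s, hs⟩ := T.exists_maximal_elem fun i => T.supNorm i (u i)
  have hC : 0 ≤ C := zero_le_one.trans hb.one_le
  set A : Fin T.nF → ℝ := fun j => T.supNorm (s j) (u (s j)) with hA
  have hA0 : ∀ j, 0 ≤ A j := fun j => T.supNorm_nonneg _ _
  set n : Fin T.nK → ℝ := fun i => ∫ x, evalAt (u i) x ^ 6 ∂(T.vol i) with hn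
  have hn0 : ∀ i, 0 ≤ n i := fun i => integral_nonneg fun x => Even.pow_nonneg (by decide) _
  have hh : ∀ i, 0 < T.h i := T.h_pos hd
  set J : Fin T.nK → Fin T.nF → ℝ := fun i j => ‖polyL2 (T.carried_surf j) (u i) - m j‖ with hJ
  refine ⟨A, hA0, ?_⟩
  have hvol : ∑ i, ∫ y, ‖fderiv ℝ (evalAt (u i ^ 4)) y‖ ∂(T.vol i)
      ≤ 4 * (√(∑ i, n i) * √(T.scalarEnergy u m)) := by
    calc ∑ i, ∫ y, ‖fderiv ℝ (evalAt (u i ^ 4)) y‖ ∂(T.vol i)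
        ≤ ∑ i, 4 * (√(n i) * ‖T.vecK i (grad (u i))‖) :=
          Finset.sum_le_sum fun i _ => T.integral_norm_fderiv_pow_four_le i (u i)
      _ = 4 * ∑ i, √(n i) * ‖T.vecK i (grad (u i))‖ := by rw [Finset.mul_sum]
      _ ≤ 4 * (√(∑ i, √(n i) ^ 2) * √(∑ i, ‖T.vecK i (grad (u i))‖ ^ 2)) := by
          gcongr
          exact Real.sum_mul_le_sqrt_mul_sqrt _ _ _
      _ ≤ 4 * (√(∑ i, n i) * √(T.scalarEnergy u m)) := by
          gcongr with i
          · rw [Real.sq_sqrt (hn0 i)]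
          · refine Finset.sum_le_sum fun i _ => ?_
            have := hh i
            have : 0 ≤ (T.h i)⁻¹ * ‖T.traceK i (u i) - T.restrictK i m‖ ^ 2 := by positivity
            linarith
  -- The area of the face and the diameter are measured on the element that realizes the maximum,
  -- where the inverse inequality turns `h ^ d * A ^ 6` into the integral of `u⁶`. Diameters are
  -- compared only when `u` is nonzero there, since otherwise `A j = 0`.
  have hface : ∀ i (j : T.faces i), A j ^ 6 * (T.surf j).real Set.univ * T.h i
      ≤ C ^ 3 * n (s j) := by
    intro i j
    by_cases hu0 : u (s j) = 0
    · have : A j = 0 := by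
        obtain ⟨x, _, hx⟩ := T.exists_supNorm_eq (s j) (u (s j))
        rw [hA]; simp only; rw [hx, hu0]; simp
      rw [this]
      have := hn0 (s j)
      simp only [ne_eq, OfNat.ofNat_ne_zero, not_false_eq_true, zero_pow, zero_mul]
      positivity
    · have h1 := hcmp i (s j) j j.2 (hs j).1 hu0
      have h2 := hb.surf_le (s j) j (hs j).1
      have h3 := hb.inverse_six (s j) (u (s j)) (hu _)
      have hhs := hh (s j)
      have hhi := (hh i).le
      calc A j ^ 6 * (T.surf j).real Set.univ * T.h i
          ≤ A j ^ 6 * (C * T.h (s j) ^ (d - 1)) * (C * T.h (s j)) := by gcongr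
        _ = C ^ 2 * (T.h (s j) ^ (d - 1 + 1) * A j ^ 6) := by ring
        _ ≤ C ^ 2 * (C * n (s j)) := by
            rw [Nat.sub_add_cancel hd]
            gcongr
        _ = C ^ 3 * n (s j) := by ring
  have hsum : ∑ i, ∑ j : T.faces i, A j ^ 6 * (T.surf j).real Set.univ * T.h i
      ≤ 2 * C ^ 4 * ∑ i, n i := by
    calc ∑ i, ∑ j : T.faces i, A j ^ 6 * (T.surf j).real Set.univ * T.h i
        ≤ ∑ i, ∑ j : T.faces i, C ^ 3 * n (s j) :=
          Finset.sum_le_sum fun i _ => Finset.sum_le_sum fun j _ => hface i j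
      _ = C ^ 3 * ∑ i, ∑ j : T.faces i, n (s j) := by simp only [Finset.mul_sum]
      _ ≤ C ^ 3 * (2 * C * ∑ i, n i) := by
          gcongr
          exact T.sum_faces_charge_le hb.card_le hn0 fun j => (hs j).1
      _ = 2 * C ^ 4 * ∑ i, n i := by ring
  have hjump : ∑ i, ∑ j : T.faces i, (T.h i)⁻¹ * J i j ^ 2 ≤ T.scalarEnergy u m := by
    refine Finset.sum_le_sum fun i _ => ?_
    rw [norm_sq_traceL2, ← Finset.mul_sum]
    exact le_add_of_nonneg_left (by positivity)
  have hsurf : ∑ i, ∑ j : T.faces i, ∫ y, |evalAt (u i ^ 4) y - clamp (A j) (m j y) ^ 4| ∂(T.surf j)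
      ≤ 4 * (√(2 * C ^ 4) * √(∑ i, n i) * √(T.scalarEnergy u m)) := by
    -- The factors `h` and `h⁻¹` are inserted so that the Cauchy–Schwarz inequality over all pairs
    -- of an element and a face separates the sum of `hsum` from the jump part of the energy.
    have e1 : ∀ i (j : T.faces i),
        ∫ y, |evalAt (u i ^ 4) y - clamp (A j) (m j y) ^ 4| ∂(T.surf j)
        ≤ 4 * (√(A j ^ 6 * (T.surf j).real Set.univ * T.h i) * √((T.h i)⁻¹ * J i j ^ 2)) := by
      intro i j
      refine (T.integral_abs_pow_four_sub_le j (u i) (m j) ((hs j).2 i j.2)).trans (le_of_eq ?_)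
      have hhi := hh i
      rw [← Real.sqrt_mul (by have := hA0 j; positivity)]
      have : A j ^ 6 * (T.surf j).real Set.univ * T.h i * ((T.h i)⁻¹ * J i j ^ 2)
          = (T.surf j).real Set.univ * (A j ^ 3 * J i j) ^ 2 := by
        field_simp
      rw [this, Real.sqrt_mul measureReal_nonneg,
        Real.sqrt_sq (mul_nonneg (pow_nonneg (hA0 j) 3) (norm_nonneg _))]
      ring
    have e2 : ∀ f : (i : Fin T.nK) → T.faces i → ℝ, ∑ i, ∑ j, f i j
        = ∑ z : (i : Fin T.nK) × T.faces i, f z.1 z.2 := fun f => (Fintype.sum_sigma' f).symm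
    calc ∑ i, ∑ j : T.faces i, ∫ y, |evalAt (u i ^ 4) y - clamp (A j) (m j y) ^ 4| ∂(T.surf j)
        ≤ ∑ i, ∑ j : T.faces i,
          4 * (√(A j ^ 6 * (T.surf j).real Set.univ * T.h i) * √((T.h i)⁻¹ * J i j ^ 2)) :=
          Finset.sum_le_sum fun i _ => Finset.sum_le_sum fun j _ => e1 i j
      _ = 4 * ∑ z : (i : Fin T.nK) × T.faces i,
          √(A z.2 ^ 6 * (T.surf z.2).real Set.univ * T.h z.1)
            * √((T.h z.1)⁻¹ * J z.1 z.2 ^ 2) := by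
          rw [← e2 fun i j => √(A j ^ 6 * (T.surf j).real Set.univ * T.h i)
            * √((T.h i)⁻¹ * J i j ^ 2)]
          simp only [Finset.mul_sum]
      _ ≤ 4 * (√(∑ i, ∑ j : T.faces i, A j ^ 6 * (T.surf j).real Set.univ * T.h i)
          * √(∑ i, ∑ j : T.faces i, (T.h i)⁻¹ * J i j ^ 2)) := by
          gcongr
          rw [e2 fun i j => A j ^ 6 * (T.surf j).real Set.univ * T.h i,
            e2 fun i j => (T.h i)⁻¹ * J i j ^ 2]
          refine Real.sum_sqrt_mul_sqrt_le _ (fun z => ?_) fun z => ?_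
          · have := hA0 z.2
            have := hh z.1
            positivity
          · have := hh z.1
            positivity
      _ ≤ 4 * (√(2 * C ^ 4 * ∑ i, n i) * √(T.scalarEnergy u m)) := by gcongr
      _ = 4 * (√(2 * C ^ 4) * √(∑ i, n i) * √(T.scalarEnergy u m)) := by
          rw [Real.sqrt_mul (by positivity)]
  unfold variation
  rw [Finset.sum_add_distrib]
  calc _ ≤ 4 * (√(∑ i, n i) * √(T.scalarEnergy u m))
        + 4 * (√(2 * C ^ 4) * √(∑ i, n i) * √(T.scalarEnergy u m)) := add_le_add hvol hsurf
    _ = _ := by ring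

/-- The discrete Sobolev inequality. -/
theorem exists_sobolev (hd : d = 2 ∨ d = 3) (hΩ : IsPolyhedralDomain Ω) (k : ℕ) (C : ℝ) :
    ∃ C' > 0, ∀ T : Mesh Ω, T.Bounds k C → ∀ u : Fin T.nK → Poly d,
      (∀ i, (u i).totalDegree ≤ k) → ∀ m : (j : Fin T.nF) → Lp ℝ 2 (T.surf j),
      (∀ j, T.face j ⊆ frontier Ω → m j = 0) →
      (∀ i i', ∀ j ∈ T.faces i, j ∈ T.faces i' → u i' ≠ 0 → T.h i ≤ C * T.h i') →
      ∑ i, T.h i ^ d * T.supNorm i (u i) ^ 6 ≤ C' * T.scalarEnergy u m ^ 3 := by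
  have hd0 : 0 < d := by omega
  obtain ⟨K, hK⟩ := exists_eLpNorm_piecewisePoly_le hd hΩ
  -- The embedding constant times the constant in the estimate of the variation of `u⁴`.
  set L : ℝ := K * (4 * (1 + √(2 * C ^ 4))) with hL
  refine ⟨|C| * L ^ 6 + 1, by positivity, fun T hb u hu m hm hcmp => ?_⟩
  have hC : 0 ≤ C := zero_le_one.trans hb.one_le
  obtain ⟨A, hA0, hA⟩ := hb.exists_variation_le hd0 hu m hcmp
  set N := ∑ i, ∫ x, evalAt (u i) x ^ 6 ∂(T.vol i) with hN
  have hN0 : 0 ≤ N := Finset.sum_nonneg fun i _ => integral_nonneg fun x =>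
    Even.pow_nonneg (by decide) _
  set E := T.scalarEnergy u m
  have hE : 0 ≤ E := T.scalarEnergy_nonneg u m
  have h1 := hK T (fun i => u i ^ 4) (fun j y => clamp (A j) (m j y) ^ 4) ?_ ?_
  rotate_left
  · intro j
    have hc : Continuous fun t => clamp (A j) t ^ 4 := (continuous_clamp _).pow 4
    refine Integrable.of_bound (hc.comp_aestronglyMeasurable (Lp.aestronglyMeasurable (m j)))
      (A j ^ 4) (ae_of_all _ fun y => ?_)
    rw [norm_pow, Real.norm_eq_abs]
    exact pow_le_pow_left₀ (abs_nonneg _) (abs_clamp_le (hA0 j) _) 4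
  · intro j hj
    rw [hm j hj]
    filter_upwards [Lp.coeFn_zero ℝ 2 (T.surf j)] with y hy
    rw [hy]
    simp [clamp, hA0 j]
  have h2 := T.ofReal_sum_integral_pow_six_le u
  rw [eLpNorm_nnreal_eq_lintegral (by norm_num)] at h1
  -- The embedding reads `N ^ (2/3) ≤ L √N √E`, where `N` is the integral of `u⁶`; cubing removes
  -- the fractional exponent.
  have h3 : ENNReal.ofReal N ^ 2 ≤ ENNReal.ofReal (L * (√N * √E)) ^ 3 := by
    rw [one_div, ENNReal.rpow_inv_le_iff (by norm_num)] at h1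
    have h4 := (h2.trans h1).trans (ENNReal.rpow_le_rpow (mul_le_mul_right (ENNReal.ofReal_le_ofReal hA) _)
      (by norm_num))
    calc ENNReal.ofReal N ^ 2 ≤ _ := pow_le_pow_left' h4 2
      _ = ENNReal.ofReal (L * (√N * √E)) ^ 3 := by
        rw [← ENNReal.rpow_mul_natCast, ← ENNReal.ofReal_coe_nnreal,
          ← ENNReal.ofReal_mul (NNReal.coe_nonneg K), ← mul_assoc]
        have e : ((3 / 2 : NNReal) : ℝ) * ((2 : ℕ) : ℝ) = ((3 : ℕ) : ℝ) := by norm_num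
        rw [e, ENNReal.rpow_natCast]
  have h4 : N ^ 2 ≤ (L * (√N * √E)) ^ 3 := by
    rw [← ENNReal.ofReal_pow hN0, ← ENNReal.ofReal_pow (by positivity)] at h3
    exact (ENNReal.ofReal_le_ofReal_iff (by positivity)).1 h3
  -- Squaring gives `N ^ 4 ≤ L ^ 6 E ^ 3 N ^ 3`, and three powers of `N` are absorbed when `N` is
  -- positive.
  have h5 : N ≤ L ^ 6 * E ^ 3 := by
    rcases hN0.eq_or_lt with h0 | hpos
    · rw [← h0]; positivity
    · have h6 : N ^ 4 ≤ L ^ 6 * E ^ 3 * N ^ 3 := by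
        calc N ^ 4 = (N ^ 2) ^ 2 := by ring
          _ ≤ ((L * (√N * √E)) ^ 3) ^ 2 := by gcongr
          _ = L ^ 6 * (√E ^ 2) ^ 3 * (√N ^ 2) ^ 3 := by ring
          _ = L ^ 6 * E ^ 3 * N ^ 3 := by rw [Real.sq_sqrt hE, Real.sq_sqrt hN0]
      have : N * N ^ 3 ≤ L ^ 6 * E ^ 3 * N ^ 3 := by rw [← pow_succ']; exact h6
      exact le_of_mul_le_mul_right this (by positivity)
  calc ∑ i, T.h i ^ d * T.supNorm i (u i) ^ 6
      ≤ ∑ i, C * ∫ x, evalAt (u i) x ^ 6 ∂(T.vol i) :=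
        Finset.sum_le_sum fun i _ => hb.inverse_six i (u i) (hu i)
    _ = C * N := by rw [hN, Finset.mul_sum]
    _ ≤ C * (L ^ 6 * E ^ 3) := by gcongr
    _ ≤ (|C| * L ^ 6 + 1) * E ^ 3 := by
        rw [abs_of_nonneg hC]
        have : 0 ≤ E ^ 3 := by positivity
        linarith

end Mesh
end HDG

/-! ### Comparable diameters of neighbouring elements, and Sobolev bounds for the finite element
spaces. -/

namespace HDG

theorem Mesh.Bounds.mono {d : ℕ} {Ω : Set (Space d)} {T : Mesh Ω} {k : ℕ} {C C' : ℝ}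
    (hb : T.Bounds k C) (h : C ≤ C') : T.Bounds k C' where
  one_le := hb.one_le.trans h
  h_le i := (hb.h_le i).trans h
  vol_le i := (hb.vol_le i).trans (by have := T.h_nonneg i; gcongr)
  surf_le i j hj := (hb.surf_le i j hj).trans (by have := T.h_nonneg i; gcongr)
  card_le i := (hb.card_le i).trans h
  sum_le := hb.sum_le.trans h
  inverse i p hp := (hb.inverse i p hp).trans (by
    have : 0 ≤ ∫ x, evalAt p x ^ 2 ∂(T.vol i) := integral_nonneg fun x => sq_nonneg _
    gcongr)
  inverse_six i p hp := (hb.inverse_six i p hp).trans (by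
    have : 0 ≤ ∫ x, evalAt p x ^ 6 ∂(T.vol i) :=
      integral_nonneg fun x => Even.pow_nonneg (by decide) _
    gcongr)

namespace FESpaces

variable {d : ℕ} {Ω : Set (Space d)} {T : Mesh Ω} (S : FESpaces T)

theorem one_mem_W {i : Fin T.nK} {w : Poly d} (hw : w ∈ S.W i) (h0 : w ≠ 0) : 1 ∈ S.W i :=
  one_mem_of_pderiv_mem (S.pderiv_W i) hw h0

theorem traceK_mem {i : Fin T.nK} {w : Poly d} (hw : w ∈ S.W i) :
    T.traceK i w ∈ T.bdrySpace S.M i := by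
  have := (S.decomp i).1 0 (S.V i).zero_mem w hw
  rwa [map_zero, zero_add] at this

theorem ntr_mem {i : Fin T.nK} {v : T.HDiv i} (hv : v ∈ S.Vs i) :
    T.ntr i v ∈ T.bdrySpace S.M i := by
  have := (S.decomp_Vs i).1 v hv 0 (S.W i).zero_mem
  have h0 : T.traceK i 0 = 0 := by simpa using T.traceK_smul i 0 0
  rwa [h0, add_zero] at this

variable {S}

/-- For the constant one, the inverse inequality from `L²` to `L³` compares `|F| ^ (1/3)` with `h ^
(-(d-1)/6) |F| ^ (1/2)`, which is a lower bound for the area of the face. So `Λ` already excludes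
small faces, provided that constants belong to `M(F)`. -/
theorem HasParameters.pow_h_le {k : ℕ} {Λ : ℝ} (hS : S.HasParameters k Λ) (hd : 0 < d)
    {i : Fin T.nK} {j : Fin T.nF} (hj : j ∈ T.faces i)
    (h1 : polyL2 (T.carried_surf j) 1 ∈ S.M j) :
    T.h i ^ (d - 1) ≤ Λ ^ 6 * (T.surf j).real Set.univ := by
  set a := (T.surf j).real Set.univ with ha
  have hne : T.surf j Set.univ ≠ 0 := T.surf_ne_zero j isOpen_univ (by
    rw [Set.univ_inter]; exact (T.face_flat j).isConnected.nonempty)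
  have ha0 : 0 < a := ENNReal.toReal_pos hne (measure_ne_top _ _)
  have hh := T.h_pos hd i
  have hinv := hS.inverse i j hj _ h1
  have hn : ‖polyL2 (T.carried_surf j) 1‖ = √a := by
    rw [← Real.sqrt_sq (norm_nonneg _), norm_sq_polyL2]
    simp [ha]
  have he : eLpNorm (polyL2 (T.carried_surf j) (1 : Poly d)) 3 (T.surf j)
      = ENNReal.ofReal (a ^ (1 / 3 : ℝ)) := by
    have h2 : eLpNorm (polyL2 (T.carried_surf j) (1 : Poly d)) 3 (T.surf j)
        = eLpNorm (fun _ => (1 : ℝ)) 3 (T.surf j) := by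
      refine eLpNorm_congr_ae ?_
      filter_upwards [polyL2_coeFn (T.carried_surf j) (1 : Poly d)] with x hx
      rw [hx, evalAt_one]
    rw [h2, eLpNorm_const _ (by norm_num) (by
      intro h; rw [h] at hne; simp at hne), ← ENNReal.ofReal_rpow_of_nonneg ha0.le (by norm_num),
      ha, ofReal_measureReal]
    simp
  rw [he, hn] at hinv
  have h3 : a ^ (1 / 3 : ℝ) ≤ Λ * T.h i ^ (-((d : ℝ) - 1) / 6) * √a := by
    rcases ENNReal.ofReal_le_ofReal_iff'.1 hinv with h | h
    · exact h
    · exact absurd h (not_le.2 (Real.rpow_pos_of_pos ha0 _))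
  have h4 := pow_le_pow_left₀ (Real.rpow_nonneg ha0.le _) h3 6
  have e1 : (a ^ (1 / 3 : ℝ)) ^ 6 = a ^ 2 := by
    rw [← Real.rpow_mul_natCast ha0.le, ← Real.rpow_natCast]; norm_num
  have e2 : (T.h i ^ (-((d : ℝ) - 1) / 6)) ^ 6 = (T.h i ^ (d - 1))⁻¹ := by
    rw [← Real.rpow_mul_natCast hh.le, ← Real.rpow_natCast (T.h i) (d - 1),
      ← Real.rpow_neg hh.le, Nat.cast_sub hd]
    congr 1
    push_cast; ring
  have e3 : √a ^ 6 = a ^ 3 := by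
    rw [show √a ^ 6 = (√a ^ 2) ^ 3 by ring, Real.sq_sqrt ha0.le]
  rw [mul_pow, mul_pow, e1, e2, e3] at h4
  have hp : 0 < T.h i ^ (d - 1) := by positivity
  have h5 : a ^ 2 * T.h i ^ (d - 1) ≤ a ^ 2 * (Λ ^ 6 * a) := by
    calc a ^ 2 * T.h i ^ (d - 1) ≤ (Λ ^ 6 * (T.h i ^ (d - 1))⁻¹ * a ^ 3) * T.h i ^ (d - 1) := by
          gcongr
      _ = a ^ 2 * (Λ ^ 6 * a) := by field_simp
  exact le_of_mul_le_mul_left h5 (by positivity)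

/-- Elements that share a face have comparable diameters. -/
theorem HasParameters.h_le_mul_h {k : ℕ} {Λ C : ℝ} (hS : S.HasParameters k Λ) (hd : 2 ≤ d)
    (hb : T.Bounds k C) {i i' : Fin T.nK} {j : Fin T.nF} (hj : j ∈ T.faces i)
    (hj' : j ∈ T.faces i') {w : Poly d} (hw : w ∈ S.W i') (hw0 : w ≠ 0) :
    T.h i ≤ (1 + Λ ^ 6) * C * T.h i' := by
  have h0 : 0 < d := by omega
  have hh := T.h_pos h0 i
  have hh' := T.h_pos h0 i'
  have hC := hb.one_le
  have hΛ : 0 ≤ Λ ^ 6 := Even.pow_nonneg (by decide) _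
  -- A nonzero polynomial in `W` forces constants into `W` by differentiation, and then into `M(F)`
  -- because traces of `W` lie in `M(∂K)`.
  have h1 : polyL2 (T.carried_surf j) 1 ∈ S.M j := S.traceK_mem (S.one_mem_W hw hw0) ⟨j, hj'⟩
  have h2 := hS.pow_h_le h0 hj h1
  have h3 := hb.surf_le i' j hj'
  have hD : 1 ≤ (1 + Λ ^ 6) * C := by nlinarith
  rcases le_total (T.h i) (T.h i') with h | h
  · calc T.h i ≤ T.h i' := h
      _ ≤ (1 + Λ ^ 6) * C * T.h i' := le_mul_of_one_le_left hh'.le hD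
  · have ht : 1 ≤ T.h i / T.h i' := (one_le_div hh').2 h
    rw [← div_le_iff₀ hh']
    -- The ratio is at least one and `d - 1 ≥ 1`, so it is bounded by its own power, to which the
    -- area bounds from the two sides apply.
    calc T.h i / T.h i' ≤ (T.h i / T.h i') ^ (d - 1) := le_self_pow₀ ht (by omega)
      _ ≤ (1 + Λ ^ 6) * C := by
        rw [div_pow, div_le_iff₀ (by positivity)]
        calc T.h i ^ (d - 1) ≤ Λ ^ 6 * (C * T.h i' ^ (d - 1)) := h2.trans (by gcongr)
          _ ≤ (1 + Λ ^ 6) * C * T.h i' ^ (d - 1) := by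
            have : 0 ≤ C * T.h i' ^ (d - 1) := by positivity
            linarith

/-- A bound for the sums of powers of the maxima on the elements by the discrete energy. -/
structure Sobolev (S : FESpaces T) (C : ℝ) : Prop where
  pow_four : ∀ u : Fin T.nK → Poly d, (∀ i, u i ∈ S.W i) →
    ∀ m : (j : Fin T.nF) → Lp ℝ 2 (T.surf j), (∀ j, T.face j ⊆ frontier Ω → m j = 0) →
    ∑ i, T.h i ^ d * T.supNorm i (u i) ^ 4 ≤ C * T.scalarEnergy u m ^ 2
  norm_sq : ∀ u : Fin T.nK → Poly d, (∀ i, u i ∈ S.W i) →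
    ∀ m : (j : Fin T.nF) → Lp ℝ 2 (T.surf j), (∀ j, T.face j ⊆ frontier Ω → m j = 0) →
    ∑ i, ‖T.polyK i (u i)‖ ^ 2 ≤ C * T.scalarEnergy u m

end FESpaces

/-- The power mean inequality that lowers the exponent of an estimate. -/
theorem sum_mul_pow_le_of_sum_mul_pow_six_le {ι : Type*} [Fintype ι] {w a : ι → ℝ} {C K E : ℝ}
    (hw : ∀ i, 0 < w i) (ha : ∀ i, 0 ≤ a i) (hC : ∑ i, w i ≤ C) (hE : 0 ≤ E)
    (h : ∑ i, w i * a i ^ 6 ≤ K * E ^ 3) :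
    ∑ i, w i * a i ^ 4 ≤ (C + K) * E ^ 2 ∧ ∑ i, w i * a i ^ 2 ≤ (C + K) * E := by
  rcases hE.eq_or_lt with rfl | hpos
  · have h0 : ∀ i, a i = 0 := by
      intro i
      have h1 : ∑ i, w i * a i ^ 6 = 0 := le_antisymm (h.trans (by simp))
        (Finset.sum_nonneg fun i _ => mul_nonneg (hw i).le (pow_nonneg (ha i) 6))
      have h2 := (Finset.sum_eq_zero_iff_of_nonneg fun i _ =>
        mul_nonneg (hw i).le (pow_nonneg (ha i) 6)).1 h1 i (Finset.mem_univ i)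
      rcases mul_eq_zero.1 h2 with h3 | h3
      · exact absurd h3 (hw i).ne'
      · exact pow_eq_zero_iff (by norm_num) |>.1 h3
    simp [h0]
  -- A pointwise inequality of Young type, to be used with `e = E ^ (n/2)`: it holds through the
  -- first summand where `a² ≤ E` and through the second where `a² ≥ E`.
  · have key : ∀ n : ℕ, ∀ e : ℝ, 0 < e → (∀ i, a i ^ n ≤ e + a i ^ 6 * (e / E ^ 3)) →
        ∑ i, w i * a i ^ n ≤ (C + K) * e := by
      intro n e he hn
      calc ∑ i, w i * a i ^ n ≤ ∑ i, w i * (e + a i ^ 6 * (e / E ^ 3)) :=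
            Finset.sum_le_sum fun i _ => mul_le_mul_of_nonneg_left (hn i) (hw i).le
        _ = (∑ i, w i) * e + (∑ i, w i * a i ^ 6) * (e / E ^ 3) := by
            simp only [mul_add, Finset.sum_add_distrib, Finset.sum_mul, mul_assoc]
        _ ≤ C * e + (K * E ^ 3) * (e / E ^ 3) := by gcongr
        _ = (C + K) * e := by field_simp
    refine ⟨key 4 (E ^ 2) (by positivity) fun i => ?_, key 2 E hpos fun i => ?_⟩
    · have : a i ^ 6 * (E ^ 2 / E ^ 3) = a i ^ 6 / E := by field_simp
      rw [this]
      rcases le_total (a i ^ 2) E with h1 | h1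
      · have : a i ^ 4 ≤ E ^ 2 := by
          calc a i ^ 4 = (a i ^ 2) ^ 2 := by ring
            _ ≤ E ^ 2 := by gcongr
        have := div_nonneg (pow_nonneg (ha i) 6) hE
        linarith
      · have : a i ^ 4 ≤ a i ^ 6 / E := by
          rw [le_div_iff₀ hpos]
          calc a i ^ 4 * E ≤ a i ^ 4 * a i ^ 2 := by gcongr
            _ = a i ^ 6 := by ring
        have := sq_nonneg E
        linarith
    · have : a i ^ 6 * (E / E ^ 3) = a i ^ 6 / E ^ 2 := by field_simp
      rw [this]
      rcases le_total (a i ^ 2) E with h1 | h1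
      · have := div_nonneg (pow_nonneg (ha i) 6) (sq_nonneg E)
        linarith
      · have : a i ^ 2 ≤ a i ^ 6 / E ^ 2 := by
          rw [le_div_iff₀ (by positivity)]
          calc a i ^ 2 * E ^ 2 ≤ a i ^ 2 * (a i ^ 2) ^ 2 := by gcongr
            _ = a i ^ 6 := by ring
        linarith

theorem Mesh.Bounds.norm_sq_polyK_le {d : ℕ} {Ω : Set (Space d)} {T : Mesh Ω} {k : ℕ} {C : ℝ}
    (hb : T.Bounds k C) (i : Fin T.nK) (p : Poly d) :
    ‖T.polyK i p‖ ^ 2 ≤ C * (T.h i ^ d * T.supNorm i p ^ 2) := by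
  rw [T.norm_sq_polyK, ← mul_assoc]
  exact (integral_sq_le (T.ae_vol_abs_le i p)).trans
    (mul_le_mul_of_nonneg_right (hb.vol_le i) (sq_nonneg _))

/-- The factor `(1 + Λ ^ 6) * C` is the ratio of neighbouring diameters. The exponents four and two
follow from six because the weights `h ^ d` have bounded sum. -/
theorem FESpaces.exists_sobolev {d : ℕ} {Ω : Set (Space d)} (hd : d = 2 ∨ d = 3)
    (hΩ : IsPolyhedralDomain Ω) (k : ℕ) (Λ C : ℝ) :
    ∃ C' > 0, ∀ (T : Mesh Ω) (S : FESpaces T), T.Bounds k C → S.HasParameters k Λ →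
      S.Sobolev C' := by
  have hd2 : 2 ≤ d := by omega
  obtain ⟨K, hK0, hK⟩ := Mesh.exists_sobolev hd hΩ k ((1 + Λ ^ 6) * C)
  have hΛ : 0 ≤ Λ ^ 6 := Even.pow_nonneg (by decide) _
  refine ⟨(1 + |C|) * (|C| + K), by positivity, fun T S hb hS => ?_⟩
  have hC : 0 ≤ C := zero_le_one.trans hb.one_le
  have hbase : ∀ u : Fin T.nK → Poly d, (∀ i, u i ∈ S.W i) →
      ∀ m : (j : Fin T.nF) → Lp ℝ 2 (T.surf j), (∀ j, T.face j ⊆ frontier Ω → m j = 0) →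
      ∑ i, T.h i ^ d * T.supNorm i (u i) ^ 4 ≤ (C + K) * T.scalarEnergy u m ^ 2 ∧
      ∑ i, T.h i ^ d * T.supNorm i (u i) ^ 2 ≤ (C + K) * T.scalarEnergy u m := by
    intro u hu m hm
    refine sum_mul_pow_le_of_sum_mul_pow_six_le
      (fun i => pow_pos (T.h_pos (by omega) i) d) (fun i => T.supNorm_nonneg i _) hb.sum_le
      (T.scalarEnergy_nonneg u m) (hK T (hb.mono ?_) u (fun i => hS.degree i _ (hu i)) m hm ?_)
    · nlinarith
    · intro i i' j hj hj' h0
      exact hS.h_le_mul_h hd2 hb hj hj' (hu i') h0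
  rw [abs_of_nonneg hC]
  refine ⟨fun u hu m hm => (hbase u hu m hm).1.trans ?_, fun u hu m hm => ?_⟩
  · have := sq_nonneg (T.scalarEnergy u m)
    gcongr
    nlinarith
  · calc ∑ i, ‖T.polyK i (u i)‖ ^ 2 ≤ ∑ i, C * (T.h i ^ d * T.supNorm i (u i) ^ 2) :=
          Finset.sum_le_sum fun i _ => hb.norm_sq_polyK_le i (u i)
      _ = C * ∑ i, T.h i ^ d * T.supNorm i (u i) ^ 2 := by rw [Finset.mul_sum]
      _ ≤ C * ((C + K) * T.scalarEnergy u m) := by gcongr; exact (hbase u hu m hm).2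
      _ ≤ _ := by
        have := T.scalarEnergy_nonneg u m
        rw [← mul_assoc]
        gcongr
        linarith

end HDG

namespace HDG

/-! ### Consequences of the M-decomposition -/

namespace Mesh

variable {d : ℕ} {Ω : Set (Space d)} (T : Mesh Ω)

/-- The trace on `∂K` as a linear map. -/
noncomputable def traceMap (i : Fin T.nK) : Poly d →ₗ[ℝ] T.TraceL2 i where
  toFun := T.traceK i
  map_add' := T.traceK_add i
  map_smul' := T.traceK_smul i

@[simp] theorem traceK_zero (i : Fin T.nK) : T.traceK i 0 = 0 := (T.traceMap i).map_zero

/-- The vector fields in `V` with vanishing divergence and normal trace. -/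
noncomputable def bubbles (i : Fin T.nK) (V : Submodule ℝ (T.HDiv i)) : Submodule ℝ (T.HDiv i) :=
  V ⊓ LinearMap.ker (T.dvg i) ⊓ LinearMap.ker (T.ntr i)

theorem mem_bubbles {i : Fin T.nK} {V : Submodule ℝ (T.HDiv i)} {b : T.HDiv i} :
    b ∈ T.bubbles i V ↔ b ∈ V ∧ T.dvg i b = 0 ∧ T.ntr i b = 0 := by
  simp [bubbles, and_assoc]

/-- An element of `N` whose field is the orthogonal projection of `u` onto the fields of `N`. -/
theorem exists_mem_inner_eq {i : Fin T.nK} (N : Submodule ℝ (T.HDiv i)) [FiniteDimensional ℝ N]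
    (u : Lp (Space d) 2 (T.vol i)) :
    ∃ b ∈ N, ∀ v ∈ N, inner ℝ (T.field i b) (T.field i v) = inner ℝ u (T.field i v) := by
  obtain ⟨b, hb, hbu⟩ := Submodule.starProjection_apply_mem (N.map (T.field i)) u
  refine ⟨b, hb, fun v hv => ?_⟩
  rw [hbu, ← sub_eq_zero, ← inner_sub_left, ← neg_eq_zero, ← inner_neg_left, neg_sub]
  exact Submodule.starProjection_inner_eq_zero u _ (Submodule.mem_map_of_mem hv)

theorem inner_bubble_grad {i : Fin T.nK} {b : T.HDiv i} (h1 : T.dvg i b = 0) (h2 : T.ntr i b = 0)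
    (w : Poly d) : inner ℝ (T.field i b) (T.vecK i (grad w)) = 0 := by
  have := T.green b w
  rw [h1, h2, map_zero, inner_zero_left, inner_zero_left, add_zero] at this
  exact this

variable {T}

/-- Surjectivity of the trace gives `v` and `w`. Removing from `v` its projection onto the bubbles
leaves the normal trace unchanged, and keeps the orthogonality to `∇W` because bubbles are
orthogonal to gradients. -/
theorem AdmitsMDecomposition.exists_lift {i : Fin T.nK} {V : Submodule ℝ (T.HDiv i)}
    {W : Submodule ℝ (Poly d)} {Mb : Submodule ℝ (T.TraceL2 i)}
    (h : T.AdmitsMDecomposition i V W Mb) [FiniteDimensional ℝ V] {μ : T.TraceL2 i}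
    (hμ : μ ∈ Mb) : ∃ G ∈ V, ∃ w ∈ W, T.PerpGradBubble i V W (T.field i G) ∧ T.PerpDiv i V w ∧
      T.ntr i G + T.traceK i w = μ := by
  obtain ⟨-, Vt, Wt, -, -, hgrad, hdiv, hbij⟩ := h
  obtain ⟨⟨v, w⟩, ⟨⟨hv, hvt⟩, hw, hwt⟩, hz⟩ := hbij.surjOn hμ
  have hfin : FiniteDimensional ℝ (T.bubbles i V) :=
    Submodule.finiteDimensional_of_le (inf_le_left.trans inf_le_left : T.bubbles i V ≤ V)
  obtain ⟨b, hb, hbv⟩ := T.exists_mem_inner_eq (T.bubbles i V) (T.field i v)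
  have hb' := T.mem_bubbles.1 hb
  refine ⟨v - b, V.sub_mem hv hb'.1, w, hw, ⟨fun w' hw' => ?_, fun b' h1 h2 h3 => ?_⟩,
    fun v' hv' => hwt _ (hdiv v' hv'), ?_⟩
  · obtain ⟨v', hv', hvw⟩ := hgrad w' hw'
    rw [map_sub, inner_sub_left, T.inner_bubble_grad hb'.2.1 hb'.2.2, ← hvw, hvt v' hv', sub_zero]
  · rw [map_sub, inner_sub_left, hbv b' (T.mem_bubbles.2 ⟨h1, h2, h3⟩), sub_self]
  · rw [map_sub, hb'.2.2, sub_zero]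
    exact hz

theorem AdmitsMDecomposition.dvg_mem {i : Fin T.nK} {V : Submodule ℝ (T.HDiv i)}
    {W : Submodule ℝ (Poly d)} {Mb : Submodule ℝ (T.TraceL2 i)}
    (h : T.AdmitsMDecomposition i V W Mb) {v : T.HDiv i} (hv : v ∈ V) : T.dvg i v ∈ W := by
  obtain ⟨-, Vt, Wt, -, hWt, -, hdiv, -⟩ := h
  exact hWt (hdiv v hv)

theorem AdmitsMDecomposition.polyHDiv_grad_mem {i : Fin T.nK} {V : Submodule ℝ (T.HDiv i)}
    {W : Submodule ℝ (Poly d)} {Mb : Submodule ℝ (T.TraceL2 i)}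
    (h : T.AdmitsMDecomposition i V W Mb) {w : Poly d} (hw : w ∈ W) :
    T.polyHDiv i (grad w) ∈ V := by
  obtain ⟨-, Vt, Wt, hVt, -, hgrad, -, -⟩ := h
  obtain ⟨v, hv, hvw⟩ := hgrad w hw
  rw [← T.eq_polyHDiv hvw]
  exact hVt hv

/-- The normal trace is injective on the complement of `∇W` and of the bubbles. -/
theorem AdmitsMDecomposition.eq_zero_of_ntr_eq_zero {i : Fin T.nK} {V : Submodule ℝ (T.HDiv i)}
    {W : Submodule ℝ (Poly d)} {Mb : Submodule ℝ (T.TraceL2 i)}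
    (h : T.AdmitsMDecomposition i V W Mb) {v : T.HDiv i} (hv : v ∈ V)
    (hp : T.PerpGradBubble i V W (T.field i v)) (h0 : T.ntr i v = 0) : T.field i v = 0 := by
  -- Green's formula tested with `w = ∇·v`, which is in `W`, leaves only the squared norm of the
  -- divergence. Then `v` is itself a bubble, hence orthogonal to itself.
  have h1 : T.dvg i v = 0 := by
    have := T.green v (T.dvg i v)
    rw [hp.1 _ (h.dvg_mem hv), h0, inner_zero_left, zero_add] at this
    exact T.poly_eq_zero_of_polyK (inner_self_eq_zero.1 this)
  exact inner_self_eq_zero.1 (hp.2 v hv h1 h0)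

theorem Bounds.norm_sq_traceK_le {k : ℕ} {C : ℝ} (hb : T.Bounds k C) (i : Fin T.nK) (p : Poly d) :
    ‖T.traceK i p‖ ^ 2 ≤ C ^ 2 * (T.h i ^ (d - 1) * T.supNorm i p ^ 2) := by
  have hC : 0 ≤ C := zero_le_one.trans hb.one_le
  have hh := T.h_nonneg i
  rw [norm_sq_traceL2]
  calc ∑ j, ‖T.traceK i p j‖ ^ 2 ≤ ∑ j : T.faces i, C * T.h i ^ (d - 1) * T.supNorm i p ^ 2 := by
        refine Finset.sum_le_sum fun j _ => ?_
        rw [traceK_apply, norm_sq_polyL2]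
        refine (integral_sq_le (T.ae_surf_abs_le j p)).trans ?_
        have := hb.surf_le i j j.2
        gcongr
    _ = (T.faces i).card * (C * T.h i ^ (d - 1) * T.supNorm i p ^ 2) := by simp
    _ ≤ C * (C * T.h i ^ (d - 1) * T.supNorm i p ^ 2) := by
        have := hb.card_le i
        gcongr
    _ = _ := by ring

/-- The discrete trace inequality. -/
theorem Bounds.norm_sq_traceK_le_polyK {k : ℕ} {C : ℝ} (hb : T.Bounds k C) (hd : 0 < d)
    (i : Fin T.nK) {p : Poly d} (hp : p.totalDegree ≤ k) :
    ‖T.traceK i p‖ ^ 2 ≤ C ^ 3 * (T.h i)⁻¹ * ‖T.polyK i p‖ ^ 2 := by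
  have hC : 0 ≤ C := zero_le_one.trans hb.one_le
  have hh := T.h_pos hd i
  have h1 := hb.inverse i p hp
  rw [← T.norm_sq_polyK] at h1
  have h2 : T.h i ^ (d - 1) * T.supNorm i p ^ 2 = (T.h i)⁻¹ * (T.h i ^ d * T.supNorm i p ^ 2) := by
    rw [← pow_sub_one_mul hd.ne' (T.h i)]
    field_simp
  calc ‖T.traceK i p‖ ^ 2 ≤ C ^ 2 * (T.h i ^ (d - 1) * T.supNorm i p ^ 2) :=
        hb.norm_sq_traceK_le i p
    _ = C ^ 2 * ((T.h i)⁻¹ * (T.h i ^ d * T.supNorm i p ^ 2)) := by rw [h2]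
    _ ≤ C ^ 2 * ((T.h i)⁻¹ * (C * ‖T.polyK i p‖ ^ 2)) := by gcongr
    _ = _ := by ring

theorem Bounds.norm_sq_normalTrace_le {k : ℕ} {C : ℝ} (hb : T.Bounds k C) (hd : 0 < d)
    (i : Fin T.nK) {v : Fin d → Poly d} (hv : ∀ r, (v r).totalDegree ≤ k) :
    ‖T.normalTrace i v‖ ^ 2 ≤ d * C ^ 3 * (T.h i)⁻¹ * ‖T.vecK i v‖ ^ 2 := by
  calc ‖T.normalTrace i v‖ ^ 2 ≤ (∑ r, ‖T.traceK i (v r)‖) ^ 2 := by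
        gcongr
        exact (norm_sum_le _ _).trans (Finset.sum_le_sum fun r _ => T.norm_mulNormal_le i r _)
    _ ≤ d * ∑ r, ‖T.traceK i (v r)‖ ^ 2 := by
        have := sq_sum_le_card_mul_sum_sq (s := Finset.univ) (f := fun r => ‖T.traceK i (v r)‖)
        simpa using this
    _ ≤ d * ∑ r, C ^ 3 * (T.h i)⁻¹ * ‖T.polyK i (v r)‖ ^ 2 := by
        gcongr with r
        exact hb.norm_sq_traceK_le_polyK hd i (hv r)
    _ = _ := by rw [norm_sq_vecK, ← Finset.mul_sum]; ring

end Mesh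

namespace FESpaces

variable {d : ℕ} {Ω : Set (Space d)} {T : Mesh Ω} {S : FESpaces T}

/-- The divergence maps `V*` onto `W`, so the scalar part of the lifting, being orthogonal to all
divergences, vanishes. Normal traces alone exhaust `M(∂K)`. -/
theorem exists_lift_Vs (S : FESpaces T) {i : Fin T.nK} {μ : T.TraceL2 i}
    (hμ : μ ∈ T.bdrySpace S.M i) :
    ∃ G ∈ S.Vs i, T.PerpGradBubble i (S.Vs i) (S.W i) (T.field i G) ∧ T.ntr i G = μ := by
  have := S.finite_Vs i
  obtain ⟨G, hG, w, hw, h1, h2, h3⟩ := (S.decomp_Vs i).exists_lift hμ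
  refine ⟨G, hG, h1, ?_⟩
  rw [← S.div_Vs i] at hw
  obtain ⟨v, hv, rfl⟩ := hw
  rw [T.poly_eq_zero_of_polyK (inner_self_eq_zero.1 (h2 v hv)), T.traceK_zero, add_zero] at h3
  exact h3

/-- The gradient equation on one element, after integration by parts. -/
theorem inner_sub_inner_grad_add_inner_jump {i : Fin T.nK} {L : Lp (Space d) 2 (T.vol i)}
    {u : Poly d} {μ : T.TraceL2 i} {G : T.HDiv i}
    (h : inner ℝ L (T.field i G) + inner ℝ (T.polyK i u) (T.polyK i (T.dvg i G))
      - inner ℝ μ (T.ntr i G) = 0) :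
    inner ℝ L (T.field i G) - inner ℝ (T.vecK i (grad u)) (T.field i G)
      + inner ℝ (T.traceK i u - μ) (T.ntr i G) = 0 := by
  have h2 := T.green G u
  rw [real_inner_comm, real_inner_comm (T.polyK i u), real_inner_comm (T.traceK i u)] at h2
  rw [inner_sub_left]
  linarith

/-- The control of the jump by the velocity gradient and by the minimal stabilization, on one
element. -/
theorem HasParameters.jump_coercivity {k : ℕ} {Λ : ℝ} (hS : S.HasParameters k Λ)
    (hd : 0 < d) {i : Fin T.nK} {L : Lp (Space d) 2 (T.vol i)} {u : Poly d}
    (hu : u ∈ S.W i) {e : T.TraceL2 i} (heM : e ∈ T.bdrySpace S.M i)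
    (h' : ∀ G ∈ S.V i, inner ℝ L (T.field i G) - inner ℝ (T.vecK i (grad u)) (T.field i G)
      + inner ℝ e (T.ntr i G) = 0) :
    (T.h i)⁻¹ * ‖e‖ ^ 2 ≤ (Λ ^ 2 + 2 * Λ ^ 2 * (1 + Λ ^ 2))
      * (‖L‖ ^ 2 + (T.h i)⁻¹ * ‖(S.MS i).starProjection e‖ ^ 2) := by
  have hh := T.h_pos hd i
  have := S.finite_V i
  obtain ⟨G, hG, w, hw, hperp, hwp, hGw⟩ := (S.decomp i).exists_lift heM
  set a := T.ntr i G
  set b := T.traceK i w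
  -- By Green's formula: `G` is orthogonal to gradients and `w` to divergences. The jump is thus
  -- split orthogonally into a normal trace `a` and a scalar trace `b`.
  have hab : inner ℝ a b = 0 := by
    rw [← T.green G w, hperp.1 w hw, real_inner_comm, hwp G hG, add_zero]
  have hesq : ‖e‖ ^ 2 = ‖a‖ ^ 2 + ‖b‖ ^ 2 := by
    rw [← hGw, norm_add_sq_real, hab]; ring
  -- The gradient equation tested with `G`: the term with `∇u` drops out by orthogonality, and `‖a‖²
  -- = -(L, G)` remains. The case `a = 0` is separate because `‖a‖` is cancelled and `Λ` is not
  -- assumed nonnegative.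
  have h1 : ‖a‖ ≤ Λ * √(T.h i) * ‖L‖ ∨ a = 0 := by
    have h2 := h' G hG
    have h3 : inner ℝ e a = ‖a‖ ^ 2 := by
      rw [← hGw, inner_add_left, real_inner_self_eq_norm_sq, real_inner_comm, hab, add_zero]
    rw [h3, real_inner_comm (T.field i G) (T.vecK i (grad u)), hperp.1 u hu, sub_zero] at h2
    have h4 : ‖a‖ ^ 2 ≤ ‖L‖ * (Λ * √(T.h i) * ‖a‖) := by
      calc ‖a‖ ^ 2 = -inner ℝ L (T.field i G) := by linarith
        _ ≤ ‖L‖ * ‖T.field i G‖ := (neg_le_abs _).trans (abs_real_inner_le_norm _ _)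
        _ ≤ ‖L‖ * (Λ * √(T.h i) * ‖a‖) := by
          gcongr
          exact hS.lift_V i G hG hperp
    rcases (norm_nonneg a).eq_or_lt with h5 | h5
    · exact Or.inr (norm_eq_zero.1 h5.symm)
    · left
      have h6 : ‖a‖ * ‖a‖ ≤ (Λ * √(T.h i) * ‖L‖) * ‖a‖ := by nlinarith
      exact le_of_mul_le_mul_right h6 h5
  have ha : (T.h i)⁻¹ * ‖a‖ ^ 2 ≤ Λ ^ 2 * ‖L‖ ^ 2 := by
    rcases h1 with h1 | h1
    · calc (T.h i)⁻¹ * ‖a‖ ^ 2 ≤ (T.h i)⁻¹ * (Λ * √(T.h i) * ‖L‖) ^ 2 := by gcongr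
        _ = (T.h i)⁻¹ * (Λ ^ 2 * √(T.h i) ^ 2 * ‖L‖ ^ 2) := by ring
        _ = Λ ^ 2 * ‖L‖ ^ 2 := by rw [Real.sq_sqrt hh.le]; field_simp
    · rw [h1]
      simp only [norm_zero, ne_eq, OfNat.ofNat_ne_zero, not_false_eq_true, zero_pow, mul_zero]
      positivity
  -- The scalar part is what the stabilization controls; `b = e - a` replaces its projection by that
  -- of the whole jump, at the cost of `a`.
  have hbb : ‖b‖ ^ 2 ≤ 2 * Λ ^ 2 * (‖(S.MS i).starProjection e‖ ^ 2 + ‖a‖ ^ 2) := by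
    have h2 := hS.stab i w hw hwp
    have h3 : ‖(S.MS i).starProjection b‖ ≤ ‖(S.MS i).starProjection e‖ + ‖a‖ := by
      have h4 : b = e - a := by rw [← hGw]; abel
      rw [h4, map_sub]
      refine (norm_sub_le _ _).trans ?_
      gcongr
      exact Submodule.norm_starProjection_apply_le _ _
    calc ‖b‖ ^ 2 ≤ (Λ * ‖(S.MS i).starProjection b‖) ^ 2 := by gcongr
      _ = Λ ^ 2 * ‖(S.MS i).starProjection b‖ ^ 2 := by ring
      _ ≤ Λ ^ 2 * (‖(S.MS i).starProjection e‖ + ‖a‖) ^ 2 := by gcongr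
      _ ≤ Λ ^ 2 * (2 * (‖(S.MS i).starProjection e‖ ^ 2 + ‖a‖ ^ 2)) := by
        gcongr
        exact add_sq_le
      _ = _ := by ring
  set P := (T.h i)⁻¹ * ‖(S.MS i).starProjection e‖ ^ 2 with hP
  have hP0 : 0 ≤ P := by positivity
  have h2 : (T.h i)⁻¹ * ‖b‖ ^ 2 ≤ 2 * Λ ^ 2 * (P + Λ ^ 2 * ‖L‖ ^ 2) := by
    calc (T.h i)⁻¹ * ‖b‖ ^ 2
        ≤ (T.h i)⁻¹ * (2 * Λ ^ 2 * (‖(S.MS i).starProjection e‖ ^ 2 + ‖a‖ ^ 2)) := by gcongr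
      _ = 2 * Λ ^ 2 * (P + (T.h i)⁻¹ * ‖a‖ ^ 2) := by rw [hP]; ring
      _ ≤ _ := by gcongr
  rw [hesq, mul_add]
  have h5 : 0 ≤ Λ ^ 2 * P := by positivity
  have h6 : 0 ≤ Λ ^ 2 * (Λ ^ 2 * P) := by positivity
  have h7 : 0 ≤ Λ ^ 2 * ‖L‖ ^ 2 := by positivity
  nlinarith

/-- Young's inequality, in a form that also allows `q = 0`. The share `g ^ 2 / 4` is small enough to
be absorbed. -/
theorem mul_le_of_sq_le {x y g q : ℝ} (hq : 0 ≤ q) (hy : y ^ 2 ≤ q * g ^ 2) :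
    x * y ≤ q * x ^ 2 + g ^ 2 / 4 := by
  rcases hq.eq_or_lt with rfl | hq
  · have : y = 0 := by nlinarith
    rw [this, mul_zero]
    positivity
  · have h1 : y ^ 2 / (4 * q) ≤ g ^ 2 / 4 := by
      rw [div_le_div_iff₀ (by positivity) (by norm_num)]
      linarith
    have h2 : q * x ^ 2 + y ^ 2 / (4 * q) - x * y = (2 * q * x - y) ^ 2 / (4 * q) := by
      field_simp; ring
    have : 0 ≤ (2 * q * x - y) ^ 2 / (4 * q) := by positivity
    linarith

/-- The control of the broken gradient by the velocity gradient and by the jump, on one element. -/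
theorem HasParameters.grad_coercivity {k : ℕ} {Λ C : ℝ} (hS : S.HasParameters k Λ)
    (hb : T.Bounds k C) (hd : 0 < d) {i : Fin T.nK} {L : Lp (Space d) 2 (T.vol i)} {u : Poly d}
    (hu : u ∈ S.W i) {e : T.TraceL2 i}
    (h' : ∀ G ∈ S.V i, inner ℝ L (T.field i G) - inner ℝ (T.vecK i (grad u)) (T.field i G)
      + inner ℝ e (T.ntr i G) = 0) :
    ‖T.vecK i (grad u)‖ ^ 2 ≤ 2 * ‖L‖ ^ 2 + 2 * d * C ^ 3 * ((T.h i)⁻¹ * ‖e‖ ^ 2) := by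
  have hC : 0 ≤ C := zero_le_one.trans hb.one_le
  have hh := T.h_pos hd i
  -- The gradient equation tested with `∇u` itself, which is in `V`. Its normal trace is controlled
  -- by the discrete trace inequality, as its components are polynomials of degree at most `k`.
  have h2 := h' _ ((S.decomp i).polyHDiv_grad_mem hu)
  rw [T.field_polyHDiv, T.ntr_polyHDiv, real_inner_self_eq_norm_sq] at h2
  have hdeg : ∀ r, (grad u r).totalDegree ≤ k := fun r => hS.degree i _ (S.pderiv_W i u hu r)
  have h3 := hb.norm_sq_normalTrace_le hd i hdeg
  have h4 := (le_abs_self _).trans (abs_real_inner_le_norm L (T.vecK i (grad u)))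
  have h5 := (le_abs_self _).trans (abs_real_inner_le_norm e (T.normalTrace i (grad u)))
  have h6 := mul_le_of_sq_le (x := ‖e‖) (by positivity) h3
  have h7 : ‖L‖ * ‖T.vecK i (grad u)‖ ≤ ‖L‖ ^ 2 + ‖T.vecK i (grad u)‖ ^ 2 / 4 := by
    have := sq_nonneg (2 * ‖L‖ - ‖T.vecK i (grad u)‖)
    linarith
  linarith

/-- The control of the velocity by the velocity gradient and by the minimal stabilization, on one
element. -/
theorem HasParameters.local_coercivity {k : ℕ} {Λ C : ℝ} (hS : S.HasParameters k Λ)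
    (hb : T.Bounds k C) (hd : 0 < d) {i : Fin T.nK} {L : Lp (Space d) 2 (T.vol i)} {u : Poly d}
    (hu : u ∈ S.W i) {μ : T.TraceL2 i} (hμ : μ ∈ T.bdrySpace S.M i)
    (h : ∀ G ∈ S.V i, inner ℝ L (T.field i G) + inner ℝ (T.polyK i u) (T.polyK i (T.dvg i G))
      - inner ℝ μ (T.ntr i G) = 0) :
    ‖T.vecK i (grad u)‖ ^ 2 + (T.h i)⁻¹ * ‖T.traceK i u - μ‖ ^ 2
      ≤ (2 + (1 + 2 * d * C ^ 3) * (Λ ^ 2 + 2 * Λ ^ 2 * (1 + Λ ^ 2)))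
        * (‖L‖ ^ 2 + (T.h i)⁻¹ * ‖(S.MS i).starProjection (T.traceK i u - μ)‖ ^ 2) := by
  have hh := T.h_pos hd i
  have hC : 0 ≤ C := zero_le_one.trans hb.one_le
  have h' := fun G hG => inner_sub_inner_grad_add_inner_jump (h G hG)
  have hej := hS.jump_coercivity hd hu (Submodule.sub_mem _ (S.traceK_mem hu) hμ) h'
  have hgr := hS.grad_coercivity hb hd hu h'
  set P := (T.h i)⁻¹ * ‖(S.MS i).starProjection (T.traceK i u - μ)‖ ^ 2 with hP
  have hP0 : 0 ≤ P := by positivity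
  set Q := (T.h i)⁻¹ * ‖T.traceK i u - μ‖ ^ 2
  calc ‖T.vecK i (grad u)‖ ^ 2 + Q ≤ 2 * ‖L‖ ^ 2 + (1 + 2 * d * C ^ 3) * Q := by linarith
    _ ≤ 2 * (‖L‖ ^ 2 + P) + (1 + 2 * d * C ^ 3) * ((Λ ^ 2 + 2 * Λ ^ 2 * (1 + Λ ^ 2))
      * (‖L‖ ^ 2 + P)) := by gcongr; linarith
    _ = _ := by ring

end FESpaces

end HDG

namespace HDG

/-! ### Existence of parameters -/

namespace Mesh

variable {d : ℕ} {Ω : Set (Space d)} (T : Mesh Ω)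

theorem exists_isShapeRegular (hd : 0 < d) : ∃ σ > 0, T.IsShapeRegular σ := by
  have h : ∀ᶠ σ : ℝ in atTop, T.IsShapeRegular σ := by
    refine eventually_all.2 fun i => Filter.Eventually.and ?_ (eventually_ge_atTop _)
    obtain ⟨x, hx⟩ := T.elem_nonempty i
    obtain ⟨r, hr, hxr⟩ := Metric.isOpen_iff.1 (T.elem_polyhedral i).isOpen x hx
    filter_upwards [eventually_ge_atTop (T.h i / r)] with σ hσ
    refine ⟨x, (Metric.ball_subset_ball ?_).trans hxr⟩
    have hh := T.h_pos hd i
    have hσ0 : 0 < σ := (div_pos hh hr).trans_le hσ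
    rw [div_le_iff₀ hr] at hσ
    rw [div_le_iff₀ hσ0]
    linarith
  obtain ⟨σ, hσ, h0⟩ := (h.and (eventually_gt_atTop 0)).exists
  exact ⟨σ, h0, hσ⟩

/-- The complement of `∇W ⊕ {b ∈ V : ∇·b = 0, b·n = 0}` in `V`. -/
noncomputable def complement (i : Fin T.nK) (V : Submodule ℝ (T.HDiv i))
    (W : Submodule ℝ (Poly d)) : Submodule ℝ (T.HDiv i) where
  carrier := {v | v ∈ V ∧ T.PerpGradBubble i V W (T.field i v)}
  zero_mem' := ⟨V.zero_mem, fun w _ => by rw [map_zero, inner_zero_left],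
    fun b _ _ _ => by rw [map_zero, inner_zero_left]⟩
  add_mem' {a b} ha hb := ⟨V.add_mem ha.1 hb.1, fun w hw => by
    rw [map_add, inner_add_left, ha.2.1 w hw, hb.2.1 w hw, add_zero], fun c h1 h2 h3 => by
    rw [map_add, inner_add_left, ha.2.2 c h1 h2 h3, hb.2.2 c h1 h2 h3, add_zero]⟩
  smul_mem' t a ha := ⟨V.smul_mem t ha.1, fun w hw => by
    rw [map_smul, real_inner_smul_left, ha.2.1 w hw, mul_zero], fun c h1 h2 h3 => by
    rw [map_smul, real_inner_smul_left, ha.2.2 c h1 h2 h3, mul_zero]⟩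

/-- The normal trace is injective on a finite-dimensional complement, so some constant exists. It is
stated for all large `Λ` so that finitely many such conditions can share one value. -/
theorem eventually_lift (hd : 0 < d) {i : Fin T.nK} {V : Submodule ℝ (T.HDiv i)}
    [hV : FiniteDimensional ℝ V] {W : Submodule ℝ (Poly d)} {Mb : Submodule ℝ (T.TraceL2 i)}
    (h : T.AdmitsMDecomposition i V W Mb) :
    ∀ᶠ Λ : ℝ in atTop, ∀ v ∈ V, T.PerpGradBubble i V W (T.field i v) →
      ‖T.field i v‖ ≤ Λ * √(T.h i) * ‖T.ntr i v‖ := by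
  have hfin : FiniteDimensional ℝ (T.complement i V W) :=
    Submodule.finiteDimensional_of_le (fun v hv => hv.1 : T.complement i V W ≤ V)
  obtain ⟨f, hf⟩ : ∃ f : T.complement i V W →ₗ[ℝ] T.TraceL2 i, ∀ v, f v = T.ntr i v :=
    ⟨(T.ntr i).domRestrict _, fun _ => rfl⟩
  obtain ⟨g, hg⟩ : ∃ g : T.complement i V W →ₗ[ℝ] Lp (Space d) 2 (T.vol i),
      ∀ v, g v = T.field i v := ⟨(T.field i).domRestrict _, fun _ => rfl⟩
  obtain ⟨C, hC, hCv⟩ := exists_norm_le_mul_norm (V := T.complement i V W)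
      (E := T.TraceL2 i) (F := Lp (Space d) 2 (T.vol i)) f g fun v hv => by
    rw [hg]
    exact h.eq_zero_of_ntr_eq_zero v.2.1 v.2.2 (by rwa [hf] at hv)
  have hh := Real.sqrt_pos.2 (T.h_pos hd i)
  filter_upwards [eventually_ge_atTop (C / √(T.h i))] with Λ hΛ v hv hp
  have h1 := hCv ⟨v, hv, hp⟩
  rw [hf, hg] at h1
  refine h1.trans ?_
  rw [div_le_iff₀ hh] at hΛ
  exact mul_le_mul_of_nonneg_right hΛ (norm_nonneg _)

end Mesh

namespace FESpaces

variable {d : ℕ} {Ω : Set (Space d)} {T : Mesh Ω} (S : FESpaces T)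

theorem exists_totalDegree_le {W : Submodule ℝ (Poly d)} [hW : FiniteDimensional ℝ W] :
    ∃ k : ℕ, ∀ w ∈ W, w.totalDegree ≤ k := by
  obtain ⟨s, hs⟩ := (Submodule.fg_iff_finiteDimensional W).2 hW
  refine ⟨s.sup MvPolynomial.totalDegree, fun w hw => ?_⟩
  have hle : W ≤ MvPolynomial.restrictTotalDegree (Fin d) ℝ (s.sup MvPolynomial.totalDegree) := by
    rw [← hs, Submodule.span_le]
    intro p hp
    exact (MvPolynomial.mem_restrictTotalDegree _ _ _).2 (Finset.le_sup (f := MvPolynomial.totalDegree) hp)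
  exact (MvPolynomial.mem_restrictTotalDegree _ _ _).1 (hle hw)

theorem eventually_stab (i : Fin T.nK) :
    ∀ᶠ Λ : ℝ in atTop, ∀ w ∈ S.W i, T.PerpDiv i (S.V i) w →
      ‖T.traceK i w‖ ≤ Λ * ‖(S.MS i).starProjection (T.traceK i w)‖ := by
  let P : Submodule ℝ (Poly d) :=
    { carrier := {w | w ∈ S.W i ∧ T.PerpDiv i (S.V i) w}
      zero_mem' := ⟨(S.W i).zero_mem, fun v _ => by rw [map_zero, inner_zero_left]⟩
      add_mem' := fun {a b} ha hb => ⟨(S.W i).add_mem ha.1 hb.1, fun v hv => by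
        rw [map_add, inner_add_left, ha.2 v hv, hb.2 v hv, add_zero]⟩
      smul_mem' := fun t a ha => ⟨(S.W i).smul_mem t ha.1, fun v hv => by
        rw [map_smul, real_inner_smul_left, ha.2 v hv, mul_zero]⟩ }
  have := S.finite_W i
  have hfin : FiniteDimensional ℝ P :=
    Submodule.finiteDimensional_of_le (fun v hv => hv.1 : P ≤ S.W i)
  obtain ⟨C, hC, hCv⟩ := exists_norm_le_mul_norm
    ((S.MS i).starProjection.toLinearMap ∘ₗ T.traceMap i ∘ₗ P.subtype)
    (T.traceMap i ∘ₗ P.subtype) fun w hw => by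
      have : (w : Poly d) = 0 := S.norm_MS i w w.2.1 w.2.2 hw
      simp [this]
  filter_upwards [eventually_ge_atTop C] with Λ hΛ w hw hp
  exact (hCv ⟨w, hw, hp⟩).trans (mul_le_mul_of_nonneg_right hΛ (norm_nonneg _))

theorem eventually_inverse (hd : 0 < d) (i : Fin T.nK) (j : Fin T.nF) :
    ∀ᶠ Λ : ℝ in atTop, ∀ μ ∈ S.M j,
      eLpNorm μ 3 (T.surf j) ≤ ENNReal.ofReal (Λ * T.h i ^ (-((d : ℝ) - 1) / 6) * ‖μ‖) := by
  have := S.finite_M j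
  have : Fact ((1 : ℝ≥0∞) ≤ 3) := ⟨by norm_num⟩
  let g : S.M j →ₗ[ℝ] Lp ℝ 3 (T.surf j) :=
    { toFun := fun μ => (S.memLp_M j μ μ.2).toLp μ
      map_add' := fun a b => by
        rw [← MemLp.toLp_add]
        exact MemLp.toLp_congr _ _ (Lp.coeFn_add _ _)
      map_smul' := fun c a => by
        rw [RingHom.id_apply, ← MemLp.toLp_const_smul]
        exact MemLp.toLp_congr _ _ (Lp.coeFn_smul _ _) }
  obtain ⟨C, hC, hCv⟩ := exists_norm_le_mul_norm (S.M j).subtype g fun μ hμ => by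
    have : μ = 0 := Subtype.ext hμ
    rw [this, map_zero]
  have hp : 0 < T.h i ^ (-((d : ℝ) - 1) / 6) := Real.rpow_pos_of_pos (T.h_pos hd i) _
  filter_upwards [eventually_ge_atTop (C / T.h i ^ (-((d : ℝ) - 1) / 6))] with Λ hΛ μ hμ
  rw [div_le_iff₀ hp] at hΛ
  have h1 := hCv ⟨μ, hμ⟩
  have h2 : eLpNorm μ 3 (T.surf j) = ENNReal.ofReal ‖g ⟨μ, hμ⟩‖ := by
    rw [Lp.norm_def, ENNReal.ofReal_toReal (Lp.eLpNorm_ne_top _)]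
    exact (eLpNorm_congr_ae (S.memLp_M j μ hμ).coeFn_toLp).symm
  rw [h2]
  exact ENNReal.ofReal_le_ofReal (h1.trans (mul_le_mul_of_nonneg_right hΛ (norm_nonneg _)))

theorem exists_hasParameters (hd : 0 < d) : ∃ (k : ℕ) (Λ : ℝ), S.HasParameters k Λ := by
  have h1 : ∀ i, ∃ k : ℕ, ∀ w ∈ S.W i, w.totalDegree ≤ k := fun i =>
    exists_totalDegree_le (hW := S.finite_W i)
  choose k hk using h1
  have h2 := eventually_all.2 fun i =>
    T.eventually_lift (hV := S.finite_V i) hd (S.decomp i)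
  have h3 := eventually_all.2 fun i =>
    T.eventually_lift (hV := S.finite_Vs i) hd (S.decomp_Vs i)
  have h4 := eventually_all.2 fun i => S.eventually_stab i
  have h5 := eventually_all.2 fun i => eventually_all.2 fun j => S.eventually_inverse hd i j
  obtain ⟨Λ, ⟨⟨h2, h3⟩, h4⟩, h5⟩ := (((h2.and h3).and h4).and h5).exists
  exact ⟨Finset.univ.sup k, Λ, fun i w hw => (hk i w hw).trans (Finset.le_sup (Finset.mem_univ i)),
    h2, h3, h4, fun i j _ => h5 i j⟩

end FESpaces

end HDG

namespace HDG

/-! ### The linear structure of the space of tuples -/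

namespace Mesh

variable {d : ℕ} {Ω : Set (Space d)} (T : Mesh Ω)

/-- The product with a component of the normal as a linear map. -/
noncomputable def mulNormalMap (i : Fin T.nK) (r : Fin d) :
    T.TraceL2 i →ₗ[ℝ] T.TraceL2 i where
  toFun := T.mulNormal i r
  map_add' a b := by ext1 j; exact smul_add _ _ _
  map_smul' c a := by ext1 j; exact smul_comm (T.normal i j r) c (a j)

/-- The gradients as elements of `H(div, K)`. -/
noncomputable def gradHDiv (i : Fin T.nK) :
    Poly d →ₗ[ℝ] T.HDiv i where
  toFun p := T.polyHDiv i (grad p)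
  map_add' p q := T.field_injective i (by
    rw [map_add, T.field_polyHDiv, T.field_polyHDiv, T.field_polyHDiv, grad_add, T.vecK_add])
  map_smul' c p := T.field_injective i (by
    rw [RingHom.id_apply, map_smul, T.field_polyHDiv, T.field_polyHDiv, grad_smul, T.vecK_smul])

theorem integral_evalAt (i : Fin T.nK) (p : Poly d) :
    ∫ x, evalAt p x ∂(T.vol i) = inner ℝ (T.polyK i p) (T.polyK i 1) := by
  rw [T.inner_polyK]; simp

end Mesh

namespace Tuple

variable {d : ℕ} {Ω : Set (Space d)} {T : Mesh Ω}

/-- A tuple as an element of a product. -/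
def equivProd : Tuple T ≃ ((i : Fin T.nK) → Fin d → T.HDiv i) × ((i : Fin T.nK) → Fin d → Poly d) ×
    ((i : Fin T.nK) → Poly d) × ((j : Fin T.nF) → Fin d → Lp ℝ 2 (T.surf j)) where
  toFun X := (X.L, X.u, X.p, X.uhat)
  invFun Y := ⟨Y.1, Y.2.1, Y.2.2.1, Y.2.2.2⟩
  left_inv _ := rfl
  right_inv _ := rfl

noncomputable instance : AddCommGroup (Tuple T) := equivProd.addCommGroup

noncomputable instance : Module ℝ (Tuple T) := equivProd.module ℝ

variable (X Y : Tuple T) (c : ℝ)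

@[simp] theorem L_add : (X + Y).L = X.L + Y.L := rfl
@[simp] theorem u_add : (X + Y).u = X.u + Y.u := rfl
@[simp] theorem p_add : (X + Y).p = X.p + Y.p := rfl
@[simp] theorem uhat_add : (X + Y).uhat = X.uhat + Y.uhat := rfl
@[simp] theorem u_sub : (X - Y).u = X.u - Y.u := rfl
@[simp] theorem uhat_sub : (X - Y).uhat = X.uhat - Y.uhat := rfl
@[simp] theorem L_smul : (c • X).L = c • X.L := rfl
@[simp] theorem u_smul : (c • X).u = c • X.u := rfl
@[simp] theorem p_smul : (c • X).p = c • X.p := rfl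
@[simp] theorem uhat_smul : (c • X).uhat = c • X.uhat := rfl
@[simp] theorem L_zero : (0 : Tuple T).L = 0 := rfl
@[simp] theorem u_zero : (0 : Tuple T).u = 0 := rfl
@[simp] theorem p_zero : (0 : Tuple T).p = 0 := rfl
@[simp] theorem uhat_zero : (0 : Tuple T).uhat = 0 := rfl

theorem ext_iff' : X = Y ↔ X.L = Y.L ∧ X.u = Y.u ∧ X.p = Y.p ∧ X.uhat = Y.uhat := by
  cases X; cases Y; simp

/-- The trace of a component of `û` as a linear map. -/
noncomputable def hatTrMap (i : Fin T.nK) (r : Fin d) : Tuple T →ₗ[ℝ] T.TraceL2 i where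
  toFun X := X.hatTr i r
  map_add' _ _ := rfl
  map_smul' _ _ := rfl

/-- The jump as a linear map. -/
noncomputable def jumpMap (i : Fin T.nK) (r : Fin d) : Tuple T →ₗ[ℝ] T.TraceL2 i where
  toFun X := X.jump i r
  map_add' X Y := by
    have := (hatTrMap i r).map_add X Y
    change T.traceK i (X.u i r + Y.u i r) - hatTrMap i r (X + Y)
      = (T.traceK i (X.u i r) - hatTrMap i r X) + (T.traceK i (Y.u i r) - hatTrMap i r Y)
    rw [T.traceK_add, this]; abel
  map_smul' c X := by
    have := (hatTrMap i r).map_smul c X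
    change T.traceK i (c • X.u i r) - hatTrMap i r (c • X)
      = c • (T.traceK i (X.u i r) - hatTrMap i r X)
    rw [T.traceK_smul, this, smul_sub]

/-- The normal component of `û` as a linear map. -/
noncomputable def hatNormalMap (i : Fin T.nK) : Tuple T →ₗ[ℝ] T.TraceL2 i :=
  ∑ r, T.mulNormalMap i r ∘ₗ hatTrMap i r

theorem hatNormalMap_apply (i : Fin T.nK) : hatNormalMap i X = X.hatNormal i := by
  simp only [hatNormalMap, LinearMap.sum_apply]
  rfl

variable {X Y}

theorem hatTr_add (i : Fin T.nK) (r : Fin d) :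
    (X + Y).hatTr i r = X.hatTr i r + Y.hatTr i r := (hatTrMap i r).map_add X Y
theorem hatTr_smul (i : Fin T.nK) (r : Fin d) :
    (c • X).hatTr i r = c • X.hatTr i r := (hatTrMap i r).map_smul c X
theorem jump_add (i : Fin T.nK) (r : Fin d) :
    (X + Y).jump i r = X.jump i r + Y.jump i r := (jumpMap i r).map_add X Y
theorem jump_smul (i : Fin T.nK) (r : Fin d) :
    (c • X).jump i r = c • X.jump i r := (jumpMap i r).map_smul c X
theorem hatNormal_add (i : Fin T.nK) : (X + Y).hatNormal i = X.hatNormal i + Y.hatNormal i := by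
  simp only [← hatNormalMap_apply, map_add]
theorem hatNormal_sub (i : Fin T.nK) : (X - Y).hatNormal i = X.hatNormal i - Y.hatNormal i := by
  simp only [← hatNormalMap_apply, map_sub]
theorem hatNormal_smul (i : Fin T.nK) : (c • X).hatNormal i = c • X.hatNormal i := by
  simp only [← hatNormalMap_apply, map_smul]

theorem normOne_sq : X.normOne ^ 2 = ∑ r, T.scalarEnergy (fun i => X.u i r) fun j => X.uhat j r := by
  rw [normOne, Real.sq_sqrt]
  · rfl
  · exact Finset.sum_nonneg fun r _ => T.scalarEnergy_nonneg (fun i => X.u i r) fun j => X.uhat j r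

theorem normOne_nonneg : 0 ≤ X.normOne := Real.sqrt_nonneg _

end Tuple

namespace FESpaces

variable {d : ℕ} {Ω : Set (Space d)} {T : Mesh Ω} (S : FESpaces T)

/-- The space `𝒢_h × V_h × Q̊_h × M_h(0)`. -/
noncomputable def memSubmodule : Submodule ℝ (Tuple T) where
  carrier := {X | S.Mem X}
  zero_mem' := ⟨fun _ _ => zero_mem _, fun _ _ => zero_mem _, fun _ => zero_mem _, by simp,
    fun _ _ => zero_mem _, fun _ _ _ => rfl⟩
  add_mem' {X Y} hX hY := ⟨fun i r => add_mem (hX.L i r) (hY.L i r),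
    fun i r => add_mem (hX.u i r) (hY.u i r), fun i => add_mem (hX.p i) (hY.p i), by
      have h1 := hX.mean_p
      have h2 := hY.mean_p
      simp only [T.integral_evalAt] at h1 h2 ⊢
      simp only [Tuple.p_add, Pi.add_apply, map_add, inner_add_left, Finset.sum_add_distrib, h1, h2,
        add_zero],
    fun j r => add_mem (hX.uhat j r) (hY.uhat j r), fun j hj r => by
      rw [Tuple.uhat_add, Pi.add_apply, Pi.add_apply, hX.boundary j hj r, hY.boundary j hj r,
        add_zero]⟩
  smul_mem' c X hX := ⟨fun i r => Submodule.smul_mem _ c (hX.L i r),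
    fun i r => Submodule.smul_mem _ c (hX.u i r), fun i => Submodule.smul_mem _ c (hX.p i), by
      have h1 := hX.mean_p
      simp only [T.integral_evalAt] at h1 ⊢
      simp only [Tuple.p_smul, Pi.smul_apply, map_smul, real_inner_smul_left, ← Finset.mul_sum, h1,
        mul_zero],
    fun j r => Submodule.smul_mem _ c (hX.uhat j r), fun j hj r => by
      rw [Tuple.uhat_smul, Pi.smul_apply, Pi.smul_apply, hX.boundary j hj r, smul_zero]⟩

variable {S}

theorem Mem.sub {X Y : Tuple T} (hX : S.Mem X) (hY : S.Mem Y) : S.Mem (X - Y) :=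
  S.memSubmodule.sub_mem hX hY

theorem Mem.hatTr_mem {X : Tuple T} (hX : S.Mem X) (i : Fin T.nK) (r : Fin d) :
    X.hatTr i r ∈ T.bdrySpace S.M i := fun j => hX.uhat j r

theorem Mem.jump_mem {X : Tuple T} (hX : S.Mem X) (i : Fin T.nK) (r : Fin d) :
    X.jump i r ∈ T.bdrySpace S.M i :=
  Submodule.sub_mem _ (S.traceK_mem (hX.u i r)) (hX.hatTr_mem i r)

theorem mulNormal_mem {i : Fin T.nK} {τ : T.TraceL2 i} (hτ : τ ∈ T.bdrySpace S.M i) (r : Fin d) :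
    T.mulNormal i r τ ∈ T.bdrySpace S.M i := fun j => (S.M j).smul_mem _ (hτ j)

theorem Mem.hatNormal_mem {X : Tuple T} (hX : S.Mem X) (i : Fin T.nK) :
    X.hatNormal i ∈ T.bdrySpace S.M i :=
  Submodule.sum_mem _ fun r _ => mulNormal_mem (hX.hatTr_mem i r) r

/-! ### The post-processed velocity -/

/-- The space `∇W ⊕ {b ∈ Vs : ∇·b = 0, b·n = 0}`. -/
noncomputable def interiorSpace (S : FESpaces T) (i : Fin T.nK) : Submodule ℝ (T.HDiv i) :=
  (S.W i).map (T.gradHDiv i) ⊔ T.bubbles i (S.Vs i)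

theorem interiorSpace_le (S : FESpaces T) (i : Fin T.nK) : S.interiorSpace i ≤ S.Vs i := by
  refine sup_le ?_ (inf_le_left.trans inf_le_left)
  rintro _ ⟨w, hw, rfl⟩
  exact (S.decomp_Vs i).polyHDiv_grad_mem hw

theorem perpGradBubble_of_interiorSpace {i : Fin T.nK} {g : Lp (Space d) 2 (T.vol i)}
    (h : ∀ v ∈ S.interiorSpace i, inner ℝ g (T.field i v) = 0) :
    T.PerpGradBubble i (S.Vs i) (S.W i) g := by
  refine ⟨fun w hw => ?_, fun b h1 h2 h3 => h b ?_⟩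
  · rw [← T.field_polyHDiv]
    exact h _ (Submodule.mem_sup_left ⟨w, hw, rfl⟩)
  · exact Submodule.mem_sup_right (T.mem_bubbles.2 ⟨h1, h2, h3⟩)

theorem inner_eq_of_interiorSpace {i : Fin T.nK} {g g' : Lp (Space d) 2 (T.vol i)}
    (h1 : ∀ w ∈ S.W i, inner ℝ g (T.vecK i (grad w)) = inner ℝ g' (T.vecK i (grad w)))
    (h2 : ∀ b ∈ S.Vs i, T.dvg i b = 0 → T.ntr i b = 0 →
      inner ℝ g (T.field i b) = inner ℝ g' (T.field i b)) {v : T.HDiv i}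
    (hv : v ∈ S.interiorSpace i) : inner ℝ g (T.field i v) = inner ℝ g' (T.field i v) := by
  obtain ⟨_, ⟨w, hw, rfl⟩, b, hb, rfl⟩ := Submodule.mem_sup.1 hv
  have hb' := T.mem_bubbles.1 hb
  rw [map_add, inner_add_right, inner_add_right, h2 b hb'.1 hb'.2.1 hb'.2.2]
  congr 1
  change inner ℝ g (T.field i (T.polyHDiv i (grad w))) = inner ℝ g' (T.field i (T.polyHDiv i (grad w)))
  rw [T.field_polyHDiv, h1 w hw]

/-- The interior moments are met by projecting `u` onto gradients plus bubbles. The normal trace is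
then corrected by a lifting orthogonal to that space, which leaves the moments unchanged. -/
theorem exists_isPostprocessed {X : Tuple T} (hX : S.Mem X) : ∃ β, S.IsPostprocessed X β := by
  have h : ∀ i, ∃ β ∈ S.Vs i, T.ntr i β = X.hatNormal i ∧ ∀ v ∈ S.interiorSpace i,
      inner ℝ (T.field i β) (T.field i v) = inner ℝ (T.vecK i (X.u i)) (T.field i v) := by
    intro i
    have := S.finite_Vs i
    have : FiniteDimensional ℝ (S.interiorSpace i) :=
      Submodule.finiteDimensional_of_le (S.interiorSpace_le i)
    obtain ⟨b, hb, hbu⟩ := T.exists_mem_inner_eq (S.interiorSpace i) (T.vecK i (X.u i))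
    have hbV := S.interiorSpace_le i hb
    obtain ⟨G, hG, hGp, hGn⟩ := S.exists_lift_Vs
      (Submodule.sub_mem _ (hX.hatNormal_mem i) (S.ntr_mem hbV))
    refine ⟨b + G, add_mem hbV hG, by rw [map_add, hGn]; abel, fun v hv => ?_⟩
    have h0 : inner ℝ (T.field i G) (T.field i v) = 0 := by
      have := inner_eq_of_interiorSpace (S := S) (g := T.field i G) (g' := 0)
        (fun w hw => by rw [hGp.1 w hw, inner_zero_left])
        (fun b h1 h2 h3 => by rw [hGp.2 b h1 h2 h3, inner_zero_left]) hv
      rw [this, inner_zero_left]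
    rw [map_add, inner_add_left, h0, add_zero, hbu v hv]
  choose β h1 h2 h3 using h
  refine ⟨β, h1, fun i w hw => ?_, fun i b hb hb1 hb2 => ?_, fun i μ _ => by rw [h2]⟩
  · rw [← T.field_polyHDiv]
    exact h3 i _ (Submodule.mem_sup_left ⟨w, hw, rfl⟩)
  · exact h3 i b (Submodule.mem_sup_right (T.mem_bubbles.2 ⟨hb, hb1, hb2⟩))

/-- Post-processing is linear in `(u, û)`; bounds for single velocities therefore become Lipschitz
bounds. -/
theorem IsPostprocessed.sub {X Y : Tuple T} {β γ : (i : Fin T.nK) → T.HDiv i}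
    (hβ : S.IsPostprocessed X β) (hγ : S.IsPostprocessed Y γ) :
    S.IsPostprocessed (X - Y) (β - γ) := by
  have hu : ∀ i, T.vecK i ((X - Y).u i) = T.vecK i (X.u i) - T.vecK i (Y.u i) := by
    intro i
    have : (X - Y).u i = X.u i + (-1 : ℝ) • Y.u i := by
      rw [Tuple.u_sub, Pi.sub_apply, neg_one_smul, sub_eq_add_neg]
    rw [this, T.vecK_add, T.vecK_smul, neg_one_smul, sub_eq_add_neg]
  refine ⟨fun i => sub_mem (hβ.mem i) (hγ.mem i), fun i w hw => ?_, fun i b h1 h2 h3 => ?_,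
    fun i μ hμ => ?_⟩
  · rw [hu, Pi.sub_apply, map_sub, inner_sub_left, inner_sub_left, hβ.grad i w hw, hγ.grad i w hw]
  · rw [hu, Pi.sub_apply, map_sub, inner_sub_left, inner_sub_left, hβ.bubble i b h1 h2 h3,
      hγ.bubble i b h1 h2 h3]
  · rw [Tuple.hatNormal_sub, Pi.sub_apply, map_sub, inner_sub_left, inner_sub_left,
      hβ.trace i μ hμ, hγ.trace i μ hμ]

/-- Both sides lie in `M(∂K)`, so equality of their moments against `M(∂K)` is equality. -/
theorem IsPostprocessed.ntr_eq {X : Tuple T} {β : (i : Fin T.nK) → T.HDiv i}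
    (hβ : S.IsPostprocessed X β) (hX : S.Mem X) (i : Fin T.nK) :
    T.ntr i (β i) = X.hatNormal i := by
  rw [← sub_eq_zero, ← inner_self_eq_zero (𝕜 := ℝ), inner_sub_left, sub_eq_zero]
  exact hβ.trace i _ (Submodule.sub_mem _ (S.ntr_mem (hβ.mem i)) (hX.hatNormal_mem i))

/-- The difference of two candidates has zero normal trace and is orthogonal to gradients and
bubbles, a complement on which the normal trace is injective. -/
theorem IsPostprocessed.unique {X : Tuple T} {β γ : (i : Fin T.nK) → T.HDiv i} (hX : S.Mem X)
    (hβ : S.IsPostprocessed X β) (hγ : S.IsPostprocessed X γ) : β = γ := by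
  ext1 i
  have h1 : T.ntr i (β i - γ i) = 0 := by
    rw [map_sub, hβ.ntr_eq hX, hγ.ntr_eq hX, sub_self]
  have h2 := (S.decomp_Vs i).eq_zero_of_ntr_eq_zero (sub_mem (hβ.mem i) (hγ.mem i))
    ⟨fun w hw => by rw [map_sub, inner_sub_left, hβ.grad i w hw, hγ.grad i w hw, sub_self],
      fun b h1 h2 h3 => by
        rw [map_sub, inner_sub_left, hβ.bubble i b h1 h2 h3, hγ.bubble i b h1 h2 h3, sub_self]⟩ h1
  exact sub_eq_zero.1 (T.field_injective i (h2.trans (map_zero _).symm))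

/-- The post-processed velocity is bounded by the velocity and its normal trace. -/
theorem HasParameters.norm_postprocessed_le {k : ℕ} {Λ C : ℝ} (hS : S.HasParameters k Λ)
    (hb : T.Bounds k C) (hd : 0 < d) {X : Tuple T} (hX : S.Mem X)
    {β : (i : Fin T.nK) → T.HDiv i} (hβ : S.IsPostprocessed X β) (i : Fin T.nK) :
    ‖T.field i (β i)‖ ≤ (1 + |Λ| * √(d * C ^ 3)) * ‖T.vecK i (X.u i)‖
      + |Λ| * (√(T.h i) * ‖X.hatNormal i‖) := by
  have hh := T.h_pos hd i
  have hC : 0 ≤ C := zero_le_one.trans hb.one_le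
  have := S.finite_Vs i
  have : FiniteDimensional ℝ (S.interiorSpace i) :=
    Submodule.finiteDimensional_of_le (S.interiorSpace_le i)
  -- The projection `b` of `β` onto gradients plus bubbles is bounded by `u`, since its moments are
  -- those of `u`. The remainder is orthogonal to that space and is bounded by its normal trace.
  obtain ⟨b, hbN, hbu⟩ := T.exists_mem_inner_eq (S.interiorSpace i) (T.field i (β i))
  have hbV := S.interiorSpace_le i hbN
  have hperp : T.PerpGradBubble i (S.Vs i) (S.W i) (T.field i (β i - b)) :=
    perpGradBubble_of_interiorSpace fun v hv => by rw [map_sub, inner_sub_left, hbu v hv, sub_self]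
  have h1 := hS.lift_Vs i _ (sub_mem (hβ.mem i) hbV) hperp
  have h2 : ‖T.field i b‖ ≤ ‖T.vecK i (X.u i)‖ := by
    have h3 : inner ℝ (T.field i b) (T.field i b) = inner ℝ (T.vecK i (X.u i)) (T.field i b) := by
      rw [hbu b hbN]
      exact inner_eq_of_interiorSpace (fun w hw => hβ.grad i w hw)
        (fun b h1 h2 h3 => hβ.bubble i b h1 h2 h3) hbN
    have h4 := (le_abs_self _).trans (abs_real_inner_le_norm (T.vecK i (X.u i)) (T.field i b))
    rw [← h3, real_inner_self_eq_norm_sq] at h4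
    rcases (norm_nonneg (T.field i b)).eq_or_lt with h5 | h5
    · rw [← h5]; exact norm_nonneg _
    · exact le_of_mul_le_mul_right (by rwa [← sq]) h5
  -- Only the gradient part of `b` has a normal trace, and it is polynomial, so the discrete trace
  -- inequality applies although bubbles need not be polynomial. Orthogonality of gradients and
  -- bubbles lets the full norm of `b` replace that of the gradient part.
  have h6 : √(T.h i) * ‖T.ntr i b‖ ≤ √(d * C ^ 3) * ‖T.field i b‖ := by
    obtain ⟨_, ⟨w, hw, rfl⟩, b', hb', rfl⟩ := Submodule.mem_sup.1 hbN
    have hb'' := T.mem_bubbles.1 hb'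
    change √(T.h i) * ‖T.ntr i (T.polyHDiv i (grad w) + b')‖
      ≤ √(d * C ^ 3) * ‖T.field i (T.polyHDiv i (grad w) + b')‖
    rw [map_add, hb''.2.2, add_zero, T.ntr_polyHDiv, map_add, T.field_polyHDiv]
    have h7 : ‖T.vecK i (grad w)‖ ^ 2 ≤ ‖T.vecK i (grad w) + T.field i b'‖ ^ 2 := by
      rw [norm_add_sq_real, real_inner_comm, T.inner_bubble_grad hb''.2.1 hb''.2.2]
      linarith [sq_nonneg ‖T.field i b'‖]
    have h8 := hb.norm_sq_normalTrace_le hd i (v := grad w) fun r =>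
      hS.degree i _ (S.pderiv_W i w hw r)
    refine (pow_le_pow_iff_left₀ (by positivity) (by positivity) two_ne_zero).1 ?_
    rw [mul_pow, mul_pow, Real.sq_sqrt hh.le, Real.sq_sqrt (by positivity)]
    calc T.h i * ‖T.normalTrace i (grad w)‖ ^ 2
        ≤ T.h i * (d * C ^ 3 * (T.h i)⁻¹ * ‖T.vecK i (grad w)‖ ^ 2) := by gcongr
      _ = d * C ^ 3 * ‖T.vecK i (grad w)‖ ^ 2 := by field_simp
      _ ≤ _ := by gcongr
  have h9 : ‖T.field i (β i - b)‖ ≤ |Λ| * (√(T.h i) * ‖X.hatNormal i‖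
      + √(d * C ^ 3) * ‖T.vecK i (X.u i)‖) := by
    calc ‖T.field i (β i - b)‖ ≤ |Λ| * √(T.h i) * ‖T.ntr i (β i - b)‖ := by
          refine h1.trans ?_
          gcongr
          exact le_abs_self _
      _ ≤ |Λ| * √(T.h i) * (‖X.hatNormal i‖ + ‖T.ntr i b‖) := by
          rw [map_sub, hβ.ntr_eq hX]
          gcongr
          exact norm_sub_le _ _
      _ = |Λ| * (√(T.h i) * ‖X.hatNormal i‖ + √(T.h i) * ‖T.ntr i b‖) := by ring
      _ ≤ |Λ| * (√(T.h i) * ‖X.hatNormal i‖ + √(d * C ^ 3) * ‖T.vecK i (X.u i)‖) := by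
          exact mul_le_mul_of_nonneg_left (add_le_add le_rfl
            (h6.trans (mul_le_mul_of_nonneg_left h2 (Real.sqrt_nonneg _)))) (abs_nonneg _)
  calc ‖T.field i (β i)‖ = ‖T.field i b + T.field i (β i - b)‖ := by rw [← map_add]; congr 2; abel
    _ ≤ ‖T.field i b‖ + ‖T.field i (β i - b)‖ := norm_add_le _ _
    _ ≤ ‖T.vecK i (X.u i)‖ + |Λ| * (√(T.h i) * ‖X.hatNormal i‖
      + √(d * C ^ 3) * ‖T.vecK i (X.u i)‖) := add_le_add h2 h9
    _ = _ := by ring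

end FESpaces

end HDG

namespace HDG

/-! ### The convective form -/

/-- The product of three nonnegative numbers is at most the sum of their cubes. The assumption `M(F)
⊂ L³(F)` enters through this lemma, since convective face terms are trilinear. -/
theorem integrable_mul_mul {α : Type*} [MeasurableSpace α] {μ : Measure α} [IsFiniteMeasure μ]
    {f g h : α → ℝ} (hf : MemLp f 3 μ) (hg : MemLp g 3 μ) (hh : MemLp h 3 μ) :
    Integrable (fun x => f x * g x * h x) μ := by
  have h3 : ∀ {f : α → ℝ}, MemLp f 3 μ → Integrable (fun x => ‖f x‖ ^ 3) μ := fun hf =>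
    MemLp.integrable_norm_pow (p := 3) (by exact_mod_cast hf) (by norm_num)
  refine (((h3 hf).add (h3 hg)).add (h3 hh)).mono' ((hf.1.mul hg.1).mul hh.1)
    (ae_of_all _ fun x => ?_)
  simp only [Pi.add_apply, norm_mul]
  have key : ∀ a b c : ℝ, 0 ≤ a → 0 ≤ b → 0 ≤ c → a * b * c ≤ a ^ 3 + b ^ 3 + c ^ 3 := by
    intro a b c ha hb hc
    nlinarith [mul_nonneg (add_nonneg (add_nonneg ha hb) hc) (add_nonneg (add_nonneg
      (sq_nonneg (a - b)) (sq_nonneg (b - c))) (sq_nonneg (a - c))), mul_nonneg (mul_nonneg ha hb) hc]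
  exact key _ _ _ (norm_nonneg _) (norm_nonneg _) (norm_nonneg _)

namespace Mesh

variable {d : ℕ} {Ω : Set (Space d)} (T : Mesh Ω)

/-- The convective term on an element. -/
noncomputable def volForm (i : Fin T.nK) (g : Lp (Space d) 2 (T.vol i)) (p q : Poly d) : ℝ :=
  ∫ x, evalAt p x * inner ℝ (g x) (vecAt (grad q) x) ∂(T.vol i)

/-- The convective term on a face. -/
noncomputable def faceForm (j : Fin T.nF) (b : Space d → ℝ) (p : Poly d) (m : Lp ℝ 2 (T.surf j))
    (q : Poly d) (l : Lp ℝ 2 (T.surf j)) : ℝ :=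
  ∫ x, (b x * m x + max (b x) 0 * (evalAt p x - m x)) * (evalAt q x - l x) ∂(T.surf j)

theorem convectiveForm_eq (β : (i : Fin T.nK) → T.HDiv i) (X Y : Tuple T) :
    FESpaces.convectiveForm β X Y = ∑ i, ∑ r, (-T.volForm i (T.field i (β i)) (X.u i r) (Y.u i r)
      + ∑ j : T.faces i, T.faceForm j (T.ntr i (β i) j) (X.u i r) (X.uhat j r) (Y.u i r)
        (Y.uhat j r)) := rfl

theorem volForm_eq_inner (i : Fin T.nK) (g : Lp (Space d) 2 (T.vol i)) (p q : Poly d) :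
    T.volForm i g p q = inner ℝ g (T.vecK i fun s => p * grad q s) := by
  rw [inner_vecK_right, volForm]
  refine integral_congr_ae (ae_of_all _ fun x => ?_)
  have : vecAt (fun s => p * grad q s) x = evalAt p x • vecAt (grad q) x := by
    ext s; simp
  simp only [this, inner_smul_right]

theorem volForm_add_left (i : Fin T.nK) (g : Lp (Space d) 2 (T.vol i)) (p p' q : Poly d) :
    T.volForm i g (p + p') q = T.volForm i g p q + T.volForm i g p' q := by
  have : (fun s => (p + p') * grad q s) = (fun s => p * grad q s) + fun s => p' * grad q s := by
    ext1 s; simp [add_mul]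
  simp only [volForm_eq_inner, this, vecK_add, inner_add_right]

theorem volForm_smul_left (i : Fin T.nK) (g : Lp (Space d) 2 (T.vol i)) (c : ℝ) (p q : Poly d) :
    T.volForm i g (c • p) q = c * T.volForm i g p q := by
  have : (fun s => (c • p) * grad q s) = c • fun s => p * grad q s := by
    ext1 s; simp
  simp only [volForm_eq_inner, this, vecK_smul, inner_smul_right]

theorem volForm_add_right (i : Fin T.nK) (g : Lp (Space d) 2 (T.vol i)) (p q q' : Poly d) :
    T.volForm i g p (q + q') = T.volForm i g p q + T.volForm i g p q' := by
  have : (fun s => p * grad (q + q') s) = (fun s => p * grad q s) + fun s => p * grad q' s := by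
    ext1 s; simp [grad_add, mul_add]
  simp only [volForm_eq_inner, this, vecK_add, inner_add_right]

theorem volForm_smul_right (i : Fin T.nK) (g : Lp (Space d) 2 (T.vol i)) (c : ℝ) (p q : Poly d) :
    T.volForm i g p (c • q) = c * T.volForm i g p q := by
  have : (fun s => p * grad (c • q) s) = c • fun s => p * grad q s := by
    ext1 s; simp [grad_smul]
  simp only [volForm_eq_inner, this, vecK_smul, inner_smul_right]

variable {T}

theorem memLp_three_evalAt {j : Fin T.nF} (p : Poly d) : MemLp (evalAt p) 3 (T.surf j) :=
  (T.carried_surf j).memLp (continuous_evalAt p) 3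

theorem memLp_three_sub {j : Fin T.nF} (p : Poly d) {m : Lp ℝ 2 (T.surf j)}
    (hm : MemLp m 3 (T.surf j)) : MemLp (fun x => evalAt p x - m x) 3 (T.surf j) :=
  (memLp_three_evalAt p).sub hm

theorem memLp_max_zero {j : Fin T.nF} {b : Space d → ℝ} (hb : MemLp b 3 (T.surf j)) :
    MemLp (fun x => max (b x) 0) 3 (T.surf j) := hb.pos_part

theorem integrable_faceForm {j : Fin T.nF} {b : Space d → ℝ} (hb : MemLp b 3 (T.surf j))
    (p : Poly d) {m : Lp ℝ 2 (T.surf j)} (hm : MemLp m 3 (T.surf j)) (q : Poly d)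
    {l : Lp ℝ 2 (T.surf j)} (hl : MemLp l 3 (T.surf j)) :
    Integrable (fun x => (b x * m x + max (b x) 0 * (evalAt p x - m x)) * (evalAt q x - l x))
      (T.surf j) := by
  have h1 := integrable_mul_mul hb hm (memLp_three_sub q hl)
  have h2 := integrable_mul_mul (memLp_max_zero hb) (memLp_three_sub p hm) (memLp_three_sub q hl)
  refine (h1.add h2).congr (ae_of_all _ fun x => ?_)
  simp only [Pi.add_apply]
  ring

theorem faceForm_add_left {j : Fin T.nF} {b : Space d → ℝ} (hb : MemLp b 3 (T.surf j))
    (p p' : Poly d) {m m' : Lp ℝ 2 (T.surf j)} (hm : MemLp m 3 (T.surf j))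
    (hm' : MemLp m' 3 (T.surf j)) (q : Poly d) {l : Lp ℝ 2 (T.surf j)}
    (hl : MemLp l 3 (T.surf j)) :
    T.faceForm j b (p + p') (m + m') q l = T.faceForm j b p m q l + T.faceForm j b p' m' q l := by
  unfold faceForm
  rw [← integral_add (integrable_faceForm hb p hm q hl) (integrable_faceForm hb p' hm' q hl)]
  refine integral_congr_ae ?_
  filter_upwards [Lp.coeFn_add m m'] with x hx
  rw [hx, Pi.add_apply, evalAt_add]
  ring

theorem faceForm_smul_left {j : Fin T.nF} {b : Space d → ℝ} (c : ℝ)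
    (p : Poly d) (m : Lp ℝ 2 (T.surf j)) (q : Poly d) (l : Lp ℝ 2 (T.surf j)) :
    T.faceForm j b (c • p) (c • m) q l = c * T.faceForm j b p m q l := by
  unfold faceForm
  rw [← integral_const_mul]
  refine integral_congr_ae ?_
  filter_upwards [Lp.coeFn_smul c m] with x hx
  rw [hx, Pi.smul_apply, evalAt_smul, smul_eq_mul]
  ring

theorem faceForm_add_right {j : Fin T.nF} {b : Space d → ℝ} (hb : MemLp b 3 (T.surf j))
    (p : Poly d) {m : Lp ℝ 2 (T.surf j)} (hm : MemLp m 3 (T.surf j)) (q q' : Poly d)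
    {l l' : Lp ℝ 2 (T.surf j)} (hl : MemLp l 3 (T.surf j)) (hl' : MemLp l' 3 (T.surf j)) :
    T.faceForm j b p m (q + q') (l + l') = T.faceForm j b p m q l + T.faceForm j b p m q' l' := by
  unfold faceForm
  rw [← integral_add (integrable_faceForm hb p hm q hl) (integrable_faceForm hb p hm q' hl')]
  refine integral_congr_ae ?_
  filter_upwards [Lp.coeFn_add l l'] with x hx
  rw [hx, Pi.add_apply, evalAt_add]
  ring

theorem faceForm_smul_right {j : Fin T.nF} {b : Space d → ℝ} (c : ℝ)
    (p : Poly d) (m : Lp ℝ 2 (T.surf j)) (q : Poly d) (l : Lp ℝ 2 (T.surf j)) :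
    T.faceForm j b p m (c • q) (c • l) = c * T.faceForm j b p m q l := by
  unfold faceForm
  rw [← integral_const_mul]
  refine integral_congr_ae ?_
  filter_upwards [Lp.coeFn_smul c l] with x hx
  rw [hx, Pi.smul_apply, evalAt_smul, smul_eq_mul]
  ring

end Mesh

namespace FESpaces

variable {d : ℕ} {Ω : Set (Space d)} {T : Mesh Ω} {S : FESpaces T}

theorem Mem.memLp_uhat {X : Tuple T} (hX : S.Mem X) (j : Fin T.nF) (r : Fin d) :
    MemLp (X.uhat j r) 3 (T.surf j) := S.memLp_M j _ (hX.uhat j r)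

theorem memLp_ntr {i : Fin T.nK} {v : T.HDiv i} (hv : v ∈ S.Vs i) (j : T.faces i) :
    MemLp (T.ntr i v j) 3 (T.surf j) := S.memLp_M j _ (S.ntr_mem hv j)

theorem convectiveForm_add_left {β : (i : Fin T.nK) → T.HDiv i} (hβ : ∀ i, β i ∈ S.Vs i)
    {X X' Y : Tuple T} (hX : S.Mem X) (hX' : S.Mem X') (hY : S.Mem Y) :
    convectiveForm β (X + X') Y = convectiveForm β X Y + convectiveForm β X' Y := by
  simp only [T.convectiveForm_eq, ← Finset.sum_add_distrib]
  refine Finset.sum_congr rfl fun i _ => Finset.sum_congr rfl fun r _ => ?_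
  have h1 := T.volForm_add_left i (T.field i (β i)) (X.u i r) (X'.u i r) (Y.u i r)
  have h2 := fun j : T.faces i => Mesh.faceForm_add_left (memLp_ntr (hβ i) j) (X.u i r) (X'.u i r)
    (hX.memLp_uhat j r) (hX'.memLp_uhat j r) (Y.u i r) (hY.memLp_uhat j r)
  simp only [Tuple.u_add, Tuple.uhat_add, Pi.add_apply, h1, h2, Finset.sum_add_distrib]
  ring

theorem convectiveForm_smul_left (β : (i : Fin T.nK) → T.HDiv i) (c : ℝ) (X Y : Tuple T) :
    convectiveForm β (c • X) Y = c * convectiveForm β X Y := by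
  simp only [T.convectiveForm_eq, Finset.mul_sum]
  refine Finset.sum_congr rfl fun i _ => Finset.sum_congr rfl fun r _ => ?_
  simp only [Tuple.u_smul, Tuple.uhat_smul, Pi.smul_apply, T.volForm_smul_left,
    Mesh.faceForm_smul_left, ← Finset.mul_sum]
  ring

theorem convectiveForm_add_right {β : (i : Fin T.nK) → T.HDiv i} (hβ : ∀ i, β i ∈ S.Vs i)
    {X Y Y' : Tuple T} (hX : S.Mem X) (hY : S.Mem Y) (hY' : S.Mem Y') :
    convectiveForm β X (Y + Y') = convectiveForm β X Y + convectiveForm β X Y' := by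
  simp only [T.convectiveForm_eq, ← Finset.sum_add_distrib]
  refine Finset.sum_congr rfl fun i _ => Finset.sum_congr rfl fun r _ => ?_
  have h1 := T.volForm_add_right i (T.field i (β i)) (X.u i r) (Y.u i r) (Y'.u i r)
  have h2 := fun j : T.faces i => Mesh.faceForm_add_right (memLp_ntr (hβ i) j) (X.u i r)
    (hX.memLp_uhat j r) (Y.u i r) (Y'.u i r) (hY.memLp_uhat j r) (hY'.memLp_uhat j r)
  simp only [Tuple.u_add, Tuple.uhat_add, Pi.add_apply, h1, h2, Finset.sum_add_distrib]
  ring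

theorem convectiveForm_smul_right (β : (i : Fin T.nK) → T.HDiv i) (c : ℝ) (X Y : Tuple T) :
    convectiveForm β X (c • Y) = c * convectiveForm β X Y := by
  simp only [T.convectiveForm_eq, Finset.mul_sum]
  refine Finset.sum_congr rfl fun i _ => Finset.sum_congr rfl fun r _ => ?_
  simp only [Tuple.u_smul, Tuple.uhat_smul, Pi.smul_apply, T.volForm_smul_right,
    Mesh.faceForm_smul_right, ← Finset.mul_sum]
  ring

/-- The normal component of `û` on a face. -/
theorem hatNormal_ae (X : Tuple T) {i : Fin T.nK} (j : T.faces i) :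
    ∀ᵐ x ∂(T.surf j), X.hatNormal i j x = ∑ r, T.normal i j r * X.uhat j r x := by
  have h1 : X.hatNormal i j = ∑ r, T.normal i j r • X.uhat j r := by
    simp only [Tuple.hatNormal, WithLp.ofLp_sum, Finset.sum_apply]
    rfl
  have h2 := eventually_all.2 fun r => Lp.coeFn_smul (T.normal i j r) (X.uhat j r)
  have h3 : ∀ᵐ x ∂(T.surf j), (∑ r, T.normal i j r • X.uhat j r : Lp ℝ 2 (T.surf j)) x
      = ∑ r, (T.normal i j r • X.uhat j r : Lp ℝ 2 (T.surf j)) x := by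
    filter_upwards [Lp.coeFn_finsetSum Finset.univ fun r => T.normal i j r • X.uhat j r] with x hx
    rw [hx, Finset.sum_apply]
  rw [h1]
  filter_upwards [h2, h3] with x hx hx3
  rw [hx3]
  exact Finset.sum_congr rfl fun r _ => by rw [hx r]; simp

/-- The upwinded convective form is nonnegative when the post-processed velocity is
divergence-free. -/
theorem convectiveForm_self_nonneg (hΩ : IsPolyhedralDomain Ω) {X Z : Tuple T} (hX : S.Mem X)
    (hZ : S.Mem Z) {β : (i : Fin T.nK) → T.HDiv i} (hβ : S.IsPostprocessed Z β)
    (hdiv : ∀ i, T.dvg i (β i) = 0) : 0 ≤ convectiveForm β X X := by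
  -- The normal trace of `β` is the flux of a single-valued trace, so `(β·n) û²` cancels between the
  -- two sides of interior faces; on boundary faces `û` vanishes.
  have hflux : ∀ r, ∑ i, ∑ j : T.faces i,
      ∫ x, T.ntr i (β i) j x * X.uhat j r x * X.uhat j r x ∂(T.surf j) = 0 := by
    intro r
    have h1 : ∀ i (j : T.faces i),
        ∫ x, T.ntr i (β i) j x * X.uhat j r x * X.uhat j r x ∂(T.surf j)
        = ∑ s, inner ℝ (T.normal i j) (EuclideanSpace.single s 1) *
          ∫ x, Z.uhat j s x * X.uhat j r x * X.uhat j r x ∂(T.surf j) := by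
      intro i j
      simp only [← integral_const_mul]
      rw [← integral_finsetSum _ fun s _ => (integrable_mul_mul (hZ.memLp_uhat j s)
        (hX.memLp_uhat j r) (hX.memLp_uhat j r)).const_mul _]
      refine integral_congr_ae ?_
      rw [hβ.ntr_eq hZ]
      filter_upwards [hatNormal_ae Z j] with x hx
      rw [hx, Finset.sum_mul, Finset.sum_mul]
      refine Finset.sum_congr rfl fun s _ => ?_
      rw [EuclideanSpace.inner_single_right]
      simp only [one_mul, conj_trivial]
      ring
    simp only [h1]
    have h2 : ∀ s, ∑ i, ∑ j : T.faces i, inner ℝ (T.normal i j) (EuclideanSpace.single s 1) *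
          ∫ x, Z.uhat j s x * X.uhat j r x * X.uhat j r x ∂(T.surf j) = 0 := fun s =>
      T.sum_normal_mul_eq_zero hΩ (EuclideanSpace.single s 1)
        (c := fun j => ∫ x, Z.uhat j s x * X.uhat j r x * X.uhat j r x ∂(T.surf j)) (fun j hj => by
          rw [hX.boundary j hj r]
          refine integral_eq_zero_of_ae ?_
          filter_upwards [Lp.coeFn_zero ℝ 2 (T.surf j)] with x hx
          rw [hx]; simp)
    have h3 : ∀ g : Fin d → (i : Fin T.nK) → T.faces i → ℝ,
        ∑ i, ∑ j : T.faces i, ∑ s, g s i j = ∑ s, ∑ i, ∑ j : T.faces i, g s i j := by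
      intro g
      rw [Finset.sum_comm]
      exact Finset.sum_congr rfl fun i _ => Finset.sum_comm
    rw [h3 fun s i j => inner ℝ (T.normal i j) (EuclideanSpace.single s 1) *
          ∫ x, Z.uhat j s x * X.uhat j r x * X.uhat j r x ∂(T.surf j)]
    exact Finset.sum_eq_zero fun s _ => h2 s
  -- Since `∇·β = 0`, the volume term is half of `⟨β·n, u²⟩`. Completing the square on each face
  -- leaves the single-valued term and a nonnegative remainder.
  have hterm : ∀ i r, -T.volForm i (T.field i (β i)) (X.u i r) (X.u i r)
      + ∑ j : T.faces i, T.faceForm j (T.ntr i (β i) j) (X.u i r) (X.uhat j r) (X.u i r)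
        (X.uhat j r) ≥ -(1 / 2) * ∑ j : T.faces i,
          ∫ x, T.ntr i (β i) j x * X.uhat j r x * X.uhat j r x ∂(T.surf j) := by
    intro i r
    have hgrad : (2 : ℝ) • (fun s => X.u i r * grad (X.u i r) s) = grad (X.u i r ^ 2) := by
      ext1 s
      simp only [grad, Pi.smul_apply, sq, Derivation.leibniz, smul_eq_mul, two_smul]
    have hv : T.volForm i (T.field i (β i)) (X.u i r) (X.u i r)
        = 1 / 2 * ∑ j : T.faces i, ∫ x, T.ntr i (β i) j x * evalAt (X.u i r) x
          * evalAt (X.u i r) x ∂(T.surf j) := by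
      have h1 := T.green (β i) (X.u i r ^ 2)
      rw [hdiv, map_zero, inner_zero_left, add_zero, ← hgrad, T.vecK_smul, inner_smul_right,
        ← T.volForm_eq_inner, T.inner_traceK_right] at h1
      have h2 : ∀ j : T.faces i, ∫ x, T.ntr i (β i) j x * evalAt (X.u i r ^ 2) x ∂(T.surf j)
          = ∫ x, T.ntr i (β i) j x * evalAt (X.u i r) x * evalAt (X.u i r) x ∂(T.surf j) :=
        fun j => integral_congr_ae (ae_of_all _ fun x => by simp only [evalAt_pow]; ring)
      simp only [h2] at h1
      linarith
    rw [hv, neg_mul, Finset.mul_sum, Finset.mul_sum, ← Finset.sum_neg_distrib,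
      ← Finset.sum_neg_distrib, ← Finset.sum_add_distrib]
    refine Finset.sum_le_sum fun j _ => ?_
    have hb := memLp_ntr (hβ.mem i) j
    have hm := hX.memLp_uhat j r
    have hp : MemLp (evalAt (X.u i r)) 3 (T.surf j) := Mesh.memLp_three_evalAt _
    have i1 : Integrable (fun x => -(1 / 2 * (T.ntr i (β i) j x * evalAt (X.u i r) x
        * evalAt (X.u i r) x))) (T.surf j) := ((integrable_mul_mul hb hp hp).const_mul _).neg
    have i2 := Mesh.integrable_faceForm hb (X.u i r) hm (X.u i r) hm
    have i3 : Integrable (fun x => -(1 / 2 * (T.ntr i (β i) j x * X.uhat j r x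
        * X.uhat j r x))) (T.surf j) := ((integrable_mul_mul hb hm hm).const_mul _).neg
    rw [← integral_const_mul, ← integral_const_mul, ← integral_neg, ← integral_neg, Mesh.faceForm,
      ← integral_add i1 i2]
    refine integral_mono i3 (i1.add i2) fun x => ?_
    simp only
    -- The two sides differ by `|b| (p - m)² / 2`; upwinding is what gives this remainder its sign.
    have key : ∀ b m p : ℝ, -(1 / 2 * (b * m * m)) ≤ -(1 / 2 * (b * p * p))
        + (b * m + max b 0 * (p - m)) * (p - m) := by
      intro b m p
      rcases le_total b 0 with h | h
      · rw [max_eq_right h]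
        nlinarith [mul_nonneg (neg_nonneg.2 h) (sq_nonneg (p - m))]
      · rw [max_eq_left h]
        nlinarith [mul_nonneg h (sq_nonneg (p - m))]
    exact key _ _ _
  rw [T.convectiveForm_eq]
  calc (0 : ℝ) = ∑ i, ∑ r, -(1 / 2) * ∑ j : T.faces i,
          ∫ x, T.ntr i (β i) j x * X.uhat j r x * X.uhat j r x ∂(T.surf j) := by
        rw [Finset.sum_comm]
        refine (Finset.sum_eq_zero fun r _ => ?_).symm
        rw [← Finset.mul_sum, hflux r, mul_zero]
    _ ≤ _ := Finset.sum_le_sum fun i _ => Finset.sum_le_sum fun r _ => hterm i r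

/-- The post-processed velocity of a discretely divergence-free velocity is divergence-free. -/
theorem IsPostprocessed.dvg_eq_zero (hΩ : IsPolyhedralDomain Ω) {X : Tuple T} (hX : S.Mem X)
    {β : (i : Fin T.nK) → T.HDiv i} (hβ : S.IsPostprocessed X β)
    (h : ∀ Y, S.Mem Y → divergenceForm X Y = 0) (i : Fin T.nK) : T.dvg i (β i) = 0 := by
  -- The divergence of `β` is an admissible pressure test function: it lies in `W`, and its mean
  -- vanishes because the total flux of `û` does.
  let Y : Tuple T := ⟨0, 0, fun i => T.dvg i (β i), 0⟩
  have hW : ∀ i, T.dvg i (β i) ∈ S.W i := fun i => (S.decomp_Vs i).dvg_mem (hβ.mem i)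
  have hg1 : HDG.grad (1 : Poly d) = 0 := by ext1 s; simp [HDG.grad]
  have hv0 : ∀ i, T.vecK i (0 : Fin d → Poly d) = 0 := fun i => by
    simpa using T.vecK_smul i 0 (0 : Fin d → Poly d)
  have hmean : ∑ i, ∫ x, evalAt (T.dvg i (β i)) x ∂(T.vol i) = 0 := by
    have h1 : ∀ i, ∫ x, evalAt (T.dvg i (β i)) x ∂(T.vol i)
        = ∑ j : T.faces i, ∑ s, inner ℝ (T.normal i j) (EuclideanSpace.single s 1) *
          ∫ x, X.uhat j s x ∂(T.surf j) := by
      intro i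
      have h2 := T.green (β i) 1
      rw [hg1, hv0, inner_zero_right, zero_add, ← T.integral_evalAt, T.inner_traceK_right,
        hβ.ntr_eq hX] at h2
      rw [h2]
      refine Finset.sum_congr rfl fun j _ => ?_
      simp only [← integral_const_mul]
      rw [← integral_finsetSum _ fun s _ => (memLp_one_iff_integrable.1
        ((hX.memLp_uhat j s).mono_exponent (by norm_num))).const_mul _]
      refine integral_congr_ae ?_
      filter_upwards [hatNormal_ae X j] with x hx
      rw [hx, evalAt_one, mul_one]
      refine Finset.sum_congr rfl fun s _ => ?_
      rw [EuclideanSpace.inner_single_right]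
      simp
    simp only [h1]
    rw [Finset.sum_congr rfl fun i _ => Finset.sum_comm, Finset.sum_comm]
    refine Finset.sum_eq_zero fun s _ => ?_
    refine T.sum_normal_mul_eq_zero hΩ (EuclideanSpace.single s 1)
      (c := fun j => ∫ x, X.uhat j s x ∂(T.surf j)) fun j hj => ?_
    rw [hX.boundary j hj s]
    refine integral_eq_zero_of_ae ?_
    filter_upwards [Lp.coeFn_zero ℝ 2 (T.surf j)] with x hx
    rw [hx]
  have hY : S.Mem Y := ⟨fun _ _ => zero_mem _, fun _ _ => zero_mem _, hW, hmean,
    fun _ _ => zero_mem _, fun _ _ _ => rfl⟩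
  have h3 := h Y hY
  -- The moments that define `β` replace `u` and `û·n` in the constraint by the field and normal
  -- trace of `β`; Green's formula leaves the squared norm of the divergence.
  have h4 : divergenceForm X Y = ∑ i, ‖T.polyK i (T.dvg i (β i))‖ ^ 2 := by
    refine Finset.sum_congr rfl fun i _ => ?_
    change -inner ℝ (T.vecK i (X.u i)) (T.vecK i (HDG.grad (T.dvg i (β i))))
      + inner ℝ (X.hatNormal i) (T.traceK i (T.dvg i (β i))) = _
    rw [← hβ.grad i _ (hW i), ← hβ.ntr_eq hX, ← T.green, real_inner_self_eq_norm_sq]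
    ring
  rw [h4, Finset.sum_eq_zero_iff_of_nonneg fun i _ => sq_nonneg _] at h3
  have h5 := h3 i (Finset.mem_univ i)
  rw [sq_eq_zero_iff, norm_eq_zero] at h5
  exact T.poly_eq_zero_of_polyK h5

end FESpaces

end HDG

namespace HDG

/-! ### Continuity of the convective form -/

/-- Hölder's inequality for three factors in `L³`. -/
theorem integral_abs_mul_mul_le {α : Type*} [MeasurableSpace α] {μ : Measure α}
    {f g h : α → ℝ} (hf : AEStronglyMeasurable f μ) (hg : AEStronglyMeasurable g μ)
    (hh : AEStronglyMeasurable h μ) {F G H : ℝ} (hF0 : 0 ≤ F) (hG0 : 0 ≤ G) (hH0 : 0 ≤ H)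
    (hF : eLpNorm f 3 μ ≤ ENNReal.ofReal F) (hG : eLpNorm g 3 μ ≤ ENNReal.ofReal G)
    (hH : eLpNorm h 3 μ ≤ ENNReal.ofReal H) : ∫ x, |f x * g x * h x| ∂μ ≤ F * G * H := by
  -- Two applications of Hölder's inequality: `1/3 + 1/3 = 2/3`, then `2/3 + 1/3 = 1`.
  have i1 : ENNReal.HolderTriple 3 3 (3 / 2) := ⟨by
    rw [ENNReal.inv_div (by norm_num) (by norm_num), ENNReal.div_eq_inv_mul, mul_two]⟩
  have i2 : ENNReal.HolderTriple (3 / 2) 3 1 := ⟨by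
    rw [ENNReal.inv_div (by norm_num) (by norm_num), ENNReal.div_eq_inv_mul, inv_one, mul_two,
      ← mul_one (3⁻¹ : ℝ≥0∞), ← mul_add, ← mul_add, ← ENNReal.div_eq_inv_mul, one_add_one_eq_two,
      show (2 : ℝ≥0∞) + 1 = 3 by norm_num, ENNReal.div_self (by norm_num) (by norm_num)]⟩
  have h1 : eLpNorm (fun x => f x * g x) (3 / 2) μ ≤ ENNReal.ofReal (F * G) := by
    rw [ENNReal.ofReal_mul hF0]
    refine (eLpNorm_le_eLpNorm_mul_eLpNorm'_of_norm (p := 3) (q := 3) hf hg (fun a b => a * b) 1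
      (ae_of_all _ fun x => by simp [norm_mul])).trans ?_
    rw [ENNReal.coe_one, one_mul]
    exact mul_le_mul' hF hG
  have h2 : eLpNorm (fun x => f x * g x * h x) 1 μ ≤ ENNReal.ofReal (F * G * H) := by
    rw [ENNReal.ofReal_mul (mul_nonneg hF0 hG0)]
    refine (eLpNorm_le_eLpNorm_mul_eLpNorm'_of_norm (p := 3 / 2) (q := 3) (hf.mul hg) hh
      (fun a b => a * b) 1 (ae_of_all _ fun x => by simp [norm_mul])).trans ?_
    rw [ENNReal.coe_one, one_mul]
    exact mul_le_mul' h1 hH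
  rw [eLpNorm_one_eq_lintegral_enorm] at h2
  have h3 : ∫ x, |f x * g x * h x| ∂μ = (∫⁻ x, ‖f x * g x * h x‖ₑ ∂μ).toReal := by
    simp only [← Real.norm_eq_abs]
    exact integral_norm_eq_lintegral_enorm ((hf.mul hg).mul hh)
  rw [h3]
  exact ENNReal.toReal_le_of_le_ofReal (by positivity) h2

namespace Mesh

variable {d : ℕ} {Ω : Set (Space d)} {T : Mesh Ω}

/-- The positive part is 1-Lipschitz, so upwinding costs no more than the linear term; the jump `u -
û` then accompanies `û` as a coefficient of `b - b'`. -/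
theorem abs_faceForm_sub_le {j : Fin T.nF} {b b' : Space d → ℝ} (hb : MemLp b 3 (T.surf j))
    (hb' : MemLp b' 3 (T.surf j)) (p : Poly d) {m : Lp ℝ 2 (T.surf j)}
    (hm : MemLp m 3 (T.surf j)) (q : Poly d) {l : Lp ℝ 2 (T.surf j)} (hl : MemLp l 3 (T.surf j))
    {B M M' V : ℝ} (hB0 : 0 ≤ B) (hM0 : 0 ≤ M) (hM0' : 0 ≤ M') (hV0 : 0 ≤ V)
    (hB : eLpNorm (fun x => b x - b' x) 3 (T.surf j) ≤ ENNReal.ofReal B)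
    (hM : eLpNorm m 3 (T.surf j) ≤ ENNReal.ofReal M)
    (hM' : eLpNorm (fun x => evalAt p x - m x) 3 (T.surf j) ≤ ENNReal.ofReal M')
    (hV : eLpNorm (fun x => evalAt q x - l x) 3 (T.surf j) ≤ ENNReal.ofReal V) :
    |T.faceForm j b p m q l - T.faceForm j b' p m q l| ≤ B * (M + M') * V := by
  have hJ := memLp_three_sub p hm
  have hL := memLp_three_sub q hl
  have hS : eLpNorm (fun x => |m x| + |evalAt p x - m x|) 3 (T.surf j)
      ≤ ENNReal.ofReal (M + M') := by
    refine (eLpNorm_add_le (f := fun x => |m x|) (g := fun x => |evalAt p x - m x|)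
      hm.abs.1 hJ.abs.1 (by norm_num)).trans ?_
    rw [ENNReal.ofReal_add hM0 hM0']
    refine add_le_add ?_ ?_
    · exact (eLpNorm_norm (m : Space d → ℝ)).le.trans hM
    · exact (eLpNorm_norm (fun x => evalAt p x - m x)).le.trans hM'
  have hint := integrable_mul_mul (hb.sub hb') (hm.abs.add hJ.abs) hL
  unfold faceForm
  rw [← integral_sub (integrable_faceForm hb p hm q hl) (integrable_faceForm hb' p hm q hl)]
  refine (abs_integral_le_integral_abs).trans (le_trans ?_ (integral_abs_mul_mul_le (hb.sub hb').1
    (hm.abs.add hJ.abs).1 hL.1 hB0 (add_nonneg hM0 hM0') hV0 hB hS hV))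
  refine integral_mono ((integrable_faceForm hb p hm q hl).sub
    (integrable_faceForm hb' p hm q hl)).abs hint.abs fun x => ?_
  simp only [Pi.sub_apply, Pi.add_apply]
  have key : ∀ b b' m J V : ℝ, |(b * m + max b 0 * J) * V - (b' * m + max b' 0 * J) * V|
      ≤ |(b - b') * (|m| + |J|) * V| := by
    intro b b' m J V
    have h1 : (b * m + max b 0 * J) * V - (b' * m + max b' 0 * J) * V
        = ((b - b') * m + (max b 0 - max b' 0) * J) * V := by ring
    rw [h1, abs_mul, abs_mul, abs_mul, abs_of_nonneg (add_nonneg (abs_nonneg m) (abs_nonneg J)),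
      mul_add]
    refine mul_le_mul_of_nonneg_right ((abs_add_le _ _).trans ?_) (abs_nonneg V)
    rw [abs_mul, abs_mul]
    refine add_le_add le_rfl (mul_le_mul_of_nonneg_right ?_ (abs_nonneg J))
    exact abs_max_sub_max_le_abs b b' 0
  exact key _ _ _ _ _

theorem abs_volForm_le (i : Fin T.nK) (g : Lp (Space d) 2 (T.vol i)) (p q : Poly d) :
    |T.volForm i g p q| ≤ T.supNorm i p * (‖g‖ * ‖T.vecK i (grad q)‖) := by
  rw [volForm_eq_inner]
  have h1 : ‖T.vecK i fun s => p * grad q s‖ ≤ T.supNorm i p * ‖T.vecK i (grad q)‖ := by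
    refine (pow_le_pow_iff_left₀ (norm_nonneg _)
      (mul_nonneg (T.supNorm_nonneg i p) (norm_nonneg _)) two_ne_zero).1 ?_
    rw [mul_pow, norm_sq_vecK, norm_sq_vecK, Finset.mul_sum]
    refine Finset.sum_le_sum fun s _ => ?_
    rw [norm_sq_polyK, norm_sq_polyK, ← integral_const_mul]
    refine integral_mono_ae (T.integrable_of_continuous ((continuous_evalAt _).pow 2))
      ((T.integrable_of_continuous ((continuous_evalAt _).pow 2)).const_mul _) ?_
    filter_upwards [T.ae_vol_abs_le i p] with x hx
    simp only [evalAt_mul, mul_pow]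
    refine mul_le_mul_of_nonneg_right ?_ (sq_nonneg _)
    exact sq_le_sq' (neg_le_of_abs_le hx) (le_of_abs_le hx)
  calc |inner ℝ g (T.vecK i fun s => p * grad q s)| ≤ ‖g‖ * ‖T.vecK i fun s => p * grad q s‖ :=
        abs_real_inner_le_norm _ _
    _ ≤ ‖g‖ * (T.supNorm i p * ‖T.vecK i (grad q)‖) := by gcongr
    _ = _ := by ring

/-- The scale of the inverse inequality from `L²` to `L³` on the faces. -/
noncomputable def faceScale (T : Mesh Ω) (i : Fin T.nK) : ℝ := T.h i ^ (((d : ℝ) - 1) / 6)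

theorem faceScale_pos (hd : 0 < d) (i : Fin T.nK) : 0 < T.faceScale i :=
  Real.rpow_pos_of_pos (T.h_pos hd i) _

theorem faceScale_pow_six (hd : 0 < d) (i : Fin T.nK) : T.faceScale i ^ 6 = T.h i ^ (d - 1) := by
  rw [faceScale, ← Real.rpow_mul_natCast (T.h_pos hd i).le, ← Real.rpow_natCast (T.h i) (d - 1),
    Nat.cast_sub hd]
  congr 1
  push_cast; ring

theorem faceScale_inv (hd : 0 < d) (i : Fin T.nK) :
    T.h i ^ (-((d : ℝ) - 1) / 6) = (T.faceScale i)⁻¹ := by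
  rw [faceScale, ← Real.rpow_neg (T.h_pos hd i).le]
  congr 1; ring

theorem sqrt_pow_eq_faceScale (hd : 0 < d) (i : Fin T.nK) :
    √(T.h i ^ (d - 1)) = T.faceScale i ^ 3 := by
  rw [← faceScale_pow_six hd, show T.faceScale i ^ 6 = (T.faceScale i ^ 3) ^ 2 by ring,
    Real.sqrt_sq (pow_nonneg (faceScale_pos hd i).le 3)]

theorem sqrt_h_mul_sqrt_pow (hd : 0 < d) (i : Fin T.nK) :
    √(T.h i) * √(T.h i ^ (d - 1)) = √(T.h i ^ d) := by
  rw [← Real.sqrt_mul (T.h_nonneg i), ← pow_sub_one_mul hd.ne' (T.h i), mul_comm]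

theorem Bounds.eLpNorm_evalAt_le {k : ℕ} {C : ℝ} (hb : T.Bounds k C) (hd : 0 < d) {i : Fin T.nK}
    (j : T.faces i) (p : Poly d) : eLpNorm (evalAt p) 3 (T.surf j)
      ≤ ENNReal.ofReal (C * T.faceScale i ^ 2 * T.supNorm i p) := by
  have hl := faceScale_pos hd i
  have hC := hb.one_le
  have h0 : 0 ≤ C * T.faceScale i ^ 2 := by positivity
  refine (eLpNorm_le_of_ae_bound (C := T.supNorm i p) (T.ae_surf_abs_le j p)).trans ?_
  rw [ENNReal.ofReal_mul h0]
  gcongr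
  have h1 : T.surf j Set.univ ≤ ENNReal.ofReal (C * T.faceScale i ^ 2) ^ 3 := by
    rw [← ofReal_measureReal (h := measure_ne_top _ _), ← ENNReal.ofReal_pow h0]
    refine ENNReal.ofReal_le_ofReal ((hb.surf_le i j j.2).trans ?_)
    rw [← faceScale_pow_six hd]
    have : C ≤ C ^ 3 := le_self_pow₀ hC (by norm_num)
    calc C * T.faceScale i ^ 6 ≤ C ^ 3 * T.faceScale i ^ 6 := by gcongr
      _ = _ := by ring
  refine (ENNReal.rpow_le_rpow h1 (by positivity)).trans (le_of_eq ?_)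
  rw [← ENNReal.rpow_natCast, ← ENNReal.rpow_mul]
  norm_num

end Mesh

namespace Tuple

variable {d : ℕ} {Ω : Set (Space d)} {T : Mesh Ω}

/-- The size of a component of the velocity on an element, measured by the maximum of `u` and by
the scaled jump. -/
noncomputable def localSize (X : Tuple T) (i : Fin T.nK) (r : Fin d) : ℝ :=
  T.supNorm i (X.u i r) + (√(T.h i ^ (d - 1)))⁻¹ * ‖X.jump i r‖

/-- The local discrete `H¹`-norm of a component of the velocity. -/
noncomputable def localNorm (X : Tuple T) (i : Fin T.nK) (r : Fin d) : ℝ :=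
  ‖T.vecK i (grad (X.u i r))‖ + (√(T.h i))⁻¹ * ‖X.jump i r‖

theorem localSize_nonneg (X : Tuple T) (i : Fin T.nK) (r : Fin d) : 0 ≤ X.localSize i r := by
  have := T.supNorm_nonneg i (X.u i r)
  unfold localSize; positivity

theorem localNorm_nonneg (X : Tuple T) (i : Fin T.nK) (r : Fin d) : 0 ≤ X.localNorm i r := by
  unfold localNorm; positivity

theorem jump_ae (X : Tuple T) {i : Fin T.nK} (j : T.faces i) (r : Fin d) :
    ∀ᵐ x ∂(T.surf j), X.jump i r j x = evalAt (X.u i r) x - X.uhat j r x := by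
  have h1 : X.jump i r j = polyL2 (T.carried_surf j) (X.u i r) - X.uhat j r := rfl
  rw [h1]
  filter_upwards [Lp.coeFn_sub (polyL2 (T.carried_surf j) (X.u i r)) (X.uhat j r),
    polyL2_coeFn (T.carried_surf j) (X.u i r)] with x hx hp
  rw [hx, Pi.sub_apply, hp]

end Tuple

namespace FESpaces

variable {d : ℕ} {Ω : Set (Space d)} {T : Mesh Ω} {S : FESpaces T}

theorem HasParameters.eLpNorm_sub_le {k : ℕ} {Λ : ℝ} (hS : S.HasParameters k Λ) (hd : 0 < d)
    {X : Tuple T} (hX : S.Mem X) {i : Fin T.nK} (j : T.faces i) (r : Fin d) :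
    eLpNorm (fun x => evalAt (X.u i r) x - X.uhat j r x) 3 (T.surf j)
      ≤ ENNReal.ofReal (|Λ| * (T.faceScale i)⁻¹ * ‖X.jump i r‖) := by
  rw [eLpNorm_congr_ae (g := X.jump i r j) ((X.jump_ae j r).mono fun x hx => hx.symm)]
  refine (hS.inverse i j j.2 _ (hX.jump_mem i r j)).trans (ENNReal.ofReal_le_ofReal ?_)
  rw [Mesh.faceScale_inv hd]
  have := Mesh.faceScale_pos hd i
  gcongr
  · exact le_abs_self _
  · exact T.norm_apply_le _ j

/-- Writing `û = u - (u - û)` bounds the first part by the maximum of `u` and the second by the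
inverse inequality. The weight of the jump in `localSize` is the one for which both parts scale with
the square of `faceScale`. -/
theorem HasParameters.eLpNorm_uhat_le {k : ℕ} {Λ C : ℝ} (hS : S.HasParameters k Λ)
    (hb : T.Bounds k C) (hd : 0 < d) {X : Tuple T} (hX : S.Mem X) {i : Fin T.nK} (j : T.faces i)
    (r : Fin d) : eLpNorm (X.uhat j r) 3 (T.surf j)
      ≤ ENNReal.ofReal ((C + |Λ|) * T.faceScale i ^ 2 * X.localSize i r) := by
  have hl := Mesh.faceScale_pos hd i
  have hA := T.supNorm_nonneg i (X.u i r)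
  have hC : 0 ≤ C := zero_le_one.trans hb.one_le
  have h1 : (X.uhat j r : Space d → ℝ)
      = evalAt (X.u i r) - fun x => evalAt (X.u i r) x - X.uhat j r x := by
    ext x; simp
  rw [h1]
  refine (MeasureTheory.eLpNorm_sub_le (Mesh.memLp_three_evalAt _).1
    (Mesh.memLp_three_sub _ (hX.memLp_uhat j r)).1 (by norm_num)).trans ?_
  refine (add_le_add (hb.eLpNorm_evalAt_le hd j _) (hS.eLpNorm_sub_le hd hX j r)).trans ?_
  rw [← ENNReal.ofReal_add (by positivity) (by positivity)]
  refine ENNReal.ofReal_le_ofReal ?_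
  rw [Tuple.localSize, Mesh.sqrt_pow_eq_faceScale hd]
  have e1 : (C + |Λ|) * T.faceScale i ^ 2
      * (T.supNorm i (X.u i r) + (T.faceScale i ^ 3)⁻¹ * ‖X.jump i r‖)
      = (C + |Λ|) * T.faceScale i ^ 2 * T.supNorm i (X.u i r)
        + (C + |Λ|) * (T.faceScale i)⁻¹ * ‖X.jump i r‖ := by
    field_simp
  rw [e1]
  have := abs_nonneg Λ
  gcongr
  · linarith
  · linarith

/-- The normal traces of the post-processed velocities are those of the traces `û`, so the bound for
components of `û` is applied to the difference of the two tuples. -/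
theorem HasParameters.eLpNorm_ntr_sub_le {k : ℕ} {Λ C : ℝ} (hS : S.HasParameters k Λ)
    (hb : T.Bounds k C) (hd : 0 < d) {X Y : Tuple T} (hX : S.Mem X) (hY : S.Mem Y)
    {β γ : (i : Fin T.nK) → T.HDiv i} (hβ : S.IsPostprocessed X β) (hγ : S.IsPostprocessed Y γ)
    {i : Fin T.nK} (j : T.faces i) :
    eLpNorm (fun x => T.ntr i (β i) j x - T.ntr i (γ i) j x) 3 (T.surf j)
      ≤ ENNReal.ofReal ((C + |Λ|) * T.faceScale i ^ 2 * ∑ r, (X - Y).localSize i r) := by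
  have hl := Mesh.faceScale_pos hd i
  have hC : 0 ≤ C := zero_le_one.trans hb.one_le
  have h1 : eLpNorm (fun x => T.ntr i (β i) j x - T.ntr i (γ i) j x) 3 (T.surf j)
      ≤ eLpNorm (∑ r, fun x => ‖(X - Y).uhat j r x‖) 3 (T.surf j) := by
    refine eLpNorm_mono_ae_real ?_
    rw [hβ.ntr_eq hX, hγ.ntr_eq hY]
    have h2 := eventually_all.2 fun r => Lp.coeFn_sub (X.uhat j r) (Y.uhat j r)
    filter_upwards [hatNormal_ae X j, hatNormal_ae Y j, h2] with x hx hy hxy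
    rw [hx, hy, ← Finset.sum_sub_distrib, Finset.sum_apply]
    refine (norm_sum_le _ _).trans (Finset.sum_le_sum fun r _ => ?_)
    rw [Tuple.uhat_sub, Pi.sub_apply, Pi.sub_apply, hxy r, ← mul_sub, norm_mul, Pi.sub_apply]
    exact mul_le_of_le_one_left (norm_nonneg _) (T.abs_normal_apply_le j r)
  refine h1.trans ((eLpNorm_sum_le (fun r _ => ((hX.sub hY).memLp_uhat j r).norm.1)
    (by norm_num)).trans ?_)
  rw [Finset.mul_sum, ENNReal.ofReal_sum_of_nonneg fun r _ =>
    mul_nonneg (by positivity) (Tuple.localSize_nonneg _ i r)]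
  refine Finset.sum_le_sum fun r _ => ?_
  rw [eLpNorm_norm]
  exact hS.eLpNorm_uhat_le hb hd (hX.sub hY) j r

end FESpaces

end HDG

/-! ### Summation over the elements: the Lipschitz bound for the convective form. -/

namespace HDG

/-- Hölder's inequality with exponents 4, 4, 2; the weight `√w` is shared between the two factors in
the weighted fourth-power sums. -/
theorem sum_sqrt_mul_mul_mul_le {ι : Type*} [Fintype ι] {w a a' b : ι → ℝ} (hw : ∀ i, 0 ≤ w i)
    {A A' B : ℝ} (hA0 : 0 ≤ A) (hA0' : 0 ≤ A')
    (hB0 : 0 ≤ B) (hA : ∑ i, w i * a i ^ 4 ≤ A ^ 4) (hA' : ∑ i, w i * a' i ^ 4 ≤ A' ^ 4)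
    (hB : ∑ i, b i ^ 2 ≤ B ^ 2) : ∑ i, √(w i) * a i * a' i * b i ≤ A * A' * B := by
  have h1 : ∑ i, (√(w i) * a i * a' i) ^ 2 ≤ (A * A') ^ 2 := by
    calc ∑ i, (√(w i) * a i * a' i) ^ 2 = ∑ i, (√(w i) * a i ^ 2) * (√(w i) * a' i ^ 2) :=
          Finset.sum_congr rfl fun i _ => by ring
      _ ≤ √(∑ i, (√(w i) * a i ^ 2) ^ 2) * √(∑ i, (√(w i) * a' i ^ 2) ^ 2) :=
          Real.sum_mul_le_sqrt_mul_sqrt _ _ _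
      _ = √(∑ i, w i * a i ^ 4) * √(∑ i, w i * a' i ^ 4) := by
          simp only [mul_pow, Real.sq_sqrt (hw _), ← pow_mul]
      _ ≤ √(A ^ 4) * √(A' ^ 4) := by gcongr
      _ = (A * A') ^ 2 := by
          rw [show A ^ 4 = (A ^ 2) ^ 2 by ring, show A' ^ 4 = (A' ^ 2) ^ 2 by ring,
            Real.sqrt_sq (sq_nonneg _), Real.sqrt_sq (sq_nonneg _)]
          ring
  calc ∑ i, √(w i) * a i * a' i * b i
      ≤ √(∑ i, (√(w i) * a i * a' i) ^ 2) * √(∑ i, b i ^ 2) := Real.sum_mul_le_sqrt_mul_sqrt _ _ _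
    _ ≤ √((A * A') ^ 2) * √(B ^ 2) := by gcongr
    _ = A * A' * B := by rw [Real.sqrt_sq (by positivity), Real.sqrt_sq hB0]

theorem sum_pow_four_le {ι : Type*} (s : Finset ι) (a : ι → ℝ) :
    (∑ i ∈ s, a i) ^ 4 ≤ (s.card : ℝ) ^ 3 * ∑ i ∈ s, a i ^ 4 := by
  calc (∑ i ∈ s, a i) ^ 4 = ((∑ i ∈ s, a i) ^ 2) ^ 2 := by ring
    _ ≤ (s.card * ∑ i ∈ s, a i ^ 2) ^ 2 := by gcongr; exact sq_sum_le_card_mul_sum_sq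
    _ = (s.card : ℝ) ^ 2 * (∑ i ∈ s, a i ^ 2) ^ 2 := by ring
    _ ≤ (s.card : ℝ) ^ 2 * (s.card * ∑ i ∈ s, (a i ^ 2) ^ 2) := by
        gcongr; exact sq_sum_le_card_mul_sum_sq
    _ = _ := by simp only [← pow_mul]; ring

theorem sum_sq_le_sq_sum_of_nonneg {ι : Type*} (s : Finset ι) {a : ι → ℝ}
    (ha : ∀ i ∈ s, 0 ≤ a i) : ∑ i ∈ s, a i ^ 2 ≤ (∑ i ∈ s, a i) ^ 2 := by
  rw [sq (∑ i ∈ s, a i), Finset.sum_mul]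
  refine Finset.sum_le_sum fun i hi => ?_
  rw [sq]
  exact mul_le_mul_of_nonneg_left (Finset.single_le_sum ha hi) (ha i hi)

theorem abs_sub_combine {v w f g q a b K L C : ℝ} (hv : |v - w| ≤ K * (q * a))
    (hf : |f - g| ≤ C * (L * (q * b))) (hq : 0 ≤ q) (ha : 0 ≤ a) (hb : 0 ≤ b) (hK : 0 ≤ K)
    (hL : 0 ≤ C * L) : |(-v + f) - (-w + g)| ≤ (K + C * L) * (q * (a + b)) := by
  have h1 : (-v + f) - (-w + g) = -(v - w) + (f - g) := by ring
  rw [h1]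
  refine (abs_add_le _ _).trans ?_
  rw [abs_neg]
  have h2 : 0 ≤ C * L * (q * a) := mul_nonneg hL (mul_nonneg hq ha)
  have h3 : 0 ≤ K * (q * b) := mul_nonneg hK (mul_nonneg hq hb)
  calc |v - w| + |f - g| ≤ K * (q * a) + C * (L * (q * b)) := add_le_add hv hf
    _ ≤ K * (q * a) + C * (L * (q * b)) + (C * L * (q * a) + K * (q * b)) :=
        le_add_of_nonneg_right (add_nonneg h2 h3)
    _ = _ := by ring

theorem abs_sum_sum_sub_le {ι κ : Type*} [Fintype ι] [Fintype κ] {f g x y : ι → κ → ℝ}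
    {q : ι → ℝ} {K : ℝ} (hK : 0 ≤ K) (hq : ∀ i, 0 ≤ q i) (hx : ∀ i r, 0 ≤ x i r)
    (hy : ∀ i r, 0 ≤ y i r) (h : ∀ i r, |f i r - g i r| ≤ K * (q i * x i r * y i r)) :
    |∑ i, ∑ r, f i r - ∑ i, ∑ r, g i r| ≤ K * ∑ i, q i * (∑ r, x i r) * ∑ r, y i r := by
  simp only [← Finset.sum_sub_distrib]
  rw [Finset.mul_sum]
  refine (Finset.abs_sum_le_sum_abs _ _).trans (Finset.sum_le_sum fun i _ => ?_)
  refine (Finset.abs_sum_le_sum_abs _ _).trans ((Finset.sum_le_sum fun r _ => h i r).trans ?_)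
  rw [← Finset.mul_sum]
  refine mul_le_mul_of_nonneg_left ?_ hK
  rw [Finset.mul_sum]
  refine Finset.sum_le_sum fun r _ => mul_le_mul_of_nonneg_right
    (mul_le_mul_of_nonneg_left ?_ (hq i)) (hy i r)
  exact Finset.single_le_sum (f := fun r => x i r) (fun r _ => hx i r) (Finset.mem_univ r)

namespace Tuple

variable {d : ℕ} {Ω : Set (Space d)} {T : Mesh Ω}

theorem scalarEnergy_le (X : Tuple T) (r : Fin d) :
    T.scalarEnergy (fun i => X.u i r) (fun j => X.uhat j r) ≤ X.normOne ^ 2 := by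
  rw [normOne_sq]
  exact Finset.single_le_sum
    (f := fun r => T.scalarEnergy (fun i => X.u i r) fun j => X.uhat j r)
    (fun r _ => T.scalarEnergy_nonneg _ _) (Finset.mem_univ r)

theorem sum_localNorm_sq_le (X : Tuple T) :
    ∑ i, (∑ r, X.localNorm i r) ^ 2 ≤ 2 * d * X.normOne ^ 2 := by
  calc ∑ i, (∑ r, X.localNorm i r) ^ 2
      ≤ ∑ i, (d : ℝ) * ∑ r, 2 * (‖T.vecK i (grad (X.u i r))‖ ^ 2
          + (T.h i)⁻¹ * ‖X.jump i r‖ ^ 2) := by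
        refine Finset.sum_le_sum fun i _ => ?_
        have h1 := sq_sum_le_card_mul_sum_sq (s := Finset.univ) (f := fun r => X.localNorm i r)
        rw [Finset.card_univ, Fintype.card_fin] at h1
        refine h1.trans ?_
        gcongr with r
        refine add_sq_le.trans (le_of_eq ?_)
        rw [mul_pow, inv_pow, Real.sq_sqrt (T.h_nonneg i)]
    _ = 2 * d * X.normOne ^ 2 := by
        rw [normOne_sq]
        simp only [← Finset.mul_sum]
        rw [Finset.sum_comm]
        unfold Mesh.scalarEnergy
        simp only [Tuple.jump, Tuple.hatTr]
        ring

end Tuple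

namespace FESpaces

variable {d : ℕ} {Ω : Set (Space d)} {T : Mesh Ω} {S : FESpaces T}

/-- The maxima are covered by the discrete Sobolev bound. The jumps need only the energy: their
fourth powers are squares of its terms, up to a surplus power of the bounded diameter, and a sum of
squares is at most the square of the sum. -/
theorem Sobolev.sum_localSize_le {k : ℕ} {C C' : ℝ} (hd : d = 2 ∨ d = 3) (hS : S.Sobolev C')
    (hC' : 0 ≤ C') (hb : T.Bounds k C) {X : Tuple T} (hX : S.Mem X) :
    ∑ i, T.h i ^ d * (∑ r, X.localSize i r) ^ 4 ≤ 8 * d ^ 3 * (C' + C ^ 2) * X.normOne ^ 4 := by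
  have hd0 : 0 < d := by omega
  have hC := hb.one_le
  set E : Fin d → ℝ := fun r => T.scalarEnergy (fun i => X.u i r) fun j => X.uhat j r with hE
  have hE0 : ∀ r, 0 ≤ E r := fun r => T.scalarEnergy_nonneg _ _
  have hjump : ∀ r, ∑ i, T.h i ^ d * ((√(T.h i ^ (d - 1)))⁻¹ * ‖X.jump i r‖) ^ 4
      ≤ C ^ 2 * E r ^ 2 := by
    intro r
    have h1 : ∀ i, T.h i ^ d * ((√(T.h i ^ (d - 1)))⁻¹ * ‖X.jump i r‖) ^ 4
        ≤ C ^ 2 * ((T.h i)⁻¹ * ‖X.jump i r‖ ^ 2) ^ 2 := by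
      intro i
      have hh := T.h_pos hd0 i
      have hs : √(T.h i ^ (d - 1)) ^ 4 = (T.h i ^ (d - 1)) ^ 2 := by
        rw [show √(T.h i ^ (d - 1)) ^ 4 = (√(T.h i ^ (d - 1)) ^ 2) ^ 2 by ring,
          Real.sq_sqrt (by positivity)]
      -- The surplus is `h ^ (4 - d)`, that is `h²` for `d = 2` and `h` for `d = 3`; both are at
      -- most `C²`.
      have h2 : T.h i ^ d * (T.h i ^ 2) ≤ C ^ 2 * (T.h i ^ (d - 1)) ^ 2 := by
        have h3 := hb.h_le i
        rcases hd with rfl | rfl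
        · have : T.h i ^ 2 ≤ C ^ 2 := by gcongr
          calc T.h i ^ 2 * T.h i ^ 2 ≤ C ^ 2 * T.h i ^ 2 := by gcongr
            _ = _ := by norm_num
        · have : T.h i ≤ C ^ 2 := h3.trans (le_self_pow₀ hC two_ne_zero)
          calc T.h i ^ 3 * T.h i ^ 2 = T.h i * (T.h i ^ 2) ^ 2 := by ring
            _ ≤ C ^ 2 * (T.h i ^ 2) ^ 2 := by gcongr
            _ = _ := by norm_num
      rw [mul_pow, inv_pow, hs]
      have h4 : T.h i ^ d * ((T.h i ^ (d - 1)) ^ 2)⁻¹ ≤ C ^ 2 * (T.h i ^ 2)⁻¹ := by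
        rw [← div_eq_mul_inv, ← div_eq_mul_inv, div_le_div_iff₀ (by positivity) (by positivity)]
        exact h2
      calc T.h i ^ d * (((T.h i ^ (d - 1)) ^ 2)⁻¹ * ‖X.jump i r‖ ^ 4)
          = T.h i ^ d * ((T.h i ^ (d - 1)) ^ 2)⁻¹ * ‖X.jump i r‖ ^ 4 := by ring
        _ ≤ C ^ 2 * (T.h i ^ 2)⁻¹ * ‖X.jump i r‖ ^ 4 := by gcongr
        _ = _ := by rw [mul_pow, inv_pow]; ring
    have hj0 : ∀ i, 0 ≤ (T.h i)⁻¹ * ‖X.jump i r‖ ^ 2 := fun i => by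
      have := T.h_nonneg i
      positivity
    calc _ ≤ ∑ i, C ^ 2 * ((T.h i)⁻¹ * ‖X.jump i r‖ ^ 2) ^ 2 := Finset.sum_le_sum fun i _ => h1 i
      _ = C ^ 2 * ∑ i, ((T.h i)⁻¹ * ‖X.jump i r‖ ^ 2) ^ 2 := by rw [Finset.mul_sum]
      _ ≤ C ^ 2 * (∑ i, (T.h i)⁻¹ * ‖X.jump i r‖ ^ 2) ^ 2 := by
          gcongr
          exact sum_sq_le_sq_sum_of_nonneg _ fun i _ => hj0 i
      _ ≤ C ^ 2 * E r ^ 2 := by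
          gcongr
          · exact Finset.sum_nonneg fun i _ => hj0 i
          · refine Finset.sum_le_sum fun i _ => ?_
            exact le_add_of_nonneg_left (sq_nonneg _)
  have hu : ∀ r, ∑ i, T.h i ^ d * T.supNorm i (X.u i r) ^ 4 ≤ C' * E r ^ 2 := fun r =>
    hS.pow_four (fun i => X.u i r) (fun i => hX.u i r) (fun j => X.uhat j r)
      fun j hj => hX.boundary j hj r
  have hsize : ∀ i r, X.localSize i r ^ 4 ≤ 8 * (T.supNorm i (X.u i r) ^ 4
      + ((√(T.h i ^ (d - 1)))⁻¹ * ‖X.jump i r‖) ^ 4) := by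
    intro i r
    rw [Tuple.localSize]
    set x := T.supNorm i (X.u i r)
    set y := (√(T.h i ^ (d - 1)))⁻¹ * ‖X.jump i r‖
    calc (x + y) ^ 4 = ((x + y) ^ 2) ^ 2 := by ring
      _ ≤ (2 * (x ^ 2 + y ^ 2)) ^ 2 := by gcongr; exact add_sq_le
      _ = 4 * (x ^ 2 + y ^ 2) ^ 2 := by ring
      _ ≤ 4 * (2 * ((x ^ 2) ^ 2 + (y ^ 2) ^ 2)) := by gcongr; exact add_sq_le
      _ = _ := by ring
  calc ∑ i, T.h i ^ d * (∑ r, X.localSize i r) ^ 4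
      ≤ ∑ i, T.h i ^ d * (d ^ 3 * ∑ r, 8 * (T.supNorm i (X.u i r) ^ 4
          + ((√(T.h i ^ (d - 1)))⁻¹ * ‖X.jump i r‖) ^ 4)) := by
        refine Finset.sum_le_sum fun i _ => ?_
        have hh := T.h_nonneg i
        have h1 := sum_pow_four_le Finset.univ fun r => X.localSize i r
        rw [Finset.card_univ, Fintype.card_fin] at h1
        refine mul_le_mul_of_nonneg_left (h1.trans ?_) (by positivity)
        gcongr with r
        exact hsize i r
    _ = 8 * d ^ 3 * ∑ r, (∑ i, T.h i ^ d * T.supNorm i (X.u i r) ^ 4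
          + ∑ i, T.h i ^ d * ((√(T.h i ^ (d - 1)))⁻¹ * ‖X.jump i r‖) ^ 4) := by
        simp only [← Finset.sum_add_distrib]
        rw [Finset.sum_comm, Finset.mul_sum]
        refine Finset.sum_congr rfl fun i _ => ?_
        rw [Finset.mul_sum, Finset.mul_sum, Finset.mul_sum]
        exact Finset.sum_congr rfl fun r _ => by ring
    _ ≤ 8 * d ^ 3 * ∑ r, (C' * E r ^ 2 + C ^ 2 * E r ^ 2) := by
        gcongr with r
        · exact hu r
        · exact hjump r
    _ = 8 * d ^ 3 * ((C' + C ^ 2) * ∑ r, E r ^ 2) := by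
        congr 1
        rw [Finset.mul_sum]
        exact Finset.sum_congr rfl fun r _ => by ring
    _ ≤ 8 * d ^ 3 * ((C' + C ^ 2) * (∑ r, E r) ^ 2) := by
        gcongr
        exact sum_sq_le_sq_sum_of_nonneg _ fun r _ => hE0 r
    _ = _ := by rw [hE, ← Tuple.normOne_sq]; ring

/-- By linearity this is the bound for the post-processed velocity of `X - Y`. The volume term and
the scaled normal trace both carry the weight `h ^ (d/2)` relative to `localSize`. -/
theorem HasParameters.norm_field_sub_le {k : ℕ} {Λ C : ℝ} (hS : S.HasParameters k Λ)
    (hb : T.Bounds k C) (hd : 0 < d) {X Y : Tuple T} (hX : S.Mem X) (hY : S.Mem Y)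
    {β γ : (i : Fin T.nK) → T.HDiv i} (hβ : S.IsPostprocessed X β) (hγ : S.IsPostprocessed Y γ)
    (i : Fin T.nK) :
    ‖T.field i (β i) - T.field i (γ i)‖ ≤ (1 + |Λ| * √(d * C ^ 3) + |Λ|) * C
      * (√(T.h i ^ d) * ∑ r, (X - Y).localSize i r) := by
  have hh := T.h_pos hd i
  have hC := hb.one_le
  have hC0 : 0 ≤ C := zero_le_one.trans hC
  have h1 := hS.norm_postprocessed_le hb hd (hX.sub hY) (hβ.sub hγ) i
  rw [Pi.sub_apply, map_sub] at h1
  set Z := X - Y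
  have hs : 0 < √(T.h i ^ (d - 1)) := Real.sqrt_pos.2 (by positivity)
  have hsize : ∀ r, T.supNorm i (Z.u i r) ≤ Z.localSize i r := fun r =>
    le_add_of_nonneg_right (by positivity)
  have hv : ‖T.vecK i (Z.u i)‖ ≤ C * (√(T.h i ^ d) * ∑ r, Z.localSize i r) := by
    have h2 : ‖T.vecK i (Z.u i)‖ ≤ ∑ r, ‖T.polyK i (Z.u i r)‖ := by
      refine (pow_le_pow_iff_left₀ (norm_nonneg _)
        (Finset.sum_nonneg fun r _ => norm_nonneg _) two_ne_zero).1 ?_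
      rw [T.norm_sq_vecK]
      exact sum_sq_le_sq_sum_of_nonneg _ fun r _ => norm_nonneg _
    refine h2.trans ?_
    rw [Finset.mul_sum, Finset.mul_sum]
    refine Finset.sum_le_sum fun r _ => ?_
    have h3 : ‖T.polyK i (Z.u i r)‖ ≤ C * (√(T.h i ^ d) * T.supNorm i (Z.u i r)) := by
      refine (pow_le_pow_iff_left₀ (norm_nonneg _)
        (by have := T.supNorm_nonneg i (Z.u i r); positivity) two_ne_zero).1 ?_
      rw [mul_pow, mul_pow, Real.sq_sqrt (by positivity)]
      refine (hb.norm_sq_polyK_le i _).trans ?_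
      gcongr
      exact le_self_pow₀ hC two_ne_zero
    refine h3.trans ?_
    gcongr
    exact hsize r
  have hn : √(T.h i) * ‖Z.hatNormal i‖ ≤ C * (√(T.h i ^ d) * ∑ r, Z.localSize i r) := by
    have h2 : ‖Z.hatNormal i‖ ≤ C * (√(T.h i ^ (d - 1)) * ∑ r, Z.localSize i r) := by
      rw [Finset.mul_sum, Finset.mul_sum]
      refine (norm_sum_le _ _).trans (Finset.sum_le_sum fun r _ => ?_)
      refine (T.norm_mulNormal_le i r _).trans ?_
      have h3 : Z.hatTr i r = T.traceK i (Z.u i r) - Z.jump i r := by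
        rw [Tuple.jump]; abel
      have h4 : ‖T.traceK i (Z.u i r)‖ ≤ C * (√(T.h i ^ (d - 1)) * T.supNorm i (Z.u i r)) := by
        refine (pow_le_pow_iff_left₀ (norm_nonneg _)
          (by have := T.supNorm_nonneg i (Z.u i r); positivity) two_ne_zero).1 ?_
        rw [mul_pow, mul_pow, Real.sq_sqrt (by positivity)]
        exact hb.norm_sq_traceK_le i _
      rw [h3]
      calc ‖T.traceK i (Z.u i r) - Z.jump i r‖ ≤ ‖T.traceK i (Z.u i r)‖ + ‖Z.jump i r‖ :=
            norm_sub_le _ _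
        _ ≤ C * (√(T.h i ^ (d - 1)) * T.supNorm i (Z.u i r)) + C * ‖Z.jump i r‖ :=
            add_le_add h4 (le_mul_of_one_le_left (norm_nonneg _) hC)
        _ = C * (√(T.h i ^ (d - 1)) * Z.localSize i r) := by
            rw [Tuple.localSize]; field_simp
    calc √(T.h i) * ‖Z.hatNormal i‖
        ≤ √(T.h i) * (C * (√(T.h i ^ (d - 1)) * ∑ r, Z.localSize i r)) := by gcongr
      _ = C * (√(T.h i) * √(T.h i ^ (d - 1)) * ∑ r, Z.localSize i r) := by ring
      _ = _ := by rw [Mesh.sqrt_h_mul_sqrt_pow hd]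
  calc _ ≤ _ := h1
    _ ≤ (1 + |Λ| * √(d * C ^ 3)) * (C * (√(T.h i ^ d) * ∑ r, Z.localSize i r))
      + |Λ| * (C * (√(T.h i ^ d) * ∑ r, Z.localSize i r)) := by gcongr
    _ = _ := by ring

theorem HasParameters.abs_volForm_sub_le {k : ℕ} {Λ C : ℝ} (hS : S.HasParameters k Λ)
    (hb : T.Bounds k C) (hd : 0 < d) {Z Z' : Tuple T} (hZ : S.Mem Z) (hZ' : S.Mem Z')
    (X Y : Tuple T) {β γ : (i : Fin T.nK) → T.HDiv i}
    (hβ : S.IsPostprocessed Z β) (hγ : S.IsPostprocessed Z' γ) (i : Fin T.nK) (r : Fin d) :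
    |T.volForm i (T.field i (β i)) (X.u i r) (Y.u i r)
      - T.volForm i (T.field i (γ i)) (X.u i r) (Y.u i r)|
      ≤ (1 + |Λ| * √(d * C ^ 3) + |Λ|) * C * (√(T.h i ^ d) * (∑ s, (Z - Z').localSize i s)
        * X.localSize i r * ‖T.vecK i (grad (Y.u i r))‖) := by
  have hsx : T.supNorm i (X.u i r) ≤ X.localSize i r := le_add_of_nonneg_right (by positivity)
  have hx0 := X.localSize_nonneg i r
  rw [T.volForm_eq_inner, T.volForm_eq_inner, ← inner_sub_left, ← T.volForm_eq_inner]
  refine (Mesh.abs_volForm_le i _ _ _).trans ?_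
  have h1 := hS.norm_field_sub_le hb hd hZ hZ' hβ hγ i
  calc _ ≤ X.localSize i r * (((1 + |Λ| * √(d * C ^ 3) + |Λ|) * C
        * (√(T.h i ^ d) * ∑ s, (Z - Z').localSize i s)) * ‖T.vecK i (grad (Y.u i r))‖) :=
        mul_le_mul hsx (mul_le_mul_of_nonneg_right h1 (norm_nonneg _)) (by positivity) hx0
    _ = _ := by ring

/-- With `l ^ 3 = h ^ ((d-1)/2)` and `s = √h`, the scales `l ^ 2`, `l ^ 2`, `l⁻¹` of the three
factors multiply to `l ^ 3`, and `s * l ^ 3` is the weight `h ^ (d/2)` of the volume term. Face and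
volume terms can therefore be summed together. -/
theorem face_scaling {l s K a x y z : ℝ} (hl : 0 < l) (hs : 0 < s) (hK : 0 ≤ K) (ha : 0 ≤ a)
    (hy : 0 ≤ y) (hz : z ≤ K * l ^ 2 * x) :
    K * l ^ 2 * a * (K * l ^ 2 * x + z) * (K * l⁻¹ * y)
      ≤ 2 * K ^ 3 * (s * l ^ 3 * a * x * (s⁻¹ * y)) := by
  calc K * l ^ 2 * a * (K * l ^ 2 * x + z) * (K * l⁻¹ * y)
      ≤ K * l ^ 2 * a * (K * l ^ 2 * x + K * l ^ 2 * x) * (K * l⁻¹ * y) := by gcongr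
    _ = _ := by field_simp; ring

theorem HasParameters.abs_faceForm_sub_le {k : ℕ} {Λ C : ℝ} (hS : S.HasParameters k Λ)
    (hb : T.Bounds k C) (hd : 0 < d) {Z Z' X Y : Tuple T} (hZ : S.Mem Z) (hZ' : S.Mem Z')
    (hX : S.Mem X) (hY : S.Mem Y) {β γ : (i : Fin T.nK) → T.HDiv i}
    (hβ : S.IsPostprocessed Z β) (hγ : S.IsPostprocessed Z' γ) (i : Fin T.nK) (r : Fin d)
    (j : T.faces i) :
    |T.faceForm j (T.ntr i (β i) j) (X.u i r) (X.uhat j r) (Y.u i r) (Y.uhat j r)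
      - T.faceForm j (T.ntr i (γ i) j) (X.u i r) (X.uhat j r) (Y.u i r) (Y.uhat j r)|
      ≤ 2 * (C + |Λ|) ^ 3 * (√(T.h i ^ d) * (∑ s, (Z - Z').localSize i s) * X.localSize i r
        * ((√(T.h i))⁻¹ * ‖Y.jump i r‖)) := by
  have hl := Mesh.faceScale_pos hd i
  have hC0 : 0 ≤ C := zero_le_one.trans hb.one_le
  have hΛ := abs_nonneg Λ
  have ha0 : 0 ≤ ∑ s, (Z - Z').localSize i s :=
    Finset.sum_nonneg fun s _ => Tuple.localSize_nonneg _ i s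
  have hx0 := X.localSize_nonneg i r
  have hK : 0 ≤ C + |Λ| := add_nonneg hC0 hΛ
  have hjx : |Λ| * (T.faceScale i)⁻¹ * ‖X.jump i r‖
      ≤ (C + |Λ|) * T.faceScale i ^ 2 * X.localSize i r := by
    have h1 : (T.faceScale i ^ 3)⁻¹ * ‖X.jump i r‖ ≤ X.localSize i r := by
      rw [Tuple.localSize, Mesh.sqrt_pow_eq_faceScale hd]
      exact le_add_of_nonneg_left (T.supNorm_nonneg i _)
    calc |Λ| * (T.faceScale i)⁻¹ * ‖X.jump i r‖
        = |Λ| * T.faceScale i ^ 2 * ((T.faceScale i ^ 3)⁻¹ * ‖X.jump i r‖) := by field_simp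
      _ ≤ |Λ| * T.faceScale i ^ 2 * X.localSize i r :=
          mul_le_mul_of_nonneg_left h1 (by positivity)
      _ ≤ (C + |Λ|) * T.faceScale i ^ 2 * X.localSize i r := by
          have : |Λ| ≤ C + |Λ| := le_add_of_nonneg_left hC0
          gcongr
  refine (Mesh.abs_faceForm_sub_le (memLp_ntr (hβ.mem i) j) (memLp_ntr (hγ.mem i) j) _
    (hX.memLp_uhat j r) _ (hY.memLp_uhat j r) (mul_nonneg (by positivity) ha0) (by positivity)
    (by positivity) (by positivity) (hS.eLpNorm_ntr_sub_le hb hd hZ hZ' hβ hγ j)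
    (hS.eLpNorm_uhat_le hb hd hX j r) (hS.eLpNorm_sub_le hd hX j r)
    (hS.eLpNorm_sub_le hd hY j r)).trans ?_
  rw [← Mesh.sqrt_h_mul_sqrt_pow hd, Mesh.sqrt_pow_eq_faceScale hd]
  have hfin := face_scaling hl (Real.sqrt_pos.2 (T.h_pos hd i)) hK ha0
    (norm_nonneg (Y.jump i r)) hjx
  refine le_trans ?_ hfin
  refine mul_le_mul_of_nonneg_left ?_ ?_
  · exact mul_le_mul_of_nonneg_right (mul_le_mul_of_nonneg_right
      (le_add_of_nonneg_left hC0) (by positivity)) (norm_nonneg _)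
  · exact mul_nonneg (mul_nonneg (by positivity) ha0) (add_nonneg (by positivity) (by positivity))

theorem HasParameters.abs_local_sub_le {k : ℕ} {Λ C : ℝ} (hS : S.HasParameters k Λ)
    (hb : T.Bounds k C) (hd : 0 < d) {Z Z' X Y : Tuple T} (hZ : S.Mem Z) (hZ' : S.Mem Z')
    (hX : S.Mem X) (hY : S.Mem Y) {β γ : (i : Fin T.nK) → T.HDiv i}
    (hβ : S.IsPostprocessed Z β) (hγ : S.IsPostprocessed Z' γ) (i : Fin T.nK) (r : Fin d) :
    |(-T.volForm i (T.field i (β i)) (X.u i r) (Y.u i r)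
      + ∑ j : T.faces i, T.faceForm j (T.ntr i (β i) j) (X.u i r) (X.uhat j r) (Y.u i r)
        (Y.uhat j r)) - (-T.volForm i (T.field i (γ i)) (X.u i r) (Y.u i r)
      + ∑ j : T.faces i, T.faceForm j (T.ntr i (γ i) j) (X.u i r) (X.uhat j r) (Y.u i r)
        (Y.uhat j r))| ≤ ((1 + |Λ| * √(d * C ^ 3) + |Λ|) * C + 2 * C * (C + |Λ|) ^ 3)
        * (√(T.h i ^ d) * (∑ s, (Z - Z').localSize i s) * X.localSize i r * Y.localNorm i r) := by
  have hC0 : 0 ≤ C := zero_le_one.trans hb.one_le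
  have hΛ := abs_nonneg Λ
  have hvol := hS.abs_volForm_sub_le hb hd hZ hZ' X Y hβ hγ i r
  have hface := hS.abs_faceForm_sub_le hb hd hZ hZ' hX hY hβ hγ i r
  have hx0 := X.localSize_nonneg i r
  have hq0 : 0 ≤ √(T.h i ^ d) * (∑ s, (Z - Z').localSize i s) * X.localSize i r :=
    mul_nonneg (mul_nonneg (Real.sqrt_nonneg _)
      (Finset.sum_nonneg fun s _ => Tuple.localSize_nonneg _ i s)) hx0
  have hg := norm_nonneg (T.vecK i (grad (Y.u i r)))
  have hj : 0 ≤ (√(T.h i))⁻¹ * ‖Y.jump i r‖ := by positivity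
  have hK1 : 0 ≤ (1 + |Λ| * √(d * C ^ 3) + |Λ|) * C := by positivity
  have hcard := hb.card_le i
  rw [Tuple.localNorm]
  generalize √(T.h i ^ d) * (∑ s, (Z - Z').localSize i s) * X.localSize i r = q at *
  generalize ‖T.vecK i (grad (Y.u i r))‖ = g at *
  generalize (√(T.h i))⁻¹ * ‖Y.jump i r‖ = y at *
  generalize (1 + |Λ| * √(d * C ^ 3) + |Λ|) * C = K1 at *
  generalize T.volForm i (T.field i (β i)) (X.u i r) (Y.u i r) = v at *
  generalize T.volForm i (T.field i (γ i)) (X.u i r) (Y.u i r) = w at *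
  set F := fun j : T.faces i =>
    T.faceForm j (T.ntr i (β i) j) (X.u i r) (X.uhat j r) (Y.u i r) (Y.uhat j r)
  set G := fun j : T.faces i =>
    T.faceForm j (T.ntr i (γ i) j) (X.u i r) (X.uhat j r) (Y.u i r) (Y.uhat j r)
  have hface' : ∀ j, |F j - G j| ≤ 2 * (C + |Λ|) ^ 3 * (q * y) := hface
  have hsum : |∑ j, F j - ∑ j, G j| ≤ C * (2 * (C + |Λ|) ^ 3 * (q * y)) := by
    rw [← Finset.sum_sub_distrib]
    refine (Finset.abs_sum_le_sum_abs _ _).trans ((Finset.sum_le_sum fun j _ => hface' j).trans ?_)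
    rw [Finset.sum_const, Finset.card_univ, Fintype.card_coe, nsmul_eq_mul]
    exact mul_le_mul_of_nonneg_right hcard (by positivity)
  rw [show 2 * C * (C + |Λ|) ^ 3 = C * (2 * (C + |Λ|) ^ 3) by ring]
  exact abs_sub_combine hvol hsum hq0 hg hj hK1 (by positivity)

/-- The continuity of the convective form. -/
theorem exists_abs_convectiveForm_sub_le (hd : d = 2 ∨ d = 3) (k : ℕ) (Λ C : ℝ) {C' : ℝ}
    (hC' : 0 ≤ C') : ∃ K > 0, ∀ (T : Mesh Ω) (S : FESpaces T), S.HasParameters k Λ →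
      T.Bounds k C → S.Sobolev C' →
      ∀ Z Z' X Y : Tuple T, S.Mem Z → S.Mem Z' → S.Mem X → S.Mem Y →
      ∀ β γ : (i : Fin T.nK) → T.HDiv i, S.IsPostprocessed Z β → S.IsPostprocessed Z' γ →
        |convectiveForm β X Y - convectiveForm γ X Y|
          ≤ K * ((Z - Z').normOne * X.normOne * Y.normOne) := by
  have hd0 : 0 < d := by omega
  -- The constants are enlarged to at least one, so that they are dominated by their own powers and
  -- the bounds take the form of fourth powers and squares that Hölder's inequality expects.
  obtain ⟨M, hM1, hM⟩ : ∃ M : ℝ, 1 ≤ M ∧ 8 * d ^ 3 * (C' + C ^ 2) ≤ M :=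
    ⟨_, le_max_left 1 (8 * d ^ 3 * (C' + C ^ 2)), le_max_right _ _⟩
  obtain ⟨N, hN1, hN⟩ : ∃ N : ℝ, 1 ≤ N ∧ 2 * (d : ℝ) ≤ N :=
    ⟨_, le_max_left 1 (2 * (d : ℝ)), le_max_right _ _⟩
  obtain ⟨K0, hK1, hK⟩ : ∃ K : ℝ, 1 ≤ K ∧
      (1 + |Λ| * √(d * C ^ 3) + |Λ|) * C + 2 * C * (C + |Λ|) ^ 3 ≤ K :=
    ⟨_, le_max_left 1 _, le_max_right _ _⟩
  have hM0 : 0 < M := by linarith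
  have hN0 : 0 < N := by linarith
  have hK0 : 0 < K0 := by linarith
  refine ⟨K0 * (M * M * N), by positivity, fun T S hS hb hSob Z Z' X Y hZ hZ' hX hY β γ hβ hγ => ?_⟩
  have hsize : ∀ X, S.Mem X → ∑ i, T.h i ^ d * (∑ r, X.localSize i r) ^ 4
      ≤ (M * X.normOne) ^ 4 := by
    intro X hX
    refine (hSob.sum_localSize_le hd hC' hb hX).trans ?_
    rw [mul_pow]
    exact mul_le_mul_of_nonneg_right (hM.trans (le_self_pow₀ hM1 (by norm_num)))
      (Even.pow_nonneg (by decide) _)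
  have hnorm : ∑ i, (∑ r, Y.localNorm i r) ^ 2 ≤ (N * Y.normOne) ^ 2 := by
    refine Y.sum_localNorm_sq_le.trans ?_
    rw [mul_pow]
    exact mul_le_mul_of_nonneg_right (hN.trans (le_self_pow₀ hN1 (by norm_num))) (sq_nonneg _)
  have hz0 := (Z - Z').normOne_nonneg
  have hx0 := X.normOne_nonneg
  have hy0 := Y.normOne_nonneg
  have hkey := sum_sqrt_mul_mul_mul_le (w := fun i => T.h i ^ d)
    (a := fun i => ∑ s, (Z - Z').localSize i s) (a' := fun i => ∑ r, X.localSize i r)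
    (b := fun i => ∑ r, Y.localNorm i r) (fun i => pow_nonneg (T.h_nonneg i) d)
    (mul_nonneg hM0.le hz0) (mul_nonneg hM0.le hx0) (mul_nonneg hN0.le hy0)
    (hsize _ (hZ.sub hZ')) (hsize _ hX) hnorm
  rw [T.convectiveForm_eq, T.convectiveForm_eq]
  refine (abs_sum_sum_sub_le (q := fun i => √(T.h i ^ d) * ∑ s, (Z - Z').localSize i s)
    (x := X.localSize) (y := Y.localNorm) hK0.le
    (fun i => mul_nonneg (Real.sqrt_nonneg _)
      (Finset.sum_nonneg fun s _ => Tuple.localSize_nonneg _ i s)) X.localSize_nonneg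
    Y.localNorm_nonneg fun i r => ?_).trans ?_
  · refine (hS.abs_local_sub_le hb hd0 hZ hZ' hX hY hβ hγ i r).trans ?_
    refine mul_le_mul_of_nonneg_right hK (mul_nonneg (mul_nonneg (mul_nonneg (Real.sqrt_nonneg _)
      (Finset.sum_nonneg fun s _ => Tuple.localSize_nonneg _ i s)) (X.localSize_nonneg i r))
      (Y.localNorm_nonneg i r))
  · calc _ ≤ K0 * (M * (Z - Z').normOne * (M * X.normOne) * (N * Y.normOne)) :=
          mul_le_mul_of_nonneg_left hkey hK0.le
      _ = _ := by ring

end FESpaces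

end HDG

namespace HDG

/-! ### The bilinear forms -/

namespace FESpaces

variable {d : ℕ} {Ω : Set (Space d)} {T : Mesh Ω} (S : FESpaces T)

/-- The form of the gradient equation as a bilinear map. -/
noncomputable def gradientBilin (ν : ℝ) : Tuple T →ₗ[ℝ] Tuple T →ₗ[ℝ] ℝ :=
  LinearMap.mk₂ ℝ (gradientForm ν)
    (fun X X' Y => by
      simp only [gradientForm, Tuple.L_add, Tuple.u_add, Pi.add_apply, map_add, Tuple.hatTr_add,
        smul_add, inner_add_left, ← Finset.sum_add_distrib]
      exact Finset.sum_congr rfl fun i _ => Finset.sum_congr rfl fun r _ => by ring)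
    (fun c X Y => by
      simp only [gradientForm, Tuple.L_smul, Tuple.u_smul, Pi.smul_apply, map_smul,
        Tuple.hatTr_smul, real_inner_smul_left, smul_eq_mul, Finset.mul_sum]
      exact Finset.sum_congr rfl fun i _ => Finset.sum_congr rfl fun r _ => by ring)
    (fun X Y Y' => by
      simp only [gradientForm, Tuple.L_add, Pi.add_apply, map_add, smul_add, inner_add_right,
        ← Finset.sum_add_distrib]
      exact Finset.sum_congr rfl fun i _ => Finset.sum_congr rfl fun r _ => by ring)
    (fun c X Y => by
      simp only [gradientForm, Tuple.L_smul, Pi.smul_apply, map_smul, real_inner_smul_right,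
        smul_eq_mul, Finset.mul_sum]
      exact Finset.sum_congr rfl fun i _ => Finset.sum_congr rfl fun r _ => by ring)

/-- The viscous form as a bilinear map. -/
noncomputable def viscousBilin (ν : ℝ) : Tuple T →ₗ[ℝ] Tuple T →ₗ[ℝ] ℝ :=
  LinearMap.mk₂ ℝ (S.viscousForm ν)
    (fun X X' Y => by
      simp only [viscousForm, Tuple.L_add, Pi.add_apply, map_add, Tuple.jump_add,
        smul_add, inner_add_left, neg_add, ← Finset.sum_add_distrib]
      exact Finset.sum_congr rfl fun i _ => Finset.sum_congr rfl fun r _ => by ring)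
    (fun c X Y => by
      simp only [viscousForm, Tuple.L_smul, Pi.smul_apply, map_smul, inner_neg_left,
        Tuple.jump_smul, inner_add_left, real_inner_smul_left, smul_eq_mul, Finset.mul_sum]
      exact Finset.sum_congr rfl fun i _ => Finset.sum_congr rfl fun r _ => by ring)
    (fun X Y Y' => by
      simp only [viscousForm, Tuple.u_add, Pi.add_apply, Mesh.grad_add, T.vecK_add, Tuple.jump_add,
        inner_add_right, ← Finset.sum_add_distrib]
      exact Finset.sum_congr rfl fun i _ => Finset.sum_congr rfl fun r _ => by ring)
    (fun c X Y => by
      simp only [viscousForm, Tuple.u_smul, Pi.smul_apply, Mesh.grad_smul, T.vecK_smul,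
        Tuple.jump_smul, real_inner_smul_right, smul_eq_mul, Finset.mul_sum]
      exact Finset.sum_congr rfl fun i _ => Finset.sum_congr rfl fun r _ => by ring)

/-- The form of the divergence constraint as a bilinear map. -/
noncomputable def divergenceBilin : Tuple T →ₗ[ℝ] Tuple T →ₗ[ℝ] ℝ :=
  LinearMap.mk₂ ℝ divergenceForm
    (fun X X' Y => by
      simp only [divergenceForm, Tuple.u_add, Pi.add_apply, T.vecK_add, Tuple.hatNormal_add,
        inner_add_left, neg_add, ← Finset.sum_add_distrib]
      exact Finset.sum_congr rfl fun i _ => by ring)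
    (fun c X Y => by
      simp only [divergenceForm, Tuple.u_smul, Pi.smul_apply, T.vecK_smul, Tuple.hatNormal_smul,
        real_inner_smul_left, smul_eq_mul, Finset.mul_sum]
      exact Finset.sum_congr rfl fun i _ => by ring)
    (fun X Y Y' => by
      simp only [divergenceForm, Tuple.p_add, Pi.add_apply, Mesh.grad_add, T.vecK_add, T.traceK_add,
        inner_add_right, neg_add, ← Finset.sum_add_distrib]
      exact Finset.sum_congr rfl fun i _ => by ring)
    (fun c X Y => by
      simp only [divergenceForm, Tuple.p_smul, Pi.smul_apply, Mesh.grad_smul, T.vecK_smul,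
        T.traceK_smul, real_inner_smul_right, smul_eq_mul, Finset.mul_sum]
      exact Finset.sum_congr rfl fun i _ => by ring)

/-- The pressure form is the negative transpose of the divergence form. -/
theorem pressureForm_eq (X Y : Tuple T) : pressureForm X Y = -divergenceForm Y X := by
  rw [pressureForm, divergenceForm, ← Finset.sum_neg_distrib]
  refine Finset.sum_congr rfl fun i _ => ?_
  have h1 := T.green_poly i (Y.u i) (X.p i)
  have h2 : inner ℝ (Y.hatNormal i) (T.traceK i (X.p i))
      = ∑ r, inner ℝ (T.mulNormal i r (T.traceK i (X.p i))) (Y.hatTr i r) := by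
    rw [Tuple.hatNormal, sum_inner]
    refine Finset.sum_congr rfl fun r _ => ?_
    rw [T.inner_mulNormal, real_inner_comm]
  rw [h2]
  simp only [Tuple.jump, inner_sub_right, Finset.sum_sub_distrib]
  linarith

/-- The viscous dissipation, with the kinematic viscosity taken out. -/
noncomputable def energy (X : Tuple T) : ℝ :=
  ∑ i, ∑ r, (‖T.field i (X.L i r)‖ ^ 2
    + (T.h i)⁻¹ * ‖(S.MS i).starProjection (X.jump i r)‖ ^ 2)

theorem energy_nonneg (X : Tuple T) : 0 ≤ S.energy X :=
  Finset.sum_nonneg fun i _ => Finset.sum_nonneg fun r _ => by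
    have := T.h_nonneg i
    positivity

/-- By Green's formula for the rows of `L` all terms that couple `L` with `u` and `û` cancel. The
stabilization contributes a square because the projection is orthogonal. -/
theorem gradientForm_add_viscousForm_self (ν : ℝ) (X : Tuple T) :
    gradientForm ν X X + S.viscousForm ν X X = ν * S.energy X := by
  rw [gradientForm, viscousForm, energy, Finset.mul_sum, ← Finset.sum_add_distrib]
  refine Finset.sum_congr rfl fun i _ => ?_
  rw [Finset.mul_sum, ← Finset.sum_add_distrib]
  refine Finset.sum_congr rfl fun r _ => ?_
  have h1 := T.green (X.L i r) (X.u i r)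
  have h2 : inner ℝ ((S.MS i).starProjection (X.jump i r)) (X.jump i r)
      = ‖(S.MS i).starProjection (X.jump i r)‖ ^ 2 := by
    have := Submodule.starProjection_inner_eq_zero (X.jump i r) _
      ((S.MS i).starProjection_apply_mem (X.jump i r))
    rw [inner_sub_left, sub_eq_zero] at this
    rw [← real_inner_self_eq_norm_sq, ← this, real_inner_comm]
  have h3 : inner ℝ (T.ntr i (X.L i r)) (X.jump i r)
      = inner ℝ (T.ntr i (X.L i r)) (T.traceK i (X.u i r))
        - inner ℝ (X.hatTr i r) (T.ntr i (X.L i r)) := by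
    rw [Tuple.jump, inner_sub_right, real_inner_comm (X.hatTr i r)]
  rw [real_inner_comm (T.polyK i (X.u i r))] at h1
  simp only [inner_add_left, inner_neg_left, real_inner_smul_left, real_inner_smul_right, h2, h3,
    real_inner_self_eq_norm_sq, ← h1]
  ring

variable {S}

/-- The coercivity of the viscous terms. -/
theorem HasParameters.normOne_sq_le {k : ℕ} {Λ C : ℝ} (hS : S.HasParameters k Λ)
    (hb : T.Bounds k C) (hd : 0 < d) {ν : ℝ} (hν : 0 < ν) {X : Tuple T} (hX : S.Mem X)
    (h : ∀ Y, S.Mem Y → gradientForm ν X Y = 0) :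
    X.normOne ^ 2 ≤ (2 + (1 + 2 * d * C ^ 3) * (Λ ^ 2 + 2 * Λ ^ 2 * (1 + Λ ^ 2)))
      * S.energy X := by
  classical
  rw [Tuple.normOne_sq, energy]
  simp only [Mesh.scalarEnergy]
  rw [Finset.sum_comm, Finset.mul_sum]
  refine Finset.sum_le_sum fun i _ => ?_
  rw [Finset.mul_sum]
  refine Finset.sum_le_sum fun r _ => ?_
  refine hS.local_coercivity hb hd (hX.u i r) (hX.hatTr_mem i r) fun G hG => ?_
  -- A test function with a single row on a single element localizes the gradient equation; the
  -- factor `ν` is cancelled.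
  let Y : Tuple T := ⟨Pi.single i (Pi.single r G), 0, 0, 0⟩
  have hY : S.Mem Y := by
    refine ⟨fun i' r' => ?_, fun _ _ => zero_mem _, fun _ => zero_mem _, by simp [Y],
      fun _ _ => zero_mem _, fun _ _ _ => rfl⟩
    change (Pi.single i (Pi.single r G) : (i : Fin T.nK) → Fin d → T.HDiv i) i' r' ∈ S.V i'
    by_cases hi : i' = i
    · subst hi
      rw [Pi.single_eq_same]
      by_cases hr : r' = r
      · subst hr
        rwa [Pi.single_eq_same]
      · rw [Pi.single_eq_of_ne hr]; exact zero_mem _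
    · rw [Pi.single_eq_of_ne hi]; exact zero_mem _
  have h1 := h Y hY
  rw [gradientForm, Finset.sum_eq_single i, Finset.sum_eq_single r] at h1
  · have h2 : Y.L i r = G := by
      change (Pi.single i (Pi.single r G) : (i : Fin T.nK) → Fin d → T.HDiv i) i r = G
      rw [Pi.single_eq_same, Pi.single_eq_same]
    rw [h2, real_inner_smul_left, real_inner_smul_right, real_inner_smul_right, ← mul_add,
      ← mul_sub] at h1
    exact (mul_eq_zero.1 h1).resolve_left hν.ne'
  · intro r' _ hr
    have h2 : Y.L i r' = 0 := by
      change (Pi.single i (Pi.single r G) : (i : Fin T.nK) → Fin d → T.HDiv i) i r' = 0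
      rw [Pi.single_eq_same, Pi.single_eq_of_ne hr]
    simp [h2]
  · simp
  · intro i' _ hi
    have h2 : Y.L i' = 0 := by
      change (Pi.single i (Pi.single r G) : (i : Fin T.nK) → Fin d → T.HDiv i) i' = 0
      rw [Pi.single_eq_of_ne hi]
    simp [h2]
  · simp

theorem finiteDimensional_of_pi {X ι ι' κ : Type*} [Finite ι] [Finite ι'] [Finite κ]
    [AddCommGroup X] [Module ℝ X] {A B : ι → Type*} {D : ι' → Type*}
    [∀ i, AddCommGroup (A i)] [∀ i, Module ℝ (A i)] [∀ i, FiniteDimensional ℝ (A i)]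
    [∀ i, AddCommGroup (B i)] [∀ i, Module ℝ (B i)] [∀ i, FiniteDimensional ℝ (B i)]
    [∀ j, AddCommGroup (D j)] [∀ j, Module ℝ (D j)] [∀ j, FiniteDimensional ℝ (D j)]
    (a : X →ₗ[ℝ] ((i : ι) → κ → A i)) (b : X →ₗ[ℝ] ((i : ι) → κ → B i))
    (c : X →ₗ[ℝ] ((i : ι) → B i)) (e : X →ₗ[ℝ] ((j : ι') → κ → D j))
    (h : ∀ x, a x = 0 → b x = 0 → c x = 0 → e x = 0 → x = 0) : FiniteDimensional ℝ X := by
  refine Module.Finite.of_injective (a.prod (b.prod (c.prod e)))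
    ((injective_iff_map_eq_zero _).2 fun x hx => ?_)
  exact h x (congrArg Prod.fst hx) (congrArg (fun y => y.2.1) hx)
    (congrArg (fun y => y.2.2.1) hx) (congrArg (fun y => y.2.2.2) hx)

instance : FiniteDimensional ℝ S.memSubmodule := by
  have := S.finite_V
  have := S.finite_W
  have := S.finite_M
  refine finiteDimensional_of_pi (A := fun i => S.V i) (B := fun i => S.W i) (D := fun j => S.M j)
    (κ := Fin d)
    { toFun := fun X i r => ⟨X.1.L i r, X.2.L i r⟩
      map_add' := fun _ _ => rfl
      map_smul' := fun _ _ => rfl }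
    { toFun := fun X i r => ⟨X.1.u i r, X.2.u i r⟩
      map_add' := fun _ _ => rfl
      map_smul' := fun _ _ => rfl }
    { toFun := fun X i => ⟨X.1.p i, X.2.p i⟩
      map_add' := fun _ _ => rfl
      map_smul' := fun _ _ => rfl }
    { toFun := fun X j r => ⟨X.1.uhat j r, X.2.uhat j r⟩
      map_add' := fun _ _ => rfl
      map_smul' := fun _ _ => rfl } fun X h1 h2 h3 h4 => ?_
  refine Subtype.ext ((Tuple.ext_iff' _ _).2 ⟨?_, ?_, ?_, ?_⟩)
  · ext1 i; ext1 r; exact congrArg Subtype.val (congrFun (congrFun h1 i) r)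
  · ext1 i; ext1 r; exact congrArg Subtype.val (congrFun (congrFun h2 i) r)
  · ext1 i; exact congrArg Subtype.val (congrFun h3 i)
  · ext1 j; ext1 r; exact congrArg Subtype.val (congrFun (congrFun h4 j) r)

end FESpaces

end HDG

namespace HDG

namespace FESpaces

variable {d : ℕ} {Ω : Set (Space d)} {T : Mesh Ω} {S : FESpaces T}

/-! ### Definiteness of the discrete norm and uniqueness of the pressure -/

/-- The discrete Poincaré inequality annihilates `u`; the jump is then `-û`, and every face belongs
to some element. -/
theorem Sobolev.eq_zero_of_normOne_eq_zero {C' : ℝ} (hSob : S.Sobolev C') (hd : 0 < d)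
    {X : Tuple T} (hX : S.Mem X) (h : X.normOne = 0) : X.u = 0 ∧ X.uhat = 0 := by
  have hE : ∀ r, T.scalarEnergy (fun i => X.u i r) (fun j => X.uhat j r) = 0 := fun r =>
    le_antisymm (by simpa [h] using X.scalarEnergy_le r) (T.scalarEnergy_nonneg _ _)
  have hu : ∀ i r, X.u i r = 0 := by
    intro i r
    have h1 := hSob.norm_sq (fun i => X.u i r) (fun i => hX.u i r) (fun j => X.uhat j r)
      fun j hj => hX.boundary j hj r
    rw [hE, mul_zero] at h1
    have h2 := (Finset.sum_eq_zero_iff_of_nonneg fun i _ => sq_nonneg _).1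
      (le_antisymm h1 (Finset.sum_nonneg fun i _ => sq_nonneg _)) i (Finset.mem_univ i)
    exact T.poly_eq_zero_of_polyK (norm_eq_zero.1 (pow_eq_zero_iff two_ne_zero |>.1 h2))
  refine ⟨funext fun i => funext fun r => hu i r, funext fun j => funext fun r => ?_⟩
  obtain ⟨i, hi⟩ := T.face_used j
  have hh := T.h_pos hd i
  have h1 := hE r
  rw [Mesh.scalarEnergy, Finset.sum_eq_zero_iff_of_nonneg fun i _ => by
    have := T.h_nonneg i
    positivity] at h1
  have h2 := h1 i (Finset.mem_univ i)
  have h3 : (T.h i)⁻¹ * ‖X.jump i r‖ ^ 2 = 0 := by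
    refine le_antisymm ?_ (by positivity)
    exact (le_add_of_nonneg_left (sq_nonneg _)).trans h2.le
  have h4 : X.jump i r = 0 := by
    simpa [hh.ne'] using h3
  rw [Tuple.jump, hu, T.traceK_zero, zero_sub, neg_eq_zero] at h4
  exact congrArg (fun τ : T.TraceL2 i => τ ⟨j, hi⟩) h4

/-- The test velocity `∇p` with zero trace is admissible because `W` is closed under derivatives,
and it yields `‖∇p‖ = 0`. -/
theorem exists_eq_C_of_divergenceForm_eq_zero {X : Tuple T} (hX : S.Mem X)
    (h : ∀ Y, S.Mem Y → divergenceForm Y X = 0) (i : Fin T.nK) :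
    X.p i = MvPolynomial.C (evalAt (X.p i) 0) := by
  let Y : Tuple T := ⟨0, fun i => grad (X.p i), 0, 0⟩
  have hY : S.Mem Y := ⟨fun _ _ => zero_mem _, fun i r => S.pderiv_W i _ (hX.p i) r,
    fun _ => zero_mem _, by simp [Y], fun _ _ => zero_mem _, fun _ _ _ => rfl⟩
  have h1 := h Y hY
  have h2 : ∀ i, Y.hatNormal i = 0 := fun i => by
    have : Y.hatNormal i = (0 : Tuple T).hatNormal i := rfl
    rw [this, ← Tuple.hatNormalMap_apply, map_zero]
  simp only [divergenceForm, h2, inner_zero_left, add_zero] at h1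
  rw [Finset.sum_neg_distrib, neg_eq_zero] at h1
  have h3 : ∑ i, ‖T.vecK i (grad (X.p i))‖ ^ 2 = 0 := by
    rw [← h1]
    exact Finset.sum_congr rfl fun i _ => (real_inner_self_eq_norm_sq _).symm
  have h4 := (Finset.sum_eq_zero_iff_of_nonneg fun i _ => sq_nonneg _).1 h3 i (Finset.mem_univ i)
  rw [T.norm_sq_vecK, Finset.sum_eq_zero_iff_of_nonneg fun i _ => sq_nonneg _] at h4
  refine eq_C_of_grad_eq_zero (funext fun r => ?_)
  exact T.poly_eq_zero_of_polyK
    (norm_eq_zero.1 (pow_eq_zero_iff two_ne_zero |>.1 (h4 r (Finset.mem_univ r))))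

/-- A trace equal to one in a single component on a single interior face measures the jump of the
constant pressures times that component of the normal, because the normals of the two elements are
opposite. Some component of the normal is nonzero. -/
theorem pressure_eq_of_mem_faces {X : Tuple T} (hX : S.Mem X)
    (h : ∀ Y, S.Mem Y → divergenceForm Y X = 0) {j : Fin T.nF} (hj : ¬ T.face j ⊆ frontier Ω)
    {i i' : Fin T.nK} (hi : j ∈ T.faces i) (hi' : j ∈ T.faces i') :
    evalAt (X.p i) 0 = evalAt (X.p i') 0 := by
  classical
  by_cases hne : i = i'
  · rw [hne]
  have hC := fun i => exists_eq_C_of_divergenceForm_eq_zero hX h i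
  set c : Fin T.nK → ℝ := fun i => evalAt (X.p i) 0 with hc
  change c i = c i'
  -- If constants are missing from `M(F)`, the test trace is not available; but then `W` is trivial
  -- on every element with this face, and the pressures there are zero.
  by_cases h1 : polyL2 (T.carried_surf j) 1 ∈ S.M j
  swap
  · have h2 : ∀ k, j ∈ T.faces k → c k = 0 := by
      intro k hk
      by_contra hck
      refine h1 (S.traceK_mem (S.one_mem_W (hX.p k) fun h0 => hck ?_) ⟨j, hk⟩)
      simp [hc, h0]
    rw [h2 i hi, h2 i' hi']
  have hnorm : ‖polyL2 (T.carried_surf j) 1‖ ^ 2 ≠ 0 := by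
    rw [norm_sq_polyL2]
    have hne : T.surf j Set.univ ≠ 0 := T.surf_ne_zero j isOpen_univ (by
      rw [Set.univ_inter]; exact (T.face_flat j).isConnected.nonempty)
    have := (ENNReal.toReal_pos hne (measure_ne_top _ _)).ne'
    simpa [Measure.real] using this
  let n : Fin T.nK → Space d := fun k => if hk : j ∈ T.faces k then T.normal k ⟨j, hk⟩ else 0
  -- Only elements that own the face `j` contribute, as `n` is zero for the others.
  have hflux : ∀ r, ∑ k, c k * n k r = 0 := by
    intro r
    let m : (j : Fin T.nF) → Fin d → Lp ℝ 2 (T.surf j) :=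
      Pi.single j (Pi.single r (polyL2 (T.carried_surf j) 1))
    let Y : Tuple T := ⟨0, 0, 0, m⟩
    have hmj : m j = Pi.single r (polyL2 (T.carried_surf j) 1) := Pi.single_eq_same _ _
    have hmj' : ∀ j', j' ≠ j → m j' = 0 := fun j' hj' => Pi.single_eq_of_ne hj' _
    have hY : S.Mem Y := by
      refine ⟨fun _ _ => zero_mem _, fun _ _ => zero_mem _, fun _ => zero_mem _, by simp [Y],
        fun j' r' => ?_, fun j' hj'' r' => ?_⟩
      · by_cases hj' : j' = j
        · subst hj'
          change m j' r' ∈ _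
          rw [hmj]
          by_cases hr : r' = r
          · subst hr; rwa [Pi.single_eq_same]
          · rw [Pi.single_eq_of_ne hr]; exact zero_mem _
        · change m j' r' ∈ _
          rw [hmj' j' hj']; exact zero_mem _
      · have hj' : j' ≠ j := fun he => hj (he ▸ hj'')
        change m j' r' = 0
        rw [hmj' j' hj']; rfl
    have h2 := h Y hY
    have h3 : ∀ k, inner ℝ (Y.hatNormal k) (T.traceK k (X.p k))
        = c k * n k r * ‖polyL2 (T.carried_surf j) 1‖ ^ 2 := by
      intro k
      have hpk : X.p k = c k • (1 : Poly d) := by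
        rw [hC k, MvPolynomial.smul_eq_C_mul, mul_one]
      have h4 : Y.hatNormal k = T.mulNormal k r (Y.hatTr k r) := by
        rw [Tuple.hatNormal, Finset.sum_eq_single r]
        · intro r' _ hr'
          ext1 j'
          change T.normal k j' r' • m j' r' = 0
          by_cases hj' : (j' : Fin T.nF) = j
          · have : m j' r' = 0 := by
              obtain ⟨j', hj''⟩ := j'
              dsimp only at hj' ⊢
              subst hj'
              rw [hmj, Pi.single_eq_of_ne hr']
            rw [this, smul_zero]
          · rw [hmj' _ hj', Pi.zero_apply, smul_zero]
        · simp
      rw [h4, hpk, T.traceK_smul, real_inner_smul_right, PiLp.inner_apply]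
      have h5 : ∀ j' : T.faces k, (j' : Fin T.nF) ≠ j →
          inner ℝ (T.mulNormal k r (Y.hatTr k r) j') (T.traceK k 1 j') = 0 := by
        intro j' hj'
        change inner ℝ (T.normal k j' r • m j' r) _ = 0
        rw [hmj' _ hj', Pi.zero_apply, smul_zero, inner_zero_left]
      by_cases hk : j ∈ T.faces k
      · rw [Finset.sum_eq_single ⟨j, hk⟩ (fun j' _ hj' => h5 j' fun he => hj' (Subtype.ext he))
          (by simp)]
        have h6 : n k = T.normal k ⟨j, hk⟩ := dif_pos hk
        change c k * inner ℝ (T.normal k ⟨j, hk⟩ r • m j r) (polyL2 (T.carried_surf j) 1) = _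
        rw [hmj, Pi.single_eq_same, real_inner_smul_left, real_inner_self_eq_norm_sq, h6]
        ring
      · have h6 : n k = 0 := dif_neg hk
        rw [Finset.sum_eq_zero fun j' _ => h5 j' fun he => hk (he ▸ j'.2), h6]
        simp
    have h7 : ∀ k, T.vecK k (0 : Fin d → Poly d) = 0 := fun k => by
      simpa using T.vecK_smul k 0 (0 : Fin d → Poly d)
    have h8 : ∀ k, T.vecK k (Y.u k) = 0 := h7
    simp only [divergenceForm, h3, h8, inner_zero_left, neg_zero, zero_add] at h2
    rw [← Finset.sum_mul] at h2
    exact (mul_eq_zero.1 h2).resolve_right hnorm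
  have hfilter : (Finset.univ.filter fun k => j ∈ T.faces k) = {i, i'} := by
    refine (Finset.eq_of_subset_of_card_le (fun k hk => ?_) ?_).symm
    · rcases Finset.mem_insert.1 hk with rfl | hk
      · simpa using hi
      · rw [Finset.mem_singleton.1 hk]; simpa using hi'
    · rw [Finset.card_pair hne]
      exact T.card_elem_le_two j
  have hni : n i = T.normal i ⟨j, hi⟩ := dif_pos hi
  have hni' : n i' = -T.normal i ⟨j, hi⟩ := by
    rw [show n i' = T.normal i' ⟨j, hi'⟩ from dif_pos hi']
    exact (T.normal_eq_or_eq_neg hi hi').resolve_left fun he =>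
      hne (T.elem_eq_of_normal_eq hi hi' he.symm)
  have hpair : ∀ r, (c i - c i') * T.normal i ⟨j, hi⟩ r = 0 := by
    intro r
    have h2 := hflux r
    rw [← Finset.sum_subset (Finset.subset_univ ({i, i'} : Finset (Fin T.nK))),
      Finset.sum_pair hne, hni, hni'] at h2
    · rw [PiLp.neg_apply] at h2
      linarith
    · intro k _ hk
      rw [← hfilter, Finset.mem_filter] at hk
      have : n k = 0 := dif_neg fun hk' => hk ⟨Finset.mem_univ k, hk'⟩
      simp [this]
  by_contra hcne
  have h0 : T.normal i ⟨j, hi⟩ = 0 := by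
    ext r
    exact (mul_eq_zero.1 (hpair r)).resolve_left (sub_ne_zero.2 hcne)
  have := T.norm_normal i ⟨j, hi⟩
  rw [h0, norm_zero] at this
  exact zero_ne_one this

/-- The discrete inf-sup property, in qualitative form. -/
theorem pressure_eq_zero (hΩ : IsPolyhedralDomain Ω) {X : Tuple T} (hX : S.Mem X)
    (h : ∀ Y, S.Mem Y → divergenceForm Y X = 0) : X.p = 0 := by
  have hC := fun i => exists_eq_C_of_divergenceForm_eq_zero hX h i
  have heq := T.eq_of_eq_across_faces hΩ (c := fun i => evalAt (X.p i) 0)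
    fun j hj i i' hi hi' => pressure_eq_of_mem_faces hX h hj hi hi'
  have hm := hX.mean_p
  ext1 i
  obtain ⟨a, ha⟩ : ∃ a, a = evalAt (X.p i) 0 := ⟨_, rfl⟩
  have h1 : ∀ i' x, evalAt (X.p i') x = a := by
    intro i' x
    rw [hC i', evalAt_C, heq i' i, ha]
  simp only [h1, integral_const, smul_eq_mul] at hm
  rw [← Finset.sum_mul] at hm
  have hpos : ∀ i, 0 < (T.vol i).real Set.univ := fun i => by
    refine ENNReal.toReal_pos ?_ (measure_ne_top _ _)
    rw [Mesh.vol, Measure.restrict_apply_univ]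
    exact ((T.elem_polyhedral i).isOpen.measure_pos volume (T.elem_nonempty i)).ne'
  have h2 : 0 < ∑ i, (T.vol i).real Set.univ :=
    Finset.sum_pos (fun i _ => hpos i) ⟨i, Finset.mem_univ i⟩
  rw [hC i, ← ha, (mul_eq_zero.1 hm).resolve_left h2.ne', map_zero, Pi.zero_apply]

end FESpaces

end HDG

namespace HDG

namespace FESpaces

variable {d : ℕ} {Ω : Set (Space d)} {T : Mesh Ω} {S : FESpaces T}

/-! ### The load -/

/-- The fields are the restrictions of `f` to the elements; their squared norms add up to at most
that of `f` because the elements are disjoint subsets of `Ω`. -/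
theorem exists_load_eq (hΩ : IsPolyhedralDomain Ω) (T : Mesh Ω)
    (f : Lp (Space d) 2 (volume.restrict Ω)) :
    ∃ g : (i : Fin T.nK) → Lp (Space d) 2 (T.vol i),
      (∀ Y : Tuple T, load f Y = ∑ i, inner ℝ (g i) (T.vecK i (Y.u i))) ∧
      ∑ i, ‖g i‖ ^ 2 ≤ ‖f‖ ^ 2 := by
  have hle : ∀ i, T.vol i ≤ volume.restrict Ω := fun i =>
    Measure.restrict_mono (T.elem_subset hΩ i) le_rfl
  have hm : ∀ i, MemLp f 2 (T.vol i) := fun i => (Lp.memLp f).mono_measure (hle i)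
  refine ⟨fun i => (hm i).toLp f, fun Y => Finset.sum_congr rfl fun i _ => ?_, ?_⟩
  · rw [T.inner_vecK_right]
    refine integral_congr_ae ?_
    filter_upwards [(hm i).coeFn_toLp] with x hx
    rw [hx]
  · have hint : IntegrableOn (fun x => ‖f x‖ ^ 2) Ω volume :=
      (memLp_two_iff_integrable_sq_norm (Lp.memLp f).1).1 (Lp.memLp f)
    have h1 : ∀ i, ‖(hm i).toLp f‖ ^ 2 = ∫ x in T.elem i, ‖f x‖ ^ 2 := by
      intro i
      rw [← real_inner_self_eq_norm_sq, L2.inner_def]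
      refine integral_congr_ae ?_
      filter_upwards [(hm i).coeFn_toLp] with x hx
      rw [hx, real_inner_self_eq_norm_sq]
    have h2 : ‖f‖ ^ 2 = ∫ x in Ω, ‖f x‖ ^ 2 := by
      rw [← real_inner_self_eq_norm_sq, L2.inner_def]
      exact integral_congr_ae (ae_of_all _ fun x => real_inner_self_eq_norm_sq _)
    simp only [h1, h2]
    rw [← integral_iUnion_fintype (fun i => T.measurableSet_elem i) T.elem_disjoint
      fun i => hint.mono_set (T.elem_subset hΩ i)]
    exact setIntegral_mono_set hint (ae_of_all _ fun x => sq_nonneg _)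
      (Set.iUnion_subset fun i => T.elem_subset hΩ i).eventuallyLE

/-- The load as a linear functional. -/
theorem exists_linearMap_load (hΩ : IsPolyhedralDomain Ω) (T : Mesh Ω)
    (f : Lp (Space d) 2 (volume.restrict Ω)) : ∃ l : Tuple T →ₗ[ℝ] ℝ, ∀ Y, l Y = load f Y := by
  obtain ⟨g, hg, -⟩ := exists_load_eq hΩ T f
  refine ⟨⟨⟨load f, fun X Y => ?_⟩, fun c X => ?_⟩, fun Y => rfl⟩
  · simp only [hg, Tuple.u_add, Pi.add_apply, T.vecK_add, inner_add_right, Finset.sum_add_distrib]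
  · simp only [hg, Tuple.u_smul, Pi.smul_apply, T.vecK_smul, real_inner_smul_right,
      ← Finset.mul_sum, RingHom.id_apply, smul_eq_mul]

theorem Sobolev.sum_norm_sq_vecK_le {C' : ℝ} (hSob : S.Sobolev C') {X : Tuple T}
    (hX : S.Mem X) : ∑ i, ‖T.vecK i (X.u i)‖ ^ 2 ≤ C' * X.normOne ^ 2 := by
  simp only [T.norm_sq_vecK, Tuple.normOne_sq]
  rw [Finset.sum_comm, Finset.mul_sum]
  exact Finset.sum_le_sum fun r _ => hSob.norm_sq (fun i => X.u i r) (fun i => hX.u i r)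
    (fun j => X.uhat j r) fun j hj => hX.boundary j hj r

theorem Sobolev.load_le {C' : ℝ} (hSob : S.Sobolev C') (hC' : 0 ≤ C')
    (hΩ : IsPolyhedralDomain Ω) (f : Lp (Space d) 2 (volume.restrict Ω)) {X : Tuple T}
    (hX : S.Mem X) : load f X ≤ √C' * ‖f‖ * X.normOne := by
  obtain ⟨g, hg, hgf⟩ := exists_load_eq hΩ T f
  have hn := X.normOne_nonneg
  rw [hg]
  calc ∑ i, inner ℝ (g i) (T.vecK i (X.u i)) ≤ ∑ i, ‖g i‖ * ‖T.vecK i (X.u i)‖ :=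
        Finset.sum_le_sum fun i _ => real_inner_le_norm _ _
    _ ≤ √(∑ i, ‖g i‖ ^ 2) * √(∑ i, ‖T.vecK i (X.u i)‖ ^ 2) := Real.sum_mul_le_sqrt_mul_sqrt _ _ _
    _ ≤ √(‖f‖ ^ 2) * √(C' * X.normOne ^ 2) :=
        mul_le_mul (Real.sqrt_le_sqrt hgf) (Real.sqrt_le_sqrt (hSob.sum_norm_sq_vecK_le hX))
          (Real.sqrt_nonneg _) (Real.sqrt_nonneg _)
    _ = √C' * ‖f‖ * X.normOne := by
        rw [Real.sqrt_sq (norm_nonneg _), Real.sqrt_mul hC', Real.sqrt_sq hn]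
        ring

/-! ### The linearized problem -/

variable (S) in
/-- `X` solves the problem that is linearized at the velocity `β`, with the functional `l` as its
right-hand side. -/
structure SolvesOseen (ν : ℝ) (β : (i : Fin T.nK) → T.HDiv i) (l : Tuple T → ℝ) (X : Tuple T) :
    Prop where
  mem : S.Mem X
  gradient : ∀ Y, S.Mem Y → gradientForm ν X Y = 0
  momentum : ∀ Y, S.Mem Y →
    S.viscousForm ν X Y + pressureForm X Y + convectiveForm β X Y = l Y
  divergence : ∀ Y, S.Mem Y → divergenceForm X Y = 0

theorem isSolution_iff {ν : ℝ} {f : Space d → Space d} {X : Tuple T} :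
    S.IsSolution ν f X ↔ ∃ β, S.IsPostprocessed X β ∧ S.SolvesOseen ν β (load f) X := by
  constructor
  · rintro ⟨hX, β, hβ, h⟩
    exact ⟨β, hβ, hX, fun Y hY => (h Y hY).1, fun Y hY => (h Y hY).2.1, fun Y hY => (h Y hY).2.2⟩
  · rintro ⟨β, hβ, h⟩
    exact ⟨h.mem, β, hβ, fun Y hY => ⟨h.gradient Y hY, h.momentum Y hY, h.divergence Y hY⟩⟩

theorem pressureForm_sub_left (X X' Y : Tuple T) :
    pressureForm (X - X') Y = pressureForm X Y - pressureForm X' Y := by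
  simp only [pressureForm_eq]
  have : divergenceForm Y (X - X') = divergenceForm Y X - divergenceForm Y X' :=
    (divergenceBilin Y).map_sub X X'
  rw [this]; ring

theorem convectiveForm_sub_left {β : (i : Fin T.nK) → T.HDiv i} (hβ : ∀ i, β i ∈ S.Vs i)
    {X X' Y : Tuple T} (hX : S.Mem X) (hX' : S.Mem X') (hY : S.Mem Y) :
    convectiveForm β (X - X') Y = convectiveForm β X Y - convectiveForm β X' Y := by
  have h := convectiveForm_add_left hβ (hX.sub hX') hX' hY
  rw [sub_add_cancel] at h
  rw [h]; ring

/-- The common load drops out, and the difference is driven by what the two convective velocities do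
to the second solution. Both the contraction estimate and uniqueness start from this. -/
theorem SolvesOseen.sub {ν : ℝ} {β γ : (i : Fin T.nK) → T.HDiv i} {l : Tuple T → ℝ}
    {X X' : Tuple T} (hβ : ∀ i, β i ∈ S.Vs i) (hX : S.SolvesOseen ν β l X)
    (hX' : S.SolvesOseen ν γ l X') :
    S.SolvesOseen ν β (fun Y => convectiveForm γ X' Y - convectiveForm β X' Y) (X - X') := by
  refine ⟨hX.mem.sub hX'.mem, fun Y hY => ?_, fun Y hY => ?_, fun Y hY => ?_⟩
  · have : gradientForm ν (X - X') Y = gradientForm ν X Y - gradientForm ν X' Y :=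
      congrArg (fun g => g Y) ((gradientBilin ν).map_sub X X')
    rw [this, hX.gradient Y hY, hX'.gradient Y hY, sub_self]
  · have : S.viscousForm ν (X - X') Y = S.viscousForm ν X Y - S.viscousForm ν X' Y :=
      congrArg (fun g => g Y) ((S.viscousBilin ν).map_sub X X')
    rw [this, pressureForm_sub_left, convectiveForm_sub_left hβ hX.mem hX'.mem hY]
    have h1 := hX.momentum Y hY
    have h2 := hX'.momentum Y hY
    linarith
  · have : divergenceForm (X - X') Y = divergenceForm X Y - divergenceForm X' Y :=
      congrArg (fun g => g Y) ((divergenceBilin).map_sub X X')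
    rw [this, hX.divergence Y hY, hX'.divergence Y hY, sub_self]

/-- The energy identity. -/
theorem SolvesOseen.energy_eq {ν : ℝ} {β : (i : Fin T.nK) → T.HDiv i} {l : Tuple T → ℝ}
    {X : Tuple T} (h : S.SolvesOseen ν β l X) : ν * S.energy X + convectiveForm β X X = l X := by
  have h1 := h.momentum X h.mem
  rw [pressureForm_eq, h.divergence X h.mem] at h1
  rw [← gradientForm_add_viscousForm_self, h.gradient X h.mem, ← h1]
  ring

/-- The energy identity, with its nonnegative convective term dropped, combined with coercivity. -/
theorem SolvesOseen.normOne_sq_le {ν c : ℝ} {β : (i : Fin T.nK) → T.HDiv i} {l : Tuple T → ℝ}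
    {X : Tuple T} (h : S.SolvesOseen ν β l X) (hν : 0 < ν) (hc : 0 ≤ c)
    (hβ : 0 ≤ convectiveForm β X X)
    (hcoer : ∀ X, S.Mem X → (∀ Y, S.Mem Y → gradientForm ν X Y = 0) →
      X.normOne ^ 2 ≤ c * S.energy X) : ν * X.normOne ^ 2 ≤ c * l X := by
  have h1 := h.energy_eq
  calc ν * X.normOne ^ 2 ≤ ν * (c * S.energy X) :=
        mul_le_mul_of_nonneg_left (hcoer X h.mem h.gradient) hν.le
    _ = c * (ν * S.energy X) := by ring
    _ ≤ c * l X := mul_le_mul_of_nonneg_left (by linarith) hc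

/-- Coercivity annihilates `u` and `û`, and the energy annihilates `L`. What is left of the momentum
equation says that the pressure is orthogonal to all discrete divergences, which forces it to
vanish. -/
theorem SolvesOseen.eq_zero {ν c C' : ℝ} {β : (i : Fin T.nK) → T.HDiv i} {l : Tuple T → ℝ}
    {X : Tuple T} (h : S.SolvesOseen ν β l X) (hl : ∀ Y, S.Mem Y → l Y = 0) (hν : 0 < ν)
    (hc : 0 ≤ c) (hβ : 0 ≤ convectiveForm β X X)
    (hcoer : ∀ X, S.Mem X → (∀ Y, S.Mem Y → gradientForm ν X Y = 0) →
      X.normOne ^ 2 ≤ c * S.energy X)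
    (hSob : S.Sobolev C') (hd : 0 < d) (hΩ : IsPolyhedralDomain Ω) : X = 0 := by
  have h1 := h.normOne_sq_le hν hc hβ hcoer
  rw [hl X h.mem, mul_zero] at h1
  have h2 : X.normOne = 0 := by
    refine (pow_eq_zero_iff two_ne_zero).1 (le_antisymm ?_ (sq_nonneg _))
    exact le_of_mul_le_mul_left (by simpa using h1) hν
  obtain ⟨hu, hhat⟩ := hSob.eq_zero_of_normOne_eq_zero hd h.mem h2
  have h3 := h.energy_eq
  rw [hl X h.mem] at h3
  have h4 : S.energy X = 0 := by
    refine le_antisymm ?_ (S.energy_nonneg X)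
    refine le_of_mul_le_mul_left (a := ν) ?_ hν
    linarith
  have hL : X.L = 0 := by
    ext1 i; ext1 r
    have hpos : ∀ i r, 0 ≤ ‖T.field i (X.L i r)‖ ^ 2
        + (T.h i)⁻¹ * ‖(S.MS i).starProjection (X.jump i r)‖ ^ 2 := fun i r => by
      have := T.h_nonneg i
      positivity
    rw [energy, Finset.sum_eq_zero_iff_of_nonneg fun i _ => Finset.sum_nonneg fun r _ => hpos i r]
      at h4
    have h5 := h4 i (Finset.mem_univ i)
    rw [Finset.sum_eq_zero_iff_of_nonneg fun r _ => hpos i r] at h5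
    have h6 := h5 r (Finset.mem_univ r)
    have h7 : ‖T.field i (X.L i r)‖ ^ 2 = 0 := by
      have h8 : 0 ≤ (T.h i)⁻¹ * ‖(S.MS i).starProjection (X.jump i r)‖ ^ 2 := by
        have := T.h_nonneg i
        positivity
      exact le_antisymm (by linarith) (sq_nonneg _)
    refine T.field_injective i ?_
    rw [norm_eq_zero.1 ((pow_eq_zero_iff two_ne_zero).1 h7)]
    exact (map_zero _).symm
  have hp : X.p = 0 := by
    refine pressure_eq_zero hΩ h.mem fun Y hY => ?_
    have h5 := h.momentum Y hY
    have hX : X = ⟨0, 0, X.p, 0⟩ := (Tuple.ext_iff' _ _).2 ⟨hL, hu, rfl, hhat⟩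
    have h6 : S.viscousForm ν X Y = 0 := by
      rw [hX]
      change S.viscousForm ν 0 Y = 0
      exact congrArg (fun g => g Y) ((S.viscousBilin ν).map_zero)
    have h7 : convectiveForm β X Y = 0 := by
      rw [hX]
      change convectiveForm β 0 Y = 0
      have := convectiveForm_smul_left β 0 0 Y
      rwa [zero_smul, zero_mul] at this
    rw [h6, h7, hl Y hY, pressureForm_eq] at h5
    linarith
  exact (Tuple.ext_iff' _ _).2 ⟨hL, hu, hp, hhat⟩

/-- The sum of the forms on the left-hand sides of the linearized problem. -/
noncomputable def oseenBilin (S : FESpaces T) (ν : ℝ) {β : (i : Fin T.nK) → T.HDiv i}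
    (hβ : ∀ i, β i ∈ S.Vs i) : S.memSubmodule →ₗ[ℝ] S.memSubmodule →ₗ[ℝ] ℝ :=
  (gradientBilin ν + S.viscousBilin ν - divergenceBilin.flip + divergenceBilin).compl₁₂
    S.memSubmodule.subtype S.memSubmodule.subtype +
  LinearMap.mk₂ ℝ (fun X Y : S.memSubmodule => convectiveForm β (X : Tuple T) Y)
    (fun X X' Y => convectiveForm_add_left hβ X.2 X'.2 Y.2)
    (fun c X Y => convectiveForm_smul_left β c X Y)
    (fun X Y Y' => convectiveForm_add_right hβ X.2 Y.2 Y'.2)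
    (fun c X Y => convectiveForm_smul_right β c X Y)

theorem oseenBilin_apply (S : FESpaces T) (ν : ℝ) {β : (i : Fin T.nK) → T.HDiv i}
    (hβ : ∀ i, β i ∈ S.Vs i) (X Y : S.memSubmodule) :
    S.oseenBilin ν hβ X Y = gradientForm ν (X : Tuple T) Y
      + (S.viscousForm ν (X : Tuple T) Y + pressureForm (X : Tuple T) Y
        + convectiveForm β (X : Tuple T) Y) + divergenceForm (X : Tuple T) Y := by
  rw [pressureForm_eq]
  change (gradientForm ν (X : Tuple T) Y + S.viscousForm ν (X : Tuple T) Y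
    - divergenceForm (Y : Tuple T) X + divergenceForm (X : Tuple T) Y)
    + convectiveForm β (X : Tuple T) Y = _
  ring

/-- The three equations are recovered from their sum by test functions in which only `L`, or only
the pressure, is nonzero. The right-hand side does not see these, since it depends only on the test
velocity. -/
theorem solvesOseen_of_oseenBilin {ν : ℝ} {β : (i : Fin T.nK) → T.HDiv i}
    (hβ : ∀ i, β i ∈ S.Vs i) {l : Tuple T → ℝ} (hl0 : l 0 = 0)
    (hl : ∀ Y Y' : Tuple T, Y.u = Y'.u → l Y = l Y') (X : S.memSubmodule)
    (h : ∀ Y : S.memSubmodule, S.oseenBilin ν hβ X Y = l Y) : S.SolvesOseen ν β l X := by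
  have h' : ∀ Y : Tuple T, S.Mem Y → gradientForm ν (X : Tuple T) Y
      + (S.viscousForm ν (X : Tuple T) Y + pressureForm (X : Tuple T) Y
        + convectiveForm β (X : Tuple T) Y) + divergenceForm (X : Tuple T) Y = l Y := fun Y hY => by
    rw [← oseenBilin_apply S ν hβ X ⟨Y, hY⟩]
    exact h ⟨Y, hY⟩
  have z1 : gradientForm ν (X : Tuple T) 0 = 0 := (gradientBilin ν _).map_zero
  have z2 : S.viscousForm ν (X : Tuple T) 0 = 0 := (S.viscousBilin ν _).map_zero
  have z3 : divergenceForm (X : Tuple T) 0 = 0 := (divergenceBilin _).map_zero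
  have z4 : pressureForm (X : Tuple T) 0 = 0 := by
    rw [pressureForm_eq, neg_eq_zero]
    exact congrArg (fun g => g (X : Tuple T)) (divergenceBilin.map_zero)
  have z5 : convectiveForm β (X : Tuple T) 0 = 0 := by
    have := convectiveForm_smul_right β 0 (X : Tuple T) 0
    rwa [zero_smul, zero_mul] at this
  have hgrad : ∀ Y, S.Mem Y → gradientForm ν (X : Tuple T) Y = 0 := by
    intro Y hY
    let Y' : Tuple T := ⟨Y.L, 0, 0, 0⟩
    have hY' : S.Mem Y' := ⟨hY.L, fun _ _ => zero_mem _, fun _ => zero_mem _, by simp [Y'],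
      fun _ _ => zero_mem _, fun _ _ _ => rfl⟩
    have h1 := h' Y' hY'
    have e1 : gradientForm ν (X : Tuple T) Y' = gradientForm ν (X : Tuple T) Y := rfl
    have e2 : S.viscousForm ν (X : Tuple T) Y' = S.viscousForm ν (X : Tuple T) 0 := rfl
    have e3 : pressureForm (X : Tuple T) Y' = pressureForm (X : Tuple T) 0 := rfl
    have e4 : convectiveForm β (X : Tuple T) Y' = convectiveForm β (X : Tuple T) 0 := rfl
    have e5 : divergenceForm (X : Tuple T) Y' = divergenceForm (X : Tuple T) 0 := rfl
    rw [e1, e2, e3, e4, e5, z2, z3, z4, z5, hl Y' 0 rfl, hl0] at h1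
    simpa using h1
  have hdiv : ∀ Y, S.Mem Y → divergenceForm (X : Tuple T) Y = 0 := by
    intro Y hY
    let Y' : Tuple T := ⟨0, 0, Y.p, 0⟩
    have hY' : S.Mem Y' := ⟨fun _ _ => zero_mem _, fun _ _ => zero_mem _, hY.p, hY.mean_p,
      fun _ _ => zero_mem _, fun _ _ _ => rfl⟩
    have h1 := h' Y' hY'
    have e1 : gradientForm ν (X : Tuple T) Y' = gradientForm ν (X : Tuple T) 0 := rfl
    have e2 : S.viscousForm ν (X : Tuple T) Y' = S.viscousForm ν (X : Tuple T) 0 := rfl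
    have e3 : pressureForm (X : Tuple T) Y' = pressureForm (X : Tuple T) 0 := rfl
    have e4 : convectiveForm β (X : Tuple T) Y' = convectiveForm β (X : Tuple T) 0 := rfl
    have e5 : divergenceForm (X : Tuple T) Y' = divergenceForm (X : Tuple T) Y := rfl
    rw [e1, e2, e3, e4, e5, z1, z2, z4, z5, hl Y' 0 rfl, hl0] at h1
    simpa using h1
  refine ⟨X.2, hgrad, fun Y hY => ?_, hdiv⟩
  have h1 := h' Y hY
  rw [hgrad Y hY, hdiv Y hY] at h1
  simpa using h1

/-- The problem is a square linear system, from a finite-dimensional space to its dual, so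
uniqueness gives existence. -/
theorem exists_solvesOseen {ν c C' : ℝ} {β : (i : Fin T.nK) → T.HDiv i}
    (hβ : ∀ i, β i ∈ S.Vs i) (hβ0 : ∀ X, S.Mem X → 0 ≤ convectiveForm β X X)
    (l : Tuple T →ₗ[ℝ] ℝ) (hl : ∀ Y Y' : Tuple T, Y.u = Y'.u → l Y = l Y') (hν : 0 < ν)
    (hc : 0 ≤ c)
    (hcoer : ∀ X, S.Mem X → (∀ Y, S.Mem Y → gradientForm ν X Y = 0) →
      X.normOne ^ 2 ≤ c * S.energy X)
    (hSob : S.Sobolev C') (hd : 0 < d) (hΩ : IsPolyhedralDomain Ω) :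
    ∃ X, S.SolvesOseen ν β l X := by
  have hinj : Function.Injective (S.oseenBilin ν hβ) := by
    refine (injective_iff_map_eq_zero _).2 fun X hX => ?_
    have h1 : S.SolvesOseen ν β (fun _ => 0) X :=
      solvesOseen_of_oseenBilin hβ rfl (fun _ _ _ => rfl) X fun Y => by
        rw [hX, LinearMap.zero_apply]
    exact Subtype.ext (h1.eq_zero (fun _ _ => rfl) hν hc (hβ0 _ X.2) hcoer hSob hd hΩ)
  have hsurj : Function.Surjective (S.oseenBilin ν hβ) :=
    (LinearMap.injective_iff_surjective_of_finrank_eq_finrank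
      (Subspace.dual_finrank_eq (K := ℝ) (V := S.memSubmodule)).symm).1 hinj
  obtain ⟨X, hX⟩ := hsurj (l ∘ₗ S.memSubmodule.subtype)
  exact ⟨X, solvesOseen_of_oseenBilin hβ (map_zero l) hl X fun Y => by rw [hX]; rfl⟩

end FESpaces

end HDG

namespace HDG

/-! ### The fixed point -/

/-- A contraction principle for a relation on a finite-dimensional space with a seminorm. -/
theorem exists_approx_fixedPoint {E H : Type*} [AddCommGroup E] [Module ℝ E]
    [NormedAddCommGroup H] [NormedSpace ℝ H] (J : E →ₗ[ℝ] H) (D : Submodule ℝ E)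
    [FiniteDimensional ℝ D] {P : E → E → Prop} (hP : ∀ Z ∈ D, ∃ X ∈ D, P Z X)
    (hcontr : ∀ Z ∈ D, ∀ Z' ∈ D, ∀ X X', P Z X → P Z' X' → ‖J (X - X')‖ ≤ 1 / 2 * ‖J (Z - Z')‖) :
    ∃ Z ∈ D, ∃ X ∈ D, P Z X ∧ J (X - Z) = 0 := by
  choose! φ hφ using hP
  -- The contraction acts on the image of `D`, which is complete as a finite-dimensional space.
  -- Representatives may be chosen arbitrarily, and the fixed point is attained only up to the
  -- kernel of `J`.
  have hs : ∀ z : D.map J, ∃ Z ∈ D, J Z = z := fun z => Submodule.mem_map.1 z.2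
  choose s hsD hsJ using hs
  have : CompleteSpace (D.map J) := FiniteDimensional.complete ℝ _
  let Φ : D.map J → D.map J := fun z => ⟨J (φ (s z)), Submodule.mem_map_of_mem (hφ _ (hsD z)).1⟩
  have hΦ : ContractingWith (1 / 2) Φ := by
    refine ⟨by rw [← NNReal.coe_lt_coe]; norm_num, LipschitzWith.of_dist_le_mul fun z z' => ?_⟩
    rw [Subtype.dist_eq, Subtype.dist_eq, dist_eq_norm, dist_eq_norm, ← map_sub, ← hsJ z,
      ← hsJ z', ← map_sub]
    simpa using hcontr _ (hsD z) _ (hsD z') _ _ (hφ _ (hsD z)).2 (hφ _ (hsD z')).2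
  have hfix : Φ (hΦ.fixedPoint Φ) = hΦ.fixedPoint Φ := hΦ.fixedPoint_isFixedPt
  refine ⟨_, hsD (hΦ.fixedPoint Φ), _, (hφ _ (hsD _)).1, (hφ _ (hsD _)).2, ?_⟩
  rw [map_sub, hsJ, sub_eq_zero]
  exact congrArg Subtype.val hfix

theorem mul_le_of_mul_sq_le {ν a A : ℝ} (ha : 0 ≤ a) (hA : 0 ≤ A) (h : ν * a ^ 2 ≤ A * a) :
    ν * a ≤ A := by
  rcases ha.eq_or_lt with rfl | ha
  · simpa using hA
  · exact le_of_mul_le_mul_right (by rwa [mul_assoc, ← sq]) ha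

namespace Tuple

variable {d : ℕ} {Ω : Set (Space d)} {T : Mesh Ω}

/-- The quantities in the discrete `H¹`-norm as a linear map into a Hilbert space. -/
noncomputable def energyMap : Tuple T →ₗ[ℝ] PiLp 2 fun q : Fin T.nK × Fin d =>
    WithLp 2 (Lp (Space d) 2 (T.vol q.1) × T.TraceL2 q.1) where
  toFun X := WithLp.toLp 2 fun q =>
    WithLp.toLp 2 (T.vecK q.1 (grad (X.u q.1 q.2)), √((T.h q.1)⁻¹) • X.jump q.1 q.2)
  map_add' X Y := by
    ext1 q
    simp only [u_add, Pi.add_apply, Mesh.grad_add, T.vecK_add, jump_add, smul_add]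
    rfl
  map_smul' c X := by
    ext1 q
    simp only [u_smul, Pi.smul_apply, Mesh.grad_smul, T.vecK_smul, jump_smul, smul_comm _ c]
    rfl

theorem norm_energyMap (X : Tuple T) : ‖energyMap X‖ = X.normOne := by
  rw [← Real.sqrt_sq (norm_nonneg (energyMap X)), PiLp.norm_sq_eq_of_L2, normOne,
    Finset.sum_comm, Fintype.sum_prod_type]
  congr 1
  refine Finset.sum_congr rfl fun i _ => Finset.sum_congr rfl fun r _ => ?_
  rw [WithLp.prod_norm_sq_eq_of_L2]
  change ‖T.vecK i (grad (X.u i r))‖ ^ 2 + ‖√((T.h i)⁻¹) • X.jump i r‖ ^ 2 = _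
  have := inv_nonneg.2 (T.h_nonneg i)
  rw [norm_smul, mul_pow, Real.norm_of_nonneg (Real.sqrt_nonneg _), Real.sq_sqrt this]

end Tuple

namespace FESpaces

variable {d : ℕ} {Ω : Set (Space d)} {T : Mesh Ω} {S : FESpaces T}

/-- The tuples whose velocity is discretely divergence-free. -/
noncomputable def divFreeSubmodule (S : FESpaces T) : Submodule ℝ (Tuple T) where
  carrier := {X | S.Mem X ∧ ∀ Y, S.Mem Y → divergenceBilin X Y = 0}
  zero_mem' := ⟨S.memSubmodule.zero_mem, fun Y _ => by rw [map_zero, LinearMap.zero_apply]⟩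
  add_mem' hX hX' := ⟨S.memSubmodule.add_mem hX.1 hX'.1, fun Y hY => by
    rw [map_add, LinearMap.add_apply, hX.2 Y hY, hX'.2 Y hY, add_zero]⟩
  smul_mem' c X hX := ⟨S.memSubmodule.smul_mem c hX.1, fun Y hY => by
    rw [map_smul, LinearMap.smul_apply, hX.2 Y hY, smul_zero]⟩

instance : FiniteDimensional ℝ S.divFreeSubmodule :=
  Submodule.finiteDimensional_of_le (S₂ := S.memSubmodule) fun _ hX => hX.1

theorem SolvesOseen.mem_divFree {ν : ℝ} {β : (i : Fin T.nK) → T.HDiv i} {l : Tuple T → ℝ}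
    {X : Tuple T} (h : S.SolvesOseen ν β l X) : X ∈ S.divFreeSubmodule :=
  ⟨h.mem, h.divergence⟩

theorem IsPostprocessed.congr {X Y : Tuple T} {β : (i : Fin T.nK) → T.HDiv i}
    (h : S.IsPostprocessed X β) (hu : X.u = Y.u) (hhat : X.uhat = Y.uhat) :
    S.IsPostprocessed Y β := by
  have hn : ∀ i, Y.hatNormal i = X.hatNormal i := fun i => by
    simp only [Tuple.hatNormal, Tuple.hatTr, hhat]
  exact ⟨h.mem, hu ▸ h.grad, hu ▸ h.bubble, fun i μ hμ => by rw [hn]; exact h.trace i μ hμ⟩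

theorem convectiveForm_nonneg_of_mem_divFree (hΩ : IsPolyhedralDomain Ω) {X Z : Tuple T}
    (hZ : Z ∈ S.divFreeSubmodule) {β : (i : Fin T.nK) → T.HDiv i} (hβ : S.IsPostprocessed Z β)
    (hX : S.Mem X) : 0 ≤ convectiveForm β X X :=
  convectiveForm_self_nonneg hΩ hX hZ.1 hβ fun i => hβ.dvg_eq_zero hΩ hZ.1 hZ.2 i

/-- The a priori bound: coercivity, the sign of convection, and the load estimated through the
discrete Poincaré inequality. No smallness of `f` is used. -/
theorem SolvesOseen.normOne_le {ν c C' : ℝ} {β : (i : Fin T.nK) → T.HDiv i} {X Z : Tuple T}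
    {f : Lp (Space d) 2 (volume.restrict Ω)} (h : S.SolvesOseen ν β (load f) X)
    (hZ : Z ∈ S.divFreeSubmodule) (hβ : S.IsPostprocessed Z β) (hν : 0 < ν) (hc : 0 ≤ c)
    (hcoer : ∀ X, S.Mem X → (∀ Y, S.Mem Y → gradientForm ν X Y = 0) →
      X.normOne ^ 2 ≤ c * S.energy X)
    (hSob : S.Sobolev C') (hC' : 0 ≤ C') (hΩ : IsPolyhedralDomain Ω) :
    X.normOne ≤ c * √C' * ν⁻¹ * ‖f‖ := by
  have h1 := h.normOne_sq_le hν hc (convectiveForm_nonneg_of_mem_divFree hΩ hZ hβ h.mem) hcoer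
  have h2 := hSob.load_le hC' hΩ f h.mem
  have h3 : ν * X.normOne ≤ c * √C' * ‖f‖ := by
    refine mul_le_of_mul_sq_le X.normOne_nonneg (by positivity) (h1.trans ?_)
    calc c * load f X ≤ c * (√C' * ‖f‖ * X.normOne) := mul_le_mul_of_nonneg_left h2 hc
      _ = _ := by ring
  calc X.normOne = ν⁻¹ * (ν * X.normOne) := by rw [inv_mul_cancel_left₀ hν.ne']
    _ ≤ ν⁻¹ * (c * √C' * ‖f‖) := mul_le_mul_of_nonneg_left h3 (inv_nonneg.2 hν.le)
    _ = _ := by ring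

/-- The velocity of the solution of the linearized problem depends Lipschitz continuously on the
convective velocity. -/
theorem SolvesOseen.normOne_sub_le {ν c C' K : ℝ} {β γ : (i : Fin T.nK) → T.HDiv i}
    {X X' Z Z' : Tuple T} {f : Lp (Space d) 2 (volume.restrict Ω)}
    (h : S.SolvesOseen ν β (load f) X) (h' : S.SolvesOseen ν γ (load f) X')
    (hZ : Z ∈ S.divFreeSubmodule) (hZ' : Z' ∈ S.divFreeSubmodule) (hβ : S.IsPostprocessed Z β)
    (hγ : S.IsPostprocessed Z' γ) (hν : 0 < ν) (hc : 0 ≤ c) (hK : 0 ≤ K)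
    (hcoer : ∀ X, S.Mem X → (∀ Y, S.Mem Y → gradientForm ν X Y = 0) →
      X.normOne ^ 2 ≤ c * S.energy X)
    (hconv : ∀ Y, S.Mem Y → |convectiveForm β X' Y - convectiveForm γ X' Y|
      ≤ K * ((Z - Z').normOne * X'.normOne * Y.normOne))
    (hSob : S.Sobolev C') (hC' : 0 ≤ C') (hΩ : IsPolyhedralDomain Ω)
    (hf : c * K * (c * √C') * ((ν ^ 2)⁻¹ * ‖f‖) ≤ 1 / 2) :
    (X - X').normOne ≤ 1 / 2 * (Z - Z').normOne := by
  -- The difference solves the problem at `β`, whose convective form is nonnegative, and is driven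
  -- by the change of velocity acting on `X'`.
  have hD := h.sub hβ.mem h'
  have h1 := hD.normOne_sq_le hν hc (convectiveForm_nonneg_of_mem_divFree hΩ hZ hβ hD.mem) hcoer
  have h2 := (neg_le_abs _).trans (hconv _ hD.mem)
  rw [neg_sub] at h2
  have hn := (Z - Z').normOne_nonneg
  have hn' := X'.normOne_nonneg
  have h3 : ν * (X - X').normOne ≤ c * K * (Z - Z').normOne * X'.normOne := by
    refine mul_le_of_mul_sq_le (X - X').normOne_nonneg
      (mul_nonneg (mul_nonneg (mul_nonneg hc hK) hn) hn') (h1.trans ?_)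
    refine (mul_le_mul_of_nonneg_left h2 hc).trans (le_of_eq ?_)
    ring
  -- The a priori bound for `X'` turns the Lipschitz constant into a multiple of `ν⁻²‖f‖`, which the
  -- smallness assumption makes at most one half.
  have h4 := h'.normOne_le hZ' hγ hν hc hcoer hSob hC' hΩ
  calc (X - X').normOne = ν⁻¹ * (ν * (X - X').normOne) := by rw [inv_mul_cancel_left₀ hν.ne']
    _ ≤ ν⁻¹ * (c * K * (Z - Z').normOne * (c * √C' * ν⁻¹ * ‖f‖)) :=
        mul_le_mul_of_nonneg_left (h3.trans (mul_le_mul_of_nonneg_left h4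
          (mul_nonneg (mul_nonneg hc hK) hn))) (inv_nonneg.2 hν.le)
    _ = c * K * (c * √C') * ((ν ^ 2)⁻¹ * ‖f‖) * (Z - Z').normOne := by
        rw [← inv_pow]; ring
    _ ≤ 1 / 2 * (Z - Z').normOne := mul_le_mul_of_nonneg_right hf hn

/-- The discrete norm sees only `(u, û)`, but the post-processed velocity depends on nothing else,
so a fixed point in this seminorm is enough. The gradient and the pressure are then determined by
the linear problem. -/
theorem existsUnique_isSolution {ν c C' K : ℝ} {f : Lp (Space d) 2 (volume.restrict Ω)}
    (hν : 0 < ν) (hc : 0 ≤ c) (hK : 0 ≤ K)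
    (hcoer : ∀ X, S.Mem X → (∀ Y, S.Mem Y → gradientForm ν X Y = 0) →
      X.normOne ^ 2 ≤ c * S.energy X)
    (hconv : ∀ Z Z' X Y : Tuple T, S.Mem Z → S.Mem Z' → S.Mem X → S.Mem Y →
      ∀ β γ : (i : Fin T.nK) → T.HDiv i, S.IsPostprocessed Z β → S.IsPostprocessed Z' γ →
        |convectiveForm β X Y - convectiveForm γ X Y|
          ≤ K * ((Z - Z').normOne * X.normOne * Y.normOne))
    (hSob : S.Sobolev C') (hC' : 0 ≤ C') (hd : 0 < d) (hΩ : IsPolyhedralDomain Ω)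
    (hf : c * K * (c * √C') * ((ν ^ 2)⁻¹ * ‖f‖) ≤ 1 / 2) :
    ∃! X : Tuple T, S.IsSolution ν f X := by
  have hcontr : ∀ Z ∈ S.divFreeSubmodule, ∀ Z' ∈ S.divFreeSubmodule, ∀ X X' : Tuple T,
      (∃ β, S.IsPostprocessed Z β ∧ S.SolvesOseen ν β (load f) X) →
      (∃ β, S.IsPostprocessed Z' β ∧ S.SolvesOseen ν β (load f) X') →
      (X - X').normOne ≤ 1 / 2 * (Z - Z').normOne := by
    rintro Z hZ Z' hZ' X X' ⟨β, hβ, h⟩ ⟨γ, hγ, h'⟩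
    exact h.normOne_sub_le h' hZ hZ' hβ hγ hν hc hK hcoer
      (fun Y hY => hconv Z Z' X' Y hZ.1 hZ'.1 h'.mem hY β γ hβ hγ) hSob hC' hΩ hf
  have heq : ∀ X X' : Tuple T, S.Mem X → S.Mem X' → (X - X').normOne = 0 →
      X.u = X'.u ∧ X.uhat = X'.uhat := by
    intro X X' hX hX' h0
    have h1 := hSob.eq_zero_of_normOne_eq_zero hd (hX.sub hX') h0
    exact ⟨sub_eq_zero.1 h1.1, sub_eq_zero.1 h1.2⟩
  obtain ⟨Z, hZ, X, hX, ⟨β, hβ, h⟩, hXZ⟩ := exists_approx_fixedPoint Tuple.energyMap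
    S.divFreeSubmodule (P := fun Z X => ∃ β, S.IsPostprocessed Z β ∧
      S.SolvesOseen ν β (load f) X)
    (fun Z hZ => by
      obtain ⟨β, hβ⟩ := exists_isPostprocessed hZ.1
      obtain ⟨l, hl⟩ := exists_linearMap_load hΩ T f
      have hl' : (l : Tuple T → ℝ) = load f := funext hl
      obtain ⟨X, hX⟩ := exists_solvesOseen hβ.mem
        (fun X hX => convectiveForm_nonneg_of_mem_divFree hΩ hZ hβ hX) l
        (fun Y Y' hYY' => by simp only [hl, load, hYY']) hν hc hcoer hSob hd hΩ
      rw [hl'] at hX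
      exact ⟨X, hX.mem_divFree, β, hβ, hX⟩)
    (fun Z hZ Z' hZ' X X' hX hX' => by
      rw [Tuple.norm_energyMap, Tuple.norm_energyMap]
      exact hcontr Z hZ Z' hZ' X X' hX hX')
  have h0 : (X - Z).normOne = 0 := by rw [← Tuple.norm_energyMap, hXZ, norm_zero]
  obtain ⟨hu, hhat⟩ := heq X Z hX.1 hZ.1 h0
  -- The tuples `X` and `Z` may differ in `L` and `p`. They share `u` and `û`, so the `β` computed
  -- from `Z` is also the one of `X`, and it is `X` that solves the method.
  refine ⟨X, isSolution_iff.2 ⟨β, hβ.congr hu.symm hhat.symm, h⟩, fun X' hX' => ?_⟩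
  obtain ⟨γ, hγ, h'⟩ := isSolution_iff.1 hX'
  -- Each solution is its own image, so the distance of two solutions is at most half of itself.
  have h1 := hcontr X' h'.mem_divFree X hX X' X ⟨γ, hγ, h'⟩ ⟨β, hβ.congr hu.symm hhat.symm, h⟩
  have h2 := (X' - X).normOne_nonneg
  obtain ⟨hu', hhat'⟩ := heq X' X h'.mem hX.1 (by linarith)
  -- Equal velocities and traces have equal post-processed velocities. Both solutions then solve the
  -- same linear problem, whose uniqueness settles `L` and `p`.
  have hβγ : γ = β := (hγ.congr hu' hhat').unique hX.1 (hβ.congr hu.symm hhat.symm)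
  rw [hβγ] at h'
  have hD := h'.sub hβ.mem h
  exact sub_eq_zero.1 (hD.eq_zero (fun Y _ => sub_self _) hν hc
    (convectiveForm_nonneg_of_mem_divFree hΩ hZ hβ hD.mem) hcoer hSob hd hΩ)

end FESpaces

end HDG

theorem theorem4p2 (d : ℕ) (hd : d = 2 ∨ d = 3) (Ω : Set (HDG.Space d))
    (hΩ : HDG.IsPolyhedralDomain Ω) :
    -- every mesh and every choice of spaces has finite parameters
    (∀ (T : HDG.Mesh Ω) (S : HDG.FESpaces T), ∃ (σ : ℝ) (k : ℕ) (Λ : ℝ),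
      0 < σ ∧ T.IsShapeRegular σ ∧ S.HasParameters k Λ) ∧
    -- the constants depend on the domain and on these parameters only
    ∀ σ : ℝ, 0 < σ → ∀ (k : ℕ) (Λ : ℝ), ∃ δ : ℝ, 0 < δ ∧ ∃ C : ℝ, 0 < C ∧
      ∀ (T : HDG.Mesh Ω) (S : HDG.FESpaces T), T.IsShapeRegular σ → S.HasParameters k Λ →
        ∀ (ν : ℝ), 0 < ν → ∀ f : Lp (HDG.Space d) 2 (volume.restrict Ω),
          (ν ^ 2)⁻¹ * ‖f‖ ≤ δ →
            (∃! X : HDG.Tuple T, S.IsSolution ν f X) ∧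
            ∀ X : HDG.Tuple T, S.IsSolution ν f X → X.normOne ≤ C * ν⁻¹ * ‖f‖ := by
  have hd0 : 0 < d := by omega
  constructor
  · intro T S
    obtain ⟨σ, hσ, hT⟩ := T.exists_isShapeRegular hd0
    obtain ⟨k, Λ, hS⟩ := S.exists_hasParameters hd0
    exact ⟨σ, k, Λ, hσ, hT, hS⟩
  · intro σ hσ k Λ
    obtain ⟨C, hC⟩ := HDG.Mesh.exists_bounds hd0 hΩ hσ k
    obtain ⟨C', hC', hSob⟩ := HDG.FESpaces.exists_sobolev hd hΩ k Λ C
    obtain ⟨K, hK, hconv⟩ := HDG.FESpaces.exists_abs_convectiveForm_sub_le (Ω := Ω) hd k Λ C hC'.le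
    -- That `C` is at least one is known only once a shape-regular mesh is given; the maximum keeps
    -- the constants positive before any mesh is chosen.
    have hmax : (0 : ℝ) ≤ max C 0 := le_max_right _ _
    set c : ℝ := 2 + (1 + 2 * d * max C 0 ^ 3) * (Λ ^ 2 + 2 * Λ ^ 2 * (1 + Λ ^ 2)) with hc
    have hc0 : 0 < c := by positivity
    have hA : 0 ≤ c * K * (c * √C') := by positivity
    -- This `δ` makes the contraction factor at most one half; the summand `1` makes the denominator
    -- visibly positive.
    refine ⟨(2 * (c * K * (c * √C') + 1))⁻¹, by positivity, c * √C', by positivity,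
      fun T S hT hS ν hν f hf => ?_⟩
    have hb := hC T hT
    have hCC : max C 0 = C := max_eq_left (zero_le_one.trans hb.one_le)
    have hcoer : ∀ X, S.Mem X → (∀ Y, S.Mem Y → HDG.FESpaces.gradientForm ν X Y = 0) →
        X.normOne ^ 2 ≤ c * S.energy X := by
      rw [hc, hCC]
      exact fun X hX h => hS.normOne_sq_le hb hd0 hν hX h
    have hf' : c * K * (c * √C') * ((ν ^ 2)⁻¹ * ‖f‖) ≤ 1 / 2 := by
      refine (mul_le_mul_of_nonneg_left hf hA).trans ?_
      rw [← div_eq_mul_inv, div_le_div_iff₀ (by positivity) two_pos]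
      linarith
    refine ⟨HDG.FESpaces.existsUnique_isSolution hν hc0.le hK.le hcoer (hconv T S hS hb
      (hSob T S hb hS)) (hSob T S hb hS) hC'.le hd0 hΩ hf', fun X hX => ?_⟩
    -- A solution of the method solves the linear problem at its own velocity, to which the a priori
    -- bound applies.
    obtain ⟨β, hβ, h⟩ := HDG.FESpaces.isSolution_iff.1 hX
    exact h.normOne_le h.mem_divFree hβ hν hc0.le hcoer (hSob T S hb hS) hC'.le hΩ
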